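/- Let $(M,g)$ be a smooth Riemannian manifold (Hausdorff, without boundary, not necessarily complete), and let $\exp_p(v)=\gamma(1)$, where $\gamma$ is the geodesic with $\gamma(0)=p$, $\dot\gamma(0)=v$, be its exponential map, defined for those $(p,v)\in TM$ for which $\gamma$ exists on $[0,1]$. Write $\gamma_{p,v}(t)=\exp_p(tv)$, let $d\exp_p(v)$ be the differential of $\exp_p$ at $v$ (with $T_vT_pM$ identified with $T_pM$), let $N_p(v)=\ker d\exp_p(v)\subset T_pM$, and let $S(p)$ be the set of the conjugate vectors at $p$, i.e. of those $v$ for which $d\exp_p(v)$ is not an isomorphism. A vector $v\in S(p)$ is a fold conjugate vector if it is regular (in some neighbourhood of $v$ every radial ray of $T_pM$ contains at most one conjugate vector) and $N_p(v)$ is one-dimensional and transversal to $S(p)$ at $v$. The Jacobi fields along $\gamma_{p,v}$ that vanish at $t=0$ are the fields $J(t)=\frac{d}{ds}\big|_{s=0}\exp_p(t(v+sa))$, $a\in T_pM$; $J'$ is the covariant derivative of $J$ along $\gamma_{p,v}$. For an open set $W\subset TM$ put $\Sigma(p)=\{\exp_p(v): v\in S(p),\ (p,v)\in W\}$ and $\Sigma=\{(p,q):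 q\in\Sigma(p)\}\subset M\times M$. Tangent vectors to such a set are the velocities of smooth curves contained in it. Let $\mathcal N\Sigma$ be the set of all $((p,\alpha),(q,\beta))\in TM\times TM$ with $(p,q)\in\Sigma$ and $g(\alpha,\xi)+g(\beta,\eta)=0$ for all $(\xi,\eta)\in T_{(p,q)}\Sigma$, and let $\mathcal N\Sigma\setminus 0$ be its part with $(\alpha,\beta)\neq 0$. **Theorem.** Let $v_0$ be a fold conjugate vector at $p_0$ and let $q_0=\exp_{p_0}(v_0)$. There is an open neighbourhood $W_0$ of $(p_0,v_0)$ in $TM$ such that the following holds for every open $W$ with $(p_0,v_0)\in W\subset W_0$. (a) Let $(p,v)\in W$ with $v\in S(p)$, and let $q=\exp_p(v)$, $w=-\dot\gamma_{p,v}(1)$. Then $T_q\Sigma(p)$ is a linear subspace, $T_qM=T_q\Sigma(p)\oplus N_q(w)$, and this sum is orthogonal: the orthogonal complement of $T_q\Sigma(p)$ is $N_q(w)$. (b) If $(p,v),(p,v')\in W$, $v\in S(p)$ and $\exp_p(v')=\exp_p(v)$, then $v'=v$; thus for $(p,q)\in\Sigma$ the geodesic $\gamma_{p,v}$ from $p$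 to $q$ with $(p,v)\in W$ is unique. Moreover, $\mathcal N\Sigma$ is the set of all $((p,J'(0)),(q,-J'(1)))$, where $(p,q)\in\Sigma$ and $J$ is a Jacobi field along this geodesic with $J(0)=J(1)=0$. (c) Consider the rank condition $$\text{for every } \alpha\in N_{p_0}(v_0)\setminus 0,\ \text{ the linear map } T_{v_0}S(p_0)\ni\tau\mapsto d^2\exp_{p_0}(v_0)(\alpha,\tau)\in T_{q_0}M\ \text{ has full rank, i.e. is injective.}\tag{cond}$$ Then $\mathcal N\Sigma\setminus 0$ is the graph of a smooth map $(p,\alpha)\mapsto(q,\beta)$ from an open subset of $TM$ to $TM$ if and only if (cond) holds. The same is true locally: for any $z\in\mathcal N\Sigma\setminus 0$ over $(p_0,q_0)$, some open neighbourhood $O$ of $z$ is such that $(\mathcal N\Sigma\setminus 0)\cap O$ is the graph of a smooth map on an open subset of $TM$ if and only if (cond) holds. Moreover, whenever $(\mathcal N\Sigma\setminus 0)\cap O$, with $O\subset TM\times TM$ open, is the graph of a smooth map on an open subset $U$ of $TM$, this map is a local diffeomorphism on $U$. -/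

import Mathlib

open Set Filter Topology Bundle
open scoped Manifold ContDiff

noncomputable section FoldConjugate

variable {E : Type*} [NormedAddCommGroup E] [NormedSpace ℝ E]
  {M : Type*} [TopologicalSpace M] [ChartedSpace E M]

/-- The velocity of a curve `γ` at time `t`, together with its base point, as an element of
the tangent bundle. -/
def velocity (E : Type*) [NormedAddCommGroup E] [NormedSpace ℝ E]
    {M : Type*} [TopologicalSpace M] [ChartedSpace E M] (γ : ℝ → M) (t : ℝ) :
    TangentBundle 𝓘(ℝ, E) M :=
  ⟨γ t, mfderiv 𝓘(ℝ, ℝ) 𝓘(ℝ, E) γ t (1 : ℝ)⟩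

/-- The tangent space at `x` of a subset `A` of a manifold `X` modelled on `F`, as the set of
velocities at `x` of smooth curves in `X` which stay inside `A` and pass through `x` at time `0`.
If `A` is an embedded submanifold, this is its usual tangent space. -/
def tangentVectors {F : Type*} [NormedAddCommGroup F] [NormedSpace ℝ F]
    {H : Type*} [TopologicalSpace H] (I : ModelWithCorners ℝ F H)
    {X : Type*} [TopologicalSpace X] [ChartedSpace H X] (A : Set X) (x : X) :
    Set (TangentSpace I x) :=
  {ξ | ∃ (ε : ℝ) (c : ℝ → X), 0 < ε ∧ ContMDiffOn 𝓘(ℝ, ℝ) I ∞ c (Ioo (-ε) ε) ∧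
    (∀ t ∈ Ioo (-ε) ε, c t ∈ A) ∧
    (⟨c 0, mfderiv 𝓘(ℝ, ℝ) I c 0 (1 : ℝ)⟩ : TangentBundle I X) = ⟨x, ξ⟩}

section Riemannian

variable [RiemannianBundle (fun x : M => TangentSpace 𝓘(ℝ, E) x)]

/-- The Riemannian metric in the coordinates of the preferred chart around `c`:
`chartMetric c y a b = g (dφ⁻¹ a, dφ⁻¹ b)` for `φ` the chart and `y` in its target. -/
def chartMetric (c : M) (y : E) : E →L[ℝ] E →L[ℝ] ℝ :=
  let A : E →L[ℝ] TangentSpace 𝓘(ℝ, E) ((extChartAt 𝓘(ℝ, E) c).symm y) :=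
    mfderiv 𝓘(ℝ, E) 𝓘(ℝ, E) (extChartAt 𝓘(ℝ, E) c).symm y
  (innerSL ℝ (E := TangentSpace 𝓘(ℝ, E) ((extChartAt 𝓘(ℝ, E) c).symm y))).bilinearComp A A

/-- The Christoffel symbols `Γ(a, b)` of the Levi-Civita connection in the preferred chart around
`c`, determined by
`g(Γ(a, b), z) = (1/2) (D_a g (b, z) + D_b g (a, z) - D_z g (a, b))` for all `z`. -/
def christoffel (c : M) (y : E) (a b : E) : E :=
  (chartMetric c y).inverse ((1 / 2 : ℝ) •
    (fderiv ℝ (chartMetric (E := E) c) y a b + fderiv ℝ (chartMetric (E := E) c) y b a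
      - ((fderiv ℝ (chartMetric (E := E) c) y).flip a).flip b))

/-- The covariant derivative `D_t J` at time `t₀` of a vector field `J` along a curve `γ`, computed
in the preferred chart around `γ t₀`: `(D_t J)(t₀) = j'(t₀) + Γ(y'(t₀), j(t₀))`, where `y` and `j`
are the coordinate expressions of `γ` and `J`. The tangent space at `γ t₀` is identified with `E`
by the same chart. -/
def covariantDeriv (γ : ℝ → M) (J : ∀ t, TangentSpace 𝓘(ℝ, E) (γ t)) (t₀ : ℝ) :
    TangentSpace 𝓘(ℝ, E) (γ t₀) :=
  let φ := extChartAt 𝓘(ℝ, E) (γ t₀)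
  let y : ℝ → E := fun t => φ (γ t)
  let j : ℝ → E := fun t => mfderiv 𝓘(ℝ, E) 𝓘(ℝ, E) φ (γ t) (J t)
  (deriv j t₀ + christoffel (γ t₀) (y t₀) (deriv y t₀) (j t₀) : E)

/-- `γ` is a geodesic on the open set `s` of times: it is smooth there and `D_t γ' = 0`. -/
def IsGeodesicOn (E : Type*) [NormedAddCommGroup E] [NormedSpace ℝ E]
    {M : Type*} [TopologicalSpace M] [ChartedSpace E M]
    [RiemannianBundle (fun x : M => TangentSpace 𝓘(ℝ, E) x)] (γ : ℝ → M) (s : Set ℝ) : Prop :=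
  ContMDiffOn 𝓘(ℝ, ℝ) 𝓘(ℝ, E) ∞ γ s ∧
    ∀ t ∈ s, covariantDeriv γ (fun t => (velocity E γ t).snd) t = 0

/-- `γ` is a geodesic, defined on a neighbourhood of `[0, 1]`, with initial data `x = (p, v)`. -/
def IsGeodesicFrom (γ : ℝ → M) (x : TangentBundle 𝓘(ℝ, E) M) : Prop :=
  ∃ ε : ℝ, 0 < ε ∧ IsGeodesicOn E γ (Ioo (-ε) (1 + ε)) ∧ velocity E γ 0 = x

open Classical in
/-- The Riemannian exponential map: `riemannianExp p v = γ 1` for the geodesic `γ` with `γ 0 = p`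
and `γ' 0 = v`. The value is `p` if there is no such geodesic on `[0, 1]`. -/
def riemannianExp (p : M) (v : TangentSpace 𝓘(ℝ, E) p) : M :=
  if h : ∃ γ : ℝ → M, IsGeodesicFrom γ (⟨p, v⟩ : TangentBundle 𝓘(ℝ, E) M) then h.choose 1 else p

/-- The geodesic `γ_{p,v}(t) = exp_p (t v)`. -/
def geodesic (p : M) (v : TangentSpace 𝓘(ℝ, E) p) (t : ℝ) : M :=
  riemannianExp p (t • v)

/-- The differential `d exp_p (v)`, with `T_v T_p M` identified with `T_p M`. -/
def dexp (p : M) (v : TangentSpace 𝓘(ℝ, E) p) :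
    TangentSpace 𝓘(ℝ, E) p →L[ℝ] TangentSpace 𝓘(ℝ, E) (riemannianExp p v) :=
  mfderiv 𝓘(ℝ, TangentSpace 𝓘(ℝ, E) p) 𝓘(ℝ, E) (riemannianExp p) v

/-- `N_p(v)`, the kernel of `d exp_p (v)`. -/
def conjKernel (p : M) (v : TangentSpace 𝓘(ℝ, E) p) : Submodule ℝ (TangentSpace 𝓘(ℝ, E) p) :=
  LinearMap.ker (dexp p v : TangentSpace 𝓘(ℝ, E) p →ₗ[ℝ] TangentSpace 𝓘(ℝ, E) (riemannianExp p v))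

/-- The tangent conjugate locus `S(p)`: the vectors `v` at which `exp_p` is defined and
`d exp_p (v)` is not an isomorphism. -/
def tangentConjLocus (p : M) : Set (TangentSpace 𝓘(ℝ, E) p) :=
  {v | (∃ γ : ℝ → M, IsGeodesicFrom γ (⟨p, v⟩ : TangentBundle 𝓘(ℝ, E) M)) ∧
    ¬ Function.Bijective (dexp p v)}

/-- `T_v S(p)`, as a subspace of `T_p M` (the span of the velocities of curves in `S(p)`). -/
def tangentConjSpace (p : M) (v : TangentSpace 𝓘(ℝ, E) p) :
    Submodule ℝ (TangentSpace 𝓘(ℝ, E) p) :=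
  Submodule.span ℝ (tangentVectors 𝓘(ℝ, TangentSpace 𝓘(ℝ, E) p) (tangentConjLocus p) v)

/-- `v` is a regular conjugate vector at `p`: it is conjugate, and in some neighbourhood of `v` any
radial ray of `T_p M` contains at most one conjugate vector. -/
def IsRegularConjugate (p : M) (v : TangentSpace 𝓘(ℝ, E) p) : Prop :=
  v ∈ tangentConjLocus p ∧ ∃ V ∈ 𝓝 v, ∀ u ∈ V ∩ tangentConjLocus p, ∀ t : ℝ, 0 < t →
    t • u ∈ V ∩ tangentConjLocus p → t • u = u

/-- `v` is a fold conjugate vector at `p`: it is a regular conjugate vector, and `N_p(v)` is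
one-dimensional and transversal to `S(p)` at `v`. -/
def IsFoldConjugate (p : M) (v : TangentSpace 𝓘(ℝ, E) p) : Prop :=
  IsRegularConjugate p v ∧ Module.finrank ℝ (conjKernel p v) = 1 ∧
    conjKernel p v ⊔ tangentConjSpace p v = ⊤

/-- The second differential `d² exp_p (v)(α, τ)`, computed in the preferred chart around
`exp_p(v)`. For `α ∈ N_p(v)` it does not depend on the chart. -/
def d2exp (p : M) (v α : TangentSpace 𝓘(ℝ, E) p) :
    TangentSpace 𝓘(ℝ, E) p →L[ℝ] E :=
  (fderiv ℝ (fderiv ℝ (fun u : TangentSpace 𝓘(ℝ, E) p =>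
    extChartAt 𝓘(ℝ, E) (riemannianExp p v) (riemannianExp p u))) v) α

/-- The rank condition: for every nonzero `α ∈ N_p(v)` the linear map
`T_v S(p) ∋ τ ↦ d² exp_p (v)(α, τ)` has full rank, that is, it is injective. -/
def FoldRankCondition (p : M) (v : TangentSpace 𝓘(ℝ, E) p) : Prop :=
  ∀ α ∈ conjKernel p v, α ≠ 0 →
    Function.Injective fun τ : tangentConjSpace p v => d2exp p v α τ

/-- The part of the conjugate locus `Σ(p)` given by the conjugate vectors at `p` in `W`. -/
def conjLocusAt (W : Set (TangentBundle 𝓘(ℝ, E) M)) (p : M) : Set M :=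
  {q | ∃ v ∈ tangentConjLocus p, (⟨p, v⟩ : TangentBundle 𝓘(ℝ, E) M) ∈ W ∧ q = riemannianExp p v}

/-- The set `Σ` of the conjugate pairs `(p, q)` given by the conjugate vectors in `W`. -/
def conjLocus (W : Set (TangentBundle 𝓘(ℝ, E) M)) : Set (M × M) :=
  {x | x.2 ∈ conjLocusAt W x.1}

/-- The normal bundle of `Σ` in `M × M` for the product metric, as the set of the
`((p, α), (q, β))` with `(p, q) ∈ Σ` and `(α, β)` orthogonal to `T_{(p,q)} Σ`. -/
def normalBundle (W : Set (TangentBundle 𝓘(ℝ, E) M)) :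
    Set (TangentBundle 𝓘(ℝ, E) M × TangentBundle 𝓘(ℝ, E) M) :=
  {z | (z.1.proj, z.2.proj) ∈ conjLocus W ∧
    ∀ (ξ : TangentSpace 𝓘(ℝ, E) z.1.proj) (η : TangentSpace 𝓘(ℝ, E) z.2.proj),
      ((ξ, η) : E × E) ∈
        tangentVectors (𝓘(ℝ, E).prod 𝓘(ℝ, E)) (conjLocus W) (z.1.proj, z.2.proj) →
      inner ℝ z.1.snd ξ + inner ℝ z.2.snd η = 0}

/-- The normal bundle of `Σ` without its zero section. -/
def puncturedNormalBundle (W : Set (TangentBundle 𝓘(ℝ, E) M)) :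
    Set (TangentBundle 𝓘(ℝ, E) M × TangentBundle 𝓘(ℝ, E) M) :=
  {z ∈ normalBundle W | z.1.snd ≠ 0 ∨ z.2.snd ≠ 0}

/-- The Jacobi field `J(t) = d[exp_p(t v)](a)` along `γ_{p,v}`, with `J(0) = 0`, `J'(0) = a`. -/
def jacobiField (p : M) (v a : TangentSpace 𝓘(ℝ, E) p) (t : ℝ) :
    TangentSpace 𝓘(ℝ, E) (geodesic p v t) :=
  mfderiv 𝓘(ℝ, TangentSpace 𝓘(ℝ, E) p) 𝓘(ℝ, E)
    (fun u : TangentSpace 𝓘(ℝ, E) p => riemannianExp p (t • u)) v a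

/-- The set of all `((p, J'(0)), (q, -J'(1)))`, where `J` is a Jacobi field with `J(0) = J(1) = 0`
along a geodesic `γ_{p,v}` from `p` to `q` whose initial vector is a conjugate vector in `W`. -/
def jacobiPairs (W : Set (TangentBundle 𝓘(ℝ, E) M)) :
    Set (TangentBundle 𝓘(ℝ, E) M × TangentBundle 𝓘(ℝ, E) M) :=
  {z | ∃ (p : M) (v a : TangentSpace 𝓘(ℝ, E) p), v ∈ tangentConjLocus p ∧
    (⟨p, v⟩ : TangentBundle 𝓘(ℝ, E) M) ∈ W ∧
    jacobiField p v a 0 = 0 ∧ jacobiField p v a 1 = 0 ∧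
    z.1 = ⟨geodesic p v 0, covariantDeriv (geodesic p v) (jacobiField p v a) 0⟩ ∧
    z.2 = ⟨geodesic p v 1, -covariantDeriv (geodesic p v) (jacobiField p v a) 1⟩}

end Riemannian

/-- Within the open set `O`, the set `C` of pairs `((p, α), (q, β))` is the graph of the smooth map
`f`, defined on the open set `U`. -/
def IsSmoothGraph (C O : Set (TangentBundle 𝓘(ℝ, E) M × TangentBundle 𝓘(ℝ, E) M))
    [IsManifold 𝓘(ℝ, E) 1 M]
    (U : Set (TangentBundle 𝓘(ℝ, E) M))
    (f : TangentBundle 𝓘(ℝ, E) M → TangentBundle 𝓘(ℝ, E) M) : Prop :=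
  IsOpen O ∧ IsOpen U ∧ ContMDiffOn 𝓘(ℝ, E).tangent 𝓘(ℝ, E).tangent ∞ f U ∧
    C ∩ O = {z | z.1 ∈ U ∧ z.2 = f z.1}

end FoldConjugate

/-!
The theorem is local, so everything happens in a chart `c` around `p₀` and a chart `c'` around
`q₀`, where the exponential map is a smooth family of maps `f (x, u)` between open sets of `E`
(`expChart`, smooth by the smooth dependence of geodesics on their initial data,
`exists_isExpFlow`).

**Riemannian input.** The first variation formula (`IsExpFlow.chartMetric_fderiv_expChart`) says
that `g(V, Df(Y)) - g(u, Y₁)` is the derivative of the energy, where `V = Df(0, u)` is the final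
velocity. Differentiating it at a critical point in a direction `(0, a)` of the kernel of `Df` gives
the pairing identity `g(D²f(a, u), Df(Y)) = g(a, Y₁)` for all `Y`
(`IsExpFlow.chartMetric_fderiv_fderiv_expChart`); here `a = J'(0)` and `D²f(a, u) = J'(1)` for a
Jacobi field `J` vanishing at both ends. It yields most of the theorem: `J'(1)` is orthogonal to the
range of `dexp_p(v)`, it is not zero, and `(J'(0), -J'(1))` is orthogonal to the velocities of the
pairs `(p, exp_p v)`. Reversing the geodesics, `J'(1)` lies in the kernel of the differential of the
exponential map at the other end, and comparing dimensions gives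
`IsExpFlow.orthogonal_range_dexp`.

**The fold.** At a fold conjugate vector the kernel of the partial differential of `f` is spanned by
one vector `e`. Since `D²f(e, u)` is not in the range of the differential and the kernel is
transversal to the conjugate vectors, `D²f(e, e)` is not in the range either
(`fderiv_fderiv_notMem_range_of_transversal`). Then `f` has a fold normal form (`FoldForm`,
`nonempty_foldForm`): the critical values form a hypersurface `ℓ q = H(x, q)`, the image of `f` lies
on one side of it, with the critical points as the only points over it, and the critical point is a
smooth function `V(x, q)` of the critical value. This gives the uniqueness of the geodesic
(`FoldForm.eq_of_apply_eq`), and shows that the tangent vectors of the hypersurface are the pairs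
`(Y₁, Df(Y))` at the critical point. By the pairing identity its conormal vectors are the multiples
of `(e, -β)`, `β = D²f(e, u)` (`FoldForm.conormal_iff`), which is the description by Jacobi fields.

**The graph condition.** The nonzero conormal vectors are parametrised by `(Ψ₁, Ψ₂)`, where the
points of the hypersurface and the factor `r` of the conormal vector `r • (e, -β)` are coded in one
point of `E × E`; the parameter can be read off smoothly from the conormal vector
(`FoldForm.eq_of_Ψ`). Hence the conormal vectors are locally the graph of a smooth map if and only
if `Ψ₁` is an immersion (`FoldForm.injective_fderiv_of_graph`, `FoldForm.exists_graph`).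
Differentiating `Df(e) = 0` along the critical points shows that the kernel of `DΨ₁` consists of the
`τ` tangent to the conjugate vectors with `D²f(e, τ) = 0` (`FoldForm.injective_fderiv_Ψ₁_iff`),
which is the rank condition. Finally, the conormal vectors are isotropic for the difference of the
two symplectic forms, so that `Ψ₂` is an immersion wherever `Ψ₁` is
(`FoldForm.injective_fderiv_Ψ₂`), and the map is a local diffeomorphism.
-/

noncomputable section FoldConjugate

/-! ### Smooth dependence of solutions of ordinary differential equations -/

section Superposition

set_option synthInstance.maxHeartbeats 200000

open scoped unitInterval

variable {K : Type*} [TopologicalSpace K] [CompactSpace K]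

/-- Pointwise application of a continuous family of continuous linear maps, as a continuous
bilinear map. -/
def ContinuousMap.clmApply (K : Type*) [TopologicalSpace K] [CompactSpace K]
    (F G : Type*) [NormedAddCommGroup F] [NormedSpace ℝ F]
    [NormedAddCommGroup G] [NormedSpace ℝ G] :
    C(K, F →L[ℝ] G) →L[ℝ] C(K, F) →L[ℝ] C(K, G) :=
  LinearMap.mkContinuous₂
    (LinearMap.mk₂ ℝ (fun (g : C(K, F →L[ℝ] G)) (h : C(K, F)) =>
        (⟨fun s => g s (h s), by fun_prop⟩ : C(K, G)))
      (fun g₁ g₂ h => by ext; simp) (fun c g h => by ext; simp)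
      (fun g h₁ h₂ => by ext; simp) (fun c g h => by ext; simp)) 1
    (fun g h => by
      rw [ContinuousMap.norm_le _ (by positivity)]
      intro s
      simp only [LinearMap.mk₂_apply, ContinuousMap.coe_mk, one_mul]
      exact (g s).le_of_opNorm_le_of_le (g.norm_coe_le_norm s) (h.norm_coe_le_norm s))

theorem ContinuousMap.norm_clmApply_le {F G : Type*} [NormedAddCommGroup F] [NormedSpace ℝ F]
    [NormedAddCommGroup G] [NormedSpace ℝ G] (g : C(K, F →L[ℝ] G)) :
    ‖ContinuousMap.clmApply K F G g‖ ≤ ‖g‖ := by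
  refine ContinuousLinearMap.opNorm_le_bound _ (norm_nonneg g) fun h => ?_
  rw [ContinuousMap.norm_le _ (by positivity)]
  intro s
  exact (g s).le_of_opNorm_le_of_le (g.norm_coe_le_norm s) (h.norm_coe_le_norm s)

theorem ContinuousMap.hasFDerivAt_comp {F G : Type*} [NormedAddCommGroup F] [NormedSpace ℝ F]
    [NormedAddCommGroup G] [NormedSpace ℝ G] {X : F → G} (hX : ContDiff ℝ 1 X) (f : C(K, F)) :
    HasFDerivAt (fun f : C(K, F) => (⟨X, hX.continuous⟩ : C(F, G)).comp f)
      (ContinuousMap.clmApply K F G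
        ((⟨fderiv ℝ X, hX.continuous_fderiv one_ne_zero⟩ : C(F, F →L[ℝ] G)).comp f)) f := by
  rw [hasFDerivAt_iff_isLittleO, Asymptotics.isLittleO_iff]
  intro ε hε
  have hc : IsCompact (range f) := isCompact_range f.continuous
  have hu := hc.uniformContinuousAt_of_continuousAt (fderiv ℝ X)
    (fun x _ => (hX.continuous_fderiv one_ne_zero).continuousAt) (Metric.dist_mem_uniformity hε)
  obtain ⟨δ, hδ, hu⟩ := Metric.mem_uniformity_dist.1 hu
  filter_upwards [Metric.ball_mem_nhds f hδ] with g hg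
  rw [ContinuousMap.norm_le _ (by positivity)]
  intro s
  have hs : dist (g s) (f s) < δ := lt_of_le_of_lt (ContinuousMap.dist_apply_le_dist s) hg
  have := (convex_ball (f s) δ).norm_image_sub_le_of_norm_fderiv_le' (𝕜 := ℝ) (f := X)
    (φ := fderiv ℝ X (f s)) (C := ε) (x := f s) (y := g s)
    (fun x _ => (hX.differentiable one_ne_zero) x)
    (fun x hx => by
      have := hu (a := f s) (b := x) (by rw [dist_comm]; exact hx) (mem_range_self s)
      rw [← dist_eq_norm, dist_comm]; exact le_of_lt this)
    (Metric.mem_ball_self hδ) hs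
  refine this.trans ?_
  gcongr
  exact (g - f).norm_coe_le_norm s

universe u

/-- The superposition operator `f ↦ X ∘ f` on continuous maps on a compact space is smooth. -/
theorem ContinuousMap.contDiff_comp_left {F G : Type u} [NormedAddCommGroup F] [NormedSpace ℝ F]
    [NormedAddCommGroup G] [NormedSpace ℝ G] {X : F → G} (hX : ContDiff ℝ ∞ X) :
    ContDiff ℝ ∞ (fun f : C(K, F) => (⟨X, hX.continuous⟩ : C(F, G)).comp f) := by
  rw [contDiff_infty]
  intro n
  induction n generalizing G with
  | zero =>
    rw [Nat.cast_zero, contDiff_zero]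
    exact ContinuousMap.continuous_postcomp _
  | succ n ih =>
    rw [Nat.cast_add, Nat.cast_one, contDiff_succ_iff_hasFDerivAt]
    have h1 : ContDiff ℝ 1 X := hX.of_le (by norm_cast)
    have h2 : ContDiff ℝ ∞ (fderiv ℝ X) := hX.fderiv_right (by norm_cast)
    exact ⟨_, ContDiff.comp (g := ContinuousMap.clmApply K F G) (ContinuousLinearMap.contDiff _)
      (ih h2),
      fun f => ContinuousMap.hasFDerivAt_comp h1 f⟩

end Superposition

section Flow

set_option synthInstance.maxHeartbeats 200000

open scoped unitInterval

variable {F : Type*} [NormedAddCommGroup F] [NormedSpace ℝ F] [CompleteSpace F]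

/-- Integration from `0`, as a continuous linear operator on `C([0, 1], F)`. -/
def integralCLM (F : Type*) [NormedAddCommGroup F] [NormedSpace ℝ F] [CompleteSpace F] :
    C(I, F) →L[ℝ] C(I, F) :=
  LinearMap.mkContinuous
    { toFun := fun y => ⟨fun s => ∫ r in (0 : ℝ)..s, IccExtend zero_le_one y r, by
        have : Continuous fun s : ℝ => ∫ r in (0 : ℝ)..s, IccExtend zero_le_one y r :=
          intervalIntegral.continuous_primitive
            (fun a b => (y.continuous.Icc_extend' (h := zero_le_one)).intervalIntegrable a b) 0
        exact this.comp continuous_subtype_val⟩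
      map_add' := fun y z => by
        ext s
        simp only [ContinuousMap.coe_mk, ContinuousMap.coe_add, Pi.add_apply]
        rw [← intervalIntegral.integral_add
          ((y.continuous.Icc_extend' (h := zero_le_one)).intervalIntegrable _ _)
          ((z.continuous.Icc_extend' (h := zero_le_one)).intervalIntegrable _ _)]
        rfl
      map_smul' := fun c y => by
        ext s
        simp only [ContinuousMap.coe_mk, ContinuousMap.coe_smul, Pi.smul_apply, RingHom.id_apply]
        rw [← intervalIntegral.integral_smul]
        rfl } 1
    (fun y => by
      rw [ContinuousMap.norm_le _ (by positivity)]
      intro s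
      have := intervalIntegral.norm_integral_le_of_norm_le_const (a := (0 : ℝ)) (b := s)
        (f := IccExtend zero_le_one y) (C := ‖y‖) (fun r _ => y.norm_coe_le_norm _)
      refine this.trans ?_
      rw [sub_zero, abs_of_nonneg s.2.1, mul_comm]
      gcongr
      exact s.2.2)

theorem integralCLM_apply (y : C(I, F)) (s : I) :
    integralCLM F y s = ∫ r in (0 : ℝ)..s, IccExtend zero_le_one y r := rfl

theorem norm_integralCLM_le : ‖integralCLM F‖ ≤ 1 :=
  LinearMap.mkContinuous_norm_le _ zero_le_one _

/-- The constant curves, as a continuous linear map `F → C([0, 1], F)`. -/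
def constCurve (F : Type*) [NormedAddCommGroup F] [NormedSpace ℝ F] : F →L[ℝ] C(I, F) :=
  LinearMap.mkContinuous
    { toFun := fun z => ContinuousMap.const I z
      map_add' := fun _ _ => rfl
      map_smul' := fun _ _ => rfl } 1
    (fun z => by
      rw [ContinuousMap.norm_le _ (by positivity)]
      intro s
      exact (one_mul ‖z‖).ge)

omit [CompleteSpace F] in
@[simp] theorem constCurve_apply (z : F) (s : I) : constCurve F z s = z := rfl

/-- The integral equation of the initial value problem `y' = τ X(y)`, `y(0) = z`: the curve `y`
solves it if and only if the value is zero. -/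
def odeDefect {X : F → F} (hX : Continuous X) (u : (ℝ × F) × C(I, F)) : C(I, F) :=
  u.2 - constCurve F u.1.2 - u.1.1 • integralCLM F ((⟨X, hX⟩ : C(F, F)).comp u.2)

theorem contDiff_odeDefect {X : F → F} (hX : ContDiff ℝ ∞ X) :
    ContDiff ℝ ∞ (odeDefect hX.continuous) := by
  have h := ContinuousMap.contDiff_comp_left (K := I) hX
  unfold odeDefect
  refine ContDiff.sub (contDiff_snd.sub ((constCurve F).contDiff.comp
    (contDiff_snd.comp contDiff_fst))) ?_
  exact (contDiff_fst.comp contDiff_fst).smul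
    ((integralCLM F).contDiff.comp (h.comp contDiff_snd))

theorem fderiv_odeDefect_inr {X : F → F} (hX : ContDiff ℝ ∞ X) (u : (ℝ × F) × C(I, F)) :
    fderiv ℝ (odeDefect hX.continuous) u ∘L .inr ℝ (ℝ × F) C(I, F) =
      .id ℝ C(I, F) - u.1.1 • (integralCLM F ∘L ContinuousMap.clmApply I F F
        ((⟨fderiv ℝ X, hX.continuous_fderiv (by simp)⟩ : C(F, F →L[ℝ] F)).comp u.2)) := by
  have h1 : ContDiff ℝ 1 X := hX.of_le (by norm_cast)
  have hd : HasFDerivAt (odeDefect hX.continuous) (fderiv ℝ (odeDefect hX.continuous) u) u :=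
    ((contDiff_odeDefect hX).differentiable (by simp) u).hasFDerivAt
  have hi : HasFDerivAt (fun y : C(I, F) => (u.1, y)) (.inr ℝ (ℝ × F) C(I, F)) u.2 :=
    hasFDerivAt_prodMk_right u.1 u.2
  have h2 := HasFDerivAt.comp u.2 hd hi
  refine h2.unique ?_
  have h3 := ContinuousMap.hasFDerivAt_comp (K := I) h1 u.2
  have h4 := (((hasFDerivAt_id u.2).sub_const (constCurve F u.1.2))).sub
    ((((integralCLM F).hasFDerivAt (x := _)).comp u.2 h3).const_smul u.1.1)
  exact h4

theorem isInvertible_fderiv_odeDefect {X : F → F} (hX : ContDiff ℝ ∞ X)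
    (u : (ℝ × F) × C(I, F)) {C : ℝ} (hC : ∀ s, ‖fderiv ℝ X (u.2 s)‖ ≤ C) (h : |u.1.1| * C < 1) :
    (fderiv ℝ (odeDefect hX.continuous) u ∘L .inr ℝ (ℝ × F) C(I, F)).IsInvertible := by
  rw [fderiv_odeDefect_inr hX]
  set g : C(I, F →L[ℝ] F) :=
    (⟨fderiv ℝ X, hX.continuous_fderiv (by simp)⟩ : C(F, F →L[ℝ] F)).comp u.2 with hg
  have hgC : ‖g‖ ≤ C := (ContinuousMap.norm_le _ ((norm_nonneg _).trans (hC 0))).2 hC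
  set T : C(I, F) →L[ℝ] C(I, F) := u.1.1 • (integralCLM F ∘L ContinuousMap.clmApply I F F g)
  have hT : ‖T‖ < 1 := by
    refine lt_of_le_of_lt ?_ h
    calc ‖T‖ ≤ ‖u.1.1‖ * ‖integralCLM F ∘L ContinuousMap.clmApply I F F g‖ :=
        ContinuousLinearMap.opNorm_smul_le _ _
      _ ≤ ‖u.1.1‖ * (1 * C) := by
        gcongr
        refine (ContinuousLinearMap.opNorm_comp_le _ _).trans ?_
        gcongr
        · exact norm_integralCLM_le
        · exact (ContinuousMap.norm_clmApply_le g).trans hgC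
      _ = |u.1.1| * C := by rw [one_mul, Real.norm_eq_abs]
  obtain ⟨w, hw⟩ := isUnit_one_sub_of_norm_lt_one (R := C(I, F) →L[ℝ] C(I, F)) hT
  exact ⟨ContinuousLinearEquiv.ofUnit w, by rw [← ContinuousLinearMap.one_def, ← hw]; rfl⟩

/-- A smooth vector field has a smooth local flow: the solution curves, which exist by the theorem
of Picard and Lindelöf, are given by the implicit function theorem applied to the integral
equation in `C([0, 1], F)`. -/
theorem exists_contDiffOn_flow {X : F → F} (hX : ContDiff ℝ ∞ X) (z₀ : F) :
    ∃ ε > (0 : ℝ), ∃ r > (0 : ℝ), ∃ φ : ℝ × F → F,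
      ContDiffOn ℝ ∞ φ (Ioo (-ε) ε ×ˢ Metric.ball z₀ r) ∧
      ∀ z ∈ Metric.ball z₀ r, φ (0, z) = z ∧
        ∀ t ∈ Ioo (-ε) ε, HasDerivAt (fun t => φ (t, z)) (X (φ (t, z))) t := by
  have hX1 : ContDiff ℝ 1 X := hX.of_le (by norm_cast)
  have hXd : Continuous (fderiv ℝ X) := hX1.continuous_fderiv one_ne_zero
  obtain ⟨ε₀, hε₀, a, r₀, L, K, hr₀, hpl⟩ :=
    IsPicardLindelof.of_contDiffAt_one (hX1.contDiffAt (x := z₀))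
  obtain ⟨α, hα, hαc⟩ := (hpl 0).exists_forall_mem_closedBall_eq_hasDerivWithinAt_continuousOn
  simp only [zero_sub, zero_add] at hα hαc
  set C : ℝ := ‖fderiv ℝ X z₀‖ + 1 with hC
  have hC0 : 0 < C := by positivity
  have hev : ∀ᶠ z in 𝓝 z₀, ‖fderiv ℝ X z‖ < C :=
    (hXd.norm.tendsto z₀).eventually (gt_mem_nhds (by rw [hC]; linarith))
  have hnhds : Metric.closedBall z₀ (r₀ : ℝ) ×ˢ Icc (-ε₀) ε₀ ∈ 𝓝 (z₀, (0 : ℝ)) :=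
    prod_mem_nhds (Metric.closedBall_mem_nhds _ hr₀) (Icc_mem_nhds (by linarith) hε₀)
  have hαat : ContinuousAt α (z₀, 0) := hαc.continuousAt hnhds
  have hα0 : α (z₀, 0) = z₀ := (hα z₀ (Metric.mem_closedBall_self r₀.2)).1
  have hev2 : ∀ᶠ p in 𝓝 (z₀, (0 : ℝ)), ‖fderiv ℝ X (α p)‖ < C :=
    hαat.eventually (by rw [hα0]; exact hev)
  obtain ⟨r₁, hr₁, hball⟩ := Metric.eventually_nhds_iff_ball.1 hev2
  set ε : ℝ := min (min ε₀ r₁) (1 / C) with hε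
  set r : ℝ := min r₀ r₁ with hr
  have hεpos : 0 < ε := by positivity
  have hrpos : 0 < r := lt_min hr₀ hr₁
  have hεε₀ : ε ≤ ε₀ := (min_le_left _ _).trans (min_le_left _ _)
  have hεr₁ : ε ≤ r₁ := (min_le_left _ _).trans (min_le_right _ _)
  have hεC : ε ≤ 1 / C := min_le_right _ _
  set D : Set (ℝ × F) := Ioo (-ε) ε ×ˢ Metric.ball z₀ r with hD
  have hDo : IsOpen D := isOpen_Ioo.prod Metric.isOpen_ball
  have hmul : ∀ p ∈ D, ∀ s ∈ Icc (0 : ℝ) 1, p.1 * s ∈ Ioo (-ε) ε := by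
    rintro ⟨τ, z⟩ ⟨hτ, -⟩ s hs
    have h1 : |τ * s| < ε := by
      rw [abs_mul, abs_of_nonneg hs.1]
      calc |τ| * s ≤ |τ| * 1 := by gcongr; exact hs.2
        _ < ε := by rw [mul_one]; exact abs_lt.2 hτ
    exact abs_lt.1 h1
  have hzr : ∀ p ∈ D, p.2 ∈ Metric.closedBall z₀ (r₀ : ℝ) := fun p hp =>
    Metric.ball_subset_closedBall (Metric.ball_subset_ball (min_le_left _ _) hp.2)
  have hderiv : ∀ z ∈ Metric.closedBall z₀ (r₀ : ℝ), ∀ t ∈ Ioo (-ε) ε,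
      HasDerivAt (fun t => α (z, t)) (X (α (z, t))) t := fun z hz t ht =>
    ((hα z hz).2 t ⟨by linarith [ht.1], by linarith [ht.2]⟩).hasDerivAt
      (Icc_mem_nhds (by linarith [ht.1]) (by linarith [ht.2]))
  have hmaps : ∀ q : D × I, ((q.1 : ℝ × F).2, (q.1 : ℝ × F).1 * (q.2 : ℝ)) ∈
      Metric.closedBall z₀ (r₀ : ℝ) ×ˢ Icc (-ε₀) ε₀ := by
    rintro ⟨⟨p, hp⟩, s, hs⟩
    have := hmul p hp s hs
    exact ⟨hzr p hp, by linarith [this.1], by linarith [this.2]⟩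
  have hcont : Continuous fun q : D × I =>
      α ((q.1 : ℝ × F).2, (q.1 : ℝ × F).1 * (q.2 : ℝ)) :=
    hαc.comp_continuous (by fun_prop) hmaps
  -- the solution curves, rescaled to `[0, 1]`, as a continuous family
  let Y : C(D, C(I, F)) := ContinuousMap.curry ⟨_, hcont⟩
  have hY : ∀ (p : D) (s : I), Y p s = α ((p : ℝ × F).2, (p : ℝ × F).1 * (s : ℝ)) := fun _ _ => rfl
  classical
  let y : ℝ × F → C(I, F) := fun p => if h : p ∈ D then Y ⟨p, h⟩ else 0
  have hy : ∀ p (h : p ∈ D), y p = Y ⟨p, h⟩ := fun p h => dif_pos h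
  have hyc : ContinuousOn y D := by
    rw [continuousOn_iff_continuous_domRestrict]
    convert Y.continuous using 1
    ext1 p
    exact hy p p.2
  have hdef : ∀ p ∈ D, odeDefect hX.continuous (p, y p) = 0 := by
    intro p hp
    ext s
    have hint : ∫ r in (0 : ℝ)..s, p.1 • X (α (p.2, p.1 * r)) =
        α (p.2, p.1 * s) - α (p.2, p.1 * 0) := by
      have hmem : ∀ r ∈ uIcc (0 : ℝ) s, r ∈ Icc (0 : ℝ) 1 := by
        intro r hr
        rw [uIcc_of_le s.2.1] at hr
        exact ⟨hr.1, hr.2.trans s.2.2⟩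
      have hd : ∀ r ∈ uIcc (0 : ℝ) s, HasDerivAt (fun r => α (p.2, p.1 * r))
          (p.1 • X (α (p.2, p.1 * r))) r := by
        intro r hr
        have h1 := hderiv p.2 (hzr p hp) (p.1 * r) (hmul p hp r (hmem r hr))
        have h2 : HasDerivAt (fun r : ℝ => p.1 * r) p.1 r := by
          simpa using (hasDerivAt_id r).const_mul p.1
        exact HasDerivAt.scomp (g₁ := fun t => α (p.2, t)) (h := fun r : ℝ => p.1 * r) r h1 h2
      refine intervalIntegral.integral_eq_sub_of_hasDerivAt hd
        (ContinuousOn.intervalIntegrable ?_)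
      have hc : ContinuousOn (fun r => α (p.2, p.1 * r)) (uIcc (0 : ℝ) s) :=
        fun r hr => (hd r hr).continuousAt.continuousWithinAt
      exact (hX.continuous.comp_continuousOn hc).const_smul p.1
    have hint2 : integralCLM F ((⟨X, hX.continuous⟩ : C(F, F)).comp (y p)) s =
        ∫ r in (0 : ℝ)..s, X (α (p.2, p.1 * r)) := by
      rw [integralCLM_apply]
      refine intervalIntegral.integral_congr fun r hr => ?_
      rw [uIcc_of_le s.2.1] at hr
      have hr' : r ∈ Icc (0 : ℝ) 1 := ⟨hr.1, hr.2.trans s.2.2⟩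
      change IccExtend zero_le_one _ r = _
      rw [IccExtend_of_mem zero_le_one _ hr', hy p hp]
      rfl
    rw [intervalIntegral.integral_smul, mul_zero, (hα p.2 (hzr p hp)).1] at hint
    simp only [odeDefect, ContinuousMap.coe_sub, Pi.sub_apply, constCurve_apply,
      ContinuousMap.coe_smul, Pi.smul_apply, hint2, hint]
    rw [hy p hp, hY]
    simp
  have hsmooth : ∀ p ∈ D, ContDiffAt ℝ ∞ y p := by
    intro p hp
    have hinv := isInvertible_fderiv_odeDefect hX (p, y p) (C := C)
      (fun s => by
        refine le_of_lt ?_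
        rw [hy p hp, hY]
        refine hball _ ?_
        have h1 := hmul p hp s s.2
        rw [Metric.mem_ball, Prod.dist_eq, max_lt_iff]
        refine ⟨lt_of_lt_of_le hp.2 (min_le_right _ _), ?_⟩
        simp only [dist_zero_right, Real.norm_eq_abs]
        exact lt_of_lt_of_le (abs_lt.2 h1) hεr₁)
      (by
        have h1 : |p.1| < 1 / C := lt_of_lt_of_le (abs_lt.2 hp.1) hεC
        rwa [lt_div_iff₀ hC0] at h1)
    have hcd : ContDiffAt ℝ ∞ (odeDefect hX.continuous) (p, y p) :=
      (contDiff_odeDefect hX).contDiffAt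
    have h1 := hcd.eventually_apply_eq_iff_implicitFunction (by simp) hinv
    have h2 := hcd.contDiffAt_implicitFunction (by simp) hinv
    have hyp : ContinuousAt y p := hyc.continuousAt (hDo.mem_nhds hp)
    have h3 : Tendsto (fun q => (q, y q)) (𝓝 p) (𝓝 (p, y p)) :=
      (continuousAt_id.prodMk hyp)
    refine h2.congr_of_eventuallyEq ?_
    filter_upwards [h3.eventually h1, hDo.mem_nhds hp] with q hq hqD
    exact ((hq.1 (by rw [hdef q hqD, hdef p hp]))).symm
  refine ⟨ε, hεpos, r, hrpos, fun p => α (p.2, p.1), ?_, ?_⟩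
  · intro p hp
    refine ContDiffAt.contDiffWithinAt ?_
    have h1 : ContDiffAt ℝ ∞ (fun q => ContinuousMap.evalCLM ℝ (1 : I) (y q)) p :=
      (ContinuousLinearMap.contDiff _).contDiffAt.comp p (hsmooth p hp)
    refine h1.congr_of_eventuallyEq ?_
    filter_upwards [hDo.mem_nhds hp] with q hq
    simp [hy q hq, hY]
  · intro z hz
    have hz' : z ∈ Metric.closedBall z₀ (r₀ : ℝ) :=
      Metric.ball_subset_closedBall (Metric.ball_subset_ball (min_le_left _ _) hz)
    exact ⟨(hα z hz').1, fun t ht => hderiv z hz' t ht⟩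

/-- The local flow of a vector field which is smooth on an open set. -/
theorem exists_contDiffOn_flow_of_isOpen [FiniteDimensional ℝ F] {X : F → F} {U : Set F}
    (hU : IsOpen U) (hX : ContDiffOn ℝ ∞ X U) {z₀ : F} (hz₀ : z₀ ∈ U) :
    ∃ ε > (0 : ℝ), ∃ V : Set F, IsOpen V ∧ z₀ ∈ V ∧ ∃ φ : ℝ × F → F,
      ContDiffOn ℝ ∞ φ (Ioo (-ε) ε ×ˢ V) ∧
      ∀ z ∈ V, φ (0, z) = z ∧ ∀ t ∈ Ioo (-ε) ε, φ (t, z) ∈ U ∧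
        HasDerivAt (fun t => φ (t, z)) (X (φ (t, z))) t := by
  obtain ⟨R, hR, hRU⟩ := Metric.nhds_basis_closedBall.mem_iff.1 (hU.mem_nhds hz₀)
  -- cut the field off outside a ball, so that it becomes globally smooth
  let χ : ContDiffBump z₀ := ⟨R / 2, R, half_pos hR, half_lt_self hR⟩
  have hX' : ContDiff ℝ ∞ fun z => χ z • X z := by
    rw [contDiff_iff_contDiffAt]
    intro z
    by_cases hz : z ∈ Metric.closedBall z₀ R
    · exact χ.contDiffAt.smul (hX.contDiffAt (hU.mem_nhds (hRU hz)))
    · refine (contDiffAt_const (c := (0 : F))).congr_of_eventuallyEq ?_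
      filter_upwards [Metric.isClosed_closedBall.isOpen_compl.mem_nhds hz] with w hw
      have hw' : R ≤ dist w z₀ := (not_le.1 (fun h => hw (Metric.mem_closedBall.2 h))).le
      rw [χ.zero_of_le_dist hw', zero_smul]
  obtain ⟨ε, hε, r, hr, φ, hφ, hsol⟩ := exists_contDiffOn_flow hX' z₀
  have hmem : Ioo (-ε) ε ×ˢ Metric.ball z₀ r ∈ 𝓝 ((0 : ℝ), z₀) :=
    (isOpen_Ioo.prod Metric.isOpen_ball).mem_nhds ⟨⟨by linarith, hε⟩, Metric.mem_ball_self hr⟩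
  have hc : ContinuousAt φ (0, z₀) := hφ.continuousOn.continuousAt hmem
  have hev : ∀ᶠ p in 𝓝 ((0 : ℝ), z₀), φ p ∈ Metric.closedBall z₀ (R / 2) :=
    hc (by rw [(hsol z₀ (Metric.mem_ball_self hr)).1]
           exact Metric.closedBall_mem_nhds _ (half_pos hR))
  obtain ⟨δ, hδ, hball⟩ := Metric.eventually_nhds_iff_ball.1 hev
  refine ⟨min ε δ, lt_min hε hδ, Metric.ball z₀ (min r δ), Metric.isOpen_ball,
    Metric.mem_ball_self (lt_min hr hδ), φ, hφ.mono ?_, fun z hz => ?_⟩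
  · refine prod_mono (Ioo_subset_Ioo ?_ (min_le_left _ _))
      (Metric.ball_subset_ball (min_le_left _ _))
    exact neg_le_neg (min_le_left _ _)
  · have hz' : z ∈ Metric.ball z₀ r := Metric.ball_subset_ball (min_le_left _ _) hz
    refine ⟨(hsol z hz').1, fun t ht => ?_⟩
    have hin : φ (t, z) ∈ Metric.closedBall z₀ (R / 2) := by
      refine hball _ ?_
      rw [Metric.mem_ball, Prod.dist_eq, max_lt_iff]
      refine ⟨?_, lt_of_lt_of_le hz (min_le_right _ _)⟩
      rw [dist_zero_right, Real.norm_eq_abs]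
      exact lt_of_lt_of_le (abs_lt.2 ht) (min_le_right _ _)
    have h1 := (hsol z hz').2 t ⟨by linarith [ht.1, min_le_left ε δ],
      by linarith [ht.2, min_le_left ε δ]⟩
    rw [χ.one_of_mem_closedBall hin, one_smul] at h1
    exact ⟨hRU (Metric.closedBall_subset_closedBall (by linarith) hin), h1⟩

end Flow

/-! ### The first variation formula and the symplectic identity in coordinates -/

section Calculus

set_option synthInstance.maxHeartbeats 200000

variable {E : Type*} [NormedAddCommGroup E] [NormedSpace ℝ E]

/-- First variation in coordinates: for a two-parameter map `Y(t, s)` and a metric `G`, the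
`t`-derivative of `G(∂ₜY, ∂ₛY)` differs from the `s`-derivative of the energy `½ G(∂ₜY, ∂ₜY)` by
the pairing of `∂ₛY` with the geodesic curvature vector `∂ₜ²Y + Γ(∂ₜY, ∂ₜY)`. -/
theorem exists_hasDerivAt_firstVariation {Y : ℝ × ℝ → E} {G : E → E →L[ℝ] E →L[ℝ] ℝ} {t₀ : ℝ}
    {Γ : E} (hY : ContDiffAt ℝ 2 Y (t₀, 0)) (hG : DifferentiableAt ℝ G (Y (t₀, 0)))
    (hsymm : ∀ a b, G (Y (t₀, 0)) a b = G (Y (t₀, 0)) b a)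
    (hΓ : ∀ z, G (Y (t₀, 0)) Γ z =
      fderiv ℝ G (Y (t₀, 0)) (fderiv ℝ Y (t₀, 0) (1, 0)) (fderiv ℝ Y (t₀, 0) (1, 0)) z -
      (1 / 2) * fderiv ℝ G (Y (t₀, 0)) z (fderiv ℝ Y (t₀, 0) (1, 0))
        (fderiv ℝ Y (t₀, 0) (1, 0))) :
    ∃ B : ℝ,
      HasDerivAt (fun t => G (Y (t, 0)) (fderiv ℝ Y (t, 0) (1, 0)) (fderiv ℝ Y (t, 0) (0, 1)))
        (G (Y (t₀, 0)) (fderiv ℝ (fderiv ℝ Y) (t₀, 0) (1, 0) (1, 0) + Γ)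
          (fderiv ℝ Y (t₀, 0) (0, 1)) + B) t₀ ∧
      HasDerivAt (fun s => (1 / 2 : ℝ) *
        G (Y (t₀, s)) (fderiv ℝ Y (t₀, s) (1, 0)) (fderiv ℝ Y (t₀, s) (1, 0))) B 0 := by
  set p : ℝ × ℝ := (t₀, 0) with hp
  have hYd : HasFDerivAt Y (fderiv ℝ Y p) p :=
    (hY.differentiableAt (by norm_num)).hasFDerivAt
  have hY2 : HasFDerivAt (fderiv ℝ Y) (fderiv ℝ (fderiv ℝ Y) p) p :=
    ((hY.fderiv_right (m := 1) (by norm_num)).differentiableAt (by norm_num)).hasFDerivAt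
  have hsym2 : fderiv ℝ (fderiv ℝ Y) p (1, 0) (0, 1) = fderiv ℝ (fderiv ℝ Y) p (0, 1) (1, 0) :=
    (hY.isSymmSndFDerivAt (by simp)) (1, 0) (0, 1)
  have hc1 : HasDerivAt (fun t : ℝ => (t, (0 : ℝ))) (1, 0) t₀ :=
    (hasDerivAt_id t₀).prodMk (hasDerivAt_const t₀ 0)
  have hc2 : HasDerivAt (fun s : ℝ => (t₀, s)) (0, 1) 0 :=
    (hasDerivAt_const 0 t₀).prodMk (hasDerivAt_id 0)
  have hGY : HasFDerivAt (fun q => G (Y q)) (fderiv ℝ G (Y p) ∘L fderiv ℝ Y p) p :=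
    HasFDerivAt.comp (g := G) p hG.hasFDerivAt hYd
  have hgt := HasFDerivAt.comp_hasDerivAt (l := fun q => G (Y q))
    (f := fun t : ℝ => (t, (0 : ℝ))) t₀ hGY hc1
  have hgs := HasFDerivAt.comp_hasDerivAt (l := fun q => G (Y q))
    (f := fun s : ℝ => (t₀, s)) 0 hGY hc2
  have hyt := HasFDerivAt.comp_hasDerivAt (f := fun t : ℝ => (t, (0 : ℝ))) t₀ hY2 hc1
  have hys := HasFDerivAt.comp_hasDerivAt (f := fun s : ℝ => (t₀, s)) 0 hY2 hc2
  have hθ := (hgt.clm_apply (hyt.clm_apply (hasDerivAt_const t₀ ((1 : ℝ), (0 : ℝ))))).clm_apply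
    (hyt.clm_apply (hasDerivAt_const t₀ ((0 : ℝ), (1 : ℝ))))
  have hL := ((hgs.clm_apply (hys.clm_apply (hasDerivAt_const 0 ((1 : ℝ), (0 : ℝ))))).clm_apply
    (hys.clm_apply (hasDerivAt_const 0 ((1 : ℝ), (0 : ℝ))))).const_mul (1 / 2 : ℝ)
  refine ⟨_, ?_, hL⟩
  refine hθ.congr_deriv ?_
  simp only [Function.comp_apply, ContinuousLinearMap.comp_apply, map_zero, add_zero,
    map_add, add_apply, ← hp, hsym2, hΓ]
  rw [hsymm (fderiv ℝ (fderiv ℝ Y) p (0, 1) (1, 0)) (fderiv ℝ Y p (1, 0))]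
  ring

variable {F : Type*} [NormedAddCommGroup F] [NormedSpace ℝ F]

/-- The exterior derivative of the first variation formula. If
`G₂(f)(D_{(0,u)} f, D_Y f) = G₁(x)(u, Y₁) + D_Y L` for all `Y`, then the second derivative
`D²f((0, a), (0, u))` of `f` in a direction `(0, a)` of the kernel of `Df` represents the form
`Y ↦ G₁(x)(a, Y₁)` on the image of `Df`. -/
theorem inner_fderiv_fderiv_eq_of_firstVariation {f : F × F → E} {L : F × F → ℝ}
    {G₁ : F → F →L[ℝ] F →L[ℝ] ℝ} {G₂ : E → E →L[ℝ] E →L[ℝ] ℝ} {z : F × F}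
    (hf : ContDiffAt ℝ 2 f z) (hL : ContDiffAt ℝ 2 L z) (hG₁ : DifferentiableAt ℝ G₁ z.1)
    (hG₂ : DifferentiableAt ℝ G₂ (f z))
    (h : ∀ᶠ w in 𝓝 z, ∀ Y : F × F,
      G₂ (f w) (fderiv ℝ f w (0, w.2)) (fderiv ℝ f w Y) = G₁ w.1 w.2 Y.1 + fderiv ℝ L w Y)
    {a : F} (ha : fderiv ℝ f z (0, a) = 0) (Y : F × F) :
    G₂ (f z) (fderiv ℝ (fderiv ℝ f) z (0, a) (0, z.2)) (fderiv ℝ f z Y) = G₁ z.1 a Y.1 := by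
  have hfd : HasFDerivAt f (fderiv ℝ f z) z := (hf.differentiableAt (by norm_num)).hasFDerivAt
  have hf2 : HasFDerivAt (fderiv ℝ f) (fderiv ℝ (fderiv ℝ f) z) z :=
    ((hf.fderiv_right (m := 1) (by norm_num)).differentiableAt (by norm_num)).hasFDerivAt
  have hL2 : HasFDerivAt (fderiv ℝ L) (fderiv ℝ (fderiv ℝ L) z) z :=
    ((hL.fderiv_right (m := 1) (by norm_num)).differentiableAt (by norm_num)).hasFDerivAt
  have hsymf : ∀ X Y, fderiv ℝ (fderiv ℝ f) z X Y = fderiv ℝ (fderiv ℝ f) z Y X :=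
    fun X Y => hf.isSymmSndFDerivAt (by simp) X Y
  have hsymL : ∀ X Y, fderiv ℝ (fderiv ℝ L) z X Y = fderiv ℝ (fderiv ℝ L) z Y X :=
    fun X Y => hL.isSymmSndFDerivAt (by simp) X Y
  have hG₂f : HasFDerivAt (fun w => G₂ (f w)) (fderiv ℝ G₂ (f z) ∘L fderiv ℝ f z) z :=
    HasFDerivAt.comp (g := G₂) z hG₂.hasFDerivAt hfd
  have hG₁f : HasFDerivAt (fun w : F × F => G₁ w.1) (fderiv ℝ G₁ z.1 ∘L .fst ℝ F F) z :=
    HasFDerivAt.comp (g := G₁) (f := fun w : F × F => w.1) z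
      hG₁.hasFDerivAt (hasFDerivAt_fst (𝕜 := ℝ) (p := z))
  have hu : HasFDerivAt (fun w : F × F => ((0 : F), w.2))
      ((0 : F × F →L[ℝ] F).prod (.snd ℝ F F)) z := (hasFDerivAt_const 0 z).prodMk hasFDerivAt_snd
  -- the derivative of the identity with the direction `Y` frozen
  have key : ∀ X Y : F × F, _ := fun X Y => by
    have h1 := (hG₂f.clm_apply (hf2.clm_apply hu)).clm_apply
      (hf2.clm_apply (hasFDerivAt_const Y z))
    have h2 := ((hG₁f.clm_apply hasFDerivAt_snd).clm_apply
      (hasFDerivAt_const Y.1 z)).add (hL2.clm_apply (hasFDerivAt_const Y z))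
    have h3 := h1.unique (h2.congr_of_eventuallyEq (h.mono fun w hw => hw Y))
    exact congrArg (fun T : F × F →L[ℝ] ℝ => T X) h3
  have k1 := key (0, a) Y
  have k2 := key Y (0, a)
  simp [ha] at k1 k2
  rw [hsymf (0, a) Y, hsymL (0, a) Y] at k1
  linarith

end Calculus

/-! ### The fold normal form of a family of maps -/

section NormalForm

set_option synthInstance.maxHeartbeats 200000

theorem isOpen_setOf_isInvertible {E F : Type*} [NormedAddCommGroup E] [NormedSpace ℝ E]
    [CompleteSpace E] [NormedAddCommGroup F] [NormedSpace ℝ F] :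
    IsOpen {T : E →L[ℝ] F | T.IsInvertible} :=
  ContinuousLinearEquiv.isOpen

/-- The inverse function theorem for smooth maps, with a smooth inverse on an open set. -/
theorem exists_openPartialHomeomorph_of_isInvertible {E F : Type*} [NormedAddCommGroup E]
    [NormedSpace ℝ E] [CompleteSpace E] [NormedAddCommGroup F] [NormedSpace ℝ F]
    {f : E → F} {U : Set E} (hU : IsOpen U) (hf : ContDiffOn ℝ ∞ f U) {x : E} (hx : x ∈ U)
    (hinv : (fderiv ℝ f x).IsInvertible) :
    ∃ e : OpenPartialHomeomorph E F, x ∈ e.source ∧ e.source ⊆ U ∧ (∀ y, e y = f y) ∧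
      ContDiffOn ℝ ∞ e.symm e.target ∧ ∀ y ∈ e.source, (fderiv ℝ f y).IsInvertible := by
  have hfx : ContDiffAt ℝ ∞ f x := hf.contDiffAt (hU.mem_nhds hx)
  obtain ⟨A, hA⟩ := hinv
  have hfd : HasFDerivAt f (A : E →L[ℝ] F) x := by
    rw [hA]; exact (hfx.differentiableAt (by simp)).hasFDerivAt
  set e₀ := hfx.toOpenPartialHomeomorph f hfd (by simp)
  have hcont : ContinuousOn (fderiv ℝ f) U := hf.continuousOn_fderiv_of_isOpen hU (by simp)
  have hO : IsOpen (U ∩ fderiv ℝ f ⁻¹' {T | T.IsInvertible}) :=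
    hcont.isOpen_inter_preimage hU isOpen_setOf_isInvertible
  refine ⟨e₀.restrOpen _ hO, ⟨hfx.mem_toOpenPartialHomeomorph_source hfd (by simp), hx, A, hA⟩,
    fun y hy => hy.2.1, fun y => rfl, fun y hy => ?_, fun y hy => hy.2.2⟩
  have hy' := (e₀.restrOpen _ hO).map_target hy
  obtain ⟨B, hB⟩ := hy'.2.2
  refine (OpenPartialHomeomorph.contDiffAt_symm _ hy (f₀' := B) ?_ ?_).contDiffWithinAt
  · rw [hB]
    exact ((hf.contDiffAt (hU.mem_nhds hy'.2.1)).differentiableAt (by simp)).hasFDerivAt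
  · exact hf.contDiffAt (hU.mem_nhds hy'.2.1)

variable {E : Type*} [NormedAddCommGroup E] [NormedSpace ℝ E] [FiniteDimensional ℝ E]

theorem ContinuousLinearMap.isInvertible_of_injective {F G : Type*} [NormedAddCommGroup F]
    [NormedSpace ℝ F] [FiniteDimensional ℝ F] [NormedAddCommGroup G] [NormedSpace ℝ G]
    [FiniteDimensional ℝ G] (h : Module.finrank ℝ F = Module.finrank ℝ G)
    {A : F →L[ℝ] G} (hA : Function.Injective A) : A.IsInvertible :=
  ⟨(LinearEquiv.ofInjectiveOfFinrankEq (A : F →ₗ[ℝ] G) hA h).toContinuousLinearEquiv, by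
    ext; rfl⟩

/-- A linear map with one-dimensional kernel spanned by `e`, and a vector `c` outside its range,
become the projection along `e` and the vector `e` after a linear change of the target. -/
theorem exists_equiv_comp_eq_sub_smul {A : E →L[ℝ] E} {lam : E →L[ℝ] ℝ} {e c : E}
    (hlam : lam e = 1) (hker : ∀ a, A a = 0 ↔ ∃ r : ℝ, a = r • e) (hc : ∀ a, A a ≠ c) :
    ∃ T : E ≃L[ℝ] E, (∀ a, T (A a) = a - lam a • e) ∧ T c = e := by
  have hAe : A e = 0 := (hker e).2 ⟨1, by simp⟩
  set S : E →L[ℝ] E := A + lam.smulRight c with hS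
  have hSa : ∀ w, S w = A w + lam w • c := fun w => rfl
  have hinj : Function.Injective S := by
    rw [injective_iff_map_eq_zero]
    intro w hw
    rw [hSa] at hw
    by_cases h0 : lam w = 0
    · rw [h0, zero_smul, add_zero] at hw
      obtain ⟨r, rfl⟩ := (hker w).1 hw
      rw [map_smul, hlam, smul_eq_mul, mul_one] at h0
      rw [h0, zero_smul]
    · refine absurd ?_ (hc (-(lam w)⁻¹ • w))
      rw [map_smul, eq_neg_of_add_eq_zero_left hw, smul_neg, neg_smul, neg_neg, smul_smul,
        inv_mul_cancel₀ h0, one_smul]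
  obtain ⟨S', hS'⟩ := ContinuousLinearMap.isInvertible_of_injective rfl hinj
  have hS'a : ∀ w, S' w = A w + lam w • c := fun w => by rw [← hSa, ← hS']; rfl
  refine ⟨S'.symm, fun a => ?_, ?_⟩
  · rw [ContinuousLinearEquiv.symm_apply_eq, hS'a]
    simp [hAe, hlam]
  · rw [ContinuousLinearEquiv.symm_apply_eq, hS'a]
    simp [hAe, hlam]

/-- Near a point where the partial differential of `f` in the second variable has a
one-dimensional kernel spanned by `e₀`, there is a smooth vector field `e` which spans the kernel
wherever the kernel is not zero. It is normalised by `lam (e z) = 1`. -/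
theorem exists_kernelField {f : E × E → E} {Ω : Set (E × E)} (hΩ : IsOpen Ω)
    (hf : ContDiffOn ℝ ∞ f Ω) {z₀ : E × E} (hz₀ : z₀ ∈ Ω) {e₀ : E} {lam : E →L[ℝ] ℝ}
    (T : E ≃L[ℝ] E) (hlam : lam e₀ = 1)
    (hT : ∀ a, T (fderiv ℝ f z₀ (0, a)) = a - lam a • e₀) :
    ∃ Ω₁ : Set (E × E), IsOpen Ω₁ ∧ z₀ ∈ Ω₁ ∧ Ω₁ ⊆ Ω ∧ ∃ e : E × E → E,
      ContDiffOn ℝ ∞ e Ω₁ ∧ e z₀ = e₀ ∧ ∀ z ∈ Ω₁, lam (e z) = 1 ∧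
        T (fderiv ℝ f z (0, e z)) = lam (T (fderiv ℝ f z (0, e z))) • e₀ ∧
        ∀ a, (∃ r : ℝ, T (fderiv ℝ f z (0, a)) = r • e₀) → a = lam a • e z := by
  have hfd : ContDiffOn ℝ ∞ (fderiv ℝ f) Ω := hf.fderiv_of_isOpen hΩ (by simp)
  -- `P` is the projection along `e₀`
  set P : E →L[ℝ] E := .id ℝ E - lam.smulRight e₀ with hP
  have hPa : ∀ a, P a = a - lam a • e₀ := fun a => rfl
  have hPe : P e₀ = 0 := by rw [hPa, hlam, one_smul, sub_self]
  have hlP : ∀ a, lam (P a) = 0 := fun a => by simp [hPa, hlam]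
  set N : E × E → E →L[ℝ] E := fun z =>
    (P ∘L (T : E →L[ℝ] E)) ∘L (fderiv ℝ f z ∘L .inr ℝ E E) + lam.smulRight e₀ with hN
  have hNa : ∀ z a, N z a = P (T (fderiv ℝ f z (0, a))) + lam a • e₀ := fun z a => rfl
  have hNs : ContDiffOn ℝ ∞ N Ω :=
    (contDiffOn_const.clm_comp (hfd.clm_comp contDiffOn_const)).add contDiffOn_const
  have hN0 : N z₀ = .id ℝ E := by
    ext a
    rw [hNa, hT, ← hPa, hPa, hlP, zero_smul, sub_zero, hPa]
    simp
  refine ⟨Ω ∩ N ⁻¹' {T | T.IsInvertible},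
    hNs.continuousOn.isOpen_inter_preimage hΩ isOpen_setOf_isInvertible,
    ⟨hz₀, by rw [mem_preimage, hN0]; exact ⟨.refl ℝ E, rfl⟩⟩, inter_subset_left,
    fun z => (N z).inverse e₀, ?_, ?_, ?_⟩
  · intro z hz
    have h1 : ContDiffAt ℝ ∞ N z := hNs.contDiffAt (hΩ.mem_nhds hz.1)
    have h2 : ContDiffAt ℝ ∞ ContinuousLinearMap.inverse (N z) :=
      ContinuousLinearMap.IsInvertible.contDiffAt_map_inverse hz.2
    exact ((h2.comp z h1).clm_apply contDiffAt_const).contDiffWithinAt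
  · simp only [hN0, ContinuousLinearMap.inverse_id, ContinuousLinearMap.id_apply]
  · rintro z ⟨hz, hinv⟩
    have hNe : N z ((N z).inverse e₀) = e₀ := hinv.self_apply_inverse e₀
    have hl : lam ((N z).inverse e₀) = 1 := by
      have := congrArg lam hNe
      rwa [hNa, map_add, hlP, zero_add, map_smul, hlam, smul_eq_mul, mul_one] at this
    refine ⟨hl, ?_, ?_⟩
    · rw [hNa, hl, one_smul, add_eq_right, hPa, sub_eq_zero] at hNe
      exact hNe
    · rintro a ⟨r, hr⟩
      have : N z a = N z (lam a • (N z).inverse e₀) := by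
        rw [map_smul, hNe, hNa, hr, map_smul, hPe, smul_zero, zero_add]
      exact hinv.injective this

end NormalForm

section FoldForm

set_option synthInstance.maxHeartbeats 200000

/-- The fold normal form near a point `z₀ = (x₀, u₀)` of a family of maps `u ↦ f (x, u)`
between spaces of the same dimension. The critical values of the family are the points `(x, q)` of
the hypersurface `ℓ q = H (x, q)`, a graph in the direction of the vector `c`; the function `V`
recovers the critical point from the critical value, and `e` spans the kernel of the differential at
the critical points. The function `ℓ q - H (x, q)` is nonnegative on the image of the family, with
equality only at the critical values. -/
structure FoldForm {E : Type*} [NormedAddCommGroup E] [NormedSpace ℝ E] (f : E × E → E)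
    (z₀ : E × E) where
  /-- The domain of the normal form in the source. -/
  Ω : Set (E × E)
  /-- The domain of the normal form in the target. -/
  D : Set (E × E)
  /-- The linear functional of which the hypersurface of critical values is a level set up to `H`. -/
  ℓ : E →L[ℝ] ℝ
  /-- The direction in which the hypersurface is a graph. -/
  c : E
  /-- The functional which normalises the kernel field. -/
  m : E →L[ℝ] ℝ
  /-- The graph function of the hypersurface of critical values. -/
  H : E × E → ℝ
  /-- The critical point over a critical value. -/
  V : E × E → E
  /-- The kernel field. -/
  e : E × E → E
  isOpen_Ω : IsOpen Ω
  isOpen_D : IsOpen D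
  mem_Ω : z₀ ∈ Ω
  contDiffOn_f : ContDiffOn ℝ ∞ f Ω
  contDiffOn_H : ContDiffOn ℝ ∞ H D
  contDiffOn_V : ContDiffOn ℝ ∞ V D
  contDiffOn_e : ContDiffOn ℝ ∞ e Ω
  ℓ_c : ℓ c = 1
  mem_D : ∀ z ∈ Ω, (z.1, f z) ∈ D
  add_mem_D : ∀ x q (s : ℝ), (x, q) ∈ D → (x, q + s • c) ∈ D
  H_add : ∀ x q (s : ℝ), H (x, q + s • c) = H (x, q)
  V_add : ∀ x q (s : ℝ), V (x, q + s • c) = V (x, q)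
  m_e : ∀ z ∈ Ω, m (e z) = 1
  eq_smul_e : ∀ z ∈ Ω, ∀ a, fderiv ℝ f z (0, a) = 0 → a = m a • e z
  H_le : ∀ z ∈ Ω, H (z.1, f z) ≤ ℓ (f z)
  H_eq_iff : ∀ z ∈ Ω, ℓ (f z) = H (z.1, f z) ↔ fderiv ℝ f z (0, e z) = 0
  V_apply : ∀ z ∈ Ω, fderiv ℝ f z (0, e z) = 0 → V (z.1, f z) = z.2
  mem_of_eq : ∀ p ∈ D, ℓ p.2 = H p → (p.1, V p) ∈ Ω ∧ f (p.1, V p) = p.2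

variable {E : Type*} [NormedAddCommGroup E] [NormedSpace ℝ E] [FiniteDimensional ℝ E]

/-- A family of maps has a fold normal form near a point at which the partial differential has a
one-dimensional kernel, spanned by `e₀`, and `D²f(e₀, e₀)` is not in its range. -/
theorem nonempty_foldForm {f : E × E → E} {Ω₀ : Set (E × E)} (hΩ₀ : IsOpen Ω₀)
    (hf₀ : ContDiffOn ℝ ∞ f Ω₀) {z₀ : E × E} (hz₀ : z₀ ∈ Ω₀) {e₀ : E} {lam : E →L[ℝ] ℝ}
    (hlam : lam e₀ = 1) (hker : ∀ a, fderiv ℝ f z₀ (0, a) = 0 ↔ ∃ r : ℝ, a = r • e₀)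
    (hfold : ∀ a, fderiv ℝ f z₀ (0, a) ≠ fderiv ℝ (fderiv ℝ f) z₀ (0, e₀) (0, e₀)) :
    ∃ Φ : FoldForm f z₀, Φ.Ω ⊆ Ω₀ := by
  set c : E := fderiv ℝ (fderiv ℝ f) z₀ (0, e₀) (0, e₀) with hc
  obtain ⟨T, hT, hTc⟩ := exists_equiv_comp_eq_sub_smul
    (A := fderiv ℝ f z₀ ∘L .inr ℝ E E) hlam hker hfold
  replace hT : ∀ a, T (fderiv ℝ f z₀ (0, a)) = a - lam a • e₀ := hT
  obtain ⟨Ω, hΩ, hzΩ, hΩΩ, e, hes, hez, he⟩ := exists_kernelField hΩ₀ hf₀ hz₀ T hlam hT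
  have hf : ContDiffOn ℝ ∞ f Ω := hf₀.mono hΩΩ
  have hfd : ContDiffOn ℝ ∞ (fderiv ℝ f) Ω := hf.fderiv_of_isOpen hΩ (by simp)
  set P : E →L[ℝ] E := .id ℝ E - lam.smulRight e₀ with hP
  have hPa : ∀ a, P a = a - lam a • e₀ := fun a => rfl
  have hPe : P e₀ = 0 := by rw [hPa, hlam, one_smul, sub_self]
  have hlP : ∀ a, lam (P a) = 0 := fun a => by simp [hPa, hlam]
  have hPP : ∀ a, P (P a) = P a := fun a => by rw [hPa (P a), hlP, zero_smul, sub_zero]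
  have hdec : ∀ a, a = P a + lam a • e₀ := fun a => by rw [hPa, sub_add_cancel]
  set ℓ : E →L[ℝ] ℝ := lam ∘L (T : E →L[ℝ] E) with hℓ
  have hℓa : ∀ q, ℓ q = lam (T q) := fun q => rfl
  set R : E →L[ℝ] E := P ∘L (T : E →L[ℝ] E) with hR
  have hRa : ∀ q, R q = P (T q) := fun q => rfl
  have hRc : R c = 0 := by rw [hRa, hTc, hPe]
  have hlR : ∀ q, lam (R q) = 0 := fun q => hlP _
  have hTdec : ∀ q, T q = R q + ℓ q • e₀ := fun q => hdec (T q)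
  -- the critical points are the zeros of `κ`
  set κ : E × E → ℝ := fun z => ℓ (fderiv ℝ f z (0, e z)) with hκ
  have hκs : ContDiffOn ℝ ∞ κ Ω :=
    ℓ.contDiff.comp_contDiffOn (hfd.clm_apply (contDiffOn_const.prodMk hes))
  have hκ0 : ∀ z ∈ Ω, κ z = 0 ↔ fderiv ℝ f z (0, e z) = 0 := by
    intro z hz
    constructor
    · intro h
      have h1 := (he z hz).2.1
      rw [← hℓa, show ℓ (fderiv ℝ f z (0, e z)) = 0 from h, zero_smul] at h1
      exact (map_eq_zero_iff T T.injective).1 h1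
    · intro h
      simp only [hκ, h, map_zero]
  set g : E × E → E × E := fun z => (z.1, R (f z) + κ z • e₀) with hg
  have hgs : ContDiffOn ℝ ∞ g Ω := contDiffOn_fst.prodMk
    ((R.contDiff.comp_contDiffOn hf).add (hκs.smul contDiffOn_const))
  have hfderiv : ∀ z ∈ Ω, HasFDerivAt f (fderiv ℝ f z) z := fun z hz =>
    ((hf.contDiffAt (hΩ.mem_nhds hz)).differentiableAt (by simp)).hasFDerivAt
  have hκderiv : ∀ z ∈ Ω, HasFDerivAt κ (fderiv ℝ κ z) z := fun z hz =>
    ((hκs.contDiffAt (hΩ.mem_nhds hz)).differentiableAt (by simp)).hasFDerivAt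
  have hgderiv : ∀ z ∈ Ω, HasFDerivAt g ((ContinuousLinearMap.fst ℝ E E).prod
      (R ∘L fderiv ℝ f z + (fderiv ℝ κ z).smulRight e₀)) z := fun z hz =>
    hasFDerivAt_fst.prodMk (((R.hasFDerivAt).comp z (hfderiv z hz)).add
      ((hκderiv z hz).smul_const e₀))
  have hκe : fderiv ℝ κ z₀ (0, e₀) = 1 := by
    have h1 : HasFDerivAt (fderiv ℝ f) (fderiv ℝ (fderiv ℝ f) z₀) z₀ :=
      ((hfd.contDiffAt (hΩ.mem_nhds hzΩ)).differentiableAt (by simp)).hasFDerivAt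
    have h2 : HasFDerivAt e (fderiv ℝ e z₀) z₀ :=
      ((hes.contDiffAt (hΩ.mem_nhds hzΩ)).differentiableAt (by simp)).hasFDerivAt
    have h3 := (ℓ.hasFDerivAt).comp z₀ (h1.clm_apply ((hasFDerivAt_const (0 : E) z₀).prodMk h2))
    have h4 := (hκderiv z₀ hzΩ).unique h3
    rw [h4]
    simp only [ContinuousLinearMap.comp_apply, add_apply,
      ContinuousLinearMap.prod_apply, map_add, zero_apply,
      ContinuousLinearMap.flip_apply, hez]
    rw [← hc, hℓa, hℓa, hT, hTc, hlam, ← hPa, hlP, zero_add]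
  have hinv : (fderiv ℝ g z₀).IsInvertible := by
    rw [(hgderiv z₀ hzΩ).fderiv]
    refine ContinuousLinearMap.isInvertible_of_injective rfl ?_
    rw [injective_iff_map_eq_zero]
    rintro ⟨x, a⟩ h
    simp only [ContinuousLinearMap.prod_apply, ContinuousLinearMap.coe_fst', Prod.mk_eq_zero,
      add_apply, ContinuousLinearMap.comp_apply, ContinuousLinearMap.smulRight_apply] at h
    obtain ⟨rfl, h⟩ := h
    rw [hRa, hT, ← hPa, hPP] at h
    have h1 := congrArg lam h
    rw [map_add, hlP, map_smul, hlam, zero_add, map_zero, smul_eq_mul, mul_one] at h1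
    rw [h1, zero_smul, add_zero] at h
    rw [hdec a, h, zero_add] at h1
    rw [show ((0 : E), lam a • e₀) = lam a • ((0 : E), e₀) by simp, map_smul, hκe, smul_eq_mul,
      mul_one] at h1
    rw [hdec a, h, h1, zero_smul, add_zero]
    rfl
  obtain ⟨G, hzG, hGΩ, hGg, hGs, hGinv⟩ :=
    exists_openPartialHomeomorph_of_isInvertible hΩ hgs hzΩ hinv
  -- the velocity of the coordinate lines of `g` in the direction `e₀`
  have hvel : ∀ p ∈ G.target, ∀ a : E, fderiv ℝ g (G.symm p) (0, a) = (0, e₀) →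
      a = lam a • e (G.symm p) ∧ lam a * fderiv ℝ κ (G.symm p) (0, e (G.symm p)) = 1 := by
    intro p hp a ha
    have hz := hGΩ (G.map_target hp)
    rw [(hgderiv _ hz).fderiv] at ha
    simp only [ContinuousLinearMap.prod_apply, ContinuousLinearMap.coe_fst', Prod.mk.injEq,
      add_apply, ContinuousLinearMap.comp_apply, ContinuousLinearMap.smulRight_apply,
      true_and] at ha
    have h1 := congrArg lam ha
    rw [map_add, hlR, map_smul, hlam, zero_add, smul_eq_mul, mul_one] at h1
    rw [h1, one_smul, add_eq_right] at ha
    have h2 := (he _ hz).2.2 a ⟨ℓ (fderiv ℝ f (G.symm p) (0, a)), by rw [hTdec, ha, zero_add]⟩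
    refine ⟨h2, ?_⟩
    rw [h2, show ((0 : E), lam a • e (G.symm p)) = lam a • ((0 : E), e (G.symm p)) by simp,
      map_smul, smul_eq_mul] at h1
    exact h1
  -- near the base point the derivative of `κ` along the kernel field is positive
  have hpos : ∀ᶠ p in 𝓝 (g z₀), p ∈ G.target ∧
      0 < fderiv ℝ κ (G.symm p) (0, e (G.symm p)) := by
    have hmem : g z₀ ∈ G.target := by rw [← hGg]; exact G.map_source hzG
    have hsymm : G.symm (g z₀) = z₀ := by rw [← hGg]; exact G.left_inv hzG
    refine (G.open_target.eventually_mem hmem).and ?_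
    have hc1 : ContinuousOn (fun z => fderiv ℝ κ z (0, e z)) Ω :=
      (hκs.continuousOn_fderiv_of_isOpen hΩ (by simp)).clm_apply
        (continuousOn_const.prodMk hes.continuousOn)
    have hc2 : ContinuousAt (fun z => fderiv ℝ κ z (0, e z)) (G.symm (g z₀)) := by
      rw [hsymm]; exact hc1.continuousAt (hΩ.mem_nhds hzΩ)
    have hc3 : ContinuousAt (fun p => fderiv ℝ κ (G.symm p) (0, e (G.symm p))) (g z₀) :=
      ContinuousAt.comp (g := fun z => fderiv ℝ κ z (0, e z)) hc2 (G.continuousAt_symm hmem)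
    refine hc3.eventually (lt_mem_nhds ?_)
    simp only [hsymm, hez, hκe]
    exact one_pos
  have hfz : fderiv ℝ f z₀ (0, e z₀) = 0 := by rw [hez]; exact (hker e₀).2 ⟨1, by simp⟩
  have hκz : κ z₀ = 0 := (hκ0 z₀ hzΩ).2 hfz
  have hgz : g z₀ = (z₀.1, R (f z₀)) := by simp only [hg, hκz, zero_smul, add_zero]
  -- a neighbourhood which is a product with respect to the splitting `E = ker lam ⊕ ℝ e₀`
  obtain ⟨r, hr, hB⟩ : ∃ r > (0 : ℝ), ∀ p : E × E, dist p.1 z₀.1 < r →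
      dist (P p.2) (R (f z₀)) < r → |lam p.2| < r →
      p ∈ G.target ∧ 0 < fderiv ℝ κ (G.symm p) (0, e (G.symm p)) := by
    have hcont : Tendsto (fun w : (E × E) × ℝ => (w.1.1, w.1.2 + w.2 • e₀))
        (𝓝 ((z₀.1, R (f z₀)), (0 : ℝ))) (𝓝 (g z₀)) := by
      have : Continuous fun w : (E × E) × ℝ => (w.1.1, w.1.2 + w.2 • e₀) := by fun_prop
      have h := this.tendsto ((z₀.1, R (f z₀)), (0 : ℝ))
      simp only [zero_smul, add_zero] at h
      rwa [← hgz] at h ⊢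
    obtain ⟨r, hr, hB⟩ := Metric.eventually_nhds_iff_ball.1 (hcont.eventually hpos)
    refine ⟨r, hr, fun p h1 h2 h3 => ?_⟩
    have := hB ((p.1, P p.2), lam p.2) (by
      simp only [Metric.mem_ball, Prod.dist_eq, max_lt_iff]
      exact ⟨⟨h1, h2⟩, by simpa using h3⟩)
    rwa [← hdec p.2] at this
  set D : Set (E × E) := {p | dist p.1 z₀.1 < r ∧ dist (R p.2) (R (f z₀)) < r} with hD
  have hDo : IsOpen D :=
    IsOpen.inter (s := {p : E × E | dist p.1 z₀.1 < r})
      (t := {p : E × E | dist (R p.2) (R (f z₀)) < r})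
      (isOpen_lt (by fun_prop) continuous_const) (isOpen_lt (by fun_prop) continuous_const)
  set Ω' : Set (E × E) := {z | z ∈ G.source ∧ (z.1, f z) ∈ D ∧ |κ z| < r} with hΩ'
  have hΩ'o : IsOpen Ω' := by
    have hcf : ContinuousOn (fun z => (z.1, f z)) G.source :=
      continuousOn_fst.prodMk (hf.continuousOn.mono hGΩ)
    have h1 := hcf.isOpen_inter_preimage G.open_source hDo
    have h2 := (hκs.continuousOn.mono hGΩ).abs.isOpen_inter_preimage G.open_source
      (isOpen_Iio (a := r))
    convert h1.inter h2 using 1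
    ext z
    simp only [hΩ', mem_ofPred_eq, mem_inter_iff, mem_preimage, mem_Iio]
    tauto
  have hmapB : ∀ p ∈ D, ∀ s : ℝ, |s| < r → (p.1, R p.2 + s • e₀) ∈ G.target ∧
      0 < fderiv ℝ κ (G.symm (p.1, R p.2 + s • e₀))
        (0, e (G.symm (p.1, R p.2 + s • e₀))) := by
    intro p hp s hs
    refine hB _ hp.1 ?_ ?_
    · rw [map_add, map_smul, hPe, smul_zero, add_zero, hRa, hPP]
      exact hp.2
    · simpa [hlR, hlam] using hs
  set Q : E × E → E × E := fun p => G.symm (p.1, R p.2) with hQ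
  have hQt : ∀ p ∈ D, (p.1, R p.2) ∈ G.target := fun p hp => by
    simpa using (hmapB p hp 0 (by simpa using hr)).1
  have hQs : ContDiffOn ℝ ∞ Q D :=
    hGs.comp (contDiff_fst.prodMk (R.contDiff.comp contDiff_snd)).contDiffOn hQt
  have hQΩ : ∀ p ∈ D, Q p ∈ Ω := fun p hp => hGΩ (G.map_target (hQt p hp))
  have hgQ : ∀ p ∈ D, g (Q p) = (p.1, R p.2) := fun p hp => by
    rw [← hGg]; exact G.right_inv (hQt p hp)
  have hQ1 : ∀ p ∈ D, (Q p).1 = p.1 := fun p hp => (Prod.ext_iff.1 (hgQ p hp)).1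
  have hgQ2 : ∀ p ∈ D, R (f (Q p)) = R p.2 ∧ κ (Q p) = 0 := by
    intro p hp
    have h1 : R (f (Q p)) + κ (Q p) • e₀ = R p.2 := congrArg Prod.snd (hgQ p hp)
    have h2 := congrArg lam h1
    rw [map_add, hlR, map_smul, hlam, hlR, zero_add, smul_eq_mul, mul_one] at h2
    rw [h2, zero_smul, add_zero] at h1
    exact ⟨h1, h2⟩
  -- on the line through a point `z`, the function `ℓ ∘ f` has its minimum at the critical point
  have hmin : ∀ z ∈ Ω', κ z ≠ 0 → ℓ (f (Q (z.1, f z))) < ℓ (f z) := by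
    rintro z ⟨hzs, hzD, hzr⟩ hne
    set γ : ℝ → E × E := fun t => G.symm (z.1, R (f z) + (t * κ z) • e₀) with hγ
    have hin : ∀ t ∈ Icc (0 : ℝ) 1, |t * κ z| < r := by
      intro t ht
      rw [abs_mul, abs_of_nonneg ht.1]
      calc t * |κ z| ≤ 1 * |κ z| := by gcongr; exact ht.2
        _ < r := by rwa [one_mul]
    have hder : ∀ t ∈ Icc (0 : ℝ) 1, ∃ p : ℝ, 0 < p ∧
        HasDerivAt (fun t => ℓ (f (γ t))) (p * (t * κ z ^ 2)) t := by
      intro t ht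
      obtain ⟨htar, hp⟩ := hmapB _ hzD (t * κ z) (hin t ht)
      simp only at htar hp
      have hγt : γ t ∈ G.source := G.map_target htar
      have hgγ : g (γ t) = (z.1, R (f z) + (t * κ z) • e₀) := by
        rw [← hGg]; exact G.right_inv htar
      have hκγ : κ (γ t) = t * κ z := by
        have h1 : R (f (γ t)) + κ (γ t) • e₀ = R (f z) + (t * κ z) • e₀ :=
          congrArg Prod.snd hgγ
        have h2 := congrArg lam h1
        simpa [hlR, hlam] using h2
      have hline : HasDerivAt (fun t : ℝ => (z.1, R (f z) + (t * κ z) • e₀)) (0, κ z • e₀) t := by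
        refine (hasDerivAt_const t z.1).prodMk ?_
        have := (((hasDerivAt_id t).mul_const (κ z)).smul_const e₀).const_add (R (f z))
        simpa using this
      have hGd : DifferentiableAt ℝ G.symm (z.1, R (f z) + (t * κ z) • e₀) :=
        (hGs.contDiffAt (G.open_target.mem_nhds htar)).differentiableAt (by simp)
      have hγd : HasDerivAt γ (deriv γ t) t := by
        have := hGd.hasFDerivAt.comp_hasDerivAt t hline
        exact this.differentiableAt.hasDerivAt
      have hgγd : HasDerivAt (fun t => g (γ t)) (fderiv ℝ g (γ t) (deriv γ t)) t :=
        ((hgderiv _ (hGΩ hγt)).differentiableAt.hasFDerivAt).comp_hasDerivAt t hγd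
      have hev : (fun t => g (γ t)) =ᶠ[𝓝 t] fun t => (z.1, R (f z) + (t * κ z) • e₀) := by
        have hcl : ContinuousAt (fun t : ℝ => (z.1, R (f z) + (t * κ z) • e₀)) t :=
          hline.continuousAt
        filter_upwards [hcl (G.open_target.mem_nhds htar)] with s hs
        rw [← hGg]; exact G.right_inv hs
      have heq : fderiv ℝ g (γ t) (deriv γ t) = (0, κ z • e₀) :=
        hgγd.unique (hline.congr_of_eventuallyEq hev)
      have hfst : (deriv γ t).1 = 0 := by
        rw [(hgderiv _ (hGΩ hγt)).fderiv] at heq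
        exact congrArg Prod.fst heq
      set a := (deriv γ t).2 with ha
      have hda : deriv γ t = (0, a) := Prod.ext hfst rfl
      have ha1 : fderiv ℝ g (γ t) (0, (κ z)⁻¹ • a) = (0, e₀) := by
        rw [show ((0 : E), (κ z)⁻¹ • a) = (κ z)⁻¹ • deriv γ t by rw [hda]; simp, map_smul, heq]
        simp [smul_smul, inv_mul_cancel₀ hne]
      obtain ⟨h1, h2⟩ := hvel _ htar _ ha1
      set q := lam ((κ z)⁻¹ • a) with hq
      have hqpos : 0 < q := by
        by_contra hneg
        have := mul_nonpos_of_nonpos_of_nonneg (not_lt.1 hneg) hp.le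
        rw [h2] at this
        linarith
      have ha2 : a = (κ z * q) • e (γ t) := by
        rw [mul_smul, show q • e (γ t) = (κ z)⁻¹ • a from h1.symm, smul_smul,
          mul_inv_cancel₀ hne, one_smul]
      refine ⟨q, hqpos, ?_⟩
      have h5 := (ℓ.hasFDerivAt).comp_hasDerivAt t ((hfderiv _ (hGΩ hγt)).comp_hasDerivAt t hγd)
      refine h5.congr_deriv ?_
      rw [hda, ha2, show ((0 : E), (κ z * q) • e (γ t)) = (κ z * q) • ((0 : E), e (γ t)) by simp,
        map_smul, map_smul, show ℓ (fderiv ℝ f (γ t) (0, e (γ t))) = κ (γ t) from rfl, hκγ,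
        smul_eq_mul]
      ring
    choose! p hp hpd using hder
    obtain ⟨t, ht, hslope⟩ := exists_hasDerivAt_eq_slope (fun t => ℓ (f (γ t)))
      (fun t => p t * (t * κ z ^ 2)) (zero_lt_one' ℝ)
      (fun t ht => (hpd t ht).continuousAt.continuousWithinAt)
      (fun t ht => hpd t (Ioo_subset_Icc_self ht))
    have hγ1 : γ 1 = z := by
      have : (z.1, R (f z) + (1 * κ z) • e₀) = G z := by rw [hGg, one_mul]
      simp only [hγ, this]
      exact G.left_inv hzs
    have hγ0 : γ 0 = Q (z.1, f z) := by simp [hγ, hQ]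
    rw [hγ1, hγ0, sub_zero, div_one] at hslope
    have h6 := mul_pos (hp t (Ioo_subset_Icc_self ht)) (mul_pos ht.1 (by positivity : 0 < κ z ^ 2))
    linarith
  have hQz : ∀ z ∈ Ω', κ z = 0 → Q (z.1, f z) = z := by
    rintro z ⟨hzs, -, -⟩ h0
    have : (z.1, R (f z)) = G z := by rw [hGg]; simp only [hg, h0, zero_smul, add_zero]
    simp only [hQ, this]
    exact G.left_inv hzs
  refine ⟨
    { Ω := Ω', D := D, ℓ := ℓ, c := c, m := lam
      H := fun p => ℓ (f (Q p)), V := fun p => (Q p).2, e := e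
      isOpen_Ω := hΩ'o
      isOpen_D := hDo
      mem_Ω := ⟨hzG, ⟨by simpa using hr, by simpa using hr⟩, by rw [hκz]; simpa using hr⟩
      contDiffOn_f := hf.mono fun z hz => hGΩ hz.1
      contDiffOn_H := ℓ.contDiff.comp_contDiffOn (hf.comp hQs hQΩ)
      contDiffOn_V := contDiff_snd.comp_contDiffOn hQs
      contDiffOn_e := hes.mono fun z hz => hGΩ hz.1
      ℓ_c := by rw [hℓa, hTc, hlam]
      mem_D := fun z hz => hz.2.1
      add_mem_D := fun x q s h => ⟨h.1, by
        have := h.2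
        simpa [hRc] using this⟩
      H_add := fun x q s => by simp only [hQ, map_add, map_smul, hRc, smul_zero, add_zero]
      V_add := fun x q s => by simp only [hQ, map_add, map_smul, hRc, smul_zero, add_zero]
      m_e := fun z hz => (he z (hGΩ hz.1)).1
      eq_smul_e := fun z hz a ha => (he z (hGΩ hz.1)).2.2 a ⟨0, by simp [ha]⟩
      H_le := fun z hz => by
        by_cases h0 : κ z = 0
        · simp only [hQz z hz h0, le_refl]
        · exact (hmin z hz h0).le
      H_eq_iff := fun z hz => by
        rw [← hκ0 z (hGΩ hz.1)]
        constructor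
        · intro h
          by_contra h0
          exact absurd h (hmin z hz h0).ne'
        · intro h0
          simp only [hQz z hz h0]
      V_apply := fun z hz h => by
        simp only [hQz z hz ((hκ0 z (hGΩ hz.1)).2 h)]
      mem_of_eq := fun p hp h => by
        have hQp : (p.1, (Q p).2) = Q p := Prod.ext (hQ1 p hp).symm rfl
        have hfQ : f (Q p) = p.2 := by
          apply T.injective
          rw [hTdec, hTdec p.2, (hgQ2 p hp).1, h]
        simp only [hQp]
        refine ⟨⟨G.map_target (hQt p hp), ?_, ?_⟩, hfQ⟩
        · rw [hfQ, hQ1 p hp]; exact hp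
        · rw [(hgQ2 p hp).2]; simpa using hr }, fun z hz => hΩΩ (hGΩ hz.1)⟩

end FoldForm

/-! ### The conormal variety of the hypersurface of critical values -/

namespace FoldForm

set_option synthInstance.maxHeartbeats 200000

variable {E : Type*} [NormedAddCommGroup E] [NormedSpace ℝ E] {f : E × E → E} {z₀ : E × E}
  (Φ : FoldForm f z₀)

/-- The parametrisation of the critical values by the points of `D`: the projection to the
hypersurface along `c`. -/
def q (p : E × E) : E := p.2 - Φ.ℓ p.2 • Φ.c + Φ.H p • Φ.c

/-- The critical point over the critical value `Φ.q p`. -/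
def Z (p : E × E) : E × E := (p.1, Φ.V p)

/-- The acceleration `D²f(e, u)`: in the case of the exponential map, the final derivative of the
Jacobi field with initial derivative `e` vanishing at both ends. -/
def β (z : E × E) : E := fderiv ℝ (fderiv ℝ f) z (0, Φ.e z) (0, z.2)

/-- The first component of the parametrisation of the conormal variety; the coordinate along `c` is
the factor in front of the normalised conormal vector. -/
def Ψ₁ (p : E × E) : E × E := (p.1, Φ.ℓ p.2 • Φ.e (Φ.Z p))

/-- The second component of the parametrisation of the conormal variety. -/
def Ψ₂ (p : E × E) : E × E := (Φ.q p, -(Φ.ℓ p.2 • Φ.β (Φ.Z p)))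

theorem q_eq (p : E × E) : Φ.q p = p.2 + (Φ.H p - Φ.ℓ p.2) • Φ.c := by
  rw [q, sub_smul]; abel

theorem ℓ_q (p : E × E) : Φ.ℓ (Φ.q p) = Φ.H p := by
  rw [q_eq, map_add, map_smul, Φ.ℓ_c, smul_eq_mul]; ring

theorem H_q (p : E × E) : Φ.H (p.1, Φ.q p) = Φ.H p := by rw [q_eq, Φ.H_add]

theorem V_q (p : E × E) : Φ.V (p.1, Φ.q p) = Φ.V p := by rw [q_eq, Φ.V_add]

theorem mem_D_q {p : E × E} (hp : p ∈ Φ.D) : (p.1, Φ.q p) ∈ Φ.D := by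
  rw [q_eq]; exact Φ.add_mem_D _ _ _ hp

theorem Z_add (x q : E) (s : ℝ) : Φ.Z (x, q + s • Φ.c) = Φ.Z (x, q) := by
  simp only [Z, Φ.V_add]

theorem q_add (x q : E) (s : ℝ) : Φ.q (x, q + s • Φ.c) = Φ.q (x, q) := by
  simp only [FoldForm.q_eq, Φ.H_add, map_add, map_smul, Φ.ℓ_c, smul_eq_mul, mul_one, add_assoc,
    ← add_smul]
  congr 2; ring

theorem Z_mem {p : E × E} (hp : p ∈ Φ.D) : Φ.Z p ∈ Φ.Ω := by
  have h := (Φ.mem_of_eq _ (Φ.mem_D_q hp) ((Φ.ℓ_q p).trans (Φ.H_q p).symm)).1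
  rwa [V_q] at h

theorem f_Z {p : E × E} (hp : p ∈ Φ.D) : f (Φ.Z p) = Φ.q p := by
  have h := (Φ.mem_of_eq _ (Φ.mem_D_q hp) ((Φ.ℓ_q p).trans (Φ.H_q p).symm)).2
  rwa [V_q] at h

theorem fderiv_Z_e {p : E × E} (hp : p ∈ Φ.D) : fderiv ℝ f (Φ.Z p) (0, Φ.e (Φ.Z p)) = 0 := by
  rw [← Φ.H_eq_iff _ (Φ.Z_mem hp), Φ.f_Z hp, ℓ_q]
  exact (Φ.H_q p).symm

theorem q_apply {z : E × E} (hz : z ∈ Φ.Ω) (h : fderiv ℝ f z (0, Φ.e z) = 0) :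
    Φ.q (z.1, f z) = f z := by
  rw [q_eq, ← (Φ.H_eq_iff z hz).2 h, sub_self, zero_smul, add_zero]

theorem Z_apply {z : E × E} (hz : z ∈ Φ.Ω) (h : fderiv ℝ f z (0, Φ.e z) = 0) :
    Φ.Z (z.1, f z) = z := Prod.ext rfl (Φ.V_apply z hz h)

/-- The parameter of the conormal vector `r • e` over the critical point `z`. -/
def param (z : E × E) (r : ℝ) : E × E := (z.1, f z + (r - Φ.ℓ (f z)) • Φ.c)

theorem param_mem {z : E × E} (hz : z ∈ Φ.Ω) (r : ℝ) : Φ.param z r ∈ Φ.D :=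
  Φ.add_mem_D _ _ _ (Φ.mem_D z hz)

theorem ℓ_param (z : E × E) (r : ℝ) : Φ.ℓ (Φ.param z r).2 = r := by
  simp [param, Φ.ℓ_c]

theorem Z_param {z : E × E} (hz : z ∈ Φ.Ω) (h : fderiv ℝ f z (0, Φ.e z) = 0) (r : ℝ) :
    Φ.Z (Φ.param z r) = z := by rw [param, Z_add, Φ.Z_apply hz h]

theorem q_param {z : E × E} (hz : z ∈ Φ.Ω) (h : fderiv ℝ f z (0, Φ.e z) = 0) (r : ℝ) :
    Φ.q (Φ.param z r) = f z := by rw [param, q_add, Φ.q_apply hz h]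

theorem Ψ₁_param {z : E × E} (hz : z ∈ Φ.Ω) (h : fderiv ℝ f z (0, Φ.e z) = 0) (r : ℝ) :
    Φ.Ψ₁ (Φ.param z r) = (z.1, r • Φ.e z) := by rw [Ψ₁, ℓ_param, Φ.Z_param hz h]; rfl

theorem Ψ₂_param {z : E × E} (hz : z ∈ Φ.Ω) (h : fderiv ℝ f z (0, Φ.e z) = 0) (r : ℝ) :
    Φ.Ψ₂ (Φ.param z r) = (f z, -(r • Φ.β z)) := by
  rw [Ψ₂, ℓ_param, Φ.Z_param hz h, Φ.q_param hz h]

theorem contDiffOn_q : ContDiffOn ℝ ∞ Φ.q Φ.D :=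
  (contDiffOn_snd.sub ((Φ.ℓ.contDiff.comp contDiff_snd).contDiffOn.smul contDiffOn_const)).add
    (Φ.contDiffOn_H.smul contDiffOn_const)

theorem contDiffOn_Z : ContDiffOn ℝ ∞ Φ.Z Φ.D := contDiffOn_fst.prodMk Φ.contDiffOn_V

theorem contDiffOn_e_Z : ContDiffOn ℝ ∞ (fun p => Φ.e (Φ.Z p)) Φ.D :=
  Φ.contDiffOn_e.comp Φ.contDiffOn_Z fun _ => Φ.Z_mem

theorem contDiffOn_fderiv_f : ContDiffOn ℝ ∞ (fderiv ℝ f) Φ.Ω :=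
  Φ.contDiffOn_f.fderiv_of_isOpen Φ.isOpen_Ω (by simp)

theorem contDiffOn_β : ContDiffOn ℝ ∞ Φ.β Φ.Ω :=
  ((Φ.contDiffOn_fderiv_f.fderiv_of_isOpen Φ.isOpen_Ω (by simp)).clm_apply
    (contDiffOn_const.prodMk Φ.contDiffOn_e)).clm_apply
    (contDiffOn_const.prodMk contDiffOn_snd)

theorem contDiffOn_Ψ₁ : ContDiffOn ℝ ∞ Φ.Ψ₁ Φ.D :=
  contDiffOn_fst.prodMk
    ((Φ.ℓ.contDiff.comp contDiff_snd).contDiffOn.smul Φ.contDiffOn_e_Z)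

theorem contDiffOn_Ψ₂ : ContDiffOn ℝ ∞ Φ.Ψ₂ Φ.D :=
  Φ.contDiffOn_q.prodMk ((Φ.ℓ.contDiff.comp contDiff_snd).contDiffOn.smul
    (Φ.contDiffOn_β.comp Φ.contDiffOn_Z fun _ => Φ.Z_mem)).neg

theorem _root_.ContDiffOn.hasFDerivAt_of_isOpen {F G : Type*} [NormedAddCommGroup F]
    [NormedSpace ℝ F] [NormedAddCommGroup G] [NormedSpace ℝ G] {g : F → G} {s : Set F}
    (hg : ContDiffOn ℝ ∞ g s) (hs : IsOpen s) {x : F} (hx : x ∈ s) :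
    HasFDerivAt g (fderiv ℝ g x) x :=
  ((hg.contDiffAt (hs.mem_nhds hx)).differentiableAt (by simp)).hasFDerivAt

/-- The image of the differential at a critical point is tangent to the hypersurface of critical
values, since `ℓ q - H` has a minimum there. -/
theorem ℓ_fderiv {z : E × E} (hz : z ∈ Φ.Ω) (h : fderiv ℝ f z (0, Φ.e z) = 0) (Y : E × E) :
    Φ.ℓ (fderiv ℝ f z Y) = fderiv ℝ Φ.H (z.1, f z) (Y.1, fderiv ℝ f z Y) := by
  have hf := Φ.contDiffOn_f.hasFDerivAt_of_isOpen Φ.isOpen_Ω hz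
  have hH := Φ.contDiffOn_H.hasFDerivAt_of_isOpen Φ.isOpen_D (Φ.mem_D z hz)
  have hd := ((Φ.ℓ.hasFDerivAt).comp z hf).sub (HasFDerivAt.comp (g := Φ.H) z hH
    ((hasFDerivAt_fst (𝕜 := ℝ) (p := z)).prodMk hf))
  have hmin : IsLocalMin (fun w => Φ.ℓ (f w) - Φ.H (w.1, f w)) z := by
    filter_upwards [Φ.isOpen_Ω.mem_nhds hz] with w hw
    rw [(Φ.H_eq_iff z hz).2 h, sub_self]
    exact sub_nonneg.2 (Φ.H_le w hw)
  have h0 := hmin.hasFDerivAt_eq_zero hd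
  have := congrArg (fun T : E × E →L[ℝ] ℝ => T Y) h0
  exact sub_eq_zero.1 this

theorem fderiv_q_apply {p : E × E} (hp : p ∈ Φ.D) (X : E × E) :
    fderiv ℝ Φ.q p X = X.2 - Φ.ℓ X.2 • Φ.c + fderiv ℝ Φ.H p X • Φ.c := by
  have hH := Φ.contDiffOn_H.hasFDerivAt_of_isOpen Φ.isOpen_D hp
  have h := ((hasFDerivAt_snd (𝕜 := ℝ) (p := p)).sub
    (((Φ.ℓ.hasFDerivAt).comp p (hasFDerivAt_snd (𝕜 := ℝ) (p := p))).smul_const Φ.c)).add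
    (hH.smul_const Φ.c)
  have h2 : HasFDerivAt Φ.q _ p := h
  rw [h2.fderiv]
  rfl

theorem fderiv_q_eq {p : E × E} (hp : p ∈ Φ.D) (X : E × E) :
    fderiv ℝ Φ.q p X = fderiv ℝ f (Φ.Z p) (X.1, fderiv ℝ Φ.V p X) := by
  have hf := Φ.contDiffOn_f.hasFDerivAt_of_isOpen Φ.isOpen_Ω (Φ.Z_mem hp)
  have hV := Φ.contDiffOn_V.hasFDerivAt_of_isOpen Φ.isOpen_D hp
  have hZ : HasFDerivAt Φ.Z ((ContinuousLinearMap.fst ℝ E E).prod (fderiv ℝ Φ.V p)) p :=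
    hasFDerivAt_fst.prodMk hV
  have h1 := hf.comp p hZ
  have h2 : HasFDerivAt Φ.q _ p := h1.congr_of_eventuallyEq (by
    filter_upwards [Φ.isOpen_D.mem_nhds hp] with w hw
    exact (Φ.f_Z hw).symm)
  rw [h2.fderiv]
  rfl

/-- Tangent vectors of the hypersurface of critical values lie in the image of the differential. -/
theorem exists_fderiv_eq {z : E × E} (hz : z ∈ Φ.Ω) (h : fderiv ℝ f z (0, Φ.e z) = 0)
    {X : E × E} (hX : Φ.ℓ X.2 = fderiv ℝ Φ.H (z.1, f z) X) :
    fderiv ℝ f z (X.1, fderiv ℝ Φ.V (z.1, f z) X) = X.2 := by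
  have h1 := Φ.fderiv_q_eq (Φ.mem_D z hz) X
  rw [Φ.fderiv_q_apply (Φ.mem_D z hz), ← hX, sub_add_cancel, Φ.Z_apply hz h] at h1
  exact h1.symm

theorem fderiv_H_c {p : E × E} (hp : p ∈ Φ.D) : fderiv ℝ Φ.H p (0, Φ.c) = 0 := by
  have hH := Φ.contDiffOn_H.hasFDerivAt_of_isOpen Φ.isOpen_D hp
  have hline : HasDerivAt (fun s : ℝ => (p.1, p.2 + s • Φ.c)) (0, Φ.c) 0 := by
    have := (((hasDerivAt_id (0 : ℝ)).smul_const Φ.c).const_add p.2)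
    rw [one_smul] at this
    exact (hasDerivAt_const (0 : ℝ) p.1).prodMk this
  have h1 : HasDerivAt (fun s : ℝ => Φ.H (p.1, p.2 + s • Φ.c)) (fderiv ℝ Φ.H p (0, Φ.c)) 0 :=
    HasFDerivAt.comp_hasDerivAt (l := Φ.H) 0 (by simpa using hH) hline
  simp only [Φ.H_add] at h1
  exact h1.unique (hasDerivAt_const _ _)

theorem fderiv_V_c {p : E × E} (hp : p ∈ Φ.D) : fderiv ℝ Φ.V p (0, Φ.c) = 0 := by
  have hV := Φ.contDiffOn_V.hasFDerivAt_of_isOpen Φ.isOpen_D hp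
  have hline : HasDerivAt (fun s : ℝ => (p.1, p.2 + s • Φ.c)) (0, Φ.c) 0 := by
    have := (((hasDerivAt_id (0 : ℝ)).smul_const Φ.c).const_add p.2)
    rw [one_smul] at this
    exact (hasDerivAt_const (0 : ℝ) p.1).prodMk this
  have h1 : HasDerivAt (fun s : ℝ => Φ.V (p.1, p.2 + s • Φ.c)) (fderiv ℝ Φ.V p (0, Φ.c)) 0 :=
    HasFDerivAt.comp_hasDerivAt (l := Φ.V) 0 (by simpa using hV) hline
  simp only [Φ.V_add] at h1
  exact h1.unique (hasDerivAt_const _ _)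

/-- Every vector is the sum of a vector in the image of the differential and a multiple of `c`. -/
theorem exists_eq_fderiv_add_smul {z : E × E} (hz : z ∈ Φ.Ω)
    (h : fderiv ℝ f z (0, Φ.e z) = 0) (η : E) :
    ∃ (μ : E) (s : ℝ), η = fderiv ℝ f z (0, μ) + s • Φ.c := by
  set s := Φ.ℓ η - fderiv ℝ Φ.H (z.1, f z) (0, η) with hs
  refine ⟨fderiv ℝ Φ.V (z.1, f z) (0, η - s • Φ.c), s, (eq_add_of_sub_eq ?_)⟩
  refine (Φ.exists_fderiv_eq hz h (X := (0, η - s • Φ.c)) ?_).symm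
  have h1 : ((0 : E), η - s • Φ.c) = (0, η) - s • ((0 : E), Φ.c) := by simp
  rw [h1, map_sub, map_smul, Φ.fderiv_H_c (Φ.mem_D z hz)]
  simp [Φ.ℓ_c, hs]

/-- A curve of critical values with prescribed velocity in the image of the differential. -/
theorem exists_curve {z : E × E} (hz : z ∈ Φ.Ω) (h : fderiv ℝ f z (0, Φ.e z) = 0) (Y : E × E)
    {W : Set (E × E)} (hW : IsOpen W) (hzW : z ∈ W) :
    ∃ ε > (0 : ℝ), ∃ u : ℝ → E, ContDiffOn ℝ ∞ u (Ioo (-ε) ε) ∧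
      (∀ t ∈ Ioo (-ε) ε, (z.1 + t • Y.1, u t) ∈ W ∧ (z.1 + t • Y.1, u t) ∈ Φ.Ω ∧
        fderiv ℝ f (z.1 + t • Y.1, u t) (0, Φ.e (z.1 + t • Y.1, u t)) = 0) ∧
      u 0 = z.2 ∧
      HasDerivAt (fun t => f (z.1 + t • Y.1, u t)) (fderiv ℝ f z Y) 0 := by
  set η := fderiv ℝ f z Y with hη
  set P : ℝ → E × E := fun t => (z.1 + t • Y.1, f z + t • η) with hP
  have hPs : ContDiff ℝ ∞ P := by fun_prop
  have hP0 : P 0 = (z.1, f z) := by simp [hP]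
  have hPd : HasDerivAt P (Y.1, η) 0 := by
    have h1 := (((hasDerivAt_id (0 : ℝ)).smul_const Y.1).const_add z.1)
    have h2 := (((hasDerivAt_id (0 : ℝ)).smul_const η).const_add (f z))
    rw [one_smul] at h1 h2
    exact h1.prodMk h2
  have hev : ∀ᶠ t in 𝓝 (0 : ℝ), P t ∈ Φ.D ∧ Φ.Z (P t) ∈ W := by
    have hD : P 0 ∈ Φ.D := by rw [hP0]; exact Φ.mem_D z hz
    have hc : ContinuousAt (fun t => Φ.Z (P t)) 0 :=
      ContinuousAt.comp (g := Φ.Z)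
        (Φ.contDiffOn_Z.continuousOn.continuousAt (Φ.isOpen_D.mem_nhds hD))
        hPs.continuous.continuousAt
    refine (hPs.continuous.continuousAt.eventually (Φ.isOpen_D.mem_nhds hD)).and
      (hc.eventually (hW.mem_nhds ?_))
    simp only [hP0, Φ.Z_apply hz h]; exact hzW
  obtain ⟨ε, hε, hball⟩ := Metric.eventually_nhds_iff_ball.1 hev
  simp only [Real.ball_eq_Ioo, zero_sub, zero_add] at hball
  refine ⟨ε, hε, fun t => Φ.V (P t), ?_, ?_, ?_, ?_⟩
  · exact Φ.contDiffOn_V.comp hPs.contDiffOn fun t ht => (hball t ht).1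
  · intro t ht
    exact ⟨(hball t ht).2, Φ.Z_mem (hball t ht).1, Φ.fderiv_Z_e (hball t ht).1⟩
  · simp only [hP0]; exact Φ.V_apply z hz h
  · have hq := Φ.contDiffOn_q.hasFDerivAt_of_isOpen Φ.isOpen_D (Φ.mem_D z hz)
    have h1 : HasDerivAt (fun t => Φ.q (P t)) (fderiv ℝ Φ.q (z.1, f z) (Y.1, η)) 0 :=
      HasFDerivAt.comp_hasDerivAt (l := Φ.q) 0 (by rwa [hP0]) hPd
    rw [Φ.fderiv_q_apply (Φ.mem_D z hz), ← Φ.ℓ_fderiv hz h Y, sub_add_cancel] at h1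
    refine h1.congr_of_eventuallyEq ?_
    filter_upwards [hev] with t ht
    exact Φ.f_Z ht.1

variable {G₁ G₂ : E → E →L[ℝ] E →L[ℝ] ℝ}

/-- The conormal space at a critical value is spanned by the pair `(e, -β)`. -/
theorem conormal_iff
    (hpos₁ : ∀ z ∈ Φ.Ω, ∀ a, a ≠ 0 → 0 < G₁ z.1 a a)
    (hpos₂ : ∀ z ∈ Φ.Ω, ∀ a, a ≠ 0 → 0 < G₂ (f z) a a)
    (hG : ∀ z ∈ Φ.Ω, fderiv ℝ f z (0, Φ.e z) = 0 → ∀ Y,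
      G₂ (f z) (Φ.β z) (fderiv ℝ f z Y) = G₁ z.1 (Φ.e z) Y.1)
    {z : E × E} (hz : z ∈ Φ.Ω) (h : fderiv ℝ f z (0, Φ.e z) = 0) (a b : E) :
    (∀ Y : E × E, G₁ z.1 a Y.1 + G₂ (f z) b (fderiv ℝ f z Y) = 0) ↔
      ∃ r : ℝ, a = r • Φ.e z ∧ b = -(r • Φ.β z) := by
  have hzero : ∀ b', (∀ η, G₂ (f z) b' η = 0) → b' = 0 := fun b' hb => by
    by_contra h0
    exact (hpos₂ z hz b' h0).ne' (hb b')
  have he0 : Φ.e z ≠ 0 := fun h0 => by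
    have := Φ.m_e z hz
    rw [h0, map_zero] at this
    exact zero_ne_one this
  constructor
  · intro hab
    have hβc : G₂ (f z) (Φ.β z) Φ.c ≠ 0 := by
      intro h0
      have hβ0 : Φ.β z = 0 := hzero _ fun η => by
        obtain ⟨μ, s, rfl⟩ := Φ.exists_eq_fderiv_add_smul hz h η
        rw [map_add, hG z hz h, map_smul, h0]
        simp
      have h1 := hG z hz h (Φ.e z, 0)
      rw [hβ0] at h1
      simp only [map_zero, zero_apply] at h1
      exact (hpos₁ z hz _ he0).ne h1
    set r := -(G₂ (f z) b Φ.c) / G₂ (f z) (Φ.β z) Φ.c with hr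
    have hb : b + r • Φ.β z = 0 := hzero _ fun η => by
      obtain ⟨μ, s, rfl⟩ := Φ.exists_eq_fderiv_add_smul hz h η
      have h1 := hab (0, μ)
      have h2 := hG z hz h (0, μ)
      simp only [map_zero, zero_add] at h1 h2
      simp only [map_add, map_smul, add_apply, smul_apply, h1, h2, smul_eq_mul]
      rw [hr]
      field_simp
      ring
    have hb' : b = -(r • Φ.β z) := eq_neg_of_add_eq_zero_left hb
    refine ⟨r, ?_, hb'⟩
    by_contra hne
    have hne' : a - r • Φ.e z ≠ 0 := sub_ne_zero.2 hne
    refine (hpos₁ z hz _ hne').ne' ?_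
    have h1 := hab (a - r • Φ.e z, 0)
    have h2 := hG z hz h (a - r • Φ.e z, 0)
    rw [hb'] at h1
    simp only [map_neg, map_smul, neg_apply, smul_apply, h2,
      smul_eq_mul] at h1
    rw [map_sub (G₁ z.1), sub_apply, map_smul (G₁ z.1), smul_apply,
      smul_eq_mul]
    linarith
  · rintro ⟨r, rfl, rfl⟩ Y
    have h2 := hG z hz h Y
    simp only [map_neg, map_smul, neg_apply, smul_apply, h2, smul_eq_mul]
    ring

/-- If the differential of `Ψ₁` is injective, then so is the differential of `Ψ₂`. The conormal
variety is isotropic for the difference of the symplectic forms of the two factors, as the pairing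
of `(Ψ₁, Ψ₂)` with the tangent vectors of the hypersurface vanishes identically. -/
theorem injective_fderiv_Ψ₂ [FiniteDimensional ℝ E]
    (hpos₁ : ∀ z ∈ Φ.Ω, ∀ a, a ≠ 0 → 0 < G₁ z.1 a a)
    (hG₁ : ∀ z ∈ Φ.Ω, DifferentiableAt ℝ G₁ z.1)
    (hG₂ : ∀ z ∈ Φ.Ω, DifferentiableAt ℝ G₂ (f z))
    (hG : ∀ z ∈ Φ.Ω, fderiv ℝ f z (0, Φ.e z) = 0 → ∀ Y,
      G₂ (f z) (Φ.β z) (fderiv ℝ f z Y) = G₁ z.1 (Φ.e z) Y.1)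
    {p : E × E} (hp : p ∈ Φ.D) (hinj : Function.Injective (fderiv ℝ Φ.Ψ₁ p)) :
    Function.Injective (fderiv ℝ Φ.Ψ₂ p) := by
  have hsurj : Function.Surjective (fderiv ℝ Φ.Ψ₁ p) :=
    (LinearMap.injective_iff_surjective (f := (fderiv ℝ Φ.Ψ₁ p : E × E →ₗ[ℝ] E × E))).1 hinj
  set a : E × E → E := fun p => (Φ.Ψ₁ p).2 with ha
  set b : E × E → E := fun p => (Φ.Ψ₂ p).2 with hb
  have had : HasFDerivAt a (fderiv ℝ a p) p :=
    (contDiff_snd.comp_contDiffOn Φ.contDiffOn_Ψ₁).hasFDerivAt_of_isOpen Φ.isOpen_D hp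
  have hbd : HasFDerivAt b (fderiv ℝ b p) p :=
    (contDiff_snd.comp_contDiffOn Φ.contDiffOn_Ψ₂).hasFDerivAt_of_isOpen Φ.isOpen_D hp
  have hqd : HasFDerivAt Φ.q (fderiv ℝ Φ.q p) p :=
    Φ.contDiffOn_q.hasFDerivAt_of_isOpen Φ.isOpen_D hp
  have hq2 : HasFDerivAt (fderiv ℝ Φ.q) (fderiv ℝ (fderiv ℝ Φ.q) p) p :=
    (Φ.contDiffOn_q.fderiv_of_isOpen Φ.isOpen_D (by simp)).hasFDerivAt_of_isOpen Φ.isOpen_D hp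
  have hsym : ∀ X Y, fderiv ℝ (fderiv ℝ Φ.q) p X Y = fderiv ℝ (fderiv ℝ Φ.q) p Y X :=
    fun X Y => (Φ.contDiffOn_q.contDiffAt (Φ.isOpen_D.mem_nhds hp)).isSymmSndFDerivAt
      (by rw [minSmoothness_of_isRCLikeNormedField]; exact WithTop.coe_le_coe.2 le_top) X Y
  have hΨ₁ : ∀ X, fderiv ℝ Φ.Ψ₁ p X = (X.1, fderiv ℝ a p X) := fun X => by
    have h1 : HasFDerivAt Φ.Ψ₁ ((ContinuousLinearMap.fst ℝ E E).prod (fderiv ℝ a p)) p :=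
      hasFDerivAt_fst.prodMk had
    rw [h1.fderiv]; rfl
  have hΨ₂ : ∀ X, fderiv ℝ Φ.Ψ₂ p X = (fderiv ℝ Φ.q p X, fderiv ℝ b p X) := fun X => by
    have h1 : HasFDerivAt Φ.Ψ₂ ((fderiv ℝ Φ.q p).prod (fderiv ℝ b p)) p := hqd.prodMk hbd
    rw [h1.fderiv]; rfl
  -- the pairing with the tangent vectors vanishes
  have hpair : ∀ w ∈ Φ.D, ∀ X : E × E,
      G₁ w.1 (a w) X.1 + G₂ (Φ.q w) (b w) (fderiv ℝ Φ.q w X) = 0 := by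
    intro w hw X
    have h1 := hG _ (Φ.Z_mem hw) (Φ.fderiv_Z_e hw) (X.1, fderiv ℝ Φ.V w X)
    rw [← Φ.fderiv_q_eq hw, Φ.f_Z hw] at h1
    simp only [ha, hb, Ψ₁, Ψ₂, map_neg, map_smul, neg_apply, smul_apply,
      smul_eq_mul, h1]
    exact add_neg_cancel _
  have hG₁d : HasFDerivAt (fun w : E × E => G₁ w.1) (fderiv ℝ G₁ p.1 ∘L .fst ℝ E E) p :=
    HasFDerivAt.comp (g := G₁) (f := fun w : E × E => w.1) p
      (hG₁ _ (Φ.Z_mem hp)).hasFDerivAt (hasFDerivAt_fst (𝕜 := ℝ) (p := p))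
  have hG₂d : HasFDerivAt (fun w : E × E => G₂ (Φ.q w))
      (fderiv ℝ G₂ (Φ.q p) ∘L fderiv ℝ Φ.q p) p := by
    refine HasFDerivAt.comp (g := G₂) p ?_ hqd
    have := hG₂ _ (Φ.Z_mem hp)
    rw [Φ.f_Z hp] at this
    exact this.hasFDerivAt
  have key : ∀ X Y : E × E,
      (fderiv ℝ G₁ p.1 X.1 (a p) Y.1 + G₁ p.1 (fderiv ℝ a p X) Y.1) +
      (fderiv ℝ G₂ (Φ.q p) (fderiv ℝ Φ.q p X) (b p) (fderiv ℝ Φ.q p Y) +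
        G₂ (Φ.q p) (fderiv ℝ b p X) (fderiv ℝ Φ.q p Y) +
        G₂ (Φ.q p) (b p) (fderiv ℝ (fderiv ℝ Φ.q) p X Y)) = 0 := by
    intro X Y
    have h1 := ((hG₁d.clm_apply had).clm_apply (hasFDerivAt_const Y.1 p)).add
      ((hG₂d.clm_apply hbd).clm_apply (hq2.clm_apply (hasFDerivAt_const Y p)))
    have h2 : HasFDerivAt (fun w => G₁ w.1 (a w) Y.1 + G₂ (Φ.q w) (b w) (fderiv ℝ Φ.q w Y))
        (0 : E × E →L[ℝ] ℝ) p := (hasFDerivAt_const (0 : ℝ) p).congr_of_eventuallyEq (by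
      filter_upwards [Φ.isOpen_D.mem_nhds hp] with w hw
      exact hpair w hw Y)
    have h3 := congrArg (fun T : E × E →L[ℝ] ℝ => T X) (h1.unique h2)
    simp at h3
    linarith
  rw [injective_iff_map_eq_zero]
  intro X hX
  rw [hΨ₂] at hX
  obtain ⟨hX1, hX2⟩ := Prod.mk_eq_zero.1 hX
  have hXY : ∀ Y : E × E,
      fderiv ℝ G₁ p.1 X.1 (a p) Y.1 + G₁ p.1 (fderiv ℝ a p X) Y.1 =
      fderiv ℝ G₁ p.1 Y.1 (a p) X.1 + G₁ p.1 (fderiv ℝ a p Y) X.1 := by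
    intro Y
    have k1 := key X Y
    have k2 := key Y X
    rw [hsym Y X] at k2
    simp only [hX1, hX2, map_zero, zero_apply] at k1 k2
    linarith
  have hfst : X.1 = 0 := by
    by_contra hne
    obtain ⟨Y, hY⟩ := hsurj (0, X.1)
    rw [hΨ₁] at hY
    obtain ⟨hY1, hY2⟩ := Prod.mk.inj hY
    have h1 := hXY Y
    rw [hY1, hY2] at h1
    simp only [map_zero, zero_apply, zero_add] at h1
    exact (hpos₁ _ (Φ.Z_mem hp) _ hne).ne h1
  have hsnd : fderiv ℝ a p X = 0 := by
    by_contra hne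
    obtain ⟨Y, hY⟩ := hsurj (fderiv ℝ a p X, 0)
    rw [hΨ₁] at hY
    have h1 := hXY Y
    rw [(Prod.mk.inj hY).1, hfst] at h1
    simp only [map_zero, zero_apply, zero_add] at h1
    have h2 : G₁ p.1 (fderiv ℝ a p X) (fderiv ℝ a p X) = 0 := by simpa using h1
    exact (hpos₁ _ (Φ.Z_mem hp) _ hne).ne' h2
  refine hinj ?_
  rw [hΨ₁, hfst, hsnd, map_zero]
  rfl

end FoldForm

/-! ### When the conormal variety is a graph -/

namespace FoldForm

set_option synthInstance.maxHeartbeats 200000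

variable {E : Type*} [NormedAddCommGroup E] [NormedSpace ℝ E] {f : E × E → E} {z₀ : E × E}
  (Φ : FoldForm f z₀)

theorem fderiv_V_add (x q : E) (s : ℝ) :
    fderiv ℝ Φ.V (x, q + s • Φ.c) = fderiv ℝ Φ.V (x, q) := by
  have h := fderiv_comp_add_right (𝕜 := ℝ) (f := Φ.V) (x := (x, q)) ((0 : E), s • Φ.c)
  have h2 : (fun p : E × E => Φ.V (p + ((0 : E), s • Φ.c))) = Φ.V := by
    ext ⟨x, q⟩
    simp [Φ.V_add]
  rw [h2] at h
  simpa using h.symm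

theorem fderiv_V_eq_zero_iff {p : E × E} (hp : p ∈ Φ.D) (η : E) :
    fderiv ℝ Φ.V p (0, η) = 0 ↔ ∃ s : ℝ, η = s • Φ.c := by
  constructor
  · intro h
    have h1 := Φ.fderiv_q_eq hp (0, η)
    rw [Φ.fderiv_q_apply hp, h] at h1
    simp only at h1
    rw [show ((0 : E), (0 : E)) = 0 from rfl, map_zero, sub_add, sub_eq_zero, ← sub_smul] at h1
    exact ⟨_, h1⟩
  · rintro ⟨s, rfl⟩
    rw [show ((0 : E), s • Φ.c) = s • ((0 : E), Φ.c) by simp, map_smul, Φ.fderiv_V_c hp, smul_zero]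

/-- The differential of the kernel field along the critical points is controlled by the mixed second
differential of `f`: differentiate `Df(e) = 0`. -/
theorem fderiv_e_eq_zero_iff {p : E × E} (hp : p ∈ Φ.D) (η : E) :
    fderiv ℝ (fun p => Φ.e (Φ.Z p)) p (0, η) = 0 ↔
      fderiv ℝ (fderiv ℝ f) (Φ.Z p) (0, Φ.e (Φ.Z p)) (0, fderiv ℝ Φ.V p (0, η)) = 0 := by
  set eh : E × E → E := fun p => Φ.e (Φ.Z p) with heh
  have hed : HasFDerivAt eh (fderiv ℝ eh p) p :=
    Φ.contDiffOn_e_Z.hasFDerivAt_of_isOpen Φ.isOpen_D hp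
  have hV := Φ.contDiffOn_V.hasFDerivAt_of_isOpen Φ.isOpen_D hp
  have hZ : HasFDerivAt Φ.Z ((ContinuousLinearMap.fst ℝ E E).prod (fderiv ℝ Φ.V p)) p :=
    hasFDerivAt_fst.prodMk hV
  have hf2 := Φ.contDiffOn_fderiv_f.hasFDerivAt_of_isOpen Φ.isOpen_Ω (Φ.Z_mem hp)
  have hsym : ∀ X Y, fderiv ℝ (fderiv ℝ f) (Φ.Z p) X Y = fderiv ℝ (fderiv ℝ f) (Φ.Z p) Y X :=
    fun X Y => (Φ.contDiffOn_f.contDiffAt (Φ.isOpen_Ω.mem_nhds (Φ.Z_mem hp))).isSymmSndFDerivAt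
      (by rw [minSmoothness_of_isRCLikeNormedField]; exact WithTop.coe_le_coe.2 le_top) X Y
  have hm : Φ.m (fderiv ℝ eh p (0, η)) = 0 := by
    have h1 := (Φ.m.hasFDerivAt).comp p hed
    have h2 : HasFDerivAt (Φ.m ∘ eh) (0 : E × E →L[ℝ] ℝ) p :=
      (hasFDerivAt_const (1 : ℝ) p).congr_of_eventuallyEq (by
        filter_upwards [Φ.isOpen_D.mem_nhds hp] with w hw
        exact Φ.m_e _ (Φ.Z_mem hw))
    exact congrArg (fun T : E × E →L[ℝ] ℝ => T (0, η)) (h1.unique h2)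
  have hsum : fderiv ℝ (fderiv ℝ f) (Φ.Z p) (0, eh p) (0, fderiv ℝ Φ.V p (0, η)) +
      fderiv ℝ f (Φ.Z p) (0, fderiv ℝ eh p (0, η)) = 0 := by
    have h1 := (hf2.comp p hZ).clm_apply ((hasFDerivAt_const (0 : E) p).prodMk hed)
    have h2 : HasFDerivAt (fun w => fderiv ℝ f (Φ.Z w) (0, eh w)) (0 : E × E →L[ℝ] E) p :=
      (hasFDerivAt_const (0 : E) p).congr_of_eventuallyEq (by
        filter_upwards [Φ.isOpen_D.mem_nhds hp] with w hw
        exact Φ.fderiv_Z_e hw)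
    have h3 := congrArg (fun T : E × E →L[ℝ] E => T (0, η)) (h1.unique h2)
    simp at h3
    rw [hsym (0, eh p), add_comm]
    exact h3
  constructor
  · intro h
    rw [h, show ((0 : E), (0 : E)) = 0 from rfl, map_zero, add_zero] at hsum
    exact hsum
  · intro h
    rw [h, zero_add] at hsum
    rw [Φ.eq_smul_e _ (Φ.Z_mem hp) _ hsum, hm, zero_smul]

theorem fderiv_Ψ₁_apply {p : E × E} (hp : p ∈ Φ.D) (X : E × E) :
    fderiv ℝ Φ.Ψ₁ p X = (X.1, Φ.ℓ p.2 • fderiv ℝ (fun p => Φ.e (Φ.Z p)) p X +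
      Φ.ℓ X.2 • Φ.e (Φ.Z p)) := by
  have hed := Φ.contDiffOn_e_Z.hasFDerivAt_of_isOpen Φ.isOpen_D hp
  have h := (hasFDerivAt_fst (𝕜 := ℝ) (p := p)).prodMk
    (((Φ.ℓ.hasFDerivAt).comp p (hasFDerivAt_snd (𝕜 := ℝ) (p := p))).smul hed)
  have h2 : HasFDerivAt Φ.Ψ₁ _ p := h
  rw [h2.fderiv]
  rfl

/-- The projection of the conormal variety to the first factor is an immersion at a nonzero
conormal vector if and only if the mixed second differential has full rank. -/
theorem injective_fderiv_Ψ₁_iff {p : E × E} (hp : p ∈ Φ.D) (hr : Φ.ℓ p.2 ≠ 0) :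
    Function.Injective (fderiv ℝ Φ.Ψ₁ p) ↔
      ∀ η, fderiv ℝ (fderiv ℝ f) (Φ.Z p) (0, Φ.e (Φ.Z p)) (0, fderiv ℝ Φ.V p (0, η)) = 0 →
        fderiv ℝ Φ.V p (0, η) = 0 := by
  rw [injective_iff_map_eq_zero]
  constructor
  · intro h η hη
    rw [← Φ.fderiv_e_eq_zero_iff hp] at hη
    have hcV := Φ.fderiv_V_c hp
    have hc : fderiv ℝ (fun p => Φ.e (Φ.Z p)) p (0, Φ.c) = 0 := by
      rw [Φ.fderiv_e_eq_zero_iff hp, hcV, show ((0 : E), (0 : E)) = 0 from rfl, map_zero]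
    have h1 := h (0, η - Φ.ℓ η • Φ.c) (by
      rw [Φ.fderiv_Ψ₁_apply hp, show ((0 : E), η - Φ.ℓ η • Φ.c) =
        (0, η) - Φ.ℓ η • ((0 : E), Φ.c) by simp, map_sub, map_smul, hη, hc]
      simp [Φ.ℓ_c])
    rw [Φ.fderiv_V_eq_zero_iff hp]
    exact ⟨_, sub_eq_zero.1 (Prod.mk_eq_zero.1 h1).2⟩
  · rintro h ⟨x, η⟩ hX
    rw [Φ.fderiv_Ψ₁_apply hp] at hX
    obtain ⟨hx, h2⟩ := Prod.mk_eq_zero.1 hX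
    simp only at hx
    subst hx
    simp only at h2
    have hm : Φ.m (fderiv ℝ (fun p => Φ.e (Φ.Z p)) p (0, η)) = 0 := by
      have h1 := (Φ.m.hasFDerivAt).comp p (Φ.contDiffOn_e_Z.hasFDerivAt_of_isOpen Φ.isOpen_D hp)
      have h2 : HasFDerivAt (Φ.m ∘ fun p => Φ.e (Φ.Z p)) (0 : E × E →L[ℝ] ℝ) p :=
        (hasFDerivAt_const (1 : ℝ) p).congr_of_eventuallyEq (by
          filter_upwards [Φ.isOpen_D.mem_nhds hp] with w hw
          exact Φ.m_e _ (Φ.Z_mem hw))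
      exact congrArg (fun T : E × E →L[ℝ] ℝ => T (0, η)) (h1.unique h2)
    have hℓ : Φ.ℓ η = 0 := by
      have := congrArg Φ.m h2
      rwa [map_add, map_smul, map_smul, hm, Φ.m_e _ (Φ.Z_mem hp), map_zero, smul_zero, zero_add,
        smul_eq_mul, mul_one] at this
    rw [hℓ, zero_smul, add_zero, smul_eq_zero] at h2
    have h3 := h2.resolve_left hr
    rw [Φ.fderiv_e_eq_zero_iff hp] at h3
    obtain ⟨s, hs⟩ := (Φ.fderiv_V_eq_zero_iff hp η).1 (h η h3)
    rw [hs, map_smul, Φ.ℓ_c, smul_eq_mul, mul_one] at hℓ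
    rw [hs, hℓ, zero_smul]
    rfl

/-- The parameter of a conormal pair is a smooth function of the base point of the second factor and
the vector in the first factor. -/
theorem eq_of_Ψ {p : E × E} (hp : p ∈ Φ.D) :
    ((Φ.Ψ₁ p).1, (Φ.Ψ₂ p).1 + (Φ.m (Φ.Ψ₁ p).2 - Φ.ℓ (Φ.Ψ₂ p).1) • Φ.c) = p := by
  refine Prod.ext rfl ?_
  simp only [Ψ₁, Ψ₂, map_smul, Φ.m_e _ (Φ.Z_mem hp), ℓ_q, smul_eq_mul, mul_one]
  rw [q_eq, add_assoc, ← add_smul]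
  simp

/-- If the conormal variety is the graph of a differentiable map near a point, then its projection to
the first factor is a local diffeomorphism there, and if the projection to the second factor is
also one, then so is the map. -/
theorem injective_fderiv_of_graph [FiniteDimensional ℝ E] {g : E × E → E × E} {p : E × E}
    (hp : p ∈ Φ.D) (hg : DifferentiableAt ℝ g (Φ.Ψ₁ p)) (hgp : Φ.Ψ₂ p = g (Φ.Ψ₁ p))
    (hgraph : ∀ᶠ y in 𝓝 (Φ.Ψ₁ p), ∃ p' ∈ Φ.D, Φ.Ψ₁ p' = y ∧ Φ.Ψ₂ p' = g y) :
    Function.Injective (fderiv ℝ Φ.Ψ₁ p) ∧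
      (Function.Injective (fderiv ℝ Φ.Ψ₂ p) →
        Function.Injective (fderiv ℝ g (Φ.Ψ₁ p))) := by
  set R : E × E → E × E := fun y => (y.1, (g y).1 + (Φ.m y.2 - Φ.ℓ (g y).1) • Φ.c) with hR
  have hRp : R (Φ.Ψ₁ p) = p := by
    simp only [hR, ← hgp]; exact Φ.eq_of_Ψ hp
  have hRd : DifferentiableAt ℝ R (Φ.Ψ₁ p) := by
    have h1 : DifferentiableAt ℝ (fun y => (g y).1) (Φ.Ψ₁ p) := differentiableAt_fst.comp _ hg
    exact differentiableAt_fst.prodMk (h1.add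
      (((Φ.m.differentiableAt.comp _ differentiableAt_snd).sub
        (Φ.ℓ.differentiableAt.comp _ h1)).smul_const Φ.c))
  have hΨ₁ : HasFDerivAt Φ.Ψ₁ (fderiv ℝ Φ.Ψ₁ p) (R (Φ.Ψ₁ p)) := by
    rw [hRp]; exact Φ.contDiffOn_Ψ₁.hasFDerivAt_of_isOpen Φ.isOpen_D hp
  have hΨ₂ : HasFDerivAt Φ.Ψ₂ (fderiv ℝ Φ.Ψ₂ p) (R (Φ.Ψ₁ p)) := by
    rw [hRp]; exact Φ.contDiffOn_Ψ₂.hasFDerivAt_of_isOpen Φ.isOpen_D hp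
  have hid : (fderiv ℝ Φ.Ψ₁ p).comp (fderiv ℝ R (Φ.Ψ₁ p)) = .id ℝ (E × E) := by
    refine (hΨ₁.comp _ hRd.hasFDerivAt).unique ((hasFDerivAt_id _).congr_of_eventuallyEq ?_)
    filter_upwards [hgraph] with y hy
    obtain ⟨p', hp', rfl, h2⟩ := hy
    have : R (Φ.Ψ₁ p') = p' := by simp only [hR, ← h2]; exact Φ.eq_of_Ψ hp'
    simp only [Function.comp_apply, this, id]
  have hsurj : Function.Surjective (fderiv ℝ Φ.Ψ₁ p) := fun y =>
    ⟨fderiv ℝ R (Φ.Ψ₁ p) y, congrArg (fun T : E × E →L[ℝ] E × E => T y) hid⟩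
  have hcomp : fderiv ℝ g (Φ.Ψ₁ p) = (fderiv ℝ Φ.Ψ₂ p).comp (fderiv ℝ R (Φ.Ψ₁ p)) := by
    refine hg.hasFDerivAt.unique ((hΨ₂.comp _ hRd.hasFDerivAt).congr_of_eventuallyEq ?_)
    filter_upwards [hgraph] with y hy
    obtain ⟨p', hp', rfl, h2⟩ := hy
    have : R (Φ.Ψ₁ p') = p' := by simp only [hR, ← h2]; exact Φ.eq_of_Ψ hp'
    simp only [Function.comp_apply, this, h2]
  refine ⟨(LinearMap.injective_iff_surjective
    (f := (fderiv ℝ Φ.Ψ₁ p : E × E →ₗ[ℝ] E × E))).2 hsurj, fun hinj => ?_⟩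
  rw [hcomp]
  refine hinj.comp fun y y' (hyy : fderiv ℝ R (Φ.Ψ₁ p) y = fderiv ℝ R (Φ.Ψ₁ p) y') => ?_
  have h1 := congrArg (fun T : E × E →L[ℝ] E × E => T y) hid
  have h2 := congrArg (fun T : E × E →L[ℝ] E × E => T y') hid
  simp only [ContinuousLinearMap.comp_apply, ContinuousLinearMap.id_apply] at h1 h2
  rw [← h1, ← h2, hyy]

/-- If the projection of the conormal variety to the first factor is an immersion over the base
point, then the conormal variety of a small piece is the graph of a smooth map: the parameter of a
conormal vector is found by inverting `Ψ₁` at the normalised vector. -/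
theorem exists_graph [FiniteDimensional ℝ E]
    (hinj : Function.Injective (fderiv ℝ Φ.Ψ₁ (Φ.param z₀ 1))) :
    ∃ W₀ : Set (E × E), IsOpen W₀ ∧ z₀ ∈ W₀ ∧ W₀ ⊆ Φ.Ω ∧ ∀ W ⊆ W₀, IsOpen W →
      ∃ (U : Set (E × E)) (g : E × E → E × E), IsOpen U ∧ ContDiffOn ℝ ∞ g U ∧
        ∀ y y', (∃ p ∈ Φ.D, Φ.Z p ∈ W ∧ Φ.ℓ p.2 ≠ 0 ∧ Φ.Ψ₁ p = y ∧ Φ.Ψ₂ p = y') ↔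
          y ∈ U ∧ y' = g y := by
  obtain ⟨G, hzG, hGD, hGΨ, hGs, -⟩ := exists_openPartialHomeomorph_of_isInvertible
    Φ.isOpen_D Φ.contDiffOn_Ψ₁ (Φ.param_mem Φ.mem_Ω 1)
    (ContinuousLinearMap.isInvertible_of_injective rfl hinj)
  have hparam : ContinuousOn (fun z => Φ.param z 1) Φ.Ω :=
    continuousOn_fst.prodMk (Φ.contDiffOn_f.continuousOn.add
      ((continuousOn_const.sub (Φ.ℓ.continuous.comp_continuousOn
        Φ.contDiffOn_f.continuousOn)).smul continuousOn_const))
  refine ⟨Φ.Ω ∩ (fun z => Φ.param z 1) ⁻¹' G.source,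
    hparam.isOpen_inter_preimage Φ.isOpen_Ω G.open_source, ⟨Φ.mem_Ω, hzG⟩, inter_subset_left,
    fun W hW hWo => ?_⟩
  -- the normalised parameter of a parameter
  have hnorm : ∀ p : E × E, Φ.q p + (1 - Φ.ℓ (Φ.q p)) • Φ.c = p.2 + (1 - Φ.ℓ p.2) • Φ.c := by
    intro p
    rw [ℓ_q, q_eq, add_assoc, ← add_smul]
    congr 2; ring
  have hbar : ∀ p ∈ Φ.D, Φ.Z p ∈ W → (p.1, p.2 + (1 - Φ.ℓ p.2) • Φ.c) ∈ G.source := by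
    intro p hp hpW
    have h1 := (hW hpW).2
    rwa [mem_preimage, param, Φ.f_Z hp, hnorm] at h1
  have hΨbar : ∀ p ∈ Φ.D, Φ.Ψ₁ (p.1, p.2 + (1 - Φ.ℓ p.2) • Φ.c) = (p.1, Φ.e (Φ.Z p)) := by
    intro p hp
    simp only [Ψ₁, Φ.Z_add, map_add, map_smul, Φ.ℓ_c, smul_eq_mul, mul_one, add_sub_cancel,
      one_smul]
  set ν : E × E → E × E := fun y => (y.1, (Φ.m y.2)⁻¹ • y.2) with hν
  set O : Set (E × E) := {y | Φ.m y.2 ≠ 0} with hO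
  have hOo : IsOpen O := isOpen_ne_fun (by fun_prop) continuous_const
  have hνs : ContDiffOn ℝ ∞ ν O :=
    contDiffOn_fst.prodMk (((Φ.m.contDiff.comp contDiff_snd).contDiffOn.inv
      (fun y hy => hy)).smul contDiffOn_snd)
  set r : E × E → E × E := fun y =>
    ((G.symm (ν y)).1, (G.symm (ν y)).2 + (Φ.m y.2 - 1) • Φ.c) with hr
  set U₁ : Set (E × E) := O ∩ ν ⁻¹' G.target with hU₁
  have hU₁o : IsOpen U₁ := hνs.continuousOn.isOpen_inter_preimage hOo G.open_target
  have hGν : ContDiffOn ℝ ∞ (fun y => G.symm (ν y)) U₁ :=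
    hGs.comp (hνs.mono inter_subset_left) fun y hy => hy.2
  have hrs : ContDiffOn ℝ ∞ r U₁ :=
    (contDiff_fst.comp_contDiffOn hGν).prodMk ((contDiff_snd.comp_contDiffOn hGν).add
      (((Φ.m.contDiff.comp contDiff_snd).contDiffOn.sub contDiffOn_const).smul contDiffOn_const))
  have hrD : ∀ y ∈ U₁, r y ∈ Φ.D := fun y hy =>
    Φ.add_mem_D _ _ _ (hGD (G.map_target hy.2))
  have hΨr : ∀ y ∈ U₁, Φ.Ψ₁ (r y) = y ∧ Φ.ℓ (r y).2 ≠ 0 := by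
    intro y hy
    have hpD := hGD (G.map_target hy.2)
    have h1 : Φ.Ψ₁ (G.symm (ν y)) = ν y := by rw [← hGΨ]; exact G.right_inv hy.2
    have h5 : Φ.ℓ (G.symm (ν y)).2 • Φ.e (Φ.Z (G.symm (ν y))) = (Φ.m y.2)⁻¹ • y.2 :=
      (Prod.ext_iff.1 h1).2
    have h2 : Φ.ℓ (G.symm (ν y)).2 = 1 := by
      have h3 := congrArg Φ.m h5
      rwa [map_smul, map_smul, Φ.m_e _ (Φ.Z_mem hpD), smul_eq_mul, smul_eq_mul, mul_one,
        inv_mul_cancel₀ hy.1] at h3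
    have h4 : Φ.ℓ (r y).2 = Φ.m y.2 := by simp [hr, h2, Φ.ℓ_c]
    refine ⟨?_, by rw [h4]; exact hy.1⟩
    rw [h2, one_smul] at h5
    have h6 := (Prod.ext_iff.1 h1).1
    refine Prod.ext h6 ?_
    simp only [Ψ₁, h4]
    rw [hr, Φ.Z_add, Prod.mk.eta, h5, smul_smul, mul_inv_cancel₀ hy.1, one_smul]
  have hZr : ContinuousOn (fun y => Φ.Z (r y)) U₁ :=
    Φ.contDiffOn_Z.continuousOn.comp hrs.continuousOn hrD
  refine ⟨U₁ ∩ (fun y => Φ.Z (r y)) ⁻¹' W, fun y => Φ.Ψ₂ (r y),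
    hZr.isOpen_inter_preimage hU₁o hWo,
    Φ.contDiffOn_Ψ₂.comp (hrs.mono inter_subset_left) fun y hy => hrD y hy.1, fun y y' => ?_⟩
  constructor
  · rintro ⟨p, hp, hpW, hℓ, rfl, rfl⟩
    have hm : Φ.m (Φ.Ψ₁ p).2 = Φ.ℓ p.2 := by
      simp [Ψ₁, Φ.m_e _ (Φ.Z_mem hp)]
    have hνp : ν (Φ.Ψ₁ p) = (p.1, Φ.e (Φ.Z p)) := by
      simp only [hν, hm]
      simp [Ψ₁, smul_smul, inv_mul_cancel₀ hℓ]
    have hsrc := hbar p hp hpW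
    have hG1 : ν (Φ.Ψ₁ p) = G (p.1, p.2 + (1 - Φ.ℓ p.2) • Φ.c) := by
      rw [hGΨ, hΨbar p hp, hνp]
    have hsymm : G.symm (ν (Φ.Ψ₁ p)) = (p.1, p.2 + (1 - Φ.ℓ p.2) • Φ.c) := by
      rw [hG1]; exact G.left_inv hsrc
    have hrp : r (Φ.Ψ₁ p) = p := by
      simp only [hr, hsymm, hm]
      refine Prod.ext rfl ?_
      simp only [add_assoc, ← add_smul]
      simp
    have hU : Φ.Ψ₁ p ∈ U₁ := ⟨by rw [hO, mem_ofPred_eq, hm]; exact hℓ,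
      by rw [mem_preimage, hG1]; exact G.map_source hsrc⟩
    refine ⟨⟨hU, ?_⟩, ?_⟩
    · rw [mem_preimage, hrp]; exact hpW
    · simp only [hrp]
  · rintro ⟨⟨hy, hyW⟩, rfl⟩
    exact ⟨r y, hrD y hy, hyW, (hΨr y hy).2, (hΨr y hy).1, rfl⟩

end FoldForm

/-! ### The fold condition from transversality -/

/-- Transversality of the kernel to the critical set implies the fold condition, provided that the
differential changes to first order in the radial direction: otherwise the differential of the
defining function of the critical set would vanish on the whole space. -/
theorem fderiv_fderiv_notMem_range_of_transversal {E : Type*} [NormedAddCommGroup E]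
    [NormedSpace ℝ E] [FiniteDimensional ℝ E] {f : E × E → E} {Ω : Set (E × E)} (hΩ : IsOpen Ω)
    (hf : ContDiffOn ℝ ∞ f Ω) {z₀ : E × E} (hz₀ : z₀ ∈ Ω) {e₀ : E} {lam : E →L[ℝ] ℝ}
    (hlam : lam e₀ = 1) (hker : ∀ a, fderiv ℝ f z₀ (0, a) = 0 ↔ ∃ r : ℝ, a = r • e₀)
    (hrad : ∀ a, fderiv ℝ f z₀ (0, a) ≠ fderiv ℝ (fderiv ℝ f) z₀ (0, e₀) (0, z₀.2))
    (T : Set E)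
    (hT : ∀ τ ∈ T, ∃ u : ℝ → E, HasDerivAt u τ 0 ∧ u 0 = z₀.2 ∧
      ∀ᶠ t in 𝓝 (0 : ℝ), ∃ a ≠ 0, fderiv ℝ f (z₀.1, u t) (0, a) = 0)
    (hspan : ∀ w : E, ∃ r : ℝ, w - r • e₀ ∈ Submodule.span ℝ T) (a : E) :
    fderiv ℝ f z₀ (0, a) ≠ fderiv ℝ (fderiv ℝ f) z₀ (0, e₀) (0, e₀) := by
  intro ha
  obtain ⟨S, hS, hSc⟩ := exists_equiv_comp_eq_sub_smul
    (A := fderiv ℝ f z₀ ∘L .inr ℝ E E) hlam hker hrad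
  replace hS : ∀ a, S (fderiv ℝ f z₀ (0, a)) = a - lam a • e₀ := hS
  obtain ⟨Ω₁, hΩ₁, hz₁, hsub, e, hes, hez, he⟩ := exists_kernelField hΩ hf hz₀ S hlam hS
  have hf₁ := hf.mono hsub
  have hf2 := (hf₁.fderiv_of_isOpen (m := ∞) hΩ₁ (by simp)).hasFDerivAt_of_isOpen hΩ₁ hz₁
  have hed := hes.hasFDerivAt_of_isOpen hΩ₁ hz₁
  have hsym : ∀ X Y, fderiv ℝ (fderiv ℝ f) z₀ X Y = fderiv ℝ (fderiv ℝ f) z₀ Y X :=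
    fun X Y => (hf₁.contDiffAt (hΩ₁.mem_nhds hz₁)).isSymmSndFDerivAt
      (by rw [minSmoothness_of_isRCLikeNormedField]; exact WithTop.coe_le_coe.2 le_top) X Y
  have hSr : ∀ a, lam (S (fderiv ℝ f z₀ (0, a))) = 0 := fun a => by
    rw [hS, map_sub, map_smul, hlam, smul_eq_mul, mul_one, sub_self]
  set φ : E →L[ℝ] ℝ :=
    (lam ∘L (S : E →L[ℝ] E)) ∘L (fderiv ℝ (fderiv ℝ f) z₀ (0, e₀) ∘L .inr ℝ E E) with hφ
  have hφa : ∀ τ, φ τ = lam (S (fderiv ℝ (fderiv ℝ f) z₀ (0, e₀) (0, τ))) := fun τ => rfl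
  have hφT : ∀ τ ∈ T, φ τ = 0 := by
    intro τ hτ
    obtain ⟨u, hu, hu0, hev⟩ := hT τ hτ
    have hline : HasDerivAt (fun t => (z₀.1, u t)) (0, τ) 0 := (hasDerivAt_const _ _).prodMk hu
    have hP0 : (z₀.1, u 0) = z₀ := by rw [hu0]
    have h1 : HasDerivAt (fun t => fderiv ℝ f (z₀.1, u t)) _ 0 :=
      HasFDerivAt.comp_hasDerivAt (l := fderiv ℝ f) 0 (by rw [hP0]; exact hf2) hline
    have h2 : HasDerivAt (fun t => e (z₀.1, u t)) _ 0 :=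
      HasFDerivAt.comp_hasDerivAt (l := e) 0 (by rw [hP0]; exact hed) hline
    have h3 := h1.clm_apply ((hasDerivAt_const (0 : ℝ) (0 : E)).prodMk h2)
    have h4 : HasDerivAt (fun t => fderiv ℝ f (z₀.1, u t) (0, e (z₀.1, u t))) 0 0 := by
      refine (hasDerivAt_const (0 : ℝ) (0 : E)).congr_of_eventuallyEq ?_
      have hc : ContinuousAt (fun t => (z₀.1, u t)) 0 := hline.continuousAt
      filter_upwards [hev, hc.eventually (hΩ₁.mem_nhds (by simpa only [hP0] using hz₁))]
        with t ht htΩ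
      obtain ⟨a, ha0, ha⟩ := ht
      have h5 := (he _ htΩ).2.2 a ⟨0, by simp [ha]⟩
      have hl : lam a ≠ 0 := fun hl => ha0 (by rw [h5, hl, zero_smul])
      rw [h5, show ((0 : E), lam a • e (z₀.1, u t)) = lam a • ((0 : E), e (z₀.1, u t)) by simp,
        map_smul, smul_eq_zero] at ha
      exact ha.resolve_left hl
    have h5 := h3.unique h4
    simp only [hP0, hez] at h5
    rw [hφa, hsym, eq_neg_of_add_eq_zero_left h5, map_neg, map_neg, hSr, neg_zero]
  have hφspan : ∀ w ∈ Submodule.span ℝ T, φ w = 0 := fun w hw => by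
    have : Submodule.span ℝ T ≤ LinearMap.ker (φ : E →ₗ[ℝ] ℝ) := Submodule.span_le.2 hφT
    exact this hw
  have hφe : φ e₀ = 0 := by rw [hφa, ← ha, hSr]
  obtain ⟨r, hr⟩ := hspan z₀.2
  have h1 := hφspan _ hr
  rw [map_sub, map_smul, hφe, smul_zero, sub_zero, hφa, hSc, hlam] at h1
  exact one_ne_zero h1

/-! ### Coordinates on the tangent bundle -/

section TangentCoordinates

variable {E : Type*} [NormedAddCommGroup E] [NormedSpace ℝ E]
  {M : Type*} [TopologicalSpace M] [ChartedSpace E M] [IsManifold 𝓘(ℝ, E) ∞ M]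

/-- The differential at `x` of the preferred chart around `c`, with values in the model space. -/
def dchart (c x : M) : TangentSpace 𝓘(ℝ, E) x →L[ℝ] E :=
  mfderiv 𝓘(ℝ, E) 𝓘(ℝ, E) (extChartAt 𝓘(ℝ, E) c) x

/-- The differential at `y` of the inverse of the preferred chart around `c`. -/
def dchartSymm (c : M) (y : E) :
    E →L[ℝ] TangentSpace 𝓘(ℝ, E) ((extChartAt 𝓘(ℝ, E) c).symm y) :=
  mfderiv 𝓘(ℝ, E) 𝓘(ℝ, E) (extChartAt 𝓘(ℝ, E) c).symm y

/-- The coordinates `x ↦ (φ (π x), dφ x)` on the tangent bundle induced by the preferred chart `φ`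
around `c`. -/
def tcoord (c : M) : PartialEquiv (TangentBundle 𝓘(ℝ, E) M) (E × E) :=
  extChartAt 𝓘(ℝ, E).tangent (⟨c, 0⟩ : TangentBundle 𝓘(ℝ, E) M)

variable {c : M}

theorem mem_tcoord_source {x : TangentBundle 𝓘(ℝ, E) M} :
    x ∈ (tcoord c).source ↔ x.1 ∈ (extChartAt 𝓘(ℝ, E) c).source := by
  rw [tcoord, extChartAt_source, extChartAt_source]
  exact TangentBundle.mem_chart_source_iff (I := 𝓘(ℝ, E)) (M := M) _ _

theorem mem_tcoord_target {z : E × E} :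
    z ∈ (tcoord (E := E) c).target ↔ z.1 ∈ (extChartAt 𝓘(ℝ, E) c).target := by
  have h1 : z ∈ (tcoord (E := E) c).target ↔
      z ∈ (chartAt (ModelProd E E) (⟨c, 0⟩ : TangentBundle 𝓘(ℝ, E) M)).target := by
    simp only [tcoord, extChartAt, OpenPartialHomeomorph.extend, PartialEquiv.trans_target]
    exact ⟨fun h => h.2, fun h => ⟨by simp, h⟩⟩
  rw [h1, TangentBundle.mem_chart_target_iff (I := 𝓘(ℝ, E)) (M := M) z ⟨c, 0⟩]
  simp

theorem tcoord_apply {x : TangentBundle 𝓘(ℝ, E) M}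
    (hx : x.1 ∈ (extChartAt 𝓘(ℝ, E) c).source) :
    tcoord c x = (extChartAt 𝓘(ℝ, E) c x.1,
      dchart c x.1 x.2) := by
  rw [extChartAt_source] at hx
  have := tangentMap_chart (I := 𝓘(ℝ, E)) (p := (⟨c, 0⟩ : TangentBundle 𝓘(ℝ, E) M)) hx
  have h2 := congrArg (TotalSpace.toProd E E) this
  rw [Equiv.apply_symm_apply] at h2
  exact h2.symm

theorem tcoord_symm_apply {z : E × E} (hz : z.1 ∈ (extChartAt 𝓘(ℝ, E) c).target) :
    (tcoord c).symm z = ⟨(extChartAt 𝓘(ℝ, E) c).symm z.1,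
      dchartSymm c z.1 z.2⟩ := by
  have := tangentMap_chart_symm (I := 𝓘(ℝ, E)) (p := (⟨c, 0⟩ : TangentBundle 𝓘(ℝ, E) M))
    (q := (⟨z.1, z.2⟩ : TangentBundle 𝓘(ℝ, E) E)) (by simpa using hz)
  exact this.symm

theorem isOpen_tcoord_source : IsOpen (tcoord (E := E) c).source := isOpen_extChartAt_source _

theorem isOpen_tcoord_target : IsOpen (tcoord (E := E) c).target := isOpen_extChartAt_target _

theorem contMDiffOn_tcoord :
    ContMDiffOn 𝓘(ℝ, E).tangent 𝓘(ℝ, E × E) ∞ (tcoord (E := E) c) (tcoord c).source := by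
  have := contMDiffOn_extChartAt (I := 𝓘(ℝ, E).tangent) (n := ∞)
    (x := (⟨c, 0⟩ : TangentBundle 𝓘(ℝ, E) M))
  rw [tcoord, extChartAt_source]
  exact this

theorem contMDiffOn_tcoord_symm :
    ContMDiffOn 𝓘(ℝ, E × E) 𝓘(ℝ, E).tangent ∞ (tcoord (E := E) c).symm (tcoord c).target :=
  contMDiffOn_extChartAt_symm (I := 𝓘(ℝ, E).tangent) (n := ∞) _

theorem mdifferentiableAt_chart {x : M} (hx : x ∈ (extChartAt 𝓘(ℝ, E) c).source) :
    MDifferentiableAt 𝓘(ℝ, E) 𝓘(ℝ, E) (extChartAt 𝓘(ℝ, E) c) x :=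
  mdifferentiableAt_extChartAt (by rwa [extChartAt_source] at hx)

theorem mdifferentiableAt_chart_symm {y : E} (hy : y ∈ (extChartAt 𝓘(ℝ, E) c).target) :
    MDifferentiableAt 𝓘(ℝ, E) 𝓘(ℝ, E) (extChartAt 𝓘(ℝ, E) c).symm y := by
  have := mdifferentiableWithinAt_extChartAt_symm (I := 𝓘(ℝ, E)) hy
  rwa [ModelWithCorners.range_eq_univ, mdifferentiableWithinAt_univ] at this

theorem mfderiv_chart_mfderiv_chart_symm {y : E} (hy : y ∈ (extChartAt 𝓘(ℝ, E) c).target) (a : E) :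
    dchart c ((extChartAt 𝓘(ℝ, E) c).symm y)
      (dchartSymm c y a) = a := by
  have := mfderiv_extChartAt_comp_mfderivWithin_extChartAt_symm (I := 𝓘(ℝ, E)) hy
  rw [ModelWithCorners.range_eq_univ, mfderivWithin_univ] at this
  exact DFunLike.congr_fun this a

theorem mfderiv_chart_symm_mfderiv_chart {x : M} (hx : x ∈ (extChartAt 𝓘(ℝ, E) c).source)
    (a : TangentSpace 𝓘(ℝ, E) x) :
    (⟨(extChartAt 𝓘(ℝ, E) c).symm (extChartAt 𝓘(ℝ, E) c x),
      dchartSymm c (extChartAt 𝓘(ℝ, E) c x)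
      (dchart c x a)⟩ : TangentBundle 𝓘(ℝ, E) M) =
      ⟨x, a⟩ := by
  have h := (tcoord c).left_inv (mem_tcoord_source.2 hx : (⟨x, a⟩ : TangentBundle 𝓘(ℝ, E) M) ∈ _)
  rw [tcoord_apply hx, tcoord_symm_apply ((extChartAt 𝓘(ℝ, E) c).map_source hx)] at h
  exact h

/-- The transition map from the chart around `c` to the chart around `c'`. -/
def transition (E : Type*) [NormedAddCommGroup E] [NormedSpace ℝ E]
  {M : Type*} [TopologicalSpace M] [ChartedSpace E M] (c c' : M) (y : E) : E :=
  extChartAt 𝓘(ℝ, E) c' ((extChartAt 𝓘(ℝ, E) c).symm y)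

omit [IsManifold 𝓘(ℝ, E) ∞ M] in
theorem isOpen_transition_source (c c' : M) :
    IsOpen ((extChartAt 𝓘(ℝ, E) c).target ∩
      (extChartAt 𝓘(ℝ, E) c).symm ⁻¹' (extChartAt 𝓘(ℝ, E) c').source) :=
  (continuousOn_extChartAt_symm c).isOpen_inter_preimage (isOpen_extChartAt_target c)
    (isOpen_extChartAt_source c')

theorem contDiffOn_transition (c c' : M) : ContDiffOn ℝ ∞ (transition E c c')
    ((extChartAt 𝓘(ℝ, E) c).target ∩
      (extChartAt 𝓘(ℝ, E) c).symm ⁻¹' (extChartAt 𝓘(ℝ, E) c').source) := by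
  rw [← contMDiffOn_iff_contDiffOn]
  have h1 := contMDiffOn_extChartAt (I := 𝓘(ℝ, E)) (n := ∞) (x := c')
  rw [← extChartAt_source (I := 𝓘(ℝ, E))] at h1
  exact h1.comp ((contMDiffOn_extChartAt_symm (I := 𝓘(ℝ, E)) (n := ∞) c).mono inter_subset_left)
    fun y hy => hy.2

theorem fderiv_transition_apply {c c' : M} {y : E} (hy : y ∈ (extChartAt 𝓘(ℝ, E) c).target)
    (hy' : (extChartAt 𝓘(ℝ, E) c).symm y ∈ (extChartAt 𝓘(ℝ, E) c').source) (a : E) :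
    fderiv ℝ (transition E c c') y a =
      dchart c' ((extChartAt 𝓘(ℝ, E) c).symm y)
        (dchartSymm c y a) := by
  rw [← mfderiv_eq_fderiv]
  have := mfderiv_comp y (mdifferentiableAt_chart hy') (mdifferentiableAt_chart_symm hy)
  exact DFunLike.congr_fun this a

theorem fderiv_transition_mfderiv {c c' x : M} (hx : x ∈ (extChartAt 𝓘(ℝ, E) c).source)
    (hx' : x ∈ (extChartAt 𝓘(ℝ, E) c').source) (a : TangentSpace 𝓘(ℝ, E) x) :
    fderiv ℝ (transition E c c') (extChartAt 𝓘(ℝ, E) c x)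
      (dchart c x a) =
      dchart c' x a := by
  have hl := (extChartAt 𝓘(ℝ, E) c).left_inv hx
  rw [fderiv_transition_apply ((extChartAt 𝓘(ℝ, E) c).map_source hx) (by rwa [hl])]
  have h := mfderiv_chart_symm_mfderiv_chart hx a
  have h2 := congrArg (tcoord c') h
  rw [tcoord_apply (show (extChartAt 𝓘(ℝ, E) c).symm (extChartAt 𝓘(ℝ, E) c x) ∈ _ by
    rw [hl]; exact hx'), tcoord_apply hx'] at h2
  exact congrArg Prod.snd h2

/-- The coordinates of the velocity of a curve are the velocity of its coordinate expression. -/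
theorem tcoord_velocity {γ : ℝ → M} {t : ℝ} (hγ : MDifferentiableAt 𝓘(ℝ, ℝ) 𝓘(ℝ, E) γ t)
    (ht : γ t ∈ (extChartAt 𝓘(ℝ, E) c).source) :
    tcoord c (velocity E γ t) = (extChartAt 𝓘(ℝ, E) c (γ t),
      deriv (fun s => extChartAt 𝓘(ℝ, E) c (γ s)) t) := by
  rw [tcoord_apply (by exact ht)]
  have := mfderiv_comp t (mdifferentiableAt_chart (E := E) ht) hγ
  rw [mfderiv_eq_fderiv] at this
  refine Prod.ext rfl ?_
  exact (DFunLike.congr_fun this (1 : ℝ)).symm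

theorem mfderiv_chart_velocity {γ : ℝ → M} {t : ℝ} (hγ : MDifferentiableAt 𝓘(ℝ, ℝ) 𝓘(ℝ, E) γ t)
    (ht : γ t ∈ (extChartAt 𝓘(ℝ, E) c).source) :
    dchart c (γ t) (velocity E γ t).2 =
      deriv (fun s => extChartAt 𝓘(ℝ, E) c (γ s)) t := by
  have := tcoord_velocity hγ ht
  rw [tcoord_apply (by exact ht)] at this
  exact congrArg Prod.snd this

end TangentCoordinates

/-! ### The metric and the Christoffel symbols in a chart -/

section ChartMetric

set_option synthInstance.maxHeartbeats 200000

theorem ContDiffOn.fderiv_apply_prod {E F : Type*} [NormedAddCommGroup E] [NormedSpace ℝ E]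
    [NormedAddCommGroup F] [NormedSpace ℝ F] {G : E → F} {U : Set E} (hU : IsOpen U)
    (hG : ContDiffOn ℝ ∞ G U) {h : E × E → E} (hh : ContDiff ℝ ∞ h) :
    ContDiffOn ℝ ∞ (fun z : E × E => fderiv ℝ G z.1 (h z)) (U ×ˢ univ) :=
  ((hG.fderiv_of_isOpen hU (m := ∞) (by simp)).comp contDiffOn_fst
    fun z hz => hz.1).clm_apply hh.contDiffOn

/-- A formula of Christoffel type, `G⁻¹` applied to first derivatives of `G`, is smooth. -/
theorem contDiffOn_inverse_apply_fderiv {E : Type*} [NormedAddCommGroup E] [NormedSpace ℝ E]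
    [FiniteDimensional ℝ E] {G : E → E →L[ℝ] E →L[ℝ] ℝ} {U : Set E} (hU : IsOpen U)
    (hG : ContDiffOn ℝ ∞ G U) (hinv : ∀ y ∈ U, (G y).IsInvertible) :
    ContDiffOn ℝ ∞ (fun z : E × E => (G z.1).inverse ((1 / 2 : ℝ) •
      (fderiv ℝ G z.1 z.2 z.2 + fderiv ℝ G z.1 z.2 z.2
        - ((fderiv ℝ G z.1).flip z.2).flip z.2))) (U ×ˢ univ) := by
  have hG1 : ContDiffOn ℝ ∞ (fun z : E × E => G z.1) (U ×ˢ univ) :=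
    hG.comp contDiffOn_fst fun z hz => hz.1
  have hi : ContDiffOn ℝ ∞ (fun z : E × E => (G z.1).inverse) (U ×ˢ univ) := by
    intro z hz
    have h1 : ContDiffAt ℝ ∞ ContinuousLinearMap.inverse (G z.1) :=
      (hinv _ hz.1).contDiffAt_map_inverse
    exact h1.comp_contDiffWithinAt z (hG1 z hz)
  have hs : ContDiffOn ℝ ∞ (fun z : E × E => z.2) (U ×ˢ univ) := contDiffOn_snd
  have hDs := hG.fderiv_apply_prod hU contDiff_snd
  refine hi.clm_apply (contDiffOn_const.fun_smul (((hDs.clm_apply hs).add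
    (hDs.clm_apply hs)).sub ?_))
  rw [contDiffOn_clm_apply]
  intro w
  simp only [ContinuousLinearMap.flip_apply]
  exact ((hG.fderiv_apply_prod hU contDiff_const).clm_apply hs).clm_apply hs

variable {E : Type*} [NormedAddCommGroup E] [NormedSpace ℝ E]
  {M : Type*} [TopologicalSpace M] [ChartedSpace E M]
  [RiemannianBundle (fun x : M => TangentSpace 𝓘(ℝ, E) x)]

variable {c : M}

theorem chartMetric_apply (c : M) (y a b : E) :
    chartMetric c y a b = inner ℝ (dchartSymm c y a) (dchartSymm c y b) := rfl

theorem chartMetric_symm (c : M) (y a b : E) : chartMetric c y a b = chartMetric c y b a := by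
  rw [chartMetric_apply, chartMetric_apply, real_inner_comm]

variable [IsManifold 𝓘(ℝ, E) ∞ M]

theorem chartMetric_pos {y : E} (hy : y ∈ (extChartAt 𝓘(ℝ, E) c).target) {a : E} (ha : a ≠ 0) :
    0 < chartMetric c y a a := by
  rw [chartMetric_apply]
  refine real_inner_self_pos.2 fun h => ha ?_
  have := mfderiv_chart_mfderiv_chart_symm hy a
  rw [h, map_zero] at this
  exact this.symm

theorem inner_eq_chartMetric {x : M} (hx : x ∈ (extChartAt 𝓘(ℝ, E) c).source)
    (a b : TangentSpace 𝓘(ℝ, E) x) :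
    inner ℝ a b = chartMetric c (extChartAt 𝓘(ℝ, E) c x) (dchart c x a) (dchart c x b) := by
  rw [chartMetric_apply]
  have h1 := mfderiv_chart_symm_mfderiv_chart hx a
  have h2 := mfderiv_chart_symm_mfderiv_chart hx b
  generalize dchartSymm c (extChartAt 𝓘(ℝ, E) c x) (dchart c x a) = a' at *
  generalize dchartSymm c (extChartAt 𝓘(ℝ, E) c x) (dchart c x b) = b' at *
  have hl := (extChartAt 𝓘(ℝ, E) c).left_inv hx
  revert a' b'
  rw [hl]
  intro a' h1 b' h2
  rw [TotalSpace.mk_inj] at h1 h2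
  rw [h1, h2]

variable [FiniteDimensional ℝ E]
  [IsContMDiffRiemannianBundle 𝓘(ℝ, E) ∞ E (fun x : M => TangentSpace 𝓘(ℝ, E) x)]

theorem contDiffOn_chartMetric :
    ContDiffOn ℝ ∞ (chartMetric (E := E) c) (extChartAt 𝓘(ℝ, E) c).target := by
  rw [contDiffOn_clm_apply]
  intro a
  rw [contDiffOn_clm_apply]
  intro b
  rw [← contMDiffOn_iff_contDiffOn]
  have h : ∀ a : E, ContMDiffOn 𝓘(ℝ, E) 𝓘(ℝ, E).tangent ∞
      (fun y => (⟨(extChartAt 𝓘(ℝ, E) c).symm y, dchartSymm c y a⟩ : TangentBundle 𝓘(ℝ, E) M))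
      (extChartAt 𝓘(ℝ, E) c).target := by
    intro a
    have h1 : ContMDiffOn 𝓘(ℝ, E) 𝓘(ℝ, E × E) ∞ (fun y : E => (y, a))
        (extChartAt 𝓘(ℝ, E) c).target :=
      (contDiff_id.prodMk contDiff_const).contMDiff.contMDiffOn
    refine (contMDiffOn_tcoord_symm.comp h1 fun y hy => mem_tcoord_target.2 hy).congr
      fun y hy => ?_
    exact (tcoord_symm_apply (z := (y, a)) hy).symm
  exact ContMDiffOn.inner_bundle (E := fun x : M => TangentSpace 𝓘(ℝ, E) x)
    (v := fun y => dchartSymm c y a) (w := fun y => dchartSymm c y b) (h a) (h b)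

omit [IsContMDiffRiemannianBundle 𝓘(ℝ, E) ∞ E (fun x : M => TangentSpace 𝓘(ℝ, E) x)] in
theorem isInvertible_chartMetric {y : E} (hy : y ∈ (extChartAt 𝓘(ℝ, E) c).target) :
    (chartMetric c y : E →L[ℝ] E →L[ℝ] ℝ).IsInvertible := by
  have hinj : Function.Injective (chartMetric c y : E →L[ℝ] E →L[ℝ] ℝ) := by
    rw [injective_iff_map_eq_zero]
    intro a ha
    by_contra h
    have := chartMetric_pos hy h
    rw [ha] at this
    exact lt_irrefl _ this
  have hd : Module.finrank ℝ E = Module.finrank ℝ (E →L[ℝ] ℝ) := by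
    rw [← LinearMap.toContinuousLinearMap.finrank_eq, Module.finrank_linearMap,
      Module.finrank_self, mul_one]
  exact ⟨(LinearEquiv.ofInjectiveOfFinrankEq
    (chartMetric c y : E →L[ℝ] E →L[ℝ] ℝ).toLinearMap hinj hd).toContinuousLinearEquiv, rfl⟩

omit [IsContMDiffRiemannianBundle 𝓘(ℝ, E) ∞ E (fun x : M => TangentSpace 𝓘(ℝ, E) x)] in
theorem chartMetric_christoffel {y : E} (hy : y ∈ (extChartAt 𝓘(ℝ, E) c).target) (a z : E) :
    chartMetric c y (christoffel c y a a) z =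
      fderiv ℝ (chartMetric (E := E) c) y a a z
        - (1 / 2) * fderiv ℝ (chartMetric (E := E) c) y z a a := by
  rw [christoffel, (isInvertible_chartMetric hy).self_apply_inverse]
  simp
  ring

omit [IsManifold 𝓘(ℝ, E) ∞ M] [FiniteDimensional ℝ E]
  [IsContMDiffRiemannianBundle 𝓘(ℝ, E) ∞ E (fun x : M => TangentSpace 𝓘(ℝ, E) x)] in
theorem christoffel_smul_smul (c : M) (y a : E) (r : ℝ) :
    christoffel c y (r • a) (r • a) = (r * r) • christoffel c y a a := by
  unfold christoffel
  rw [← ContinuousLinearMap.map_smul]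
  congr 1
  ext z
  simp
  ring

theorem contDiffOn_christoffel : ContDiffOn ℝ ∞ (fun z : E × E => christoffel c z.1 z.2 z.2)
    ((extChartAt 𝓘(ℝ, E) c).target ×ˢ univ) := by
  exact contDiffOn_inverse_apply_fderiv (isOpen_extChartAt_target c) contDiffOn_chartMetric
    fun y hy => isInvertible_chartMetric hy

end ChartMetric

/-! ### First variation of the energy, and the geodesic equation in an arbitrary chart -/

section PartialDerivatives

variable {G E : Type*} [NormedAddCommGroup G] [NormedSpace ℝ G] [NormedAddCommGroup E]
  [NormedSpace ℝ E]

theorem hasDerivAt_fst_slice {Y : ℝ × G → E} {t : ℝ} {s : G} (hY : DifferentiableAt ℝ Y (t, s)) :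
    HasDerivAt (fun t => Y (t, s)) (fderiv ℝ Y (t, s) (1, 0)) t := by
  have h := (hasDerivAt_id t).prodMk (hasDerivAt_const t s)
  exact HasFDerivAt.comp_hasDerivAt (l := Y) (f := fun t => (t, s)) t hY.hasFDerivAt h

theorem hasDerivAt_snd_slice {Y : ℝ × ℝ → E} {t s : ℝ} (hY : DifferentiableAt ℝ Y (t, s)) :
    HasDerivAt (fun s => Y (t, s)) (fderiv ℝ Y (t, s) (0, 1)) s := by
  have h := (hasDerivAt_const s t).prodMk (hasDerivAt_id s)
  exact HasFDerivAt.comp_hasDerivAt (l := Y) (f := fun s => (t, s)) s hY.hasFDerivAt h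

theorem ContDiffOn.differentiableAt_of_isOpen {f : G → E} {U : Set G} (hf : ContDiffOn ℝ ∞ f U)
    (hU : IsOpen U) {x : G} (hx : x ∈ U) : DifferentiableAt ℝ f x :=
  (hf.contDiffAt (hU.mem_nhds hx)).differentiableAt (by simp)

theorem deriv_deriv_fst_slice {Y : ℝ × G → E} {U : Set (ℝ × G)} (hU : IsOpen U)
    (hY : ContDiffOn ℝ ∞ Y U) {t : ℝ} {s : G} (h : (t, s) ∈ U) :
    deriv (deriv fun t => Y (t, s)) t = fderiv ℝ (fderiv ℝ Y) (t, s) (1, 0) (1, 0) := by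
  have h1 : (deriv fun t => Y (t, s)) =ᶠ[𝓝 t] fun t => fderiv ℝ Y (t, s) (1, 0) := by
    have : ContinuousAt (fun t : ℝ => (t, s)) t := by fun_prop
    filter_upwards [this (hU.mem_nhds h)] with t' ht'
    exact (hasDerivAt_fst_slice (hY.differentiableAt_of_isOpen hU ht')).deriv
  rw [h1.deriv_eq]
  have h2 : ContDiffOn ℝ ∞ (fderiv ℝ Y) U := hY.fderiv_of_isOpen hU (by simp)
  have h3 := hasDerivAt_fst_slice (h2.differentiableAt_of_isOpen hU h)
  exact (h3.clm_apply (hasDerivAt_const t ((1 : ℝ), (0 : G)))).deriv.trans (by simp)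

end PartialDerivatives

section ChartComp

variable {X : Type*} [NormedAddCommGroup X] [NormedSpace ℝ X]
  {E : Type*} [NormedAddCommGroup E] [NormedSpace ℝ E]
  {M : Type*} [TopologicalSpace M] [ChartedSpace E M] [IsManifold 𝓘(ℝ, E) ∞ M]

theorem ContMDiffOn.contDiffOn_chart_comp {F : X → M} {U : Set X}
    (hF : ContMDiffOn 𝓘(ℝ, X) 𝓘(ℝ, E) ∞ F U) (c : M) :
    ContDiffOn ℝ ∞ (fun x => extChartAt 𝓘(ℝ, E) c (F x))
      (U ∩ F ⁻¹' (extChartAt 𝓘(ℝ, E) c).source) := by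
  rw [← contMDiffOn_iff_contDiffOn]
  have h1 := contMDiffOn_extChartAt (I := 𝓘(ℝ, E)) (n := ∞) (x := c)
  rw [← extChartAt_source (I := 𝓘(ℝ, E))] at h1
  exact h1.comp (hF.mono inter_subset_left) fun y hy => hy.2

omit [IsManifold 𝓘(ℝ, E) ∞ M] in
theorem ContMDiffOn.isOpen_inter_preimage_chart {F : X → M} {U : Set X} (hU : IsOpen U)
    (hF : ContMDiffOn 𝓘(ℝ, X) 𝓘(ℝ, E) ∞ F U) (c : M) :
    IsOpen (U ∩ F ⁻¹' (extChartAt 𝓘(ℝ, E) c).source) :=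
  hF.continuousOn.isOpen_inter_preimage hU (isOpen_extChartAt_source c)

theorem contMDiffOn_chart_symm_comp {y : X → E} {U : Set X} {c : M} (hy : ContDiffOn ℝ ∞ y U)
    (h : MapsTo y U (extChartAt 𝓘(ℝ, E) c).target) :
    ContMDiffOn 𝓘(ℝ, X) 𝓘(ℝ, E) ∞ (fun x => (extChartAt 𝓘(ℝ, E) c).symm (y x)) U :=
  (contMDiffOn_extChartAt_symm (I := 𝓘(ℝ, E)) (n := ∞) c).comp hy.contMDiffOn h

omit [IsManifold 𝓘(ℝ, E) ∞ M] in
theorem ContMDiffOn.mdifferentiableAt_of_isOpen {F : X → M} {U : Set X}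
    (hF : ContMDiffOn 𝓘(ℝ, X) 𝓘(ℝ, E) ∞ F U) (hU : IsOpen U) {x : X} (hx : x ∈ U) :
    MDifferentiableAt 𝓘(ℝ, X) 𝓘(ℝ, E) F x :=
  (hF.contMDiffAt (hU.mem_nhds hx)).mdifferentiableAt (by simp)

end ChartComp

section FirstVariation

set_option synthInstance.maxHeartbeats 200000

variable {E : Type*} [NormedAddCommGroup E] [NormedSpace ℝ E]
  {M : Type*} [TopologicalSpace M] [ChartedSpace E M]

/-- The velocity of a curve, as a tangent vector at its current point. -/
def curveDeriv (E : Type*) [NormedAddCommGroup E] [NormedSpace ℝ E]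
    {M : Type*} [TopologicalSpace M] [ChartedSpace E M] (γ : ℝ → M) (t : ℝ) :
    TangentSpace 𝓘(ℝ, E) (γ t) :=
  mfderiv 𝓘(ℝ, ℝ) 𝓘(ℝ, E) γ t (1 : ℝ)

theorem dchart_curveDeriv [IsManifold 𝓘(ℝ, E) ∞ M] {c : M} {γ : ℝ → M} {t : ℝ}
    (hγ : MDifferentiableAt 𝓘(ℝ, ℝ) 𝓘(ℝ, E) γ t)
    (ht : γ t ∈ (extChartAt 𝓘(ℝ, E) c).source) :
    dchart c (γ t) (curveDeriv E γ t) = deriv (fun s => extChartAt 𝓘(ℝ, E) c (γ s)) t :=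
  mfderiv_chart_velocity hγ ht

variable [RiemannianBundle (fun x : M => TangentSpace 𝓘(ℝ, E) x)]

/-- The left-hand side `y'' + Γ(y', y')` of the geodesic equation in the chart around `c`. -/
def geodesicResidual (c : M) (y : ℝ → E) (t : ℝ) : E :=
  deriv (deriv y) t + christoffel c (y t) (deriv y t) (deriv y t)

variable [IsManifold 𝓘(ℝ, E) ∞ M] [FiniteDimensional ℝ E]
  [IsContMDiffRiemannianBundle 𝓘(ℝ, E) ∞ E (fun x : M => TangentSpace 𝓘(ℝ, E) x)]

/-- First variation of the energy density `½ |∂ₜF|²` of a family of curves `F(·, s)`: the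
derivatives of `⟨∂ₜF, ∂ₛF⟩` in `t` and of the energy density in `s` differ by the pairing of the
left-hand side of the geodesic equation with `∂ₛF`. -/
theorem exists_hasDerivAt_inner_curveDeriv {F : ℝ × ℝ → M} {U : Set (ℝ × ℝ)} (hU : IsOpen U)
    (hF : ContMDiffOn 𝓘(ℝ, ℝ × ℝ) 𝓘(ℝ, E) ∞ F U) {t₀ : ℝ} (h₀ : (t₀, 0) ∈ U) {c : M}
    (hc : F (t₀, 0) ∈ (extChartAt 𝓘(ℝ, E) c).source) :
    ∃ B : ℝ, HasDerivAt (fun t => inner ℝ (curveDeriv E (fun t => F (t, 0)) t :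
        TangentSpace 𝓘(ℝ, E) (F (t, 0))) (curveDeriv E (fun s => F (t, s)) 0))
      (chartMetric c (extChartAt 𝓘(ℝ, E) c (F (t₀, 0)))
        (geodesicResidual c (fun t => extChartAt 𝓘(ℝ, E) c (F (t, 0))) t₀)
        (deriv (fun s => extChartAt 𝓘(ℝ, E) c (F (t₀, s))) 0) + B) t₀ ∧
      HasDerivAt (fun s => (1 / 2 : ℝ) * inner ℝ (curveDeriv E (fun t => F (t, s)) t₀ :
        TangentSpace 𝓘(ℝ, E) (F (t₀, s))) (curveDeriv E (fun t => F (t, s)) t₀)) B 0 := by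
  set Y : ℝ × ℝ → E := fun x => extChartAt 𝓘(ℝ, E) c (F x) with hYdef
  set U' := U ∩ F ⁻¹' (extChartAt 𝓘(ℝ, E) c).source with hU'
  have hU'o : IsOpen U' := hF.isOpen_inter_preimage_chart hU c
  have hY : ContDiffOn ℝ ∞ Y U' := hF.contDiffOn_chart_comp c
  have h0 : (t₀, (0 : ℝ)) ∈ U' := ⟨h₀, hc⟩
  have hy : Y (t₀, 0) ∈ (extChartAt 𝓘(ℝ, E) c).target := (extChartAt 𝓘(ℝ, E) c).map_source hc
  have hd : ∀ x ∈ U', DifferentiableAt ℝ Y x := fun x hx => hY.differentiableAt_of_isOpen hU'o hx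
  have hmd : ∀ x ∈ U', MDifferentiableAt 𝓘(ℝ, ℝ × ℝ) 𝓘(ℝ, E) F x :=
    fun x hx => hF.mdifferentiableAt_of_isOpen hU hx.1
  have hc1 : ∀ t s, (t, s) ∈ U' → dchart c (F (t, s)) (curveDeriv E (fun t => F (t, s)) t) =
      fderiv ℝ Y (t, s) (1, 0) := by
    intro t s hts
    have hg : MDifferentiableAt 𝓘(ℝ, ℝ) 𝓘(ℝ, ℝ × ℝ) (fun t : ℝ => (t, s)) t :=
      (DifferentiableAt.prodMk differentiableAt_id
        (differentiableAt_const s)).mdifferentiableAt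
    have h1 : MDifferentiableAt 𝓘(ℝ, ℝ) 𝓘(ℝ, E) (fun t => F (t, s)) t :=
      MDifferentiableAt.comp t (hmd _ hts) hg
    exact (dchart_curveDeriv h1 hts.2).trans (hasDerivAt_fst_slice (hd _ hts)).deriv
  have hc2 : ∀ t s, (t, s) ∈ U' → dchart c (F (t, s)) (curveDeriv E (fun s => F (t, s)) s) =
      fderiv ℝ Y (t, s) (0, 1) := by
    intro t s hts
    have hg : MDifferentiableAt 𝓘(ℝ, ℝ) 𝓘(ℝ, ℝ × ℝ) (fun s : ℝ => (t, s)) s :=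
      (DifferentiableAt.prodMk (differentiableAt_const t)
        differentiableAt_id).mdifferentiableAt
    have h1 : MDifferentiableAt 𝓘(ℝ, ℝ) 𝓘(ℝ, E) (fun s => F (t, s)) s :=
      MDifferentiableAt.comp s (hmd _ hts) hg
    exact (dchart_curveDeriv h1 hts.2).trans (hasDerivAt_snd_slice (hd _ hts)).deriv
  have hGd : DifferentiableAt ℝ (chartMetric (E := E) c) (Y (t₀, 0)) :=
    contDiffOn_chartMetric.differentiableAt_of_isOpen (isOpen_extChartAt_target c) hy
  obtain ⟨B, hB1, hB2⟩ := exists_hasDerivAt_firstVariation (Y := Y) (G := chartMetric (E := E) c)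
    (t₀ := t₀) (Γ := christoffel c (Y (t₀, 0)) (fderiv ℝ Y (t₀, 0) (1, 0))
      (fderiv ℝ Y (t₀, 0) (1, 0)))
    ((hY.contDiffAt (hU'o.mem_nhds h0)).of_le (WithTop.coe_le_coe.2 le_top)) hGd
    (fun a b => chartMetric_symm c _ a b) (fun z => chartMetric_christoffel hy _ z)
  refine ⟨B, ?_, ?_⟩
  · have e1 : deriv (fun t => Y (t, 0)) t₀ = fderiv ℝ Y (t₀, 0) (1, 0) :=
      (hasDerivAt_fst_slice (hd _ h0)).deriv
    have e2 : deriv (fun s => Y (t₀, s)) 0 = fderiv ℝ Y (t₀, 0) (0, 1) :=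
      (hasDerivAt_snd_slice (hd _ h0)).deriv
    have e3 := deriv_deriv_fst_slice hU'o hY h0
    rw [geodesicResidual, e1, e2, e3]
    refine hB1.congr_of_eventuallyEq ?_
    have : ContinuousAt (fun t : ℝ => (t, (0 : ℝ))) t₀ := by fun_prop
    filter_upwards [this (hU'o.mem_nhds h0)] with t ht
    rw [inner_eq_chartMetric ht.2, hc1 t 0 ht, hc2 t 0 ht]
  · refine hB2.congr_of_eventuallyEq ?_
    have : ContinuousAt (fun s : ℝ => (t₀, s)) 0 := by fun_prop
    filter_upwards [this (hU'o.mem_nhds h0)] with s hs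
    rw [inner_eq_chartMetric hs.2, hc1 t₀ s hs]

/-- The geodesic equation does not depend on the chart. -/
theorem geodesicResidual_eq_zero_of_chart {γ : ℝ → M} {s : Set ℝ} (hs : IsOpen s)
    (hγ : ContMDiffOn 𝓘(ℝ, ℝ) 𝓘(ℝ, E) ∞ γ s) {t : ℝ} (ht : t ∈ s) {c c' : M}
    (hc : γ t ∈ (extChartAt 𝓘(ℝ, E) c).source) (hc' : γ t ∈ (extChartAt 𝓘(ℝ, E) c').source)
    (h : geodesicResidual c (fun t => extChartAt 𝓘(ℝ, E) c (γ t)) t = 0) :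
    geodesicResidual c' (fun t => extChartAt 𝓘(ℝ, E) c' (γ t)) t = 0 := by
  set y' : ℝ → E := fun t => extChartAt 𝓘(ℝ, E) c' (γ t) with hy'
  have hy't : y' t ∈ (extChartAt 𝓘(ℝ, E) c').target := (extChartAt 𝓘(ℝ, E) c').map_source hc'
  by_contra hne
  set z := geodesicResidual c' y' t with hz
  -- the variation of `γ` which has velocity `z` in the chart around `c'`
  set s' := s ∩ γ ⁻¹' (extChartAt 𝓘(ℝ, E) c').source with hs'
  have hs'o : IsOpen s' := hγ.isOpen_inter_preimage_chart hs c'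
  have hyc : ContDiffOn ℝ ∞ y' s' := hγ.contDiffOn_chart_comp c'
  set Y : ℝ × ℝ → E := fun x => y' x.1 + x.2 • z with hYdef
  have hYc : ContDiffOn ℝ ∞ Y (s' ×ˢ univ) :=
    (hyc.comp contDiffOn_fst fun x hx => hx.1).add (contDiffOn_snd.smul contDiffOn_const)
  set U := (s' ×ˢ univ) ∩ Y ⁻¹' (extChartAt 𝓘(ℝ, E) c').target with hU
  have hUo : IsOpen U := hYc.continuousOn.isOpen_inter_preimage (hs'o.prod isOpen_univ)
    (isOpen_extChartAt_target c')
  have hF := contMDiffOn_chart_symm_comp (c := c') (hYc.mono inter_subset_left : ContDiffOn ℝ ∞ Y U)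
    fun x hx => hx.2
  set F : ℝ × ℝ → M := fun x => (extChartAt 𝓘(ℝ, E) c').symm (Y x) with hFdef
  have hF0 : ∀ t ∈ s', F (t, 0) = γ t := by
    intro t ht
    simp only [hFdef, hYdef, zero_smul, add_zero]
    exact (extChartAt 𝓘(ℝ, E) c').left_inv ht.2
  have hts : t ∈ s' := ⟨ht, hc'⟩
  have h0 : (t, (0 : ℝ)) ∈ U := by
    refine ⟨⟨hts, mem_univ _⟩, ?_⟩
    simpa [hYdef] using hy't
  obtain ⟨B, hB1, hB2⟩ := exists_hasDerivAt_inner_curveDeriv hUo hF h0 (c := c)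
    (by rw [hF0 t hts]; exact hc)
  obtain ⟨B', hB1', hB2'⟩ := exists_hasDerivAt_inner_curveDeriv hUo hF h0 (c := c')
    (by rw [hF0 t hts]; exact hc')
  have hBB := hB2.unique hB2'
  subst hBB
  have hfin := hB1.unique hB1'
  have hev : ∀ᶠ t' in 𝓝 t, F (t', 0) = γ t' :=
    Filter.mem_of_superset (hs'o.mem_nhds hts) hF0
  have hres : ∀ k : M, geodesicResidual k (fun t => extChartAt 𝓘(ℝ, E) k (F (t, 0))) t =
      geodesicResidual k (fun t => extChartAt 𝓘(ℝ, E) k (γ t)) t := by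
    intro k
    have h1 : (fun t => extChartAt 𝓘(ℝ, E) k (F (t, 0))) =ᶠ[𝓝 t]
        fun t => extChartAt 𝓘(ℝ, E) k (γ t) := hev.mono fun t' ht' => by simp only [ht']
    rw [geodesicResidual, geodesicResidual, h1.deriv_eq, h1.deriv.deriv_eq, h1.eq_of_nhds]
  have hz' : deriv (fun s => extChartAt 𝓘(ℝ, E) c' (F (t, s))) 0 = z := by
    have h1 : (fun s => extChartAt 𝓘(ℝ, E) c' (F (t, s))) =ᶠ[𝓝 0] fun s => y' t + s • z := by
      have : ContinuousAt (fun s : ℝ => (t, s)) 0 := by fun_prop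
      filter_upwards [this (hUo.mem_nhds h0)] with s hs
      exact (extChartAt 𝓘(ℝ, E) c').right_inv hs.2
    rw [h1.deriv_eq]
    have := ((hasDerivAt_id (0 : ℝ)).smul_const z).const_add (y' t)
    simpa using this.deriv
  rw [hres, hres, h, hz', map_zero, zero_apply, hF0 t hts] at hfin
  have hpos := chartMetric_pos hy't hne
  simp only [zero_add] at hfin
  have : chartMetric c' (y' t) z z = 0 := by
    simp only [hy'] at *
    linarith
  exact hpos.ne' this

end FirstVariation

/-! ### Geodesics: coordinates, reparametrisation and uniqueness -/

section Geodesics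

set_option synthInstance.maxHeartbeats 200000
set_option linter.unusedSectionVars false

variable {E : Type*} [NormedAddCommGroup E] [NormedSpace ℝ E]
  {M : Type*} [TopologicalSpace M] [ChartedSpace E M]
  [RiemannianBundle (fun x : M => TangentSpace 𝓘(ℝ, E) x)]
  [IsManifold 𝓘(ℝ, E) ∞ M]

theorem covariantDeriv_curveDeriv {γ : ℝ → M} {s : Set ℝ} (hs : IsOpen s)
    (hγ : ContMDiffOn 𝓘(ℝ, ℝ) 𝓘(ℝ, E) ∞ γ s) {t : ℝ} (ht : t ∈ s) :
    covariantDeriv γ (fun t => (velocity E γ t).snd) t =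
      geodesicResidual (γ t) (fun r => extChartAt 𝓘(ℝ, E) (γ t) (γ r)) t := by
  have hsrc : γ t ∈ (extChartAt 𝓘(ℝ, E) (γ t)).source := mem_extChartAt_source _
  have hj : (fun r => dchart (γ t) (γ r) (curveDeriv E γ r)) =ᶠ[𝓝 t]
      deriv (fun r => extChartAt 𝓘(ℝ, E) (γ t) (γ r)) := by
    filter_upwards [(hγ.isOpen_inter_preimage_chart hs (γ t)).mem_nhds ⟨ht, hsrc⟩] with r hr
    exact dchart_curveDeriv (hγ.mdifferentiableAt_of_isOpen hs hr.1) hr.2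
  have : covariantDeriv γ (fun t => (velocity E γ t).snd) t =
      deriv (fun r => dchart (γ t) (γ r) (curveDeriv E γ r)) t +
      christoffel (γ t) (extChartAt 𝓘(ℝ, E) (γ t) (γ t))
        (deriv (fun r => extChartAt 𝓘(ℝ, E) (γ t) (γ r)) t)
        (dchart (γ t) (γ t) (curveDeriv E γ t)) := rfl
  rw [this, hj.deriv_eq, hj.eq_of_nhds]
  rfl

theorem geodesicResidual_congr {c : M} {y y' : ℝ → E} {t : ℝ} (h : y =ᶠ[𝓝 t] y') :
    geodesicResidual c y t = geodesicResidual c y' t := by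
  rw [geodesicResidual, geodesicResidual, h.deriv_eq, h.deriv.deriv_eq, h.eq_of_nhds]

theorem geodesicResidual_comp_affine (c : M) (y : ℝ → E) (r b t : ℝ) :
    geodesicResidual c (fun t => y (r * t + b)) t =
      (r * r) • geodesicResidual c y (r * t + b) := by
  have h : ∀ f : ℝ → E, deriv (fun t => f (r * t + b)) = fun t => r • deriv f (r * t + b) := by
    intro f
    funext t
    have h1 := deriv_comp_mul_left (𝕜 := ℝ) r (fun u => f (u + b)) t
    rw [deriv_comp_add_const] at h1
    exact h1
  rw [geodesicResidual, geodesicResidual, h y, christoffel_smul_smul]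
  have h2 : deriv (fun t => r • deriv y (r * t + b)) t =
      r • deriv (fun t => deriv y (r * t + b)) t := by
    have := deriv_const_smul_field (𝕜 := ℝ) (x := t) r (fun t => deriv y (r * t + b))
    exact this
  rw [h2, h (deriv y), smul_add, smul_smul]

/-- The geodesic vector field on the tangent bundle, in coordinates. -/
def spray (c : M) (z : E × E) : E × E := (z.2, -christoffel c z.1 z.2 z.2)

variable [FiniteDimensional ℝ E]
  [IsContMDiffRiemannianBundle 𝓘(ℝ, E) ∞ E (fun x : M => TangentSpace 𝓘(ℝ, E) x)]

theorem contDiffOn_spray (c : M) :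
    ContDiffOn ℝ ∞ (spray (E := E) c) ((extChartAt 𝓘(ℝ, E) c).target ×ˢ univ) :=
  contDiffOn_snd.prodMk contDiffOn_christoffel.neg

theorem IsGeodesicOn.geodesicResidual_eq_zero {γ : ℝ → M} {s : Set ℝ} (h : IsGeodesicOn E γ s)
    (hs : IsOpen s) {t : ℝ} (ht : t ∈ s) {c : M} (hc : γ t ∈ (extChartAt 𝓘(ℝ, E) c).source) :
    geodesicResidual c (fun t => extChartAt 𝓘(ℝ, E) c (γ t)) t = 0 := by
  refine geodesicResidual_eq_zero_of_chart hs h.1 ht (mem_extChartAt_source (γ t)) hc ?_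
  rw [← covariantDeriv_curveDeriv hs h.1 ht]
  exact h.2 t ht

theorem isGeodesicOn_of_geodesicResidual {γ : ℝ → M} {s : Set ℝ} (hs : IsOpen s)
    (hγ : ContMDiffOn 𝓘(ℝ, ℝ) 𝓘(ℝ, E) ∞ γ s)
    (h : ∀ t ∈ s, ∃ c, γ t ∈ (extChartAt 𝓘(ℝ, E) c).source ∧
      geodesicResidual c (fun t => extChartAt 𝓘(ℝ, E) c (γ t)) t = 0) : IsGeodesicOn E γ s := by
  refine ⟨hγ, fun t ht => ?_⟩
  obtain ⟨c, hc, h0⟩ := h t ht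
  rw [covariantDeriv_curveDeriv hs hγ ht]
  exact geodesicResidual_eq_zero_of_chart hs hγ ht hc (mem_extChartAt_source (γ t)) h0

theorem IsGeodesicOn.congr {γ γ' : ℝ → M} {s : Set ℝ} (h : IsGeodesicOn E γ s) (hs : IsOpen s)
    (heq : EqOn γ' γ s) : IsGeodesicOn E γ' s := by
  refine isGeodesicOn_of_geodesicResidual hs (h.1.congr heq) fun t ht => ⟨γ t, ?_, ?_⟩
  · rw [heq ht]
    exact mem_extChartAt_source _
  · rw [geodesicResidual_congr (y' := fun r => extChartAt 𝓘(ℝ, E) (γ t) (γ r))]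
    · exact h.geodesicResidual_eq_zero hs ht (mem_extChartAt_source _)
    · filter_upwards [hs.mem_nhds ht] with r hr
      rw [heq hr]

theorem IsGeodesicOn.union {γ : ℝ → M} {s s' : Set ℝ} (h : IsGeodesicOn E γ s)
    (h' : IsGeodesicOn E γ s') (hs : IsOpen s) (hs' : IsOpen s') : IsGeodesicOn E γ (s ∪ s') :=
  ⟨h.1.union_of_isOpen h'.1 hs hs', fun t ht => ht.elim (h.2 t) (h'.2 t)⟩

theorem IsGeodesicOn.mono {γ : ℝ → M} {s s' : Set ℝ} (h : IsGeodesicOn E γ s) (hs : s' ⊆ s) :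
    IsGeodesicOn E γ s' :=
  ⟨h.1.mono hs, fun t ht => h.2 t (hs ht)⟩

theorem IsGeodesicOn.mdifferentiableAt {γ : ℝ → M} {s : Set ℝ} (h : IsGeodesicOn E γ s)
    (hs : IsOpen s) {t : ℝ} (ht : t ∈ s) : MDifferentiableAt 𝓘(ℝ, ℝ) 𝓘(ℝ, E) γ t :=
  h.1.mdifferentiableAt_of_isOpen hs ht

theorem velocity_comp {γ γ' : ℝ → M} {g : ℝ → ℝ} {r t : ℝ}
    (h : MDifferentiableAt 𝓘(ℝ, ℝ) 𝓘(ℝ, E) γ (g t)) (hd : HasDerivAt g r t)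
    (hγ' : ∀ s, γ' s = γ (g s)) :
    velocity E γ' t = ⟨γ (g t), r • curveDeriv E γ (g t)⟩ := by
  obtain rfl : γ' = γ ∘ g := funext hγ'
  have h1 := mfderiv_comp (I := 𝓘(ℝ, ℝ)) (I' := 𝓘(ℝ, ℝ)) (I'' := 𝓘(ℝ, E))
    (f := g) (g := γ) t h hd.differentiableAt.mdifferentiableAt
  have h2 : mfderiv 𝓘(ℝ, ℝ) 𝓘(ℝ, ℝ) g t (1 : ℝ) = r * (1 : ℝ) := by
    rw [mfderiv_eq_fderiv]
    exact hd.deriv.trans (mul_one r).symm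
  have h3 := DFunLike.congr_fun h1 (1 : ℝ)
  have h4 : mfderiv 𝓘(ℝ, ℝ) 𝓘(ℝ, E) γ (g t) (r * (1 : ℝ) : ℝ) =
      r • mfderiv 𝓘(ℝ, ℝ) 𝓘(ℝ, E) γ (g t) (1 : ℝ) := map_smul _ r (1 : ℝ)
  refine congrArg (TotalSpace.mk' E (γ (g t))) ?_
  refine h3.trans ?_
  refine Eq.trans ?_ h4
  exact congrArg (mfderiv 𝓘(ℝ, ℝ) 𝓘(ℝ, E) γ (g t)) h2

theorem velocity_comp_affine {γ : ℝ → M} {r b t : ℝ}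
    (h : MDifferentiableAt 𝓘(ℝ, ℝ) 𝓘(ℝ, E) γ (r * t + b)) :
    velocity E (fun t => γ (r * t + b)) t =
      ⟨γ (r * t + b), r • curveDeriv E γ (r * t + b)⟩ := by
  have hd : HasDerivAt (fun t : ℝ => r * t + b) r t := by
    simpa using ((hasDerivAt_id t).const_mul r).add_const b
  exact velocity_comp (g := fun t => r * t + b) h hd fun s => rfl

theorem IsGeodesicOn.comp_affine {γ : ℝ → M} {s : Set ℝ} (h : IsGeodesicOn E γ s) (hs : IsOpen s)
    (r b : ℝ) : IsGeodesicOn E (fun t => γ (r * t + b)) ((fun t => r * t + b) ⁻¹' s) := by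
  have hc : ContDiff ℝ ∞ fun t : ℝ => r * t + b := (contDiff_const.mul contDiff_id).add contDiff_const
  refine isGeodesicOn_of_geodesicResidual (hs.preimage hc.continuous)
    (h.1.comp hc.contMDiff.contMDiffOn fun t ht => ht) fun t ht => ⟨γ (r * t + b), ?_, ?_⟩
  · exact mem_extChartAt_source _
  · rw [geodesicResidual_comp_affine _ (fun u => extChartAt 𝓘(ℝ, E) (γ (r * t + b)) (γ u)),
      h.geodesicResidual_eq_zero hs ht (mem_extChartAt_source _), smul_zero]

/-- In coordinates, the velocity of a geodesic is an integral curve of the geodesic field. -/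
theorem IsGeodesicOn.hasDerivAt_tcoord {γ : ℝ → M} {s : Set ℝ} (h : IsGeodesicOn E γ s)
    (hs : IsOpen s) {t : ℝ} (ht : t ∈ s) {c : M} (hc : γ t ∈ (extChartAt 𝓘(ℝ, E) c).source) :
    HasDerivAt (fun t => tcoord c (velocity E γ t)) (spray c (tcoord c (velocity E γ t))) t := by
  have ho := h.1.isOpen_inter_preimage_chart hs c
  have hy := h.1.contDiffOn_chart_comp c
  set y : ℝ → E := fun t => extChartAt 𝓘(ℝ, E) c (γ t)
  have h1 : (fun t => tcoord c (velocity E γ t)) =ᶠ[𝓝 t] fun t => (y t, deriv y t) := by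
    filter_upwards [ho.mem_nhds ⟨ht, hc⟩] with r hr
    exact tcoord_velocity (h.mdifferentiableAt hs hr.1) hr.2
  rw [h1.hasDerivAt_iff, h1.eq_of_nhds]
  have hy1 : HasDerivAt y (deriv y t) t :=
    (hy.differentiableAt_of_isOpen ho ⟨ht, hc⟩).hasDerivAt
  have hy2 : HasDerivAt (deriv y) (deriv (deriv y) t) t := by
    have : ContDiffOn ℝ ∞ (deriv y) _ := hy.deriv_of_isOpen ho (m := ∞) (by simp)
    exact (this.differentiableAt_of_isOpen ho ⟨ht, hc⟩).hasDerivAt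
  have h0 := h.geodesicResidual_eq_zero hs ht hc
  have h2 : deriv (deriv y) t = -christoffel c (y t) (deriv y t) (deriv y t) :=
    eq_neg_of_add_eq_zero_left h0
  rw [h2] at hy2
  exact hy1.prodMk hy2

theorem isGeodesicOn_of_hasDerivAt_spray {ψ : ℝ → E × E} {s : Set ℝ} {c : M} (hs : IsOpen s)
    (hψ : ContDiffOn ℝ ∞ ψ s) (h : ∀ t ∈ s, (ψ t).1 ∈ (extChartAt 𝓘(ℝ, E) c).target ∧
      HasDerivAt ψ (spray c (ψ t)) t) :
    IsGeodesicOn E (fun t => (extChartAt 𝓘(ℝ, E) c).symm (ψ t).1) s ∧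
      ∀ t ∈ s, tcoord c (velocity E (fun t => (extChartAt 𝓘(ℝ, E) c).symm (ψ t).1) t) = ψ t := by
  set γ : ℝ → M := fun t => (extChartAt 𝓘(ℝ, E) c).symm (ψ t).1 with hγdef
  have hγ : ContMDiffOn 𝓘(ℝ, ℝ) 𝓘(ℝ, E) ∞ γ s :=
    contMDiffOn_chart_symm_comp (contDiff_fst.comp_contDiffOn hψ) fun t ht => (h t ht).1
  have hsrc : ∀ t ∈ s, γ t ∈ (extChartAt 𝓘(ℝ, E) c).source :=
    fun t ht => (extChartAt 𝓘(ℝ, E) c).map_target (h t ht).1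
  have hd1 : ∀ t ∈ s, HasDerivAt (fun t => (ψ t).1) (ψ t).2 t := fun t ht =>
    HasFDerivAt.comp_hasDerivAt (l := Prod.fst) (f := ψ) t hasFDerivAt_fst (h t ht).2
  have hd2 : ∀ t ∈ s, HasDerivAt (fun t => (ψ t).2)
      (-christoffel c (ψ t).1 (ψ t).2 (ψ t).2) t := fun t ht =>
    HasFDerivAt.comp_hasDerivAt (l := Prod.snd) (f := ψ) t hasFDerivAt_snd (h t ht).2
  have hy : ∀ t ∈ s, (fun r => extChartAt 𝓘(ℝ, E) c (γ r)) =ᶠ[𝓝 t] fun r => (ψ r).1 := by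
    intro t ht
    filter_upwards [hs.mem_nhds ht] with r hr
    exact (extChartAt 𝓘(ℝ, E) c).right_inv (h r hr).1
  have hdy : ∀ t ∈ s, deriv (fun r => extChartAt 𝓘(ℝ, E) c (γ r)) t = (ψ t).2 := fun t ht => by
    rw [(hy t ht).deriv_eq, (hd1 t ht).deriv]
  constructor
  · refine isGeodesicOn_of_geodesicResidual hs hγ fun t ht => ⟨c, hsrc t ht, ?_⟩
    have h2 : deriv (fun r => extChartAt 𝓘(ℝ, E) c (γ r)) =ᶠ[𝓝 t] fun r => (ψ r).2 := by
      filter_upwards [hs.mem_nhds ht] with r hr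
      exact hdy r hr
    rw [geodesicResidual, h2.deriv_eq, (hd2 t ht).deriv, hdy t ht, (hy t ht).eq_of_nhds]
    simp
  · intro t ht
    rw [tcoord_velocity (hγ.mdifferentiableAt_of_isOpen hs ht) (hsrc t ht), hdy t ht]
    exact Prod.ext (hy t ht).eq_of_nhds rfl

theorem IsGeodesicOn.eventuallyEq {γ γ' : ℝ → M} {s : Set ℝ} (h : IsGeodesicOn E γ s)
    (h' : IsGeodesicOn E γ' s) (hs : IsOpen s) {t : ℝ} (ht : t ∈ s) {c : M}
    (hc : γ t ∈ (extChartAt 𝓘(ℝ, E) c).source) (hc' : γ' t ∈ (extChartAt 𝓘(ℝ, E) c).source)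
    (heq : tcoord c (velocity E γ t) = tcoord c (velocity E γ' t)) : γ =ᶠ[𝓝 t] γ' := by
  have hz : tcoord c (velocity E γ t) ∈ (extChartAt 𝓘(ℝ, E) c).target ×ˢ (univ : Set E) := by
    rw [tcoord_velocity (h.mdifferentiableAt hs ht) hc]
    exact ⟨(extChartAt 𝓘(ℝ, E) c).map_source hc, mem_univ _⟩
  have hX : ContDiffAt ℝ 1 (spray (E := E) c) (tcoord c (velocity E γ t)) :=
    ((contDiffOn_spray c).contDiffAt
      (((isOpen_extChartAt_target c).prod isOpen_univ).mem_nhds hz)).of_le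
        (WithTop.coe_le_coe.2 le_top)
  obtain ⟨K, S, hS, hL⟩ := hX.exists_lipschitzOnWith
  have key : ∀ {γ : ℝ → M}, IsGeodesicOn E γ s → γ t ∈ (extChartAt 𝓘(ℝ, E) c).source →
      S ∈ 𝓝 (tcoord c (velocity E γ t)) → ∀ᶠ r in 𝓝 t,
      (HasDerivAt (fun r => tcoord c (velocity E γ r)) (spray c (tcoord c (velocity E γ r))) r ∧
        tcoord c (velocity E γ r) ∈ S) ∧ γ r ∈ (extChartAt 𝓘(ℝ, E) c).source := by
    intro γ h hc hS
    filter_upwards [(h.1.isOpen_inter_preimage_chart hs c).mem_nhds ⟨ht, hc⟩,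
      (h.hasDerivAt_tcoord hs ht hc).continuousAt hS] with r hr hr'
    exact ⟨⟨h.hasDerivAt_tcoord hs hr.1 hr.2, hr'⟩, hr.2⟩
  have k1 := key h hc hS
  have k2 := key h' hc' (heq ▸ hS)
  have := ODE_solution_unique_of_eventually (v := fun _ => spray c) (s := fun _ => S) (K := K)
    (.of_forall fun _ => hL) (k1.mono fun r hr => hr.1) (k2.mono fun r hr => hr.1) heq
  filter_upwards [this, k1, k2] with r hr hr1 hr2
  have h1 : tcoord c (velocity E γ r) = tcoord c (velocity E γ' r) := hr
  have h2 := (tcoord c).injOn (mem_tcoord_source.2 hr1.2) (mem_tcoord_source.2 hr2.2) h1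
  exact congrArg TotalSpace.proj h2

/-- Geodesics are determined by their velocity at one time. -/
theorem IsGeodesicOn.eqOn [T2Space M] {γ γ' : ℝ → M} {s : Set ℝ} (h : IsGeodesicOn E γ s)
    (h' : IsGeodesicOn E γ' s) (hs : IsOpen s) (hsc : IsPreconnected s) {t : ℝ} (ht : t ∈ s)
    (heq : velocity E γ t = velocity E γ' t) : EqOn γ γ' s := by
  have hsub : s ⊆ {r | γ =ᶠ[𝓝 r] γ'} := by
    refine hsc.subset_of_closure_inter_subset isOpen_setOfPred_eventually_nhds ⟨t, ht, ?_⟩ ?_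
    · have hp : γ t = γ' t := congrArg TotalSpace.proj heq
      exact h.eventuallyEq h' hs ht (mem_extChartAt_source (γ t))
        (by rw [← hp]; exact mem_extChartAt_source (γ t)) (by rw [heq])
    · rintro r ⟨hr, hrs⟩
      have hf : ∃ᶠ r' in 𝓝 r, γ =ᶠ[𝓝 r'] γ' := mem_closure_iff_frequently.1 hr
      have hc1 : ContinuousAt γ r := (h.1.continuousOn).continuousAt (hs.mem_nhds hrs)
      have hc2 : ContinuousAt γ' r := (h'.1.continuousOn).continuousAt (hs.mem_nhds hrs)
      have hp : γ r = γ' r := by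
        by_contra hne
        have : ∀ᶠ r' in 𝓝 r, (γ r', γ' r') ∈ {p : M × M | p.1 ≠ p.2} :=
          (hc1.prodMk hc2).eventually (isClosed_diagonal.isOpen_compl.mem_nhds hne)
        obtain ⟨r', h1, h2⟩ := (hf.and_eventually this).exists
        exact h2 h1.eq_of_nhds
      have hsrc : γ r ∈ (extChartAt 𝓘(ℝ, E) (γ r)).source := mem_extChartAt_source _
      have hsrc' : γ' r ∈ (extChartAt 𝓘(ℝ, E) (γ r)).source := by rw [← hp]; exact hsrc
      refine h.eventuallyEq h' hs hrs hsrc hsrc' ?_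
      by_contra hne
      have hd1 := (h.hasDerivAt_tcoord hs hrs hsrc).continuousAt
      have hd2 := (h'.hasDerivAt_tcoord hs hrs hsrc').continuousAt
      have := (hd1.prodMk hd2).eventually
        (isClosed_diagonal.isOpen_compl.mem_nhds hne : (diagonal (E × E))ᶜ ∈ _)
      obtain ⟨r', h1, h2⟩ := (hf.and_eventually this).exists
      refine h2 ?_
      have hv : velocity E γ r' = velocity E γ' r' := by
        rw [velocity, velocity, h1.mfderiv_eq, h1.eq_of_nhds]
      show tcoord _ _ = tcoord _ _
      rw [hv]
  exact fun r hr => (hsub hr : γ =ᶠ[𝓝 r] γ').eq_of_nhds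

end Geodesics

/-! ### The geodesic flow -/

section GeodesicFlow

set_option synthInstance.maxHeartbeats 200000
set_option linter.unusedSectionVars false

variable {E : Type*} [NormedAddCommGroup E] [NormedSpace ℝ E]
  {M : Type*} [TopologicalSpace M] [ChartedSpace E M]
  [RiemannianBundle (fun x : M => TangentSpace 𝓘(ℝ, E) x)]
  [IsManifold 𝓘(ℝ, E) ∞ M]

/-- `F` is a smooth family of geodesics on `(a, b)`, parametrised by the coordinates `z ∈ N` (in the
chart around `c`) of their velocities at time `0`. -/
structure IsGeodesicFlow (c : M) (F : ℝ × (E × E) → M) (a b : ℝ) (N : Set (E × E)) : Prop where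
  contMDiffOn : ContMDiffOn 𝓘(ℝ, ℝ × (E × E)) 𝓘(ℝ, E) ∞ F (Ioo a b ×ˢ N)
  isGeodesicOn : ∀ z ∈ N, IsGeodesicOn E (fun t => F (t, z)) (Ioo a b)
  velocity_zero : ∀ z ∈ N, velocity E (fun t => F (t, z)) 0 = (tcoord c).symm z

variable [FiniteDimensional ℝ E]
  [IsContMDiffRiemannianBundle 𝓘(ℝ, E) ∞ E (fun x : M => TangentSpace 𝓘(ℝ, E) x)]

theorem IsGeodesicFlow.mono {c : M} {F : ℝ × (E × E) → M} {a b a' b' : ℝ} {N N' : Set (E × E)}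
    (h : IsGeodesicFlow c F a b N) (ha : a ≤ a') (hb : b' ≤ b) (hN : N' ⊆ N) :
    IsGeodesicFlow c F a' b' N' :=
  ⟨h.1.mono (prod_mono (Ioo_subset_Ioo ha hb) hN),
    fun z hz => (h.2 z (hN hz)).mono (Ioo_subset_Ioo ha hb), fun z hz => h.3 z (hN hz)⟩

theorem exists_local_geodesicFlow {c : M} {z₀ : E × E}
    (hz₀ : z₀.1 ∈ (extChartAt 𝓘(ℝ, E) c).target) :
    ∃ ε > 0, ∃ V, IsOpen V ∧ z₀ ∈ V ∧ (∀ z ∈ V, z.1 ∈ (extChartAt 𝓘(ℝ, E) c).target) ∧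
      ∃ F : ℝ × (E × E) → M, IsGeodesicFlow c F (-ε) ε V := by
  have hU : IsOpen ((extChartAt 𝓘(ℝ, E) c).target ×ˢ (univ : Set E)) :=
    (isOpen_extChartAt_target c).prod isOpen_univ
  obtain ⟨ε, hε, V, hV, hzV, φ, hφ, h⟩ := exists_contDiffOn_flow_of_isOpen hU
    (contDiffOn_spray c) (z₀ := z₀) ⟨hz₀, mem_univ _⟩
  have hVt : ∀ z ∈ V, z.1 ∈ (extChartAt 𝓘(ℝ, E) c).target := by
    intro z hz
    have := ((h z hz).2 0 ⟨neg_lt_zero.2 hε, hε⟩).1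
    rw [(h z hz).1] at this
    exact this.1
  refine ⟨ε, hε, V, hV, hzV, hVt, fun x => (extChartAt 𝓘(ℝ, E) c).symm (φ x).1, ?_, ?_, ?_⟩
  · exact contMDiffOn_chart_symm_comp (contDiff_fst.comp_contDiffOn hφ)
      fun x hx => ((h x.2 hx.2).2 x.1 hx.1).1.1
  all_goals
    intro z hz
    have hs := isGeodesicOn_of_hasDerivAt_spray (ψ := fun t => φ (t, z)) (c := c) isOpen_Ioo
      (hφ.comp (contDiff_id.prodMk contDiff_const).contDiffOn fun t ht => ⟨ht, hz⟩)
      fun t ht => ⟨((h z hz).2 t ht).1.1, ((h z hz).2 t ht).2⟩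
  · exact hs.1
  · have hz0 := (h z hz).1
    have h0 : tcoord c (velocity E (fun t => (extChartAt 𝓘(ℝ, E) c).symm (φ (t, z)).1) 0) = z :=
      (hs.2 0 ⟨neg_lt_zero.2 hε, hε⟩).trans hz0
    have hsrc : velocity E (fun t => (extChartAt 𝓘(ℝ, E) c).symm (φ (t, z)).1) 0 ∈
        (tcoord c).source := by
      rw [mem_tcoord_source]
      refine (extChartAt 𝓘(ℝ, E) c).map_target ?_
      rw [hz0]
      exact hVt z hz
    have := (tcoord c).left_inv hsrc
    rw [h0] at this
    exact this.symm

variable [T2Space M]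

/-- A smooth family of geodesics is prolonged by the local flow around a later velocity. -/
theorem IsGeodesicFlow.extend {c c' : M} {F F₁ : ℝ × (E × E) → M} {a b T ε : ℝ}
    {N V : Set (E × E)} (h : IsGeodesicFlow c F a b N) (h₁ : IsGeodesicFlow c' F₁ (-ε) ε V)
    (hN : IsOpen N) (hV : IsOpen V) (h0 : (0 : ℝ) ∈ Ioo a b) (hT : T ∈ Ioo a b) (hT0 : 0 ≤ T)
    (hε : 0 < ε) {z₀ : E × E} (hz₀ : z₀ ∈ N)
    (hsrc : F (T, z₀) ∈ (extChartAt 𝓘(ℝ, E) c').source)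
    (hvel : tcoord c' (velocity E (fun t => F (t, z₀)) T) ∈ V) :
    ∃ N' F', IsOpen N' ∧ z₀ ∈ N' ∧ N' ⊆ N ∧ IsGeodesicFlow c F' a (T + ε) N' := by
  classical
  have hIo : IsOpen (Ioo a b ×ˢ N) := isOpen_Ioo.prod hN
  -- the velocity at time `T`, in the chart around `c'`, depends smoothly on the parameter
  set Y : ℝ × (E × E) → E := fun x => extChartAt 𝓘(ℝ, E) c' (F x) with hY
  set D := (Ioo a b ×ˢ N) ∩ F ⁻¹' (extChartAt 𝓘(ℝ, E) c').source with hD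
  have hDo : IsOpen D := h.1.isOpen_inter_preimage_chart hIo c'
  have hYc : ContDiffOn ℝ ∞ Y D := h.1.contDiffOn_chart_comp c'
  set G : E × E → E × E := fun z => (Y (T, z), fderiv ℝ Y (T, z) (1, 0)) with hG
  set N₁ := (fun z : E × E => (T, z)) ⁻¹' D with hN₁
  have hN₁o : IsOpen N₁ := hDo.preimage (by fun_prop)
  have hmk : ContDiff ℝ ∞ (fun z : E × E => (T, z)) := contDiff_const.prodMk contDiff_id
  have hGc : ContDiffOn ℝ ∞ G N₁ :=
    (hYc.comp hmk.contDiffOn fun z hz => hz).prodMk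
      (((hYc.fderiv_of_isOpen hDo (m := ∞) (by simp)).comp hmk.contDiffOn fun z hz => hz).clm_apply
        contDiffOn_const)
  have hGv : ∀ z ∈ N₁, tcoord c' (velocity E (fun t => F (t, z)) T) = G z := by
    intro z hz
    rw [tcoord_velocity ((h.2 z hz.1.2).mdifferentiableAt isOpen_Ioo hz.1.1) hz.2]
    exact Prod.ext rfl (hasDerivAt_fst_slice (hYc.differentiableAt_of_isOpen hDo hz)).deriv
  have hz₀1 : z₀ ∈ N₁ := ⟨⟨hT, hz₀⟩, hsrc⟩
  set N' := N₁ ∩ G ⁻¹' V with hN'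
  have hN'o : IsOpen N' := hGc.continuousOn.isOpen_inter_preimage hN₁o hV
  have hN'N : N' ⊆ N := fun z hz => hz.1.1.2
  -- the prolongation
  set F₂ : ℝ × (E × E) → M := fun x => F₁ (x.1 - T, G x.2) with hF₂
  have hF₂c : ContMDiffOn 𝓘(ℝ, ℝ × (E × E)) 𝓘(ℝ, E) ∞ F₂ (Ioo (T - ε) (T + ε) ×ˢ N') := by
    have hg : ContDiffOn ℝ ∞ (fun x : ℝ × (E × E) => (x.1 - T, G x.2))
        (Ioo (T - ε) (T + ε) ×ˢ N') :=
      (contDiffOn_fst.sub contDiffOn_const).prodMk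
        (hGc.comp contDiffOn_snd fun x hx => hx.2.1)
    refine h₁.1.comp hg.contMDiffOn fun x hx => ⟨⟨?_, ?_⟩, hx.2.2⟩ <;>
      linarith [hx.1.1, hx.1.2]
  have hF₂g : ∀ z ∈ N', IsGeodesicOn E (fun t => F₂ (t, z)) (Ioo (T - ε) (T + ε)) := by
    intro z hz
    have := (h₁.2 (G z) hz.2).comp_affine isOpen_Ioo 1 (-T)
    have h2 : (fun t => F₂ (t, z)) = fun t => F₁ (1 * t + -T, G z) := by
      funext t
      simp only [hF₂]
      congr 2
      ring
    rw [h2]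
    refine this.mono fun t ht => ⟨?_, ?_⟩ <;> linarith [ht.1, ht.2]
  have hF₂v : ∀ z ∈ N', velocity E (fun t => F₂ (t, z)) T = velocity E (fun t => F (t, z)) T := by
    intro z hz
    have h2 : (fun t => F₂ (t, z)) = fun t => F₁ (1 * t + -T, G z) := by
      funext t
      simp only [hF₂]
      congr 2
      ring
    have h3 : (1 : ℝ) * T + -T = 0 := by ring
    have hm : MDifferentiableAt 𝓘(ℝ, ℝ) 𝓘(ℝ, E) (fun t => F₁ (t, G z)) (1 * T + -T) := by
      rw [h3]
      exact (h₁.2 (G z) hz.2).mdifferentiableAt isOpen_Ioo ⟨neg_lt_zero.2 hε, hε⟩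
    rw [h2, velocity_comp_affine (γ := fun t => F₁ (t, G z)) hm, one_smul, h3]
    have h4 : (⟨F₁ (0, G z), curveDeriv E (fun t => F₁ (t, G z)) 0⟩ : TangentBundle 𝓘(ℝ, E) M) =
      velocity E (fun t => F₁ (t, G z)) 0 := rfl
    rw [h4, h₁.3 (G z) hz.2, ← hGv z hz.1]
    exact (tcoord c').left_inv (mem_tcoord_source.2 hz.1.2)
  have hTε : T ∈ Ioo (T - ε) (T + ε) := ⟨by linarith, by linarith⟩
  have heq : ∀ z ∈ N', ∀ t ∈ Ioo a b ∩ Ioo (T - ε) (T + ε), F₂ (t, z) = F (t, z) := by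
    intro z hz
    have ho : IsOpen (Ioo a b ∩ Ioo (T - ε) (T + ε)) := isOpen_Ioo.inter isOpen_Ioo
    refine IsGeodesicOn.eqOn ((hF₂g z hz).mono inter_subset_right)
      ((h.2 z (hN'N hz)).mono inter_subset_left) ho ?_ ⟨hT, hTε⟩ (hF₂v z hz)
    rw [Ioo_inter_Ioo]
    exact isPreconnected_Ioo
  set F' : ℝ × (E × E) → M := fun x => if x.1 ≤ T then F x else F₂ x with hF'
  set b' := min b (T + ε) with hb'
  have hTb' : T < b' := lt_min hT.2 hTε.2
  set a' := max a (T - ε) with ha'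
  have haT : a' < T := max_lt hT.1 hTε.1
  have e1 : EqOn F' F (Ioo a b' ×ˢ N') := by
    rintro ⟨t, z⟩ ⟨ht, hz⟩
    simp only [hF']
    split_ifs with hle
    · rfl
    · push Not at hle
      exact heq z hz t ⟨⟨ht.1, ht.2.trans_le (min_le_left _ _)⟩, hTε.1.trans hle,
        ht.2.trans_le (min_le_right _ _)⟩
  have e2 : EqOn F' F₂ (Ioo a' (T + ε) ×ˢ N') := by
    rintro ⟨t, z⟩ ⟨ht, hz⟩
    simp only [hF']
    split_ifs with hle
    · exact (heq z hz t ⟨⟨(le_max_left _ _).trans_lt ht.1, lt_of_le_of_lt hle hT.2⟩,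
        (le_max_right _ _).trans_lt ht.1, ht.2⟩).symm
    · rfl
  have hcov : Ioo a b' ∪ Ioo a' (T + ε) = Ioo a (T + ε) := by
    ext t
    constructor
    · rintro (ht | ht)
      · exact ⟨ht.1, ht.2.trans_le (min_le_right _ _)⟩
      · exact ⟨(le_max_left _ _).trans_lt ht.1, ht.2⟩
    · intro ht
      by_cases h1 : t < b'
      · exact Or.inl ⟨ht.1, h1⟩
      · exact Or.inr ⟨by linarith, ht.2⟩
  refine ⟨N', F', hN'o, ⟨hz₀1, ?_⟩, hN'N, ?_, ?_, ?_⟩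
  · show G z₀ ∈ V
    rw [← hGv z₀ hz₀1]
    exact hvel
  · rw [← hcov, union_prod]
    refine ContMDiffOn.union_of_isOpen ?_ ?_ (isOpen_Ioo.prod hN'o) (isOpen_Ioo.prod hN'o)
    · exact (h.1.mono (prod_mono (Ioo_subset_Ioo le_rfl (min_le_left _ _)) hN'N)).congr e1
    · exact (hF₂c.mono (prod_mono (Ioo_subset_Ioo (le_max_right _ _) le_rfl) le_rfl)).congr e2
  · intro z hz
    rw [← hcov]
    refine IsGeodesicOn.union ?_ ?_ isOpen_Ioo isOpen_Ioo
    · exact ((h.2 z (hN'N hz)).mono (Ioo_subset_Ioo le_rfl (min_le_left _ _))).congr isOpen_Ioo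
        fun t ht => e1 ⟨ht, hz⟩
    · exact ((hF₂g z hz).mono (Ioo_subset_Ioo (le_max_right _ _) le_rfl)).congr isOpen_Ioo
        fun t ht => e2 ⟨ht, hz⟩
  · intro z hz
    rw [← h.3 z (hN'N hz)]
    have h0' : (0 : ℝ) ∈ Ioo a b' := ⟨h0.1, lt_of_le_of_lt hT0 hTb'⟩
    have h1 : (fun t => F' (t, z)) =ᶠ[𝓝 0] fun t => F (t, z) := by
      filter_upwards [isOpen_Ioo.mem_nhds h0'] with t ht
      exact e1 ⟨ht, hz⟩
    rw [velocity, velocity, h1.mfderiv_eq, h1.eq_of_nhds]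

theorem velocity_congr {γ γ' : ℝ → M} {t : ℝ} (h : γ =ᶠ[𝓝 t] γ') :
    velocity E γ t = velocity E γ' t := by
  rw [velocity, velocity, h.mfderiv_eq, h.eq_of_nhds]

/-- Near a geodesic defined on `[0, 1]` the geodesic flow is defined and smooth up to time `1`. -/
theorem exists_geodesicFlow {γ : ℝ → M} {ε : ℝ} (hε : 0 < ε)
    (hγ : IsGeodesicOn E γ (Ioo (-ε) (1 + ε))) {c : M}
    (hc : γ 0 ∈ (extChartAt 𝓘(ℝ, E) c).source) :
    ∃ δ > 0, ∃ N, IsOpen N ∧ tcoord c (velocity E γ 0) ∈ N ∧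
      (∀ z ∈ N, z.1 ∈ (extChartAt 𝓘(ℝ, E) c).target) ∧
      ∃ F : ℝ × (E × E) → M, IsGeodesicFlow c F (-δ) (1 + δ) N := by
  set z₀ := tcoord c (velocity E γ 0) with hz₀
  have h0I : (0 : ℝ) ∈ Ioo (-ε) (1 + ε) := ⟨by linarith, by linarith⟩
  have hsrc0 : velocity E γ 0 ∈ (tcoord c).source := mem_tcoord_source.2 hc
  -- `P T`: the flow near `γ` is smooth on a time interval that contains `[0, T]`. Restarting the
  -- flow at a nearby time shows that `P` is locally constant on `[0, 1]`, which is connected.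
  let P : ℝ → Prop := fun T => ∃ a b N, a < 0 ∧ T < b ∧ IsOpen N ∧ z₀ ∈ N ∧
      (∀ z ∈ N, z.1 ∈ (extChartAt 𝓘(ℝ, E) c).target) ∧
      ∃ F : ℝ × (E × E) → M, IsGeodesicFlow c F a b N
  have hP0 : P 0 := by
    obtain ⟨η, hη, V, hV, hzV, hVt, F, hF⟩ := exists_local_geodesicFlow (c := c) (z₀ := z₀)
      (mem_tcoord_target.1 ((tcoord c).map_source hsrc0))
    exact ⟨-η, η, V, neg_lt_zero.2 hη, hη, hV, hzV, hVt, F, hF⟩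
  have hstep : ∀ T ∈ Icc (0 : ℝ) 1, ∀ᶠ T' in 𝓝[Icc (0 : ℝ) 1] T, (P T → P T') ∧ (P T' → P T) := by
    intro T hT
    have hTI : T ∈ Ioo (-ε) (1 + ε) := ⟨by linarith [hT.1], by linarith [hT.2]⟩
    have hsT : γ T ∈ (extChartAt 𝓘(ℝ, E) (γ T)).source := mem_extChartAt_source _
    obtain ⟨η, hη, V, hV, hzV, hVt, F₁, hF₁⟩ := exists_local_geodesicFlow (c := γ T)
      (z₀ := tcoord (γ T) (velocity E γ T))
      (mem_tcoord_target.1 ((tcoord (γ T)).map_source (mem_tcoord_source.2 hsT)))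
    have hgood : ∀ T₁, |T₁ - T| < η / 2 → T₁ ∈ Icc (0 : ℝ) 1 → T₁ ∈ Ioo (-ε) (1 + ε) →
        γ T₁ ∈ (extChartAt 𝓘(ℝ, E) (γ T)).source → tcoord (γ T) (velocity E γ T₁) ∈ V →
        ∀ T₂, |T₂ - T| < η / 2 → P T₁ → P T₂ := by
      rintro T₁ hT₁ h01 hT₁I hs₁ hv₁ T₂ hT₂ ⟨a, b, N, ha, hb, hN, hzN, hNt, F, hF⟩
      have h0ab : (0 : ℝ) ∈ Ioo a b := ⟨ha, lt_of_le_of_lt h01.1 hb⟩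
      have hT₁ab : T₁ ∈ Ioo a b := ⟨lt_of_lt_of_le ha h01.1, hb⟩
      have ho : IsOpen (Ioo a b ∩ Ioo (-ε) (1 + ε)) := isOpen_Ioo.inter isOpen_Ioo
      have heq : EqOn (fun t => F (t, z₀)) γ (Ioo a b ∩ Ioo (-ε) (1 + ε)) := by
        refine ((hF.2 z₀ hzN).mono inter_subset_left).eqOn (hγ.mono inter_subset_right) ho ?_
          (t := 0) ⟨h0ab, h0I⟩ ?_
        · rw [Ioo_inter_Ioo]
          exact isPreconnected_Ioo
        · rw [hF.3 z₀ hzN]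
          exact (tcoord c).left_inv hsrc0
      have hvT : velocity E (fun t => F (t, z₀)) T₁ = velocity E γ T₁ :=
        velocity_congr (Filter.mem_of_superset (ho.mem_nhds ⟨hT₁ab, hT₁I⟩) heq)
      obtain ⟨N', F', hN', hzN', hN'N, hF'⟩ := hF.extend hF₁ hN hV h0ab hT₁ab h01.1 hη hzN
        (by
          have := heq ⟨hT₁ab, hT₁I⟩
          simp only at this
          rw [this]
          exact hs₁) (by rw [hvT]; exact hv₁)
      refine ⟨a, T₁ + η, N', ha, ?_, hN', hzN', fun z hz => hNt z (hN'N hz), F', hF'⟩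
      rw [abs_lt] at hT₁ hT₂
      linarith [hT₁.1, hT₂.2]
    have hT0 : |T - T| < η / 2 := by simpa using hη
    have e1 : ∀ᶠ T' in 𝓝[Icc (0 : ℝ) 1] T, |T' - T| < η / 2 := by
      refine nhdsWithin_le_nhds ?_
      have := Metric.ball_mem_nhds T (half_pos hη)
      filter_upwards [this] with r hr
      rwa [Metric.mem_ball, Real.dist_eq] at hr
    have e2 : ∀ᶠ T' in 𝓝[Icc (0 : ℝ) 1] T, γ T' ∈ (extChartAt 𝓘(ℝ, E) (γ T)).source :=
      nhdsWithin_le_nhds ((hγ.1.continuousOn.continuousAt (isOpen_Ioo.mem_nhds hTI))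
        ((isOpen_extChartAt_source (γ T)).mem_nhds hsT))
    have e3 : ∀ᶠ T' in 𝓝[Icc (0 : ℝ) 1] T, tcoord (γ T) (velocity E γ T') ∈ V :=
      nhdsWithin_le_nhds ((hγ.hasDerivAt_tcoord isOpen_Ioo hTI hsT).continuousAt
        (hV.mem_nhds hzV))
    filter_upwards [e1, e2, e3, self_mem_nhdsWithin] with T' h1 h2 h3 h4
    have hT'I : T' ∈ Ioo (-ε) (1 + ε) := ⟨by linarith [h4.1], by linarith [h4.2]⟩
    exact ⟨hgood T hT0 hT hTI hsT hzV T' h1, hgood T' h1 h4 hT'I h2 h3 T hT0⟩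
  have hP1 : P 1 := isPreconnected_Icc.induction₂' (fun x y => P x → P y) hstep
    (fun x y z _ _ _ hxy hyz hx => hyz (hxy hx)) (left_mem_Icc.2 zero_le_one)
    (right_mem_Icc.2 zero_le_one) hP0
  obtain ⟨a, b, N, ha, hb, hN, hzN, hNt, F, hF⟩ := hP1
  refine ⟨min (-a) (b - 1), lt_min (by linarith) (by linarith), N, hN, hzN, hNt, F,
    hF.mono ?_ ?_ le_rfl⟩
  · linarith [min_le_left (-a) (b - 1)]
  · linarith [min_le_right (-a) (b - 1)]

end GeodesicFlow

/-! ### The exponential map in coordinates -/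

section ExpChart

set_option synthInstance.maxHeartbeats 200000
set_option linter.unusedSectionVars false

variable {E : Type*} [NormedAddCommGroup E] [NormedSpace ℝ E]
  {M : Type*} [TopologicalSpace M] [ChartedSpace E M]
  [RiemannianBundle (fun x : M => TangentSpace 𝓘(ℝ, E) x)]
  [IsManifold 𝓘(ℝ, E) ∞ M] [FiniteDimensional ℝ E]
  [IsContMDiffRiemannianBundle 𝓘(ℝ, E) ∞ E (fun x : M => TangentSpace 𝓘(ℝ, E) x)]
  [T2Space M]

theorem exists_Ioo_subset_of_Icc_subset {U : Set ℝ} (hU : IsOpen U) (h : Icc 0 1 ⊆ U) :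
    ∃ ε > 0, Ioo (-ε) (1 + ε) ⊆ U := by
  obtain ⟨ε₀, h₀, hb₀⟩ := Metric.isOpen_iff.1 hU 0 (h (left_mem_Icc.2 zero_le_one))
  obtain ⟨ε₁, h₁, hb₁⟩ := Metric.isOpen_iff.1 hU 1 (h (right_mem_Icc.2 zero_le_one))
  refine ⟨min ε₀ ε₁, lt_min h₀ h₁, fun t ht => ?_⟩
  have m0 := min_le_left ε₀ ε₁
  have m1 := min_le_right ε₀ ε₁
  by_cases h1 : t < 0
  · refine hb₀ ?_
    rw [Metric.mem_ball, Real.dist_eq, abs_lt]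
    exact ⟨by linarith [ht.1], by linarith⟩
  · by_cases h2 : 1 < t
    · refine hb₁ ?_
      rw [Metric.mem_ball, Real.dist_eq, abs_lt]
      exact ⟨by linarith, by linarith [ht.2]⟩
    · exact h ⟨not_lt.1 h1, not_lt.1 h2⟩

theorem IsGeodesicFrom.riemannianExp_eq {γ : ℝ → M} {p : M} {v : TangentSpace 𝓘(ℝ, E) p}
    (h : IsGeodesicFrom γ (⟨p, v⟩ : TangentBundle 𝓘(ℝ, E) M)) : riemannianExp p v = γ 1 := by
  have hex : ∃ γ : ℝ → M, IsGeodesicFrom γ (⟨p, v⟩ : TangentBundle 𝓘(ℝ, E) M) := ⟨γ, h⟩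
  rw [riemannianExp, dif_pos hex]
  obtain ⟨ε, hε, hg, hv⟩ := h
  obtain ⟨ε', hε', hg', hv'⟩ := hex.choose_spec
  set γ' := hex.choose
  have hm : 0 < min ε ε' := lt_min hε hε'
  have m0 := min_le_left ε ε'
  have m1 := min_le_right ε ε'
  have := (hg'.mono (Ioo_subset_Ioo (by linarith) (by linarith) :
      Ioo (-min ε ε') (1 + min ε ε') ⊆ _)).eqOn
    (hg.mono (Ioo_subset_Ioo (by linarith) (by linarith))) isOpen_Ioo isPreconnected_Ioo
    (t := 0) ⟨by linarith, by linarith⟩ (hv'.trans hv.symm)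
  exact this ⟨by linarith, by linarith⟩

theorem isGeodesicFrom_smul {γ : ℝ → M} {p : M} {v : TangentSpace 𝓘(ℝ, E) p} {ε : ℝ}
    (hε : 0 < ε) (hγ : IsGeodesicOn E γ (Ioo (-ε) (1 + ε)))
    (hv : velocity E γ 0 = ⟨p, v⟩) {t : ℝ} (ht : t ∈ Ioo (-ε) (1 + ε)) :
    IsGeodesicFrom (fun s => γ (t * s + 0)) (⟨p, t • v⟩ : TangentBundle 𝓘(ℝ, E) M) := by
  have h1 := hγ.comp_affine isOpen_Ioo t 0
  have ho : IsOpen ((fun s : ℝ => t * s + 0) ⁻¹' Ioo (-ε) (1 + ε)) :=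
    isOpen_Ioo.preimage (by fun_prop)
  obtain ⟨ε', hε', hsub⟩ := exists_Ioo_subset_of_Icc_subset ho (by
    intro s hs
    simp only [mem_preimage, add_zero, mem_Ioo]
    constructor
    · rcases le_or_gt 0 t with h | h
      · nlinarith [mul_nonneg h hs.1]
      · nlinarith [hs.2, ht.1]
    · rcases le_or_gt 0 t with h | h
      · nlinarith [hs.2, ht.2]
      · nlinarith [hs.1])
  refine ⟨ε', hε', h1.mono hsub, ?_⟩
  have h00 : t * 0 + 0 = 0 := by ring
  have hm : MDifferentiableAt 𝓘(ℝ, ℝ) 𝓘(ℝ, E) γ (t * 0 + 0) := by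
    rw [h00]
    exact hγ.mdifferentiableAt isOpen_Ioo ⟨by linarith, by linarith⟩
  rw [velocity_comp_affine hm, h00]
  exact congrArg (fun x : TangentBundle 𝓘(ℝ, E) M =>
    (⟨x.1, t • x.2⟩ : TangentBundle 𝓘(ℝ, E) M)) hv

theorem geodesic_eq {γ : ℝ → M} {p : M} {v : TangentSpace 𝓘(ℝ, E) p} {ε : ℝ}
    (hε : 0 < ε) (hγ : IsGeodesicOn E γ (Ioo (-ε) (1 + ε)))
    (hv : velocity E γ 0 = ⟨p, v⟩) {t : ℝ} (ht : t ∈ Ioo (-ε) (1 + ε)) :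
    geodesic p v t = γ t := by
  rw [geodesic, (isGeodesicFrom_smul hε hγ hv ht).riemannianExp_eq]
  congr 1
  ring

/-- The exponential map `(p, v) ↦ exp_p v` in the charts around `c` (for the base point) and around
`c'` (for the end point). -/
def expChart (c c' : M) (z : E × E) : E :=
  extChartAt 𝓘(ℝ, E) c' (riemannianExp ((tcoord (E := E) c).symm z).1 ((tcoord c).symm z).2)

/-- A smooth geodesic flow defined up to time `1` whose end points lie in the chart around `c'`. -/
structure IsExpFlow (c c' : M) (F : ℝ × (E × E) → M) (δ : ℝ) (N : Set (E × E)) : Prop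
    extends IsGeodesicFlow c F (-δ) (1 + δ) N where
  pos : 0 < δ
  isOpen : IsOpen N
  mem_target : ∀ z ∈ N, z.1 ∈ (extChartAt 𝓘(ℝ, E) c).target
  mem_source : ∀ z ∈ N, F (1, z) ∈ (extChartAt 𝓘(ℝ, E) c').source

/-- The vectors at which the exponential map is defined form an open set, on which it is given by
a smooth geodesic flow. -/
theorem exists_isExpFlow {p : M} {v : TangentSpace 𝓘(ℝ, E) p}
    (h : ∃ γ : ℝ → M, IsGeodesicFrom γ (⟨p, v⟩ : TangentBundle 𝓘(ℝ, E) M)) {c c' : M}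
    (hc : p ∈ (extChartAt 𝓘(ℝ, E) c).source)
    (hc' : riemannianExp p v ∈ (extChartAt 𝓘(ℝ, E) c').source) :
    ∃ δ N F, IsExpFlow c c' F δ N ∧ tcoord c (⟨p, v⟩ : TangentBundle 𝓘(ℝ, E) M) ∈ N := by
  obtain ⟨γ, hγ⟩ := h
  rw [hγ.riemannianExp_eq] at hc'
  obtain ⟨ε, hε, hg, hv⟩ := hγ
  have hp : γ 0 = p := congrArg TotalSpace.proj hv
  obtain ⟨δ, hδ, N, hN, hzN, hNt, F, hF⟩ := exists_geodesicFlow hε hg (c := c) (by rwa [hp])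
  rw [hv] at hzN
  have h1 : F (1, tcoord c (⟨p, v⟩ : TangentBundle 𝓘(ℝ, E) M)) = γ 1 := by
    have m0 := min_le_left δ ε
    have m1 := min_le_right δ ε
    have hm : 0 < min δ ε := lt_min hδ hε
    refine ((hF.2 _ hzN).mono (Ioo_subset_Ioo (by linarith) (by linarith) :
      Ioo (-min δ ε) (1 + min δ ε) ⊆ _)).eqOn
      (hg.mono (Ioo_subset_Ioo (by linarith) (by linarith))) isOpen_Ioo isPreconnected_Ioo
      (t := 0) ⟨by linarith, by linarith⟩ ?_ ⟨by linarith, by linarith⟩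
    rw [hF.3 _ hzN, hv]
    exact (tcoord c).left_inv (mem_tcoord_source.2 hc)
  have hcont : ContinuousOn (fun z => F (1, z)) N :=
    hF.1.continuousOn.comp (by fun_prop) fun z hz => ⟨⟨by linarith, by linarith⟩, hz⟩
  refine ⟨δ, N ∩ (fun z => F (1, z)) ⁻¹' (extChartAt 𝓘(ℝ, E) c').source, F,
    ⟨hF.mono le_rfl le_rfl inter_subset_left, hδ,
      hcont.isOpen_inter_preimage hN (isOpen_extChartAt_source c'), fun z hz => hNt z hz.1,
      fun z hz => hz.2⟩, hzN, ?_⟩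
  show F (1, tcoord c (⟨p, v⟩ : TangentBundle 𝓘(ℝ, E) M)) ∈ (extChartAt 𝓘(ℝ, E) c').source
  rw [h1]
  exact hc'

namespace IsExpFlow

variable {c c' : M} {F : ℝ × (E × E) → M} {δ : ℝ} {N : Set (E × E)}

theorem isGeodesicFrom (h : IsExpFlow c c' F δ N) {z : E × E} (hz : z ∈ N) :
    IsGeodesicFrom (fun t => F (t, z)) ((tcoord c).symm z) :=
  ⟨δ, h.pos, h.isGeodesicOn z hz, h.velocity_zero z hz⟩

theorem riemannianExp_eq (h : IsExpFlow c c' F δ N) {z : E × E} (hz : z ∈ N) :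
    riemannianExp ((tcoord (E := E) c).symm z).1 ((tcoord c).symm z).2 = F (1, z) :=
  (h.isGeodesicFrom hz).riemannianExp_eq

theorem geodesic_eq (h : IsExpFlow c c' F δ N) {z : E × E} (hz : z ∈ N) {t : ℝ}
    (ht : t ∈ Ioo (-δ) (1 + δ)) :
    geodesic ((tcoord (E := E) c).symm z).1 ((tcoord c).symm z).2 t = F (t, z) :=
  _root_.geodesic_eq h.pos (h.isGeodesicOn z hz) (h.velocity_zero z hz) ht

theorem expChart_eq (h : IsExpFlow c c' F δ N) {z : E × E} (hz : z ∈ N) :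
    expChart c c' z = extChartAt 𝓘(ℝ, E) c' (F (1, z)) := by
  rw [expChart, h.riemannianExp_eq hz]

theorem contDiffOn_expChart (h : IsExpFlow c c' F δ N) :
    ContDiffOn ℝ ∞ (expChart (E := E) c c') N := by
  have hI : (1 : ℝ) ∈ Ioo (-δ) (1 + δ) := ⟨by linarith [h.pos], by linarith [h.pos]⟩
  have h1 : ContMDiffOn 𝓘(ℝ, E × E) 𝓘(ℝ, E) ∞ (fun z => F (1, z)) N :=
    h.contMDiffOn.comp (contDiff_const.prodMk contDiff_id).contMDiff.contMDiffOn
      fun z hz => ⟨hI, hz⟩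
  exact ((h1.contDiffOn_chart_comp c').mono fun z hz => ⟨hz, h.mem_source z hz⟩).congr
    fun z hz => h.expChart_eq hz

theorem differentiableAt_expChart (h : IsExpFlow c c' F δ N) {z : E × E} (hz : z ∈ N) :
    DifferentiableAt ℝ (expChart (E := E) c c') z :=
  h.contDiffOn_expChart.differentiableAt_of_isOpen h.isOpen hz

theorem expChart_mem_target (h : IsExpFlow c c' F δ N) {z : E × E} (hz : z ∈ N) :
    expChart c c' z ∈ (extChartAt 𝓘(ℝ, E) c').target := by
  rw [h.expChart_eq hz]
  exact (extChartAt 𝓘(ℝ, E) c').map_source (h.mem_source z hz)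

/-- The derivative of the exponential map in the radial direction is the final velocity. -/
theorem tcoord_velocity_one (h : IsExpFlow c c' F δ N) {z : E × E} (hz : z ∈ N) :
    tcoord c' (velocity E (fun t => F (t, z)) 1) =
      (expChart c c' z, fderiv ℝ (expChart (E := E) c c') z (0, z.2)) := by
  have hI : (1 : ℝ) ∈ Ioo (-δ) (1 + δ) := ⟨by linarith [h.pos], by linarith [h.pos]⟩
  rw [tcoord_velocity ((h.isGeodesicOn z hz).mdifferentiableAt isOpen_Ioo hI) (h.mem_source z hz),
    h.expChart_eq hz]
  refine Prod.ext rfl ?_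
  have hc : Continuous fun t : ℝ => (z.1, t • z.2) := by fun_prop
  have hz1 : (z.1, (1 : ℝ) • z.2) = z := by rw [one_smul]
  have hev : (fun t => extChartAt 𝓘(ℝ, E) c' (F (t, z))) =ᶠ[𝓝 1]
      fun t => expChart c c' (z.1, t • z.2) := by
    have hN : ∀ᶠ t : ℝ in 𝓝 1, (z.1, t • z.2) ∈ N :=
      hc.continuousAt (h.isOpen.mem_nhds (by rw [hz1]; exact hz))
    filter_upwards [hN, isOpen_Ioo.mem_nhds hI] with t ht htI
    rw [← h.geodesic_eq hz htI, geodesic, expChart]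
    have hzt := h.mem_target z hz
    rw [tcoord_symm_apply (z := (z.1, t • z.2)) hzt, tcoord_symm_apply hzt]
    simp only [map_smul]
  show deriv _ _ = _
  rw [hev.deriv_eq]
  have hd : HasDerivAt (fun t : ℝ => (z.1, t • z.2)) (0, z.2) 1 := by
    simpa using (hasDerivAt_const (1 : ℝ) z.1).prodMk ((hasDerivAt_id (1 : ℝ)).smul_const z.2)
  have hf : HasFDerivAt (expChart (E := E) c c') (fderiv ℝ (expChart (E := E) c c') z)
      (z.1, (1 : ℝ) • z.2) := by
    rw [hz1]
    exact (h.differentiableAt_expChart hz).hasFDerivAt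
  exact (HasFDerivAt.comp_hasDerivAt (l := expChart (E := E) c c')
    (f := fun t : ℝ => (z.1, t • z.2)) 1 hf hd).deriv

end IsExpFlow

/-! ### The first variation formula for the exponential map -/

/-- The energy density of a geodesic is constant. -/
theorem IsGeodesicOn.inner_curveDeriv_eq {γ : ℝ → M} {a b : ℝ} (h : IsGeodesicOn E γ (Ioo a b))
    {t t' : ℝ} (ht : t ∈ Ioo a b) (ht' : t' ∈ Ioo a b) :
    inner ℝ (curveDeriv E γ t) (curveDeriv E γ t) =
      inner ℝ (curveDeriv E γ t') (curveDeriv E γ t') := by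
  have key : ∀ t ∈ Ioo a b, HasDerivAt (fun t => inner ℝ (curveDeriv E γ t) (curveDeriv E γ t))
      0 t := by
    intro t ht
    -- vary `γ` by shifting the time
    set F : ℝ × ℝ → M := fun x => γ (x.1 + x.2) with hF
    set U : Set (ℝ × ℝ) := (fun x => x.1 + x.2) ⁻¹' Ioo a b with hU
    have hUo : IsOpen U := isOpen_Ioo.preimage (by fun_prop)
    have hFc : ContMDiffOn 𝓘(ℝ, ℝ × ℝ) 𝓘(ℝ, E) ∞ F U :=
      h.1.comp (contDiff_fst.add contDiff_snd : ContDiff ℝ ∞ fun x : ℝ × ℝ => x.1 + x.2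
        ).contMDiff.contMDiffOn fun x hx => hx
    have h0 : (t, (0 : ℝ)) ∈ U := by simpa [hU] using ht
    obtain ⟨B, hB1, hB2⟩ := exists_hasDerivAt_inner_curveDeriv hUo hFc h0
      (mem_extChartAt_source (F (t, 0)))
    have hF0 : ∀ r : ℝ, F (r, 0) = γ r := fun r => by simp [hF]
    have hres : geodesicResidual (F (t, 0))
        (fun t' => extChartAt 𝓘(ℝ, E) (F (t, 0)) (F (t', 0))) t = 0 := by
      simp only [hF0]
      exact h.geodesicResidual_eq_zero isOpen_Ioo ht (mem_extChartAt_source _)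
    rw [hres, map_zero, zero_apply, zero_add] at hB1
    have e1 : ∀ t s, t + s ∈ Ioo a b → velocity E (fun t => F (t, s)) t = velocity E γ (t + s) := by
      intro t s hts
      rw [velocity_comp (γ := γ) (g := fun t => t + s) (r := 1)
        (h.mdifferentiableAt isOpen_Ioo hts) ((hasDerivAt_id t).add_const s) fun r => rfl,
        one_smul]
      rfl
    have e2 : ∀ t ∈ Ioo a b, velocity E (fun s => F (t, s)) 0 = velocity E γ t := by
      intro t ht
      have h0 : t + 0 = t := add_zero t
      rw [velocity_comp (γ := γ) (g := fun s => t + s) (r := 1)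
        (h.mdifferentiableAt isOpen_Ioo (by rwa [h0])) ((hasDerivAt_id (0 : ℝ)).const_add t)
        fun r => rfl, one_smul, h0]
      rfl
    let q : ∀ x y : TangentBundle 𝓘(ℝ, E) M, x.1 = y.1 → ℝ := fun x y hxy =>
      inner ℝ x.2 (hxy ▸ y.2 : TangentSpace 𝓘(ℝ, E) x.1)
    have hq : ∀ {x y x' : TangentBundle 𝓘(ℝ, E) M} (hxy : x.1 = y.1), x = x' → y = x' →
        q x y hxy = inner ℝ x'.2 x'.2 := by
      rintro x y x' hxy rfl rfl
      rfl
    have hB1' : HasDerivAt (fun t => inner ℝ (curveDeriv E γ t) (curveDeriv E γ t)) B t := by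
      refine hB1.congr_of_eventuallyEq ?_
      filter_upwards [isOpen_Ioo.mem_nhds ht] with r hr
      have h1 := e1 r 0 (by rwa [add_zero])
      rw [add_zero] at h1
      exact (hq (x := velocity E (fun t => F (t, 0)) r) (y := velocity E (fun s => F (r, s)) 0)
        rfl h1 (e2 r hr)).symm
    have hB2' : HasDerivAt (fun s => (1 / 2 : ℝ) *
        inner ℝ (curveDeriv E γ (t + s)) (curveDeriv E γ (t + s))) B 0 := by
      refine hB2.congr_of_eventuallyEq ?_
      have : ContinuousAt (fun s : ℝ => t + s) 0 := by fun_prop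
      filter_upwards [this (isOpen_Ioo.mem_nhds (by simpa using ht))] with s hs
      have h1 := e1 t s hs
      exact congrArg (fun r => 1 / 2 * r) (hq (x := velocity E (fun t => F (t, s)) t)
        (y := velocity E (fun t => F (t, s)) t) rfl h1 h1).symm
    have hB3 : HasDerivAt (fun s => (1 / 2 : ℝ) *
        inner ℝ (curveDeriv E γ (t + s)) (curveDeriv E γ (t + s))) (1 / 2 * B) 0 := by
      have h2 : HasDerivAt (fun t => inner ℝ (curveDeriv E γ t) (curveDeriv E γ t)) B (t + 0) := by
        rwa [add_zero]
      exact (h2.comp_const_add t 0).const_mul (1 / 2 : ℝ)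
    have hB0 := hB2'.unique hB3
    have : B = 0 := by linarith
    rwa [this] at hB1'
  exact (isOpen_Ioo (a := a) (b := b)).is_const_of_deriv_eq_zero isPreconnected_Ioo
    (fun t ht => (key t ht).differentiableAt.differentiableWithinAt)
    (fun t ht => (key t ht).deriv) ht ht'

end ExpChart

section ExpFirstVariation

set_option synthInstance.maxHeartbeats 200000
set_option linter.unusedSectionVars false

variable {E : Type*} [NormedAddCommGroup E] [NormedSpace ℝ E]
  {M : Type*} [TopologicalSpace M] [ChartedSpace E M]
  [RiemannianBundle (fun x : M => TangentSpace 𝓘(ℝ, E) x)]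
  [IsManifold 𝓘(ℝ, E) ∞ M] [FiniteDimensional ℝ E]
  [IsContMDiffRiemannianBundle 𝓘(ℝ, E) ∞ E (fun x : M => TangentSpace 𝓘(ℝ, E) x)]
  [T2Space M]

theorem IsGeodesicFrom.riemannianExp_proj_snd {γ : ℝ → M} {x : TangentBundle 𝓘(ℝ, E) M}
    (h : IsGeodesicFrom γ x) : riemannianExp x.1 x.2 = γ 1 :=
  IsGeodesicFrom.riemannianExp_eq (p := x.1) (v := x.2) h

theorem contDiffOn_energy (c : M) :
    ContDiffOn ℝ ∞ (fun z : E × E => (1 / 2 : ℝ) * chartMetric c z.1 z.2 z.2)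
      ((extChartAt 𝓘(ℝ, E) c).target ×ˢ univ) := by
  have hG : ContDiffOn ℝ ∞ (fun z : E × E => chartMetric c z.1)
      ((extChartAt 𝓘(ℝ, E) c).target ×ˢ univ) :=
    contDiffOn_chartMetric.comp contDiffOn_fst fun z hz => hz.1
  exact contDiffOn_const.mul ((hG.clm_apply contDiffOn_snd).clm_apply contDiffOn_snd)

namespace IsExpFlow

variable {c c' : M} {F : ℝ × (E × E) → M} {δ : ℝ} {N : Set (E × E)}

theorem apply_zero (h : IsExpFlow c c' F δ N) {z : E × E} (hz : z ∈ N) :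
    F (0, z) = (extChartAt 𝓘(ℝ, E) c).symm z.1 := by
  have h1 := congrArg TotalSpace.proj (h.velocity_zero z hz)
  rw [tcoord_symm_apply (h.mem_target z hz)] at h1
  exact h1

theorem apply_zero_mem_source (h : IsExpFlow c c' F δ N) {z : E × E} (hz : z ∈ N) :
    F (0, z) ∈ (extChartAt 𝓘(ℝ, E) c).source := by
  rw [h.apply_zero hz]
  exact (extChartAt 𝓘(ℝ, E) c).map_target (h.mem_target z hz)

theorem dchart_curveDeriv_zero (h : IsExpFlow c c' F δ N) {z : E × E} (hz : z ∈ N) :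
    dchart c (F (0, z)) (curveDeriv E (fun t => F (t, z)) 0) = z.2 := by
  have h1 := congrArg (tcoord c) (h.velocity_zero z hz)
  rw [(tcoord c).right_inv (mem_tcoord_target.2 (h.mem_target z hz)),
    tcoord_apply (h.apply_zero_mem_source hz)] at h1
  exact congrArg Prod.snd h1

theorem dchart_curveDeriv_one (h : IsExpFlow c c' F δ N) {z : E × E} (hz : z ∈ N) :
    dchart c' (F (1, z)) (curveDeriv E (fun t => F (t, z)) 1) =
      fderiv ℝ (expChart (E := E) c c') z (0, z.2) := by
  have h1 := h.tcoord_velocity_one hz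
  rw [tcoord_apply (h.mem_source z hz)] at h1
  exact congrArg Prod.snd h1

theorem zero_mem (h : IsExpFlow c c' F δ N) : (0 : ℝ) ∈ Ioo (-δ) (1 + δ) :=
  ⟨by linarith [h.pos], by linarith [h.pos]⟩

theorem one_mem (h : IsExpFlow c c' F δ N) : (1 : ℝ) ∈ Ioo (-δ) (1 + δ) :=
  ⟨by linarith [h.pos], by linarith [h.pos]⟩

/-- First variation formula: the exponential map pulls the pairing with the final velocity back to
the pairing with the initial velocity, up to the differential of the energy. -/
theorem chartMetric_fderiv_expChart (h : IsExpFlow c c' F δ N) {z : E × E} (hz : z ∈ N)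
    (Y : E × E) :
    chartMetric c' (expChart c c' z) (fderiv ℝ (expChart (E := E) c c') z (0, z.2))
        (fderiv ℝ (expChart (E := E) c c') z Y) =
      chartMetric c z.1 z.2 Y.1 +
        fderiv ℝ (fun z : E × E => (1 / 2 : ℝ) * chartMetric c z.1 z.2 z.2) z Y := by
  have hz0 : z + (0 : ℝ) • Y = z := by simp
  have hcl : ContDiff ℝ ∞ fun s : ℝ => z + s • Y :=
    contDiff_const.add (contDiff_id.smul contDiff_const)
  have hline : HasDerivAt (fun s : ℝ => z + s • Y) Y 0 := by
    simpa using ((hasDerivAt_id (0 : ℝ)).smul_const Y).const_add z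
  set Fs : ℝ × ℝ → M := fun x => F (x.1, z + x.2 • Y) with hFs
  set g : ℝ × ℝ → ℝ × (E × E) := fun x => (x.1, z + x.2 • Y) with hg
  have hgc : ContDiff ℝ ∞ g := contDiff_fst.prodMk (hcl.comp contDiff_snd)
  set U := g ⁻¹' (Ioo (-δ) (1 + δ) ×ˢ N) with hU
  have hUo : IsOpen U := (isOpen_Ioo.prod h.isOpen).preimage hgc.continuous
  have hFc : ContMDiffOn 𝓘(ℝ, ℝ × ℝ) 𝓘(ℝ, E) ∞ Fs U :=
    h.contMDiffOn.comp hgc.contMDiff.contMDiffOn fun x hx => hx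
  have hz' : z + (0 : ℝ) • Y ∈ N := by rwa [hz0]
  have hNev : ∀ᶠ s : ℝ in 𝓝 0, z + s • Y ∈ N :=
    hcl.continuous.continuousAt (h.isOpen.mem_nhds hz')
  set B := fderiv ℝ (fun z : E × E => (1 / 2 : ℝ) * chartMetric c z.1 z.2 z.2) z Y with hB
  have hL : HasDerivAt (fun s : ℝ => (1 / 2 : ℝ) *
      chartMetric c (z + s • Y).1 (z + s • Y).2 (z + s • Y).2) B 0 := by
    have hd : DifferentiableAt ℝ (fun z : E × E => (1 / 2 : ℝ) * chartMetric c z.1 z.2 z.2)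
        (z + (0 : ℝ) • Y) := by
      rw [hz0]
      exact (contDiffOn_energy c).differentiableAt_of_isOpen
        ((isOpen_extChartAt_target c).prod isOpen_univ) ⟨h.mem_target z hz, mem_univ _⟩
    have := HasFDerivAt.comp_hasDerivAt
      (l := fun z : E × E => (1 / 2 : ℝ) * chartMetric c z.1 z.2 z.2)
      (f := fun s : ℝ => z + s • Y) 0 hd.hasFDerivAt hline
    rwa [hz0] at this
  set θ : ℝ → ℝ := fun t => inner ℝ (curveDeriv E (fun t => Fs (t, 0)) t :
        TangentSpace 𝓘(ℝ, E) (Fs (t, 0))) (curveDeriv E (fun s => Fs (t, s)) 0) with hθ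
  have hder : ∀ t ∈ Ioo (-δ) (1 + δ), HasDerivAt θ B t := by
    intro t ht
    obtain ⟨B', hB1, hB2⟩ := exists_hasDerivAt_inner_curveDeriv hUo hFc (t₀ := t) ⟨ht, hz'⟩
      (mem_extChartAt_source (Fs (t, 0)))
    have hres : geodesicResidual (Fs (t, 0))
        (fun t' => extChartAt 𝓘(ℝ, E) (Fs (t, 0)) (Fs (t', 0))) t = 0 :=
      (h.isGeodesicOn _ hz').geodesicResidual_eq_zero isOpen_Ioo ht (mem_extChartAt_source _)
    rw [hres, map_zero, zero_apply, zero_add] at hB1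
    have hBB : B' = B := by
      refine hB2.unique (hL.congr_of_eventuallyEq ?_)
      filter_upwards [hNev] with s hs
      have h1 := (h.isGeodesicOn _ hs).inner_curveDeriv_eq ht h.zero_mem
      have h2 := inner_eq_chartMetric (c := c) (h.apply_zero_mem_source hs)
        (curveDeriv E (fun t => F (t, z + s • Y)) 0) (curveDeriv E (fun t => F (t, z + s • Y)) 0)
      have h3 : extChartAt 𝓘(ℝ, E) c (F (0, z + s • Y)) = (z + s • Y).1 := by
        rw [h.apply_zero hs, (extChartAt 𝓘(ℝ, E) c).right_inv (h.mem_target _ hs)]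
      rw [h.dchart_curveDeriv_zero hs, h3] at h2
      exact congrArg (fun r => 1 / 2 * r) (h1.trans h2)
    rwa [hBB] at hB1
  have hslope : θ 1 - θ 0 = B := by
    obtain ⟨t, ht, hs⟩ := exists_hasDerivAt_eq_slope θ (fun _ => B) zero_lt_one
      (fun t ht => (hder t ⟨by linarith [ht.1, h.pos], by linarith [ht.2, h.pos]⟩
        ).continuousAt.continuousWithinAt)
      (fun t ht => hder t ⟨by linarith [ht.1, h.pos], by linarith [ht.2, h.pos]⟩)
    rw [hs]
    ring
  have hmd : ∀ t ∈ Ioo (-δ) (1 + δ), MDifferentiableAt 𝓘(ℝ, ℝ) 𝓘(ℝ, E) (fun s => Fs (t, s)) 0 := by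
    intro t ht
    have hgs : MDifferentiableAt 𝓘(ℝ, ℝ) 𝓘(ℝ, ℝ × ℝ) (fun s : ℝ => (t, s)) 0 :=
      (DifferentiableAt.prodMk (differentiableAt_const t)
        differentiableAt_id).mdifferentiableAt
    exact MDifferentiableAt.comp (g := Fs) 0 (hFc.mdifferentiableAt_of_isOpen hUo
      (show (t, (0 : ℝ)) ∈ U from ⟨ht, hz'⟩)) hgs
  have hθ0 : θ 0 = chartMetric c z.1 z.2 Y.1 := by
    have h1 : dchart c (Fs (0, 0)) (curveDeriv E (fun s => Fs (0, s)) 0) = Y.1 := by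
      rw [dchart_curveDeriv (hmd 0 h.zero_mem) (h.apply_zero_mem_source hz')]
      have h2 : (fun s => extChartAt 𝓘(ℝ, E) c (Fs (0, s))) =ᶠ[𝓝 0] fun s => (z + s • Y).1 := by
        filter_upwards [hNev] with s hs
        simp only [hFs]
        rw [h.apply_zero hs, (extChartAt 𝓘(ℝ, E) c).right_inv (h.mem_target _ hs)]
      rw [h2.deriv_eq]
      exact (HasFDerivAt.comp_hasDerivAt (l := Prod.fst) (f := fun s : ℝ => z + s • Y) 0
        hasFDerivAt_fst hline).deriv
    have h3 : θ 0 = chartMetric c (extChartAt 𝓘(ℝ, E) c (Fs (0, 0)))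
        (dchart c (Fs (0, 0)) (curveDeriv E (fun t => Fs (t, 0)) 0))
        (dchart c (Fs (0, 0)) (curveDeriv E (fun s => Fs (0, s)) 0)) :=
      inner_eq_chartMetric (h.apply_zero_mem_source hz') _ _
    have h4 : dchart c (Fs (0, 0)) (curveDeriv E (fun t => Fs (t, 0)) 0) = z.2 :=
      (h.dchart_curveDeriv_zero hz').trans (by rw [hz0])
    have h5 : extChartAt 𝓘(ℝ, E) c (Fs (0, 0)) = z.1 := by
      simp only [hFs]
      rw [h.apply_zero hz', (extChartAt 𝓘(ℝ, E) c).right_inv (h.mem_target _ hz'), hz0]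
    rw [h3, h1, h4, h5]
  have hθ1 : θ 1 = chartMetric c' (expChart c c' z) (fderiv ℝ (expChart (E := E) c c') z (0, z.2))
        (fderiv ℝ (expChart (E := E) c c') z Y) := by
    have h1 : dchart c' (Fs (1, 0)) (curveDeriv E (fun s => Fs (1, s)) 0) =
        fderiv ℝ (expChart (E := E) c c') z Y := by
      rw [dchart_curveDeriv (hmd 1 h.one_mem) (h.mem_source _ hz')]
      have h2 : (fun s => extChartAt 𝓘(ℝ, E) c' (Fs (1, s))) =ᶠ[𝓝 0]
          fun s => expChart c c' (z + s • Y) := by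
        filter_upwards [hNev] with s hs
        exact (h.expChart_eq hs).symm
      rw [h2.deriv_eq]
      have hd := (h.differentiableAt_expChart hz').hasFDerivAt
      have := (HasFDerivAt.comp_hasDerivAt (l := expChart (E := E) c c')
        (f := fun s : ℝ => z + s • Y) 0 hd hline).deriv
      rwa [hz0] at this
    have h3 : θ 1 = chartMetric c' (extChartAt 𝓘(ℝ, E) c' (Fs (1, 0)))
        (dchart c' (Fs (1, 0)) (curveDeriv E (fun t => Fs (t, 0)) 1))
        (dchart c' (Fs (1, 0)) (curveDeriv E (fun s => Fs (1, s)) 0)) :=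
      inner_eq_chartMetric (h.mem_source _ hz') _ _
    have h4 : dchart c' (Fs (1, 0)) (curveDeriv E (fun t => Fs (t, 0)) 1) =
        fderiv ℝ (expChart (E := E) c c') z (0, z.2) :=
      (h.dchart_curveDeriv_one hz').trans (by rw [hz0])
    have h5 : extChartAt 𝓘(ℝ, E) c' (Fs (1, 0)) = expChart c c' z :=
      (h.expChart_eq hz').symm.trans (congrArg (expChart c c') hz0)
    rw [h3, h1, h4, h5]
  rw [← hθ0, ← hθ1]
  linarith

/-- The pairing identity for a conjugate vector: the Jacobi field with `J(0) = J(1) = 0` and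
`J'(0) = a` has `J'(1) = D² exp (a, v)`, and `⟨J'(1), dexp Y⟩ = ⟨J'(0), Y⟩`. -/
theorem chartMetric_fderiv_fderiv_expChart (h : IsExpFlow c c' F δ N) {z : E × E} (hz : z ∈ N)
    {a : E} (ha : fderiv ℝ (expChart (E := E) c c') z (0, a) = 0) (Y : E × E) :
    chartMetric c' (expChart c c' z)
        (fderiv ℝ (fderiv ℝ (expChart (E := E) c c')) z (0, a) (0, z.2))
        (fderiv ℝ (expChart (E := E) c c') z Y) = chartMetric c z.1 a Y.1 := by
  refine inner_fderiv_fderiv_eq_of_firstVariation (f := expChart (E := E) c c')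
    (L := fun z : E × E => (1 / 2 : ℝ) * chartMetric c z.1 z.2 z.2)
    (G₁ := chartMetric c) (G₂ := chartMetric c') (z := z)
    ((h.contDiffOn_expChart.contDiffAt (h.isOpen.mem_nhds hz)).of_le
      (WithTop.coe_le_coe.2 le_top)) ?_ ?_ ?_ ?_ ha Y
  · exact ((contDiffOn_energy c).contDiffAt (((isOpen_extChartAt_target c).prod
      isOpen_univ).mem_nhds ⟨h.mem_target z hz, mem_univ _⟩)).of_le (WithTop.coe_le_coe.2 le_top)
  · exact contDiffOn_chartMetric.differentiableAt_of_isOpen (isOpen_extChartAt_target c)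
      (h.mem_target z hz)
  · exact contDiffOn_chartMetric.differentiableAt_of_isOpen (isOpen_extChartAt_target c')
      (h.expChart_mem_target hz)
  · filter_upwards [h.isOpen.mem_nhds hz] with w hw Y
    exact h.chartMetric_fderiv_expChart hw Y

theorem fderiv_fderiv_ne_zero (h : IsExpFlow c c' F δ N) {z : E × E} (hz : z ∈ N)
    {a : E} (ha : fderiv ℝ (expChart (E := E) c c') z (0, a) = 0) (ha0 : a ≠ 0) :
    fderiv ℝ (fderiv ℝ (expChart (E := E) c c')) z (0, a) (0, z.2) ≠ 0 := by
  intro h0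
  have h1 := h.chartMetric_fderiv_fderiv_expChart hz ha (a, 0)
  rw [h0, map_zero, zero_apply] at h1
  exact (chartMetric_pos (h.mem_target z hz) ha0).ne h1

/-- `J'(1)` is orthogonal to, hence not in, the range of the differential of the exponential
map. -/
theorem fderiv_ne_fderiv_fderiv (h : IsExpFlow c c' F δ N) {z : E × E} (hz : z ∈ N)
    {a : E} (ha : fderiv ℝ (expChart (E := E) c c') z (0, a) = 0) (ha0 : a ≠ 0) (b : E) :
    fderiv ℝ (expChart (E := E) c c') z (0, b) ≠
      fderiv ℝ (fderiv ℝ (expChart (E := E) c c')) z (0, a) (0, z.2) := by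
  intro hb
  have h1 := h.chartMetric_fderiv_fderiv_expChart hz ha (0, b)
  rw [hb, map_zero] at h1
  exact (chartMetric_pos (h.expChart_mem_target hz) (h.fderiv_fderiv_ne_zero hz ha ha0)).ne' h1

/-- Reversing the geodesics inverts the exponential map together with its final velocity. -/
theorem exists_isGeodesicFrom_reverse (h : IsExpFlow c c' F δ N) {z : E × E} (hz : z ∈ N) :
    IsGeodesicFrom (fun t => F (-1 * t + 1, z))
      ((tcoord (E := E) c').symm
        (expChart c c' z, -fderiv ℝ (expChart (E := E) c c') z (0, z.2))) := by
  have hg := (h.isGeodesicOn z hz).comp_affine isOpen_Ioo (-1) 1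
  have h1 : (-1 : ℝ) * 0 + 1 = 1 := by ring
  refine ⟨δ, h.pos, hg.mono fun t ht => ?_, ?_⟩
  · exact ⟨by linarith [ht.2], by linarith [ht.1]⟩
  · have hm : MDifferentiableAt 𝓘(ℝ, ℝ) 𝓘(ℝ, E) (fun t => F (t, z)) (-1 * 0 + 1) := by
      rw [h1]
      exact (h.isGeodesicOn z hz).mdifferentiableAt isOpen_Ioo h.one_mem
    rw [velocity_comp_affine (γ := fun t => F (t, z)) hm, h1]
    have hs : (⟨F (1, z), (-1 : ℝ) • curveDeriv E (fun t => F (t, z)) 1⟩ :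
        TangentBundle 𝓘(ℝ, E) M) ∈ (tcoord c').source := mem_tcoord_source.2 (h.mem_source z hz)
    have h2 : tcoord c' (⟨F (1, z), (-1 : ℝ) • curveDeriv E (fun t => F (t, z)) 1⟩ :
        TangentBundle 𝓘(ℝ, E) M) =
        (expChart c c' z, -fderiv ℝ (expChart (E := E) c c') z (0, z.2)) := by
      rw [tcoord_apply (h.mem_source z hz), h.expChart_eq hz]
      refine Prod.ext rfl ?_
      show dchart c' (F (1, z)) ((-1 : ℝ) • curveDeriv E (fun t => F (t, z)) 1) = _
      rw [map_smul, h.dchart_curveDeriv_one hz, neg_one_smul]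
    rw [← h2]
    exact ((tcoord c').left_inv hs).symm

theorem expChart_reverse (h : IsExpFlow c c' F δ N) {z : E × E} (hz : z ∈ N) :
    expChart c' c (expChart c c' z, -fderiv ℝ (expChart (E := E) c c') z (0, z.2)) = z.1 := by
  rw [expChart, (h.exists_isGeodesicFrom_reverse hz).riemannianExp_proj_snd]
  have h1 : (-1 : ℝ) * 1 + 1 = 0 := by ring
  simp only [h1]
  rw [h.apply_zero hz, (extChartAt 𝓘(ℝ, E) c).right_inv (h.mem_target _ hz)]

end IsExpFlow

end ExpFirstVariation

/-! ### The differential of the exponential map and Jacobi fields in coordinates -/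

section JacobiCoordinates

set_option synthInstance.maxHeartbeats 200000
set_option linter.unusedSectionVars false

variable {E : Type*} [NormedAddCommGroup E] [NormedSpace ℝ E]
  {M : Type*} [TopologicalSpace M] [ChartedSpace E M]
  [RiemannianBundle (fun x : M => TangentSpace 𝓘(ℝ, E) x)]
  [IsManifold 𝓘(ℝ, E) ∞ M]

omit [RiemannianBundle (fun x : M => TangentSpace 𝓘(ℝ, E) x)] in
theorem bijective_dchart {c x : M} (hx : x ∈ (extChartAt 𝓘(ℝ, E) c).source) :
    Function.Bijective (dchart (E := E) c x) :=
  (isInvertible_mfderiv_extChartAt (I := 𝓘(ℝ, E)) hx).bijective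

omit [RiemannianBundle (fun x : M => TangentSpace 𝓘(ℝ, E) x)] in
theorem dchart_self (x : M) (a : TangentSpace 𝓘(ℝ, E) x) : dchart x x a = a :=
  DFunLike.congr_fun (mfderiv_extChartAt_self (I := 𝓘(ℝ, E)) (x := x)) a

/-- The coordinates of a vector depend affinely on the vector, also for the Riemannian norm. -/
theorem hasFDerivAt_tcoord {c p : M} (hp : p ∈ (extChartAt 𝓘(ℝ, E) c).source)
    (v : TangentSpace 𝓘(ℝ, E) p) :
    HasFDerivAt (fun u : TangentSpace 𝓘(ℝ, E) p =>
      tcoord c (⟨p, u⟩ : TangentBundle 𝓘(ℝ, E) M))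
      ((ContinuousLinearMap.inr ℝ E E).comp (dchart c p)) v := by
  have h1 : (fun u : TangentSpace 𝓘(ℝ, E) p => tcoord c (⟨p, u⟩ : TangentBundle 𝓘(ℝ, E) M)) =
      fun u => (extChartAt 𝓘(ℝ, E) c p, dchart c p u) := by
    funext u
    exact tcoord_apply hp
  rw [h1]
  have h2 : HasFDerivAt (fun u : TangentSpace 𝓘(ℝ, E) p => dchart c p u) (dchart c p) v :=
    (dchart c p).hasFDerivAt
  exact ((hasFDerivAt_const (extChartAt 𝓘(ℝ, E) c p) v).prodMk h2).congr_fderiv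
    (by ext <;> simp)

theorem mdifferentiableAt_and_dchart_mfderiv {c c' p : M}
    (hp : p ∈ (extChartAt 𝓘(ℝ, E) c).source) {f : TangentSpace 𝓘(ℝ, E) p → M} {Φ : E × E → M}
    {N : Set (E × E)} (hN : IsOpen N) (hΦ : ContMDiffOn 𝓘(ℝ, E × E) 𝓘(ℝ, E) ∞ Φ N)
    {v : TangentSpace 𝓘(ℝ, E) p} (hz : tcoord c (⟨p, v⟩ : TangentBundle 𝓘(ℝ, E) M) ∈ N)
    (hf : ∀ u, tcoord c (⟨p, u⟩ : TangentBundle 𝓘(ℝ, E) M) ∈ N →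
      f u = Φ (tcoord c (⟨p, u⟩ : TangentBundle 𝓘(ℝ, E) M)))
    (hc' : f v ∈ (extChartAt 𝓘(ℝ, E) c').source) :
    MDifferentiableAt 𝓘(ℝ, TangentSpace 𝓘(ℝ, E) p) 𝓘(ℝ, E) f v ∧
    ∀ a : TangentSpace 𝓘(ℝ, E) p, dchart c' (f v)
      (mfderiv 𝓘(ℝ, TangentSpace 𝓘(ℝ, E) p) 𝓘(ℝ, E) f v a) =
      fderiv ℝ (fun z => extChartAt 𝓘(ℝ, E) c' (Φ z))
        (tcoord c (⟨p, v⟩ : TangentBundle 𝓘(ℝ, E) M)) (0, dchart c p a) := by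
  have hd := hasFDerivAt_tcoord hp v
  have hev : f =ᶠ[𝓝 v] fun u => Φ (tcoord c (⟨p, u⟩ : TangentBundle 𝓘(ℝ, E) M)) := by
    filter_upwards [hd.continuousAt (hN.mem_nhds hz)] with u hu
    exact hf u hu
  have hm : MDifferentiableAt 𝓘(ℝ, TangentSpace 𝓘(ℝ, E) p) 𝓘(ℝ, E) f v := by
    refine MDifferentiableAt.congr_of_eventuallyEq ?_ hev
    exact MDifferentiableAt.comp (g := Φ) v (hΦ.mdifferentiableAt_of_isOpen hN hz)
      hd.differentiableAt.mdifferentiableAt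
  refine ⟨hm, fun a => ?_⟩
  have h1 := mfderiv_comp v (mdifferentiableAt_chart (E := E) hc') hm
  rw [mfderiv_eq_fderiv] at h1
  have h2 : dchart c' (f v) (mfderiv 𝓘(ℝ, TangentSpace 𝓘(ℝ, E) p) 𝓘(ℝ, E) f v a) =
      fderiv ℝ (fun u => extChartAt 𝓘(ℝ, E) c' (f u)) v a := (DFunLike.congr_fun h1 a).symm
  rw [h2]
  have hev' : (fun u => extChartAt 𝓘(ℝ, E) c' (f u)) =ᶠ[𝓝 v]
      fun u => extChartAt 𝓘(ℝ, E) c' (Φ (tcoord c (⟨p, u⟩ : TangentBundle 𝓘(ℝ, E) M))) :=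
    hev.fun_comp (extChartAt 𝓘(ℝ, E) c')
  rw [hev'.fderiv_eq]
  have hΦd : DifferentiableAt ℝ (fun z => extChartAt 𝓘(ℝ, E) c' (Φ z))
      (tcoord c (⟨p, v⟩ : TangentBundle 𝓘(ℝ, E) M)) :=
    (hΦ.contDiffOn_chart_comp c').differentiableAt_of_isOpen
      (hΦ.isOpen_inter_preimage_chart hN c') ⟨hz, by
        show Φ _ ∈ (extChartAt 𝓘(ℝ, E) c').source
        rw [← hf v hz]
        exact hc'⟩
  have h3 := HasFDerivAt.comp (g := fun z => extChartAt 𝓘(ℝ, E) c' (Φ z)) v hΦd.hasFDerivAt hd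
  exact DFunLike.congr_fun h3.fderiv a

theorem christoffel_zero_right (c : M) (y a : E) : christoffel c y a 0 = 0 := by
  unfold christoffel
  have : (1 / 2 : ℝ) • (fderiv ℝ (chartMetric (E := E) c) y a 0 +
      fderiv ℝ (chartMetric (E := E) c) y 0 a -
      ((fderiv ℝ (chartMetric (E := E) c) y).flip a).flip 0) = 0 := by
    simp
  rw [this, map_zero]

/-- Where a vector field along a curve vanishes, its covariant derivative is the derivative of its
coordinates in any chart. -/
theorem dchart_covariantDeriv_of_eq_zero {γ : ℝ → M} {J : ∀ t, TangentSpace 𝓘(ℝ, E) (γ t)}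
    {t₀ : ℝ} {c : M} (hγ : ContinuousAt γ t₀) (hc : γ t₀ ∈ (extChartAt 𝓘(ℝ, E) c).source)
    (hy : DifferentiableAt ℝ (fun t => extChartAt 𝓘(ℝ, E) c (γ t)) t₀) (hJ : J t₀ = 0) {w : E}
    (hw : HasDerivAt (fun t => dchart c (γ t) (J t)) w t₀) :
    dchart c (γ t₀) (covariantDeriv γ J t₀) = w := by
  set c₀ := γ t₀ with hc₀
  have hs : γ t₀ ∈ (extChartAt 𝓘(ℝ, E) c₀).source := mem_extChartAt_source _
  set y := fun t => extChartAt 𝓘(ℝ, E) c (γ t) with hydef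
  have hyt : y t₀ ∈ (extChartAt 𝓘(ℝ, E) c).target ∩
      (extChartAt 𝓘(ℝ, E) c).symm ⁻¹' (extChartAt 𝓘(ℝ, E) c₀).source := by
    refine ⟨(extChartAt 𝓘(ℝ, E) c).map_source hc, ?_⟩
    rw [mem_preimage, (extChartAt 𝓘(ℝ, E) c).left_inv hc]
    exact hs
  have hτ : DifferentiableAt ℝ (fderiv ℝ (transition E c c₀)) (y t₀) :=
    ((contDiffOn_transition c c₀).fderiv_of_isOpen (m := ∞) (isOpen_transition_source c c₀)
      (by simp)).differentiableAt_of_isOpen (isOpen_transition_source c c₀) hyt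
  have hj : (fun t => dchart c₀ (γ t) (J t)) =ᶠ[𝓝 t₀]
      fun t => fderiv ℝ (transition E c c₀) (y t) (dchart c (γ t) (J t)) := by
    filter_upwards [hγ ((isOpen_extChartAt_source c).mem_nhds hc),
      hγ ((isOpen_extChartAt_source c₀).mem_nhds hs)] with t h1 h2
    exact (fderiv_transition_mfderiv h1 h2 (J t)).symm
  have hA : HasDerivAt (fun t => fderiv ℝ (transition E c c₀) (y t))
      (fderiv ℝ (fderiv ℝ (transition E c c₀)) (y t₀) (deriv y t₀)) t₀ :=
    HasFDerivAt.comp_hasDerivAt (l := fderiv ℝ (transition E c c₀)) (f := y) t₀ hτ.hasFDerivAt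
      hy.hasDerivAt
  have hj0 : dchart c (γ t₀) (J t₀) = 0 := by rw [hJ, map_zero]
  have hder := (hA.clm_apply hw).deriv
  rw [hj0, map_zero, zero_add] at hder
  have hcov : covariantDeriv γ J t₀ = deriv (fun t => dchart c₀ (γ t) (J t)) t₀ +
      christoffel c₀ (extChartAt 𝓘(ℝ, E) c₀ (γ t₀))
        (deriv (fun t => extChartAt 𝓘(ℝ, E) c₀ (γ t)) t₀) (dchart c₀ (γ t₀) (J t₀)) := rfl
  rw [hJ, map_zero, christoffel_zero_right, add_zero, hj.deriv_eq, hder] at hcov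
  obtain ⟨x, hx⟩ := (bijective_dchart hc).2 w
  have h1 := fderiv_transition_mfderiv hc hs x
  rw [hx] at h1
  have h2 : covariantDeriv γ J t₀ = x := hcov.trans (h1.trans (dchart_self (γ t₀) x))
  rw [h2, hx]

variable [FiniteDimensional ℝ E]
  [IsContMDiffRiemannianBundle 𝓘(ℝ, E) ∞ E (fun x : M => TangentSpace 𝓘(ℝ, E) x)]
  [T2Space M]

namespace IsExpFlow

variable {c c' : M} {F : ℝ × (E × E) → M} {δ : ℝ} {N : Set (E × E)}
  {p : M} {v : TangentSpace 𝓘(ℝ, E) p}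

theorem riemannianExp_eq_of_mem (h : IsExpFlow c c' F δ N)
    (hp : p ∈ (extChartAt 𝓘(ℝ, E) c).source)
    (hz : tcoord c (⟨p, v⟩ : TangentBundle 𝓘(ℝ, E) M) ∈ N) :
    riemannianExp p v = F (1, tcoord c (⟨p, v⟩ : TangentBundle 𝓘(ℝ, E) M)) := by
  have h1 := h.isGeodesicFrom hz
  rw [(tcoord c).left_inv (mem_tcoord_source.2 hp)] at h1
  exact h1.riemannianExp_eq

theorem isGeodesicFrom_of_mem (h : IsExpFlow c c' F δ N)
    (hp : p ∈ (extChartAt 𝓘(ℝ, E) c).source)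
    (hz : tcoord c (⟨p, v⟩ : TangentBundle 𝓘(ℝ, E) M) ∈ N) :
    ∃ γ : ℝ → M, IsGeodesicFrom γ (⟨p, v⟩ : TangentBundle 𝓘(ℝ, E) M) := by
  have h1 := h.isGeodesicFrom hz
  rw [(tcoord c).left_inv (mem_tcoord_source.2 hp)] at h1
  exact ⟨_, h1⟩

theorem riemannianExp_mem_source (h : IsExpFlow c c' F δ N)
    (hp : p ∈ (extChartAt 𝓘(ℝ, E) c).source)
    (hz : tcoord c (⟨p, v⟩ : TangentBundle 𝓘(ℝ, E) M) ∈ N) :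
    riemannianExp p v ∈ (extChartAt 𝓘(ℝ, E) c').source := by
  rw [h.riemannianExp_eq_of_mem hp hz]
  exact h.mem_source _ hz

theorem chart_riemannianExp (h : IsExpFlow c c' F δ N)
    (hp : p ∈ (extChartAt 𝓘(ℝ, E) c).source)
    (hz : tcoord c (⟨p, v⟩ : TangentBundle 𝓘(ℝ, E) M) ∈ N) :
    extChartAt 𝓘(ℝ, E) c' (riemannianExp p v) =
      expChart c c' (tcoord c (⟨p, v⟩ : TangentBundle 𝓘(ℝ, E) M)) := by
  rw [h.riemannianExp_eq_of_mem hp hz, h.expChart_eq hz]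

theorem geodesic_eq_of_mem (h : IsExpFlow c c' F δ N)
    (hp : p ∈ (extChartAt 𝓘(ℝ, E) c).source)
    (hz : tcoord c (⟨p, v⟩ : TangentBundle 𝓘(ℝ, E) M) ∈ N) {t : ℝ} (ht : t ∈ Ioo (-δ) (1 + δ)) :
    geodesic p v t = F (t, tcoord c (⟨p, v⟩ : TangentBundle 𝓘(ℝ, E) M)) := by
  refine _root_.geodesic_eq h.pos (h.isGeodesicOn _ hz) ?_ ht
  rw [h.velocity_zero _ hz]
  exact (tcoord c).left_inv (mem_tcoord_source.2 hp)

/-- The differential of `exp_p` in coordinates. -/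
theorem dchart_dexp (h : IsExpFlow c c' F δ N) (hp : p ∈ (extChartAt 𝓘(ℝ, E) c).source)
    (hz : tcoord c (⟨p, v⟩ : TangentBundle 𝓘(ℝ, E) M) ∈ N) (a : TangentSpace 𝓘(ℝ, E) p) :
    dchart c' (riemannianExp p v) (dexp p v a) =
      fderiv ℝ (expChart (E := E) c c') (tcoord c (⟨p, v⟩ : TangentBundle 𝓘(ℝ, E) M))
        (0, dchart c p a) := by
  have hΦ : ContMDiffOn 𝓘(ℝ, E × E) 𝓘(ℝ, E) ∞ (fun z => F (1, z)) N :=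
    h.contMDiffOn.comp (contDiff_const.prodMk contDiff_id).contMDiff.contMDiffOn
      fun z hz => ⟨h.one_mem, hz⟩
  have h1 := (mdifferentiableAt_and_dchart_mfderiv hp h.isOpen hΦ hz (f := riemannianExp p)
    (c' := c') (fun u hu => h.riemannianExp_eq_of_mem hp hu)
    (h.riemannianExp_mem_source hp hz)).2 a
  have h2 : (fun z => extChartAt 𝓘(ℝ, E) c' (F (1, z))) =ᶠ[𝓝 (tcoord c
      (⟨p, v⟩ : TangentBundle 𝓘(ℝ, E) M))] expChart (E := E) c c' := by
    filter_upwards [h.isOpen.mem_nhds hz] with w hw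
    exact (h.expChart_eq hw).symm
  rw [h2.fderiv_eq] at h1
  exact h1

theorem dexp_eq_zero_iff (h : IsExpFlow c c' F δ N) (hp : p ∈ (extChartAt 𝓘(ℝ, E) c).source)
    (hz : tcoord c (⟨p, v⟩ : TangentBundle 𝓘(ℝ, E) M) ∈ N) (a : TangentSpace 𝓘(ℝ, E) p) :
    dexp p v a = 0 ↔ fderiv ℝ (expChart (E := E) c c')
      (tcoord c (⟨p, v⟩ : TangentBundle 𝓘(ℝ, E) M)) (0, dchart c p a) = 0 := by
  rw [← h.dchart_dexp hp hz]
  constructor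
  · intro h0
    rw [h0, map_zero]
  · intro h0
    exact (bijective_dchart (h.riemannianExp_mem_source hp hz)).1 (h0.trans (map_zero _).symm)

/-- The conjugate vectors are the critical points of the exponential map in coordinates. -/
theorem mem_tangentConjLocus_iff (h : IsExpFlow c c' F δ N)
    (hp : p ∈ (extChartAt 𝓘(ℝ, E) c).source)
    (hz : tcoord c (⟨p, v⟩ : TangentBundle 𝓘(ℝ, E) M) ∈ N) :
    v ∈ tangentConjLocus p ↔ ∃ a ≠ 0, fderiv ℝ (expChart (E := E) c c')
      (tcoord c (⟨p, v⟩ : TangentBundle 𝓘(ℝ, E) M)) (0, a) = 0 := by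
  have hfd : FiniteDimensional ℝ (TangentSpace 𝓘(ℝ, E) p) := inferInstanceAs
    (FiniteDimensional ℝ E)
  have hfd' : FiniteDimensional ℝ (TangentSpace 𝓘(ℝ, E) (riemannianExp p v)) := inferInstanceAs
    (FiniteDimensional ℝ E)
  have hbij : Function.Bijective (dexp p v) ↔ Function.Injective (dexp p v) := by
    refine ⟨fun hb => hb.1, fun hi => ⟨hi, ?_⟩⟩
    exact (LinearMap.injective_iff_surjective_of_finrank_eq_finrank
      (f := (dexp p v).toLinearMap) rfl).1 hi
  constructor
  · rintro ⟨-, hb⟩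
    rw [hbij, injective_iff_map_eq_zero] at hb
    push Not at hb
    obtain ⟨a, ha, ha0⟩ := hb
    exact ⟨dchart c p a, fun h0 => ha0 ((bijective_dchart hp).1 (h0.trans (map_zero _).symm)),
      (h.dexp_eq_zero_iff hp hz a).1 ha⟩
  · rintro ⟨a, ha0, ha⟩
    obtain ⟨b, rfl⟩ := (bijective_dchart hp).2 a
    refine ⟨h.isGeodesicFrom_of_mem hp hz, fun hb => ha0 ?_⟩
    have := hb.1 (((h.dexp_eq_zero_iff hp hz b).2 ha).trans (map_zero _).symm)
    rw [this, map_zero]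

theorem dchart_jacobiField (h : IsExpFlow c c' F δ N) (hp : p ∈ (extChartAt 𝓘(ℝ, E) c).source)
    (hz : tcoord c (⟨p, v⟩ : TangentBundle 𝓘(ℝ, E) M) ∈ N) (a : TangentSpace 𝓘(ℝ, E) p) {t : ℝ}
    (ht : t ∈ Ioo (-δ) (1 + δ)) {k : M}
    (hk : F (t, tcoord c (⟨p, v⟩ : TangentBundle 𝓘(ℝ, E) M)) ∈ (extChartAt 𝓘(ℝ, E) k).source) :
    dchart k (geodesic p v t) (jacobiField p v a t) =
      fderiv ℝ (fun x => extChartAt 𝓘(ℝ, E) k (F x))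
        (t, tcoord c (⟨p, v⟩ : TangentBundle 𝓘(ℝ, E) M)) (0, (0, dchart c p a)) := by
  have hmk : ContDiff ℝ ∞ fun z : E × E => (t, z) := contDiff_const.prodMk contDiff_id
  have hΦ : ContMDiffOn 𝓘(ℝ, E × E) 𝓘(ℝ, E) ∞ (fun z => F (t, z)) N :=
    h.contMDiffOn.comp hmk.contMDiff.contMDiffOn fun z hz => ⟨ht, hz⟩
  have h1 := (mdifferentiableAt_and_dchart_mfderiv hp h.isOpen hΦ hz
    (f := fun u => riemannianExp p (t • u)) (c' := k)
    (fun u hu => h.geodesic_eq_of_mem hp hu ht) (by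
      have := h.geodesic_eq_of_mem hp hz ht
      rw [geodesic] at this
      rw [this]
      exact hk)).2 a
  refine h1.trans ?_
  have ho : IsOpen (Ioo (-δ) (1 + δ) ×ˢ N) := isOpen_Ioo.prod h.isOpen
  have hd : DifferentiableAt ℝ (fun x => extChartAt 𝓘(ℝ, E) k (F x))
      (t, tcoord c (⟨p, v⟩ : TangentBundle 𝓘(ℝ, E) M)) :=
    (h.contMDiffOn.contDiffOn_chart_comp k).differentiableAt_of_isOpen
      (h.contMDiffOn.isOpen_inter_preimage_chart ho k) ⟨⟨ht, hz⟩, hk⟩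
  have hg : HasFDerivAt (fun z : E × E => (t, z)) (ContinuousLinearMap.inr ℝ ℝ (E × E))
      (tcoord c (⟨p, v⟩ : TangentBundle 𝓘(ℝ, E) M)) := hasFDerivAt_prodMk_right t _
  have h2 := HasFDerivAt.comp (g := fun x => extChartAt 𝓘(ℝ, E) k (F x))
    (f := fun z : E × E => (t, z)) _ hd.hasFDerivAt hg
  exact DFunLike.congr_fun h2.fderiv _

theorem jacobiField_zero (p : M) (v a : TangentSpace 𝓘(ℝ, E) p) : jacobiField p v a 0 = 0 := by
  have h1 : (fun u : TangentSpace 𝓘(ℝ, E) p => riemannianExp p ((0 : ℝ) • u)) =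
      fun _ => riemannianExp p ((0 : ℝ) • v) := by
    funext u
    rw [zero_smul, zero_smul]
  have h2 : mfderiv 𝓘(ℝ, TangentSpace 𝓘(ℝ, E) p) 𝓘(ℝ, E)
    (fun u : TangentSpace 𝓘(ℝ, E) p => riemannianExp p ((0 : ℝ) • u)) v a = 0 := by
    have h3 : HasMFDerivAt 𝓘(ℝ, TangentSpace 𝓘(ℝ, E) p) 𝓘(ℝ, E)
      (fun u : TangentSpace 𝓘(ℝ, E) p => riemannianExp p ((0 : ℝ) • u)) v 0 := by
      rw [h1]
      exact hasMFDerivAt_const _ _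
    rw [h3.mfderiv]
    rfl
  exact h2

theorem jacobiField_one_eq_zero_iff (h : IsExpFlow c c' F δ N)
    (hp : p ∈ (extChartAt 𝓘(ℝ, E) c).source)
    (hz : tcoord c (⟨p, v⟩ : TangentBundle 𝓘(ℝ, E) M) ∈ N) (a : TangentSpace 𝓘(ℝ, E) p) :
    jacobiField p v a 1 = 0 ↔ fderiv ℝ (expChart (E := E) c c')
      (tcoord c (⟨p, v⟩ : TangentBundle 𝓘(ℝ, E) M)) (0, dchart c p a) = 0 := by
  rw [← h.dexp_eq_zero_iff hp hz]
  have h1 : (fun u : TangentSpace 𝓘(ℝ, E) p => riemannianExp p ((1 : ℝ) • u)) =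
      riemannianExp p := by
    funext u
    rw [one_smul]
  have h2 : mfderiv 𝓘(ℝ, TangentSpace 𝓘(ℝ, E) p) 𝓘(ℝ, E)
    (fun u : TangentSpace 𝓘(ℝ, E) p => riemannianExp p ((1 : ℝ) • u)) v a = (dexp p v a : E) := by
    rw [h1]
    rfl
  exact Eq.congr_left h2

/-- The common computation of the covariant derivatives of a Jacobi field at times `0` and `1`: the
second derivatives of the geodesic flow are symmetric, so `J'` is the derivative of the velocity in
the direction of the variation. -/
theorem tcoord_covariantDeriv_jacobiField (h : IsExpFlow c c' F δ N)
    (hp : p ∈ (extChartAt 𝓘(ℝ, E) c).source)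
    (hz : tcoord c (⟨p, v⟩ : TangentBundle 𝓘(ℝ, E) M) ∈ N) (a : TangentSpace 𝓘(ℝ, E) p) {t : ℝ}
    (ht : t ∈ Ioo (-δ) (1 + δ)) {k : M}
    (hk : F (t, tcoord c (⟨p, v⟩ : TangentBundle 𝓘(ℝ, E) M)) ∈ (extChartAt 𝓘(ℝ, E) k).source)
    (hJ : jacobiField p v a t = 0) {V : E × E → E} {w : E}
    (hV : ∀ᶠ z in 𝓝 (tcoord c (⟨p, v⟩ : TangentBundle 𝓘(ℝ, E) M)),
      dchart k (F (t, z)) (curveDeriv E (fun t => F (t, z)) t) = V z)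
    (hw : fderiv ℝ V (tcoord c (⟨p, v⟩ : TangentBundle 𝓘(ℝ, E) M)) (0, dchart c p a) = w) :
    dchart k (geodesic p v t) (covariantDeriv (geodesic p v) (jacobiField p v a) t) = w := by
  set z := tcoord c (⟨p, v⟩ : TangentBundle 𝓘(ℝ, E) M) with hzdef
  have ho : IsOpen (Ioo (-δ) (1 + δ) ×ˢ N) := isOpen_Ioo.prod h.isOpen
  set D := Ioo (-δ) (1 + δ) ×ˢ N ∩ F ⁻¹' (extChartAt 𝓘(ℝ, E) k).source with hD
  have hDo : IsOpen D := h.contMDiffOn.isOpen_inter_preimage_chart ho k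
  set Y : ℝ × (E × E) → E := fun x => extChartAt 𝓘(ℝ, E) k (F x) with hY
  have hYc : ContDiffOn ℝ ∞ Y D := h.contMDiffOn.contDiffOn_chart_comp k
  have htD : (t, z) ∈ D := ⟨⟨ht, hz⟩, hk⟩
  have hgeo : geodesic p v =ᶠ[𝓝 t] fun t => F (t, z) := by
    filter_upwards [isOpen_Ioo.mem_nhds ht] with r hr
    exact h.geodesic_eq_of_mem hp hz hr
  have hFt : MDifferentiableAt 𝓘(ℝ, ℝ) 𝓘(ℝ, E) (fun t => F (t, z)) t :=
    (h.isGeodesicOn z hz).mdifferentiableAt isOpen_Ioo ht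
  have hcont : ContinuousAt (geodesic p v) t := hFt.continuousAt.congr hgeo.symm
  have hYt : ContinuousAt (fun r : ℝ => (r, z)) t := by fun_prop
  have hD2 : DifferentiableAt ℝ (fderiv ℝ Y) (t, z) :=
    (hYc.fderiv_of_isOpen hDo (m := ∞) (by simp)).differentiableAt_of_isOpen hDo htD
  refine dchart_covariantDeriv_of_eq_zero hcont ?_ ?_ hJ ?_
  · rw [h.geodesic_eq_of_mem hp hz ht]
    exact hk
  · refine (hasDerivAt_fst_slice (hYc.differentiableAt_of_isOpen hDo htD)
      ).differentiableAt.congr_of_eventuallyEq ?_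
    exact hgeo.fun_comp (extChartAt 𝓘(ℝ, E) k)
  · have h1 : (fun r => dchart k (geodesic p v r) (jacobiField p v a r)) =ᶠ[𝓝 t]
        fun r => fderiv ℝ Y (r, z) (0, (0, dchart c p a)) := by
      filter_upwards [hYt (hDo.mem_nhds htD)] with r hr
      exact h.dchart_jacobiField hp hz a hr.1.1 hr.2
    refine HasDerivAt.congr_of_eventuallyEq ?_ h1
    have h2 := (hasDerivAt_fst_slice hD2).clm_apply
      (hasDerivAt_const t ((0 : ℝ), ((0 : E), dchart c p a)))
    refine h2.congr_deriv ?_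
    have hsym : IsSymmSndFDerivAt ℝ Y (t, z) :=
      (hYc.contDiffAt (hDo.mem_nhds htD)).isSymmSndFDerivAt (by
        rw [minSmoothness_of_isRCLikeNormedField]
        exact WithTop.coe_le_coe.2 le_top)
    rw [map_zero, add_zero, hsym (1, 0) (0, (0, dchart c p a)), ← hw]
    have hmk : HasFDerivAt (fun z : E × E => (t, z)) (ContinuousLinearMap.inr ℝ ℝ (E × E)) z :=
      hasFDerivAt_prodMk_right t _
    have h3 : V =ᶠ[𝓝 z] fun z => fderiv ℝ Y (t, z) (1, 0) := by
      have hYz : ContinuousAt (fun z : E × E => (t, z)) z := hmk.continuousAt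
      filter_upwards [hV, hYz (hDo.mem_nhds htD)] with z' hz' hzD
      rw [← hz', dchart_curveDeriv ((h.isGeodesicOn z' hzD.1.2).mdifferentiableAt isOpen_Ioo ht)
        hzD.2]
      exact (hasDerivAt_fst_slice (hYc.differentiableAt_of_isOpen hDo hzD)).deriv
    rw [h3.fderiv_eq]
    have h4 : HasFDerivAt (fun z => fderiv ℝ Y (t, z))
        ((fderiv ℝ (fderiv ℝ Y) (t, z)).comp (ContinuousLinearMap.inr ℝ ℝ (E × E))) z :=
      HasFDerivAt.comp (g := fderiv ℝ Y) (f := fun z : E × E => (t, z)) z hD2.hasFDerivAt hmk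
    have h5 := h4.clm_apply (hasFDerivAt_const ((1 : ℝ), (0 : E × E)) z)
    rw [h5.fderiv]
    simp

theorem dchart_covariantDeriv_zero (h : IsExpFlow c c' F δ N)
    (hp : p ∈ (extChartAt 𝓘(ℝ, E) c).source)
    (hz : tcoord c (⟨p, v⟩ : TangentBundle 𝓘(ℝ, E) M) ∈ N) (a : TangentSpace 𝓘(ℝ, E) p) :
    dchart c (geodesic p v 0) (covariantDeriv (geodesic p v) (jacobiField p v a) 0) =
      dchart c p a := by
  refine h.tcoord_covariantDeriv_jacobiField hp hz a h.zero_mem (h.apply_zero_mem_source hz)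
    (jacobiField_zero p v a) (V := Prod.snd) ?_ ?_
  · filter_upwards [h.isOpen.mem_nhds hz] with z hz
    exact h.dchart_curveDeriv_zero hz
  · rw [fderiv_snd]
    rfl

theorem dchart_covariantDeriv_one (h : IsExpFlow c c' F δ N)
    (hp : p ∈ (extChartAt 𝓘(ℝ, E) c).source)
    (hz : tcoord c (⟨p, v⟩ : TangentBundle 𝓘(ℝ, E) M) ∈ N) (a : TangentSpace 𝓘(ℝ, E) p)
    (ha : fderiv ℝ (expChart (E := E) c c') (tcoord c (⟨p, v⟩ : TangentBundle 𝓘(ℝ, E) M))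
      (0, dchart c p a) = 0) :
    dchart c' (geodesic p v 1) (covariantDeriv (geodesic p v) (jacobiField p v a) 1) =
      fderiv ℝ (fderiv ℝ (expChart (E := E) c c')) (tcoord c (⟨p, v⟩ : TangentBundle 𝓘(ℝ, E) M))
        (0, dchart c p a) (0, dchart c p v) := by
  refine h.tcoord_covariantDeriv_jacobiField hp hz a h.one_mem (h.mem_source _ hz)
    ((h.jacobiField_one_eq_zero_iff hp hz a).2 ha)
    (V := fun z => fderiv ℝ (expChart (E := E) c c') z (0, z.2)) ?_ ?_
  · filter_upwards [h.isOpen.mem_nhds hz] with z hz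
    exact h.dchart_curveDeriv_one hz
  · have hz2 : (tcoord c (⟨p, v⟩ : TangentBundle 𝓘(ℝ, E) M)).2 = dchart c p v :=
      congrArg Prod.snd (tcoord_apply (x := (⟨p, v⟩ : TangentBundle 𝓘(ℝ, E) M)) hp)
    have hd : DifferentiableAt ℝ (fderiv ℝ (expChart (E := E) c c'))
        (tcoord c (⟨p, v⟩ : TangentBundle 𝓘(ℝ, E) M)) :=
      (h.contDiffOn_expChart.fderiv_of_isOpen h.isOpen (m := ∞)
        (by simp)).differentiableAt_of_isOpen h.isOpen hz
    have h1 : HasFDerivAt (fun z : E × E => ((0 : E), z.2))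
        ((0 : E × E →L[ℝ] E).prod (ContinuousLinearMap.snd ℝ E E))
        (tcoord c (⟨p, v⟩ : TangentBundle 𝓘(ℝ, E) M)) :=
      (hasFDerivAt_const (0 : E) _).prodMk hasFDerivAt_snd
    rw [(hd.hasFDerivAt.clm_apply h1).fderiv, ← hz2]
    simp [ha]

end IsExpFlow

end JacobiCoordinates

/-! ### The conjugate locus and its tangent vectors in coordinates -/

section CurveCoordinates

variable {E : Type*} [NormedAddCommGroup E] [NormedSpace ℝ E]
  {M : Type*} [TopologicalSpace M] [ChartedSpace E M] [IsManifold 𝓘(ℝ, E) ∞ M]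

theorem hasDerivAt_chart_of_velocity_eq {γ : ℝ → M} {t : ℝ} {x c : M} {ξ : TangentSpace 𝓘(ℝ, E) x}
    (hγ : MDifferentiableAt 𝓘(ℝ, ℝ) 𝓘(ℝ, E) γ t) (hv : velocity E γ t = ⟨x, ξ⟩)
    (hx : x ∈ (extChartAt 𝓘(ℝ, E) c).source) :
    HasDerivAt (fun s => extChartAt 𝓘(ℝ, E) c (γ s)) (dchart c x ξ) t := by
  obtain rfl : γ t = x := congrArg TotalSpace.proj hv
  have hξ : curveDeriv E γ t = ξ := (TotalSpace.mk_inj).1 hv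
  have hd : DifferentiableAt ℝ (fun s => extChartAt 𝓘(ℝ, E) c (γ s)) t := by
    rw [← mdifferentiableAt_iff_differentiableAt]
    exact MDifferentiableAt.comp t (mdifferentiableAt_chart hx) hγ
  have := hd.hasDerivAt
  rwa [← dchart_curveDeriv hγ hx, hξ] at this

theorem velocity_chart_symm {y : ℝ → E} {s : Set ℝ} {t : ℝ} {c : M} {w : E} (hs : IsOpen s)
    (hy : ContDiffOn ℝ ∞ y s) (ht : t ∈ s) (h : MapsTo y s (extChartAt 𝓘(ℝ, E) c).target)
    (hw : HasDerivAt y w t) :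
    velocity E (fun t => (extChartAt 𝓘(ℝ, E) c).symm (y t)) t = (tcoord c).symm (y t, w) := by
  have hm := (contMDiffOn_chart_symm_comp hy h).mdifferentiableAt_of_isOpen hs ht
  have hsrc : (extChartAt 𝓘(ℝ, E) c).symm (y t) ∈ (extChartAt 𝓘(ℝ, E) c).source :=
    (extChartAt 𝓘(ℝ, E) c).map_target (h ht)
  have h1 := tcoord_velocity hm hsrc
  have h2 : (fun r => extChartAt 𝓘(ℝ, E) c ((extChartAt 𝓘(ℝ, E) c).symm (y r))) =ᶠ[𝓝 t] y := by
    filter_upwards [hs.mem_nhds ht] with r hr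
    exact (extChartAt 𝓘(ℝ, E) c).right_inv (h hr)
  rw [h2.deriv_eq, hw.deriv, (extChartAt 𝓘(ℝ, E) c).right_inv (h ht)] at h1
  rw [← h1]
  exact ((tcoord c).left_inv (mem_tcoord_source.2 hsrc)).symm

omit [IsManifold 𝓘(ℝ, E) ∞ M] in
/-- The velocity of a curve in `M × M`, in terms of the velocities of its components. -/
theorem mk_mfderiv_prodMk_eq_iff {γ₁ γ₂ : ℝ → M} {t : ℝ} {p q : M} {ξ : TangentSpace 𝓘(ℝ, E) p}
    {η : TangentSpace 𝓘(ℝ, E) q} (h₁ : MDifferentiableAt 𝓘(ℝ, ℝ) 𝓘(ℝ, E) γ₁ t)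
    (h₂ : MDifferentiableAt 𝓘(ℝ, ℝ) 𝓘(ℝ, E) γ₂ t) :
    (⟨(γ₁ t, γ₂ t), mfderiv 𝓘(ℝ, ℝ) (𝓘(ℝ, E).prod 𝓘(ℝ, E)) (fun t => (γ₁ t, γ₂ t)) t (1 : ℝ)⟩ :
      TangentBundle (𝓘(ℝ, E).prod 𝓘(ℝ, E)) (M × M)) = ⟨(p, q), ((ξ, η) : E × E)⟩ ↔
    velocity E γ₁ t = ⟨p, ξ⟩ ∧ velocity E γ₂ t = ⟨q, η⟩ := by
  have h3 := DFunLike.congr_fun (mfderiv_prodMk h₁ h₂) (1 : ℝ)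
  constructor
  · intro h
    obtain ⟨rfl, rfl⟩ := Prod.mk.inj (congrArg TotalSpace.proj h)
    have h4 := h3.symm.trans ((TotalSpace.mk_inj).1 h)
    exact ⟨congrArg (TotalSpace.mk' E _) (congrArg Prod.fst h4),
      congrArg (TotalSpace.mk' E _) (congrArg Prod.snd h4)⟩
  · rintro ⟨hv₁, hv₂⟩
    obtain rfl : γ₁ t = p := congrArg TotalSpace.proj hv₁
    obtain rfl : γ₂ t = q := congrArg TotalSpace.proj hv₂
    have e₁ := (TotalSpace.mk_inj).1 hv₁
    have e₂ := (TotalSpace.mk_inj).1 hv₂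
    refine congrArg (TotalSpace.mk' (E × E) _) (h3.trans ?_)
    exact Prod.ext e₁ e₂

end CurveCoordinates

namespace FoldForm

variable {E : Type*} [NormedAddCommGroup E] [NormedSpace ℝ E] {f : E × E → E} {z₀ : E × E}
  (Φ : FoldForm f z₀)

/-- Velocities of curves of critical values satisfy the linearised equation of the hypersurface of
critical values, hence come from velocities of critical points. -/
theorem fderiv_eq_of_curve {z : E × E} (hz : z ∈ Φ.Ω)
    (hcrit : fderiv ℝ f z (0, Φ.e z) = 0) {P : ℝ → E × E} {X : E × E} (hP : HasDerivAt P X 0)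
    (hP0 : P 0 = (z.1, f z)) (hev : ∀ᶠ t in 𝓝 (0 : ℝ), ∃ z' ∈ Φ.Ω,
      fderiv ℝ f z' (0, Φ.e z') = 0 ∧ P t = (z'.1, f z')) :
    fderiv ℝ f z (X.1, fderiv ℝ Φ.V (z.1, f z) X) = X.2 := by
  refine Φ.exists_fderiv_eq hz hcrit ?_
  have h1 : HasDerivAt (fun t => Φ.ℓ (P t).2) (Φ.ℓ X.2) 0 :=
    HasFDerivAt.comp_hasDerivAt (l := fun p : E × E => Φ.ℓ p.2) (f := P) 0
      (Φ.ℓ.hasFDerivAt.comp (P 0) hasFDerivAt_snd) hP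
  have h2 : HasDerivAt (fun t => Φ.H (P t)) (fderiv ℝ Φ.H (z.1, f z) X) 0 := by
    refine HasFDerivAt.comp_hasDerivAt (l := Φ.H) (f := P) 0 ?_ hP
    rw [hP0]
    exact Φ.contDiffOn_H.hasFDerivAt_of_isOpen Φ.isOpen_D (Φ.mem_D z hz)
  refine h1.unique (h2.congr_of_eventuallyEq ?_)
  filter_upwards [hev] with t ⟨z', hz', hc, hPt⟩
  rw [hPt]
  exact (Φ.H_eq_iff z' hz').2 hc

theorem e_ne_zero {z : E × E} (hz : z ∈ Φ.Ω) : Φ.e z ≠ 0 := by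
  intro h
  have := Φ.m_e z hz
  rw [h, map_zero] at this
  exact zero_ne_one this

theorem fderiv_e_eq_zero_of_ne_zero {z : E × E} (hz : z ∈ Φ.Ω) {a : E} (ha0 : a ≠ 0)
    (ha : fderiv ℝ f z (0, a) = 0) : fderiv ℝ f z (0, Φ.e z) = 0 := by
  have h1 := Φ.eq_smul_e z hz a ha
  have hm : Φ.m a ≠ 0 := by
    intro h0
    rw [h0, zero_smul] at h1
    exact ha0 h1
  have h2 : ((0 : E), a) = Φ.m a • ((0 : E), Φ.e z) := Prod.ext (by simp) h1
  rw [h2, map_smul, smul_eq_zero] at ha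
  exact ha.resolve_left hm

/-- Two points over the same base point with the same image coincide if one is critical. -/
theorem eq_of_apply_eq {z z' : E × E} (hz : z ∈ Φ.Ω) (hz' : z' ∈ Φ.Ω)
    (hcrit : fderiv ℝ f z (0, Φ.e z) = 0) (h1 : z'.1 = z.1) (h2 : f z' = f z) : z' = z := by
  have hcrit' : fderiv ℝ f z' (0, Φ.e z') = 0 := by
    rw [← Φ.H_eq_iff z' hz', h1, h2]
    exact (Φ.H_eq_iff z hz).2 hcrit
  refine Prod.ext h1 ?_
  rw [← Φ.V_apply z' hz' hcrit', ← Φ.V_apply z hz hcrit, h1, h2]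

end FoldForm

section ConjugateLocus

set_option synthInstance.maxHeartbeats 200000
set_option linter.unusedSectionVars false

variable {E : Type*} [NormedAddCommGroup E] [NormedSpace ℝ E]
  {M : Type*} [TopologicalSpace M] [ChartedSpace E M]
  [RiemannianBundle (fun x : M => TangentSpace 𝓘(ℝ, E) x)]
  [IsManifold 𝓘(ℝ, E) ∞ M] [FiniteDimensional ℝ E]
  [IsContMDiffRiemannianBundle 𝓘(ℝ, E) ∞ E (fun x : M => TangentSpace 𝓘(ℝ, E) x)]
  [T2Space M]

/-- A neighbourhood of a fold conjugate vector: coordinates in which the exponential map is smooth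
and has a fold normal form. -/
structure FoldChart (E : Type*) [NormedAddCommGroup E] [NormedSpace ℝ E]
    {M : Type*} [TopologicalSpace M] [ChartedSpace E M]
    [RiemannianBundle (fun x : M => TangentSpace 𝓘(ℝ, E) x)] [IsManifold 𝓘(ℝ, E) ∞ M]
    (c c' : M) (z₀ : E × E) where
  /-- The geodesic flow near the fold conjugate vector. -/
  F : ℝ × (E × E) → M
  /-- The flow is defined on the times `(-δ, 1 + δ)`. -/
  δ : ℝ
  /-- The initial data of the flow, in coordinates. -/
  N : Set (E × E)
  flow : IsExpFlow c c' F δ N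
  /-- The normal form of the exponential map. -/
  form : FoldForm (expChart (E := E) c c') z₀
  subset : form.Ω ⊆ N

namespace FoldChart

variable {c c' : M} {z₀ : E × E} (K : FoldChart E c c' z₀) {W : Set (TangentBundle 𝓘(ℝ, E) M)}

/-- The coordinate expression of the exponential map. -/
local notation "f" => expChart (E := E) c c'

theorem mem_target {z : E × E} (hz : z ∈ K.form.Ω) : z.1 ∈ (extChartAt 𝓘(ℝ, E) c).target :=
  K.flow.mem_target z (K.subset hz)

theorem expChart_mem_target {z : E × E} (hz : z ∈ K.form.Ω) :
    f z ∈ (extChartAt 𝓘(ℝ, E) c').target :=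
  K.flow.expChart_mem_target (K.subset hz)

theorem tcoord_tcoord_symm {z : E × E} (hz : z ∈ K.form.Ω) :
    tcoord c ((tcoord (E := E) c).symm z) = z :=
  (tcoord c).right_inv (mem_tcoord_target.2 (K.mem_target hz))

theorem isOpen_preimage (hW : IsOpen W) :
    IsOpen (K.form.Ω ∩ (tcoord (E := E) c).symm ⁻¹' W) :=
  (contMDiffOn_tcoord_symm.continuousOn.mono fun _ hz =>
    mem_tcoord_target.2 (K.mem_target hz)).isOpen_inter_preimage K.form.isOpen_Ω hW

theorem mem_tangentConjLocus_iff {p : M} {v : TangentSpace 𝓘(ℝ, E) p}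
    (hp : p ∈ (extChartAt 𝓘(ℝ, E) c).source)
    (hz : tcoord c (⟨p, v⟩ : TangentBundle 𝓘(ℝ, E) M) ∈ K.form.Ω) :
    v ∈ tangentConjLocus p ↔ fderiv ℝ f (tcoord c (⟨p, v⟩ : TangentBundle 𝓘(ℝ, E) M))
      (0, K.form.e (tcoord c (⟨p, v⟩ : TangentBundle 𝓘(ℝ, E) M))) = 0 := by
  rw [K.flow.mem_tangentConjLocus_iff hp (K.subset hz)]
  exact ⟨fun ⟨_, ha0, ha⟩ => K.form.fderiv_e_eq_zero_of_ne_zero hz ha0 ha,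
    fun h => ⟨_, K.form.e_ne_zero hz, h⟩⟩

/-- The assumption on an open set `W` of initial data to lie in the neighbourhood. -/
def Contains (W : Set (TangentBundle 𝓘(ℝ, E) M)) : Prop :=
  ∀ x ∈ W, x.1 ∈ (extChartAt 𝓘(ℝ, E) c).source ∧ tcoord c x ∈ K.form.Ω

variable {K}

theorem mem_conjLocusAt_iff (hW : K.Contains W) {p q : M} :
    q ∈ conjLocusAt W p ↔ ∃ z ∈ K.form.Ω, (tcoord c).symm z ∈ W ∧
      fderiv ℝ f z (0, K.form.e z) = 0 ∧ p = (extChartAt 𝓘(ℝ, E) c).symm z.1 ∧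
      q = (extChartAt 𝓘(ℝ, E) c').symm (f z) := by
  constructor
  · rintro ⟨v, hv, hvW, rfl⟩
    obtain ⟨hp, hz⟩ := hW _ hvW
    refine ⟨_, hz, ?_, (K.mem_tangentConjLocus_iff hp hz).1 hv, ?_, ?_⟩
    · rwa [(tcoord c).left_inv (mem_tcoord_source.2 hp)]
    · rw [tcoord_apply hp]
      exact ((extChartAt 𝓘(ℝ, E) c).left_inv hp).symm
    · rw [← K.flow.chart_riemannianExp hp (K.subset hz)]
      exact ((extChartAt 𝓘(ℝ, E) c').left_inv
        (K.flow.riemannianExp_mem_source hp (K.subset hz))).symm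
  · rintro ⟨z, hz, hzW, hcrit, rfl, rfl⟩
    have hzt := K.mem_target hz
    have hX := tcoord_symm_apply (z := z) hzt
    set p := (extChartAt 𝓘(ℝ, E) c).symm z.1 with hpdef
    have hp : p ∈ (extChartAt 𝓘(ℝ, E) c).source := (extChartAt 𝓘(ℝ, E) c).map_target hzt
    have hzz : tcoord c (⟨p, dchartSymm c z.1 z.2⟩ : TangentBundle 𝓘(ℝ, E) M) = z := by
      rw [← hX]
      exact K.tcoord_tcoord_symm hz
    refine ⟨dchartSymm c z.1 z.2, ?_, ?_, ?_⟩
    · rw [K.mem_tangentConjLocus_iff hp (by rwa [hzz]), hzz]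
      exact hcrit
    · rwa [← hX]
    · have h1 := K.flow.chart_riemannianExp hp (v := dchartSymm c z.1 z.2)
        (by rw [hzz]; exact K.subset hz)
      rw [hzz] at h1
      rw [← h1]
      exact (extChartAt 𝓘(ℝ, E) c').left_inv (K.flow.riemannianExp_mem_source hp
        (by rw [hzz]; exact K.subset hz))

/-- The tangent vectors to `Σ(p)` at `exp_p v` are the image of the differential of `exp_p`. -/
theorem tangentVectors_conjLocusAt (hW : K.Contains W) (hWo : IsOpen W) {p : M}
    {v : TangentSpace 𝓘(ℝ, E) p} (hv : v ∈ tangentConjLocus p)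
    (hvW : (⟨p, v⟩ : TangentBundle 𝓘(ℝ, E) M) ∈ W) :
    tangentVectors 𝓘(ℝ, E) (conjLocusAt W p) (riemannianExp p v) = range (dexp p v) := by
  obtain ⟨hp, hz⟩ := hW _ hvW
  have hcrit := (K.mem_tangentConjLocus_iff hp hz).1 hv
  have hzW : tcoord c (⟨p, v⟩ : TangentBundle 𝓘(ℝ, E) M) ∈
      K.form.Ω ∩ (tcoord (E := E) c).symm ⁻¹' W :=
    ⟨hz, by rwa [mem_preimage, (tcoord c).left_inv (mem_tcoord_source.2 hp)]⟩
  have hz1 : (tcoord c (⟨p, v⟩ : TangentBundle 𝓘(ℝ, E) M)).1 = extChartAt 𝓘(ℝ, E) c p := by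
    rw [tcoord_apply hp]
  have hq := K.flow.riemannianExp_mem_source hp (K.subset hz)
  have hfz := K.flow.chart_riemannianExp hp (K.subset hz)
  have hdexp := K.flow.dchart_dexp hp (K.subset hz)
  set z := tcoord c (⟨p, v⟩ : TangentBundle 𝓘(ℝ, E) M) with hzdef
  ext ζ
  constructor
  · rintro ⟨ε, γ, hε, hγ, hmem, hvel⟩
    have h0 : (0 : ℝ) ∈ Ioo (-ε) ε := ⟨neg_lt_zero.2 hε, hε⟩
    have hm := hγ.mdifferentiableAt_of_isOpen isOpen_Ioo h0
    have hd := hasDerivAt_chart_of_velocity_eq hm hvel hq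
    have hγ0 : γ 0 = riemannianExp p v := congrArg TotalSpace.proj hvel
    have h1 := K.form.fderiv_eq_of_curve hz hcrit
      (P := fun t => (z.1, extChartAt 𝓘(ℝ, E) c' (γ t)))
      ((hasDerivAt_const (0 : ℝ) z.1).prodMk hd) (by rw [hγ0, hfz]) (by
        filter_upwards [isOpen_Ioo.mem_nhds h0] with t ht
        obtain ⟨z', hz', -, hc', hp', hq'⟩ := (mem_conjLocusAt_iff hW).1 (hmem t ht)
        refine ⟨z', hz', hc', ?_⟩
        rw [hz1, hp', (extChartAt 𝓘(ℝ, E) c).right_inv (K.mem_target hz'), hq',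
          (extChartAt 𝓘(ℝ, E) c').right_inv (K.expChart_mem_target hz')])
    obtain ⟨a, ha⟩ := (bijective_dchart hp).2
      (fderiv ℝ K.form.V (z.1, f z) (0, dchart c' (riemannianExp p v) ζ))
    refine ⟨a, (bijective_dchart hq).1 ?_⟩
    rw [hdexp, ha]
    exact h1
  · rintro ⟨a, rfl⟩
    obtain ⟨ε, hε, u, hu, hmem, hu0, hder⟩ := K.form.exists_curve hz hcrit (0, dchart c p a)
      (K.isOpen_preimage hWo) hzW
    have h0 : (0 : ℝ) ∈ Ioo (-ε) ε := ⟨neg_lt_zero.2 hε, hε⟩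
    simp only [smul_zero, add_zero] at hmem hder
    have hys : ContDiffOn ℝ ∞ (fun t => f (z.1, u t)) (Ioo (-ε) ε) :=
      K.form.contDiffOn_f.comp (contDiffOn_const.prodMk hu) fun t ht => (hmem t ht).2.1
    have hyt : MapsTo (fun t => f (z.1, u t)) (Ioo (-ε) ε) (extChartAt 𝓘(ℝ, E) c').target :=
      fun t ht => K.expChart_mem_target (hmem t ht).2.1
    refine ⟨ε, fun t => (extChartAt 𝓘(ℝ, E) c').symm (f (z.1, u t)), hε,
      contMDiffOn_chart_symm_comp hys hyt, fun t ht => ?_, ?_⟩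
    · refine (mem_conjLocusAt_iff hW).2 ⟨_, (hmem t ht).2.1, (hmem t ht).1.2, (hmem t ht).2.2, ?_,
        rfl⟩
      simp only [hz1]
      exact ((extChartAt 𝓘(ℝ, E) c).left_inv hp).symm
    · refine (velocity_chart_symm isOpen_Ioo hys h0 hyt hder).trans ?_
      rw [hu0, ← hdexp]
      have h2 : f (z.1, z.2) = extChartAt 𝓘(ℝ, E) c' (riemannianExp p v) := hfz.symm
      rw [h2]
      have h3 := (tcoord c').left_inv (mem_tcoord_source.2 hq :
        (⟨riemannianExp p v, dexp p v a⟩ : TangentBundle 𝓘(ℝ, E) M) ∈ _)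
      rw [tcoord_apply hq] at h3
      exact h3

/-- The tangent vectors to `Σ` at `(p, exp_p v)` in coordinates: pairs `(Y₁, D exp Y)`. -/
theorem mem_tangentVectors_conjLocus_iff (hW : K.Contains W) (hWo : IsOpen W) {z : E × E}
    (hz : z ∈ K.form.Ω) (hzW : (tcoord c).symm z ∈ W) (hcrit : fderiv ℝ f z (0, K.form.e z) = 0)
    {p q : M} (hp : p ∈ (extChartAt 𝓘(ℝ, E) c).source) (hpz : extChartAt 𝓘(ℝ, E) c p = z.1)
    (hq : q ∈ (extChartAt 𝓘(ℝ, E) c').source) (hqz : extChartAt 𝓘(ℝ, E) c' q = f z)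
    (ξ : TangentSpace 𝓘(ℝ, E) p) (η : TangentSpace 𝓘(ℝ, E) q) :
    ((ξ, η) : E × E) ∈ tangentVectors (𝓘(ℝ, E).prod 𝓘(ℝ, E)) (conjLocus W) (p, q) ↔
      ∃ Y : E × E, dchart c p ξ = Y.1 ∧ dchart c' q η = fderiv ℝ f z Y := by
  constructor
  · rintro ⟨ε, γ, hε, hγ, hmem, hvel⟩
    have h0 : (0 : ℝ) ∈ Ioo (-ε) ε := ⟨neg_lt_zero.2 hε, hε⟩
    have hm : MDifferentiableAt 𝓘(ℝ, ℝ) (𝓘(ℝ, E).prod 𝓘(ℝ, E)) γ 0 :=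
      (hγ.contMDiffAt (isOpen_Ioo.mem_nhds h0)).mdifferentiableAt (by simp)
    have hm1 : MDifferentiableAt 𝓘(ℝ, ℝ) 𝓘(ℝ, E) (fun t => (γ t).1) 0 := hm.fst
    have hm2 : MDifferentiableAt 𝓘(ℝ, ℝ) 𝓘(ℝ, E) (fun t => (γ t).2) 0 := hm.snd
    obtain ⟨hv1, hv2⟩ := (mk_mfderiv_prodMk_eq_iff hm1 hm2).1 hvel
    have hd1 := hasDerivAt_chart_of_velocity_eq hm1 hv1 hp
    have hd2 := hasDerivAt_chart_of_velocity_eq hm2 hv2 hq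
    have hγ0 : γ 0 = (p, q) := congrArg TotalSpace.proj hvel
    have h1 := K.form.fderiv_eq_of_curve hz hcrit
      (P := fun t => (extChartAt 𝓘(ℝ, E) c (γ t).1, extChartAt 𝓘(ℝ, E) c' (γ t).2))
      (hd1.prodMk hd2) (by rw [hγ0, hpz, hqz]) (by
        filter_upwards [isOpen_Ioo.mem_nhds h0] with t ht
        obtain ⟨z', hz', -, hc', hp', hq'⟩ := (mem_conjLocusAt_iff hW).1 (hmem t ht)
        refine ⟨z', hz', hc', ?_⟩
        rw [hp', (extChartAt 𝓘(ℝ, E) c).right_inv (K.mem_target hz'), hq',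
          (extChartAt 𝓘(ℝ, E) c').right_inv (K.expChart_mem_target hz')])
    exact ⟨_, rfl, h1.symm⟩
  · rintro ⟨Y, hξ, hη⟩
    obtain ⟨ε, hε, u, hu, hmem, hu0, hder⟩ := K.form.exists_curve hz hcrit Y
      (K.isOpen_preimage hWo) ⟨hz, hzW⟩
    have h0 : (0 : ℝ) ∈ Ioo (-ε) ε := ⟨neg_lt_zero.2 hε, hε⟩
    have hxs : ContDiff ℝ ∞ fun t : ℝ => z.1 + t • Y.1 :=
      contDiff_const.add (contDiff_id.smul contDiff_const)
    have hxd : HasDerivAt (fun t : ℝ => z.1 + t • Y.1) Y.1 0 := by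
      simpa using ((hasDerivAt_id (0 : ℝ)).smul_const Y.1).const_add z.1
    have hxt : MapsTo (fun t : ℝ => z.1 + t • Y.1) (Ioo (-ε) ε) (extChartAt 𝓘(ℝ, E) c).target :=
      fun t ht => K.mem_target (hmem t ht).2.1
    have hys : ContDiffOn ℝ ∞ (fun t => f (z.1 + t • Y.1, u t)) (Ioo (-ε) ε) :=
      K.form.contDiffOn_f.comp (hxs.contDiffOn.prodMk hu) fun t ht => (hmem t ht).2.1
    have hyt : MapsTo (fun t => f (z.1 + t • Y.1, u t)) (Ioo (-ε) ε)
        (extChartAt 𝓘(ℝ, E) c').target :=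
      fun t ht => K.expChart_mem_target (hmem t ht).2.1
    have hc1 := contMDiffOn_chart_symm_comp hxs.contDiffOn hxt
    have hc2 := contMDiffOn_chart_symm_comp hys hyt
    refine ⟨ε, fun t => ((extChartAt 𝓘(ℝ, E) c).symm (z.1 + t • Y.1),
      (extChartAt 𝓘(ℝ, E) c').symm (f (z.1 + t • Y.1, u t))), hε, hc1.prodMk hc2,
      fun t ht => ?_, ?_⟩
    · exact (mem_conjLocusAt_iff hW).2 ⟨_, (hmem t ht).2.1, (hmem t ht).1.2, (hmem t ht).2.2, rfl,
        rfl⟩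
    · refine (mk_mfderiv_prodMk_eq_iff (hc1.mdifferentiableAt_of_isOpen isOpen_Ioo h0)
        (hc2.mdifferentiableAt_of_isOpen isOpen_Ioo h0)).2 ⟨?_, ?_⟩
      · rw [velocity_chart_symm isOpen_Ioo hxs.contDiffOn h0 hxt hxd, zero_smul, add_zero, ← hpz,
          ← hξ]
        have h3 := (tcoord c).left_inv (mem_tcoord_source.2 hp :
          (⟨p, ξ⟩ : TangentBundle 𝓘(ℝ, E) M) ∈ _)
        rw [tcoord_apply hp] at h3
        exact h3
      · rw [velocity_chart_symm isOpen_Ioo hys h0 hyt hder, zero_smul, add_zero, hu0, ← hη]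
        have h2 : f (z.1, z.2) = extChartAt 𝓘(ℝ, E) c' q := hqz.symm
        rw [h2]
        have h3 := (tcoord c').left_inv (mem_tcoord_source.2 hq :
          (⟨q, η⟩ : TangentBundle 𝓘(ℝ, E) M) ∈ _)
        rw [tcoord_apply hq] at h3
        exact h3

end FoldChart

end ConjugateLocus

/-! ### Reversal of geodesics and the orthogonal complement of the range of `dexp` -/

section Reversal

set_option synthInstance.maxHeartbeats 200000
set_option linter.unusedSectionVars false

variable {E : Type*} [NormedAddCommGroup E] [NormedSpace ℝ E]
  {M : Type*} [TopologicalSpace M] [ChartedSpace E M]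
  [RiemannianBundle (fun x : M => TangentSpace 𝓘(ℝ, E) x)]
  [IsManifold 𝓘(ℝ, E) ∞ M] [FiniteDimensional ℝ E]
  [IsContMDiffRiemannianBundle 𝓘(ℝ, E) ∞ E (fun x : M => TangentSpace 𝓘(ℝ, E) x)]
  [T2Space M]

namespace IsExpFlow

variable {c c' : M} {F F' : ℝ × (E × E) → M} {δ δ' : ℝ} {N N' : Set (E × E)}

/-- The derivative of the identity `exp_q (-γ'(1)) = p` for the reversed geodesics. -/
theorem fderiv_expChart_reverse (h : IsExpFlow c c' F δ N) (h' : IsExpFlow c' c F' δ' N')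
    {z : E × E} (hz : z ∈ N)
    (hz' : (expChart c c' z, -fderiv ℝ (expChart (E := E) c c') z (0, z.2)) ∈ N') (Y : E × E) :
    fderiv ℝ (expChart (E := E) c' c)
      (expChart c c' z, -fderiv ℝ (expChart (E := E) c c') z (0, z.2))
      (fderiv ℝ (expChart (E := E) c c') z Y,
        -(fderiv ℝ (fderiv ℝ (expChart (E := E) c c')) z Y (0, z.2) +
          fderiv ℝ (expChart (E := E) c c') z (0, Y.2))) = Y.1 := by
  have hd := (h.differentiableAt_expChart hz).hasFDerivAt
  have hd2 : DifferentiableAt ℝ (fderiv ℝ (expChart (E := E) c c')) z :=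
    (h.contDiffOn_expChart.fderiv_of_isOpen h.isOpen (m := ∞)
      (by simp)).differentiableAt_of_isOpen h.isOpen hz
  have h1 : HasFDerivAt (fun z : E × E => ((0 : E), z.2))
      ((0 : E × E →L[ℝ] E).prod (ContinuousLinearMap.snd ℝ E E)) z :=
    (hasFDerivAt_const (0 : E) _).prodMk hasFDerivAt_snd
  have hR := hd.prodMk (hd2.hasFDerivAt.clm_apply h1).neg
  have h2 := HasFDerivAt.comp (g := expChart (E := E) c' c) z
    (h'.differentiableAt_expChart hz').hasFDerivAt hR
  have h3 : HasFDerivAt (Prod.fst : E × E → E) _ z := h2.congr_of_eventuallyEq (by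
    filter_upwards [h.isOpen.mem_nhds hz] with w hw
    exact (h.expChart_reverse hw).symm)
  have h4 := DFunLike.congr_fun (h3.unique hasFDerivAt_fst) Y
  rw [ContinuousLinearMap.coe_fst'] at h4
  rw [← h4]
  simp [add_comm]

/-- The final derivative of a Jacobi field vanishing at both ends is a conjugate direction for the
reversed geodesic. -/
theorem fderiv_expChart_reverse_eq_zero (h : IsExpFlow c c' F δ N)
    (h' : IsExpFlow c' c F' δ' N') {z : E × E} (hz : z ∈ N)
    (hz' : (expChart c c' z, -fderiv ℝ (expChart (E := E) c c') z (0, z.2)) ∈ N') {a : E}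
    (ha : fderiv ℝ (expChart (E := E) c c') z (0, a) = 0) :
    fderiv ℝ (expChart (E := E) c' c)
      (expChart c c' z, -fderiv ℝ (expChart (E := E) c c') z (0, z.2))
      (0, fderiv ℝ (fderiv ℝ (expChart (E := E) c c')) z (0, a) (0, z.2)) = 0 := by
  have h1 := h.fderiv_expChart_reverse h' hz hz' (0, a)
  simp only [ha, add_zero] at h1
  rw [show ((0 : E), -fderiv ℝ (fderiv ℝ (expChart (E := E) c c')) z (0, a) (0, z.2)) =
    -((0 : E), fderiv ℝ (fderiv ℝ (expChart (E := E) c c')) z (0, a) (0, z.2)) by simp, map_neg,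
    neg_eq_zero] at h1
  exact h1

/-- The conjugate directions of the reversed geodesic are orthogonal to the range of the
differential of the exponential map. -/
theorem chartMetric_fderiv_expChart_eq_zero (h : IsExpFlow c c' F δ N)
    (h' : IsExpFlow c' c F' δ' N') {z : E × E} (hz : z ∈ N)
    (hz' : (expChart c c' z, -fderiv ℝ (expChart (E := E) c c') z (0, z.2)) ∈ N') {b : E}
    (hb : fderiv ℝ (expChart (E := E) c' c)
      (expChart c c' z, -fderiv ℝ (expChart (E := E) c c') z (0, z.2)) (0, b) = 0) (a : E) :
    chartMetric c' (expChart c c' z) b (fderiv ℝ (expChart (E := E) c c') z (0, a)) = 0 := by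
  have h1 := h'.chartMetric_fderiv_fderiv_expChart hz' hb
    (fderiv ℝ (expChart (E := E) c c') z (0, a),
      -(fderiv ℝ (fderiv ℝ (expChart (E := E) c c')) z (0, a) (0, z.2) +
        fderiv ℝ (expChart (E := E) c c') z (0, a)))
  rw [h.fderiv_expChart_reverse h' hz hz' (0, a), map_zero] at h1
  exact h1.symm

/-- At a conjugate vector, the orthogonal complement of the range of `dexp` is the kernel of the
differential of the exponential map for the reversed geodesic. The inclusion `⊇` is
`chartMetric_fderiv_expChart_eq_zero`; the two sides have the same dimension, since
`J'(0) ↦ J'(1)` embeds the kernel of `dexp` in the right hand side. -/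
theorem orthogonal_range_dexp (h : IsExpFlow c c' F δ N) {p : M} {v : TangentSpace 𝓘(ℝ, E) p}
    (hp : p ∈ (extChartAt 𝓘(ℝ, E) c).source)
    (hz : tcoord c (⟨p, v⟩ : TangentBundle 𝓘(ℝ, E) M) ∈ N)
    {w : TangentSpace 𝓘(ℝ, E) (riemannianExp p v)}
    (hw : velocity E (geodesic p v) 1 = ⟨riemannianExp p v, -w⟩) :
    (LinearMap.range (dexp p v).toLinearMap)ᗮ = conjKernel (riemannianExp p v) w := by
  have hq := h.riemannianExp_mem_source hp hz
  have hfz := h.chart_riemannianExp hp hz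
  have hker := h.dexp_eq_zero_iff hp hz
  have hdexp := h.dchart_dexp hp hz
  have hvel : velocity E (geodesic p v) 1 =
      velocity E (fun t => F (t, tcoord c (⟨p, v⟩ : TangentBundle 𝓘(ℝ, E) M))) 1 := by
    refine velocity_congr ?_
    filter_upwards [isOpen_Ioo.mem_nhds h.one_mem] with t ht
    exact h.geodesic_eq_of_mem hp hz ht
  have hv1 := h.tcoord_velocity_one hz
  rw [← hvel, hw, tcoord_apply (by exact hq)] at hv1
  set z := tcoord c (⟨p, v⟩ : TangentBundle 𝓘(ℝ, E) M) with hzdef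
  have hw2 : dchart c' (riemannianExp p v) w = -fderiv ℝ (expChart (E := E) c c') z (0, z.2) := by
    have h1 : dchart c' (riemannianExp p v) (-w) = fderiv ℝ (expChart (E := E) c c') z (0, z.2) :=
      congrArg Prod.snd hv1
    rw [← h1, map_neg, neg_neg]
  have hzw : tcoord c' (⟨(riemannianExp p v), w⟩ : TangentBundle 𝓘(ℝ, E) M) =
      (expChart c c' z, -fderiv ℝ (expChart (E := E) c c') z (0, z.2)) := by
    rw [tcoord_apply (by exact hq), hfz, ← hw2]
  have hrev := h.exists_isGeodesicFrom_reverse hz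
  rw [← hzw, (tcoord c').left_inv (mem_tcoord_source.2 hq)] at hrev
  have hsrc : riemannianExp (riemannianExp p v) w ∈ (extChartAt 𝓘(ℝ, E) c).source := by
    rw [hrev.riemannianExp_eq, show (-1 : ℝ) * 1 + 1 = 0 by ring]
    exact h.apply_zero_mem_source hz
  obtain ⟨δ', N', F', h', hz'⟩ := exists_isExpFlow ⟨_, hrev⟩ hq hsrc
  have hker' := h'.dexp_eq_zero_iff hq hz'
  rw [hzw] at hz' hker'
  have hfd : FiniteDimensional ℝ (TangentSpace 𝓘(ℝ, E) p) := inferInstanceAs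
    (FiniteDimensional ℝ E)
  have hfd' : FiniteDimensional ℝ (TangentSpace 𝓘(ℝ, E) (riemannianExp p v)) := inferInstanceAs
    (FiniteDimensional ℝ E)
  have hle : conjKernel (riemannianExp p v) w ≤ (LinearMap.range (dexp p v).toLinearMap)ᗮ := by
    intro b hb
    rw [Submodule.mem_orthogonal]
    rintro _ ⟨a, rfl⟩
    rw [real_inner_comm, inner_eq_chartMetric hq, hfz]
    have h1 : dchart c' (riemannianExp p v) ((dexp p v).toLinearMap a) =
      fderiv ℝ (expChart (E := E) c c') z (0, dchart c p a) := hdexp a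
    rw [h1]
    exact h.chartMetric_fderiv_expChart_eq_zero h' hz hz' ((hker' b).1 hb) _
  refine (Submodule.eq_of_le_of_finrank_le hle ?_).symm
  set L := LinearEquiv.ofBijective (dchart c' (riemannianExp p v)).toLinearMap
    (bijective_dchart hq) with hL
  have hLs : ∀ y, dchart c' (riemannianExp p v) (L.symm y) = y := fun y => L.apply_symm_apply y
  set B : TangentSpace 𝓘(ℝ, E) p →ₗ[ℝ] TangentSpace 𝓘(ℝ, E) (riemannianExp p v) :=
    L.symm.toLinearMap ∘ₗ
    (((fderiv ℝ (fderiv ℝ (expChart (E := E) c c')) z).flip (0, z.2)).toLinearMap ∘ₗ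
      ((LinearMap.inr ℝ E E) ∘ₗ (dchart c p).toLinearMap)) with hB
  have hBa : ∀ a, dchart c' (riemannianExp p v) (B a) =
      fderiv ℝ (fderiv ℝ (expChart (E := E) c c')) z (0, dchart c p a) (0, z.2) :=
    fun a => hLs _
  have hmaps : ∀ a ∈ LinearMap.ker (dexp p v).toLinearMap,
      B a ∈ conjKernel (riemannianExp p v) w := by
    intro a ha
    refine (hker' (B a)).2 ?_
    rw [hBa]
    exact h.fderiv_expChart_reverse_eq_zero h' hz hz' ((hker a).1 ha)
  have hinj : Function.Injective (B.restrict hmaps) := by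
    rw [injective_iff_map_eq_zero]
    rintro ⟨a, ha⟩ hBz
    have h1 : B a = 0 := congrArg Subtype.val hBz
    have h2 := hBa a
    rw [h1, map_zero] at h2
    by_contra hne
    refine h.fderiv_fderiv_ne_zero hz ((hker a).1 ha) (fun h0 => hne ?_) h2.symm
    exact Subtype.ext ((bijective_dchart hp).1 (h0.trans (map_zero _).symm))
  have h1 := LinearMap.finrank_le_finrank_of_injective hinj
  have h2 := (LinearMap.range (dexp p v).toLinearMap).finrank_add_finrank_orthogonal
  have h3 := (dexp p v).toLinearMap.finrank_range_add_finrank_ker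
  have h4 : Module.finrank ℝ (TangentSpace 𝓘(ℝ, E) p) =
    Module.finrank ℝ (TangentSpace 𝓘(ℝ, E) (riemannianExp p v)) := rfl
  have h5 : Module.finrank ℝ (LinearMap.ker (dexp p v).toLinearMap) =
    Module.finrank ℝ ↥(LinearMap.ker (dexp p v).toLinearMap) := rfl
  linarith

end IsExpFlow

namespace FoldChart

variable {c c' : M} {z₀ : E × E} {K : FoldChart E c c' z₀} {W : Set (TangentBundle 𝓘(ℝ, E) M)}

theorem exists_submodule_eq_tangentVectors (hW : K.Contains W) (hWo : IsOpen W) {p q : M}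
    {v : TangentSpace 𝓘(ℝ, E) p} {w : TangentSpace 𝓘(ℝ, E) q} (hv : v ∈ tangentConjLocus p)
    (hvW : (⟨p, v⟩ : TangentBundle 𝓘(ℝ, E) M) ∈ W)
    (hw : velocity E (geodesic p v) 1 = ⟨q, -w⟩) :
    ∃ T : Submodule ℝ (TangentSpace 𝓘(ℝ, E) q),
      (T : Set (TangentSpace 𝓘(ℝ, E) q)) = tangentVectors 𝓘(ℝ, E) (conjLocusAt W p) q ∧
      IsCompl T (conjKernel q w) ∧ Tᗮ = conjKernel q w := by
  obtain ⟨hp, hz⟩ := hW _ hvW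
  have hq : riemannianExp p v = q := by
    have h1 : geodesic p v 1 = q := congrArg TotalSpace.proj hw
    rwa [geodesic, one_smul] at h1
  subst hq
  have horth := K.flow.orthogonal_range_dexp hp (K.subset hz) hw
  have hfd : FiniteDimensional ℝ (TangentSpace 𝓘(ℝ, E) (riemannianExp p v)) := inferInstanceAs
    (FiniteDimensional ℝ E)
  refine ⟨LinearMap.range (dexp p v).toLinearMap, ?_, ?_, horth⟩
  · rw [tangentVectors_conjLocusAt hW hWo hv hvW]
    rfl
  · rw [← horth]
    exact (LinearMap.range (dexp p v).toLinearMap).isCompl_orthogonal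

end FoldChart

end Reversal

/-! ### The normal bundle of the conjugate locus in coordinates -/

section NormalBundle

set_option synthInstance.maxHeartbeats 200000
set_option linter.unusedSectionVars false

variable {E : Type*} [NormedAddCommGroup E] [NormedSpace ℝ E]
  {M : Type*} [TopologicalSpace M] [ChartedSpace E M] [IsManifold 𝓘(ℝ, E) ∞ M]

theorem eq_tcoord_symm_iff {c p : M} {a : TangentSpace 𝓘(ℝ, E) p} {y b : E}
    (hp : p ∈ (extChartAt 𝓘(ℝ, E) c).source) (hy : y ∈ (extChartAt 𝓘(ℝ, E) c).target) :
    (⟨p, a⟩ : TangentBundle 𝓘(ℝ, E) M) = (tcoord c).symm (y, b) ↔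
      extChartAt 𝓘(ℝ, E) c p = y ∧ dchart c p a = b := by
  rw [(tcoord c).eq_symm_apply (mem_tcoord_source.2 hp) (mem_tcoord_target.2 hy),
    tcoord_apply (by exact hp), Prod.mk_inj]

theorem tcoord_symm_snd_eq_zero_iff {c : M} {y b : E}
    (hy : y ∈ (extChartAt 𝓘(ℝ, E) c).target) : ((tcoord c).symm (y, b)).2 = 0 ↔ b = 0 := by
  have h1 : dchart c ((tcoord c).symm (y, b)).1 ((tcoord c).symm (y, b)).2 = b := by
    have h2 := tcoord_apply (c := c) (x := (tcoord c).symm (y, b))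
      (mem_tcoord_source.1 ((tcoord c).map_target (mem_tcoord_target.2 hy)))
    rw [(tcoord c).right_inv (mem_tcoord_target.2 hy)] at h2
    exact (congrArg Prod.snd h2).symm
  constructor
  · intro h
    rw [← h1, h, map_zero]
  · intro h
    exact (bijective_dchart (mem_tcoord_source.1
      ((tcoord c).map_target (mem_tcoord_target.2 hy)))).1 ((h1.trans h).trans (map_zero _).symm)

variable [RiemannianBundle (fun x : M => TangentSpace 𝓘(ℝ, E) x)] [FiniteDimensional ℝ E]
  [IsContMDiffRiemannianBundle 𝓘(ℝ, E) ∞ E (fun x : M => TangentSpace 𝓘(ℝ, E) x)]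
  [T2Space M]

namespace FoldChart

variable {c c' : M} {z₀ : E × E} {K : FoldChart E c c' z₀} {W : Set (TangentBundle 𝓘(ℝ, E) M)}

/-- The coordinate expression of the exponential map. -/
local notation "f" => expChart (E := E) c c'

variable (K) in
theorem chartMetric_β {z : E × E} (hz : z ∈ K.form.Ω) (hcrit : fderiv ℝ f z (0, K.form.e z) = 0)
    (Y : E × E) : chartMetric c' (f z) (K.form.β z) (fderiv ℝ f z Y) =
      chartMetric c z.1 (K.form.e z) Y.1 :=
  K.flow.chartMetric_fderiv_fderiv_expChart (K.subset hz) hcrit Y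

/-- A conjugate vector in the neighbourhood is determined by its base point and its image. -/
theorem eq_of_riemannianExp_eq (hW : K.Contains W) {p : M} {v v' : TangentSpace 𝓘(ℝ, E) p}
    (hv : v ∈ tangentConjLocus p) (hvW : (⟨p, v⟩ : TangentBundle 𝓘(ℝ, E) M) ∈ W)
    (hvW' : (⟨p, v'⟩ : TangentBundle 𝓘(ℝ, E) M) ∈ W)
    (h : riemannianExp p v' = riemannianExp p v) : v' = v := by
  obtain ⟨hp, hz⟩ := hW _ hvW
  obtain ⟨hp', hz'⟩ := hW _ hvW'
  have h1 := K.flow.chart_riemannianExp hp (K.subset hz)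
  rw [← h, K.flow.chart_riemannianExp hp (K.subset hz')] at h1
  have h2 := K.form.eq_of_apply_eq hz hz' ((K.mem_tangentConjLocus_iff hp hz).1 hv)
    (by rw [tcoord_apply (by exact hp), tcoord_apply (by exact hp)]) h1
  have h3 : (⟨p, v'⟩ : TangentBundle 𝓘(ℝ, E) M) = ⟨p, v⟩ :=
    (tcoord c).injOn (mem_tcoord_source.2 hp') (mem_tcoord_source.2 hp) h2
  exact TotalSpace.mk_inj.1 h3

/-- The normal bundle in coordinates: the conormal vectors at `(p, exp_p v)` are the multiples of
`(e, -β)`. -/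
theorem mem_normalBundle_iff (hW : K.Contains W) (hWo : IsOpen W)
    {X : TangentBundle 𝓘(ℝ, E) M × TangentBundle 𝓘(ℝ, E) M} :
    X ∈ normalBundle W ↔ ∃ z ∈ K.form.Ω, (tcoord c).symm z ∈ W ∧
      fderiv ℝ f z (0, K.form.e z) = 0 ∧ ∃ r : ℝ, X.1 = (tcoord c).symm (z.1, r • K.form.e z) ∧
        X.2 = (tcoord c').symm (f z, -(r • K.form.β z)) := by
  have key : ∀ (p q : M) (a : TangentSpace 𝓘(ℝ, E) p) (b : TangentSpace 𝓘(ℝ, E) q),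
      ∀ z ∈ K.form.Ω, (tcoord c).symm z ∈ W → fderiv ℝ f z (0, K.form.e z) = 0 →
      p ∈ (extChartAt 𝓘(ℝ, E) c).source → extChartAt 𝓘(ℝ, E) c p = z.1 →
      q ∈ (extChartAt 𝓘(ℝ, E) c').source → extChartAt 𝓘(ℝ, E) c' q = f z →
      ((∀ (ξ : TangentSpace 𝓘(ℝ, E) p) (η : TangentSpace 𝓘(ℝ, E) q), ((ξ, η) : E × E) ∈
        tangentVectors (𝓘(ℝ, E).prod 𝓘(ℝ, E)) (conjLocus W) (p, q) →
        inner ℝ a ξ + inner ℝ b η = 0) ↔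
        ∃ r : ℝ, dchart c p a = r • K.form.e z ∧ dchart c' q b = -(r • K.form.β z)) := by
    intro p q a b z hz hzW hcrit hp hpz hq hqz
    rw [← K.form.conormal_iff (G₁ := chartMetric c) (G₂ := chartMetric c')
      (fun z hz a ha => chartMetric_pos (K.mem_target hz) ha)
      (fun z hz a ha => chartMetric_pos (K.expChart_mem_target hz) ha)
      (fun z hz => K.chartMetric_β hz) hz hcrit]
    constructor
    · intro h Y
      obtain ⟨ξ, hξ⟩ := (bijective_dchart hp).2 Y.1
      obtain ⟨η, hη⟩ := (bijective_dchart hq).2 (fderiv ℝ f z Y)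
      have h1 := h ξ η ((mem_tangentVectors_conjLocus_iff hW hWo hz hzW hcrit hp hpz hq hqz ξ η).2
        ⟨Y, hξ, hη⟩)
      rwa [inner_eq_chartMetric hp, inner_eq_chartMetric hq, hpz, hqz, hξ, hη] at h1
    · intro h ξ η hξη
      obtain ⟨Y, hξ, hη⟩ :=
        (mem_tangentVectors_conjLocus_iff hW hWo hz hzW hcrit hp hpz hq hqz ξ η).1 hξη
      rw [inner_eq_chartMetric hp, inner_eq_chartMetric hq, hpz, hqz, hξ, hη]
      exact h Y
  obtain ⟨⟨p, a⟩, ⟨q, b⟩⟩ := X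
  constructor
  · rintro ⟨hpq, horth⟩
    obtain ⟨z, hz, hzW, hcrit, hp', hq'⟩ := (mem_conjLocusAt_iff hW).1 hpq
    replace hp' : p = (extChartAt 𝓘(ℝ, E) c).symm z.1 := hp'
    replace hq' : q = (extChartAt 𝓘(ℝ, E) c').symm (f z) := hq'
    have hzt := K.mem_target hz
    have hfzt := K.expChart_mem_target hz
    have hp : p ∈ (extChartAt 𝓘(ℝ, E) c).source := hp' ▸ (extChartAt 𝓘(ℝ, E) c).map_target hzt
    have hq : q ∈ (extChartAt 𝓘(ℝ, E) c').source :=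
      hq' ▸ (extChartAt 𝓘(ℝ, E) c').map_target hfzt
    have hpz : extChartAt 𝓘(ℝ, E) c p = z.1 := hp' ▸ (extChartAt 𝓘(ℝ, E) c).right_inv hzt
    have hqz : extChartAt 𝓘(ℝ, E) c' q = f z := hq' ▸ (extChartAt 𝓘(ℝ, E) c').right_inv hfzt
    obtain ⟨r, ha, hb⟩ := (key p q a b z hz hzW hcrit hp hpz hq hqz).1 horth
    exact ⟨z, hz, hzW, hcrit, r, (eq_tcoord_symm_iff hp hzt).2 ⟨hpz, ha⟩,
      (eq_tcoord_symm_iff hq hfzt).2 ⟨hqz, hb⟩⟩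
  · rintro ⟨z, hz, hzW, hcrit, r, h1, h2⟩
    replace h1 : (⟨p, a⟩ : TangentBundle 𝓘(ℝ, E) M) = (tcoord c).symm (z.1, r • K.form.e z) := h1
    replace h2 : (⟨q, b⟩ : TangentBundle 𝓘(ℝ, E) M) =
      (tcoord c').symm (f z, -(r • K.form.β z)) := h2
    have hzt := K.mem_target hz
    have hfzt := K.expChart_mem_target hz
    have hp' : p = (extChartAt 𝓘(ℝ, E) c).symm z.1 := by
      rw [tcoord_symm_apply (by exact hzt)] at h1
      exact congrArg TotalSpace.proj h1
    have hq' : q = (extChartAt 𝓘(ℝ, E) c').symm (f z) := by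
      rw [tcoord_symm_apply (by exact hfzt)] at h2
      exact congrArg TotalSpace.proj h2
    have hp : p ∈ (extChartAt 𝓘(ℝ, E) c).source := hp' ▸ (extChartAt 𝓘(ℝ, E) c).map_target hzt
    have hq : q ∈ (extChartAt 𝓘(ℝ, E) c').source :=
      hq' ▸ (extChartAt 𝓘(ℝ, E) c').map_target hfzt
    obtain ⟨hpz, ha⟩ := (eq_tcoord_symm_iff hp hzt).1 h1
    obtain ⟨hqz, hb⟩ := (eq_tcoord_symm_iff hq hfzt).1 h2
    exact ⟨(mem_conjLocusAt_iff hW).2 ⟨z, hz, hzW, hcrit, hp', hq'⟩,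
      (key p q a b z hz hzW hcrit hp hpz hq hqz).2 ⟨r, ha, hb⟩⟩

/-- The pairs of initial and final derivatives of Jacobi fields have the same description in
coordinates as the normal bundle. -/
theorem mem_jacobiPairs_iff (hW : K.Contains W)
    {X : TangentBundle 𝓘(ℝ, E) M × TangentBundle 𝓘(ℝ, E) M} :
    X ∈ jacobiPairs W ↔ ∃ z ∈ K.form.Ω, (tcoord c).symm z ∈ W ∧
      fderiv ℝ f z (0, K.form.e z) = 0 ∧ ∃ r : ℝ, X.1 = (tcoord c).symm (z.1, r • K.form.e z) ∧
        X.2 = (tcoord c').symm (f z, -(r • K.form.β z)) := by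
  have key : ∀ (p : M) (v a : TangentSpace 𝓘(ℝ, E) p) (r : ℝ),
      p ∈ (extChartAt 𝓘(ℝ, E) c).source →
      tcoord c (⟨p, v⟩ : TangentBundle 𝓘(ℝ, E) M) ∈ K.form.Ω →
      fderiv ℝ f (tcoord c (⟨p, v⟩ : TangentBundle 𝓘(ℝ, E) M)) (0, dchart c p a) = 0 →
      dchart c p a = r • K.form.e (tcoord c (⟨p, v⟩ : TangentBundle 𝓘(ℝ, E) M)) →
      (⟨geodesic p v 0, covariantDeriv (geodesic p v) (jacobiField p v a) 0⟩ :
        TangentBundle 𝓘(ℝ, E) M) = (tcoord c).symm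
        ((tcoord c (⟨p, v⟩ : TangentBundle 𝓘(ℝ, E) M)).1,
          r • K.form.e (tcoord c (⟨p, v⟩ : TangentBundle 𝓘(ℝ, E) M))) ∧
      (⟨geodesic p v 1, -covariantDeriv (geodesic p v) (jacobiField p v a) 1⟩ :
        TangentBundle 𝓘(ℝ, E) M) = (tcoord c').symm
        (f (tcoord c (⟨p, v⟩ : TangentBundle 𝓘(ℝ, E) M)),
          -(r • K.form.β (tcoord c (⟨p, v⟩ : TangentBundle 𝓘(ℝ, E) M)))) := by
    intro p v a r hp hz ha har
    have hzN := K.subset hz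
    have h0 := K.flow.dchart_covariantDeriv_zero hp hzN a
    have h1 := K.flow.dchart_covariantDeriv_one hp hzN a ha
    have g0 := K.flow.geodesic_eq_of_mem hp hzN K.flow.zero_mem
    have g1 := K.flow.geodesic_eq_of_mem hp hzN K.flow.one_mem
    have hs0 := K.flow.apply_zero_mem_source hzN
    have hs1 := K.flow.mem_source _ hzN
    have hz2 : dchart c p v = (tcoord c (⟨p, v⟩ : TangentBundle 𝓘(ℝ, E) M)).2 := by
      rw [tcoord_apply (by exact hp)]
    constructor
    · refine (eq_tcoord_symm_iff (g0 ▸ hs0) (K.mem_target hz)).2 ⟨?_, ?_⟩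
      · rw [g0, K.flow.apply_zero hzN]
        exact (extChartAt 𝓘(ℝ, E) c).right_inv (K.mem_target hz)
      · exact h0.trans har
    · refine (eq_tcoord_symm_iff (g1 ▸ hs1) (K.expChart_mem_target hz)).2 ⟨?_, ?_⟩
      · rw [g1]
        exact (K.flow.expChart_eq hzN).symm
      · rw [map_neg, h1, hz2, har, FoldForm.β]
        congr 1
        rw [show ((0 : E), r • K.form.e (tcoord c (⟨p, v⟩ : TangentBundle 𝓘(ℝ, E) M))) =
          r • ((0 : E), K.form.e (tcoord c (⟨p, v⟩ : TangentBundle 𝓘(ℝ, E) M))) by simp, map_smul]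
        rfl
  constructor
  · rintro ⟨p, v, a, hv, hvW, -, hJ, hX1, hX2⟩
    obtain ⟨hp, hz⟩ := hW _ hvW
    have ha := (K.flow.jacobiField_one_eq_zero_iff hp (K.subset hz) a).1 hJ
    have har := K.form.eq_smul_e _ hz _ ha
    obtain ⟨k1, k2⟩ := key p v a _ hp hz ha har
    refine ⟨_, hz, ?_, (K.mem_tangentConjLocus_iff hp hz).1 hv, _, hX1.trans k1, hX2.trans k2⟩
    rwa [(tcoord c).left_inv (mem_tcoord_source.2 hp)]
  · rintro ⟨z, hz, hzW, hcrit, r, hX1, hX2⟩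
    obtain ⟨⟨p, v⟩, hx⟩ : ∃ x, x = (tcoord c).symm z := ⟨_, rfl⟩
    rw [← hx] at hzW
    have hp := (hW _ hzW).1
    have hzz : tcoord c (⟨p, v⟩ : TangentBundle 𝓘(ℝ, E) M) = z := by
      rw [hx]
      exact K.tcoord_tcoord_symm hz
    subst hzz
    obtain ⟨a, ha⟩ := (bijective_dchart hp).2 (r • K.form.e (tcoord c ⟨p, v⟩))
    have ha0 : fderiv ℝ f (tcoord c (⟨p, v⟩ : TangentBundle 𝓘(ℝ, E) M)) (0, dchart c p a) = 0 := by
      rw [ha, show ((0 : E), r • K.form.e (tcoord c (⟨p, v⟩ : TangentBundle 𝓘(ℝ, E) M))) =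
        r • ((0 : E), K.form.e (tcoord c (⟨p, v⟩ : TangentBundle 𝓘(ℝ, E) M))) by simp, map_smul,
        hcrit, smul_zero]
    obtain ⟨k1, k2⟩ := key p v a r hp hz ha0 ha
    exact ⟨p, v, a, (K.mem_tangentConjLocus_iff hp hz).2 hcrit, hzW, IsExpFlow.jacobiField_zero p v a,
      (K.flow.jacobiField_one_eq_zero_iff hp (K.subset hz) a).2 ha0, hX1.trans k1.symm,
      hX2.trans k2.symm⟩

theorem normalBundle_eq_jacobiPairs (hW : K.Contains W) (hWo : IsOpen W) :
    normalBundle W = jacobiPairs W := by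
  ext X
  rw [mem_normalBundle_iff hW hWo, mem_jacobiPairs_iff hW]

/-- The parametrisation of the nonzero conormal vectors by an open subset of `E × E`. -/
theorem mem_puncturedNormalBundle_iff (hW : K.Contains W) (hWo : IsOpen W)
    {X : TangentBundle 𝓘(ℝ, E) M × TangentBundle 𝓘(ℝ, E) M} :
    X ∈ puncturedNormalBundle W ↔ ∃ p ∈ K.form.D, (tcoord c).symm (K.form.Z p) ∈ W ∧
      K.form.ℓ p.2 ≠ 0 ∧ X.1 = (tcoord c).symm (K.form.Ψ₁ p) ∧
        X.2 = (tcoord c').symm (K.form.Ψ₂ p) := by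
  have key : ∀ z ∈ K.form.Ω, ∀ r : ℝ, X.1 = (tcoord c).symm (z.1, r • K.form.e z) →
      X.2 = (tcoord c').symm (f z, -(r • K.form.β z)) →
      ((X.1.snd ≠ 0 ∨ X.2.snd ≠ 0) ↔ r ≠ 0) := by
    intro z hz r h1 h2
    rw [h1, h2, ne_eq, ne_eq, tcoord_symm_snd_eq_zero_iff (K.mem_target hz),
      tcoord_symm_snd_eq_zero_iff (K.expChart_mem_target hz)]
    simp only [neg_eq_zero, smul_eq_zero, K.form.e_ne_zero hz, or_false]
    tauto
  constructor
  · rintro ⟨hX, hne⟩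
    obtain ⟨z, hz, hzW, hcrit, r, h1, h2⟩ := (mem_normalBundle_iff hW hWo).1 hX
    refine ⟨K.form.param z r, K.form.param_mem hz r, ?_, ?_, ?_, ?_⟩
    · rwa [K.form.Z_param hz hcrit]
    · rw [K.form.ℓ_param]
      exact (key z hz r h1 h2).1 hne
    · rwa [K.form.Ψ₁_param hz hcrit]
    · rwa [K.form.Ψ₂_param hz hcrit]
  · rintro ⟨p, hp, hpW, hr, h1, h2⟩
    have h2' : X.2 = (tcoord c').symm
        (f (K.form.Z p), -(K.form.ℓ p.2 • K.form.β (K.form.Z p))) := by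
      rw [K.form.f_Z hp]
      exact h2
    exact ⟨(mem_normalBundle_iff hW hWo).2 ⟨_, K.form.Z_mem hp, hpW, K.form.fderiv_Z_e hp, _, h1,
      h2'⟩, (key _ (K.form.Z_mem hp) _ h1 h2').2 hr⟩

end FoldChart

end NormalBundle

/-! ### The tangent space of the tangent conjugate locus and the rank condition -/

theorem fderiv_fderiv_comp_of_hasFDerivAt {G F E : Type*} [NormedAddCommGroup G] [NormedSpace ℝ G]
    [NormedAddCommGroup F] [NormedSpace ℝ F] [NormedAddCommGroup E] [NormedSpace ℝ E] {f : F → E}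
    {A : G → F} {L : G →L[ℝ] F} (hA : ∀ u, HasFDerivAt A L u) {s : Set F} (hs : IsOpen s)
    (hf : ContDiffOn ℝ ∞ f s) {v : G} (hv : A v ∈ s) {g : G → E}
    (hg : ∀ u, A u ∈ s → g u = f (A u)) (a b : G) :
    fderiv ℝ (fderiv ℝ g) v a b = fderiv ℝ (fderiv ℝ f) (A v) (L a) (L b) := by
  have hev : ∀ᶠ u in 𝓝 v, A u ∈ s := (hA v).continuousAt (hs.mem_nhds hv)
  have h1 : fderiv ℝ g =ᶠ[𝓝 v] fun u => (fderiv ℝ f (A u)).comp L := by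
    filter_upwards [hev.eventually_nhds] with u hu
    have h2 : g =ᶠ[𝓝 u] fun u => f (A u) := hu.mono fun w hw => hg w hw
    rw [h2.fderiv_eq]
    exact (HasFDerivAt.comp (g := f) u
      (hf.differentiableAt_of_isOpen hs hu.self_of_nhds).hasFDerivAt (hA u)).fderiv
  rw [h1.fderiv_eq]
  have h3 : HasFDerivAt (fun u => fderiv ℝ f (A u)) ((fderiv ℝ (fderiv ℝ f) (A v)).comp L) v :=
    HasFDerivAt.comp (g := fderiv ℝ f) v
      ((hf.fderiv_of_isOpen hs (m := ∞) (by simp)).differentiableAt_of_isOpen hs hv).hasFDerivAt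
      (hA v)
  rw [(h3.clm_comp (hasFDerivAt_const L v)).fderiv]
  simp

section RankCondition

set_option synthInstance.maxHeartbeats 200000
set_option linter.unusedSectionVars false

variable {E : Type*} [NormedAddCommGroup E] [NormedSpace ℝ E]
  {M : Type*} [TopologicalSpace M] [ChartedSpace E M]
  [RiemannianBundle (fun x : M => TangentSpace 𝓘(ℝ, E) x)]
  [IsManifold 𝓘(ℝ, E) ∞ M] [FiniteDimensional ℝ E]
  [IsContMDiffRiemannianBundle 𝓘(ℝ, E) ∞ E (fun x : M => TangentSpace 𝓘(ℝ, E) x)]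
  [T2Space M]

variable {c c' : M} {F : ℝ × (E × E) → M} {δ : ℝ} {N : Set (E × E)} {p : M}
  {v : TangentSpace 𝓘(ℝ, E) p}

/-- The tangent vectors of the tangent conjugate locus are velocities of curves of critical
points. -/
theorem IsExpFlow.exists_hasDerivAt_of_mem_tangentVectors (h : IsExpFlow c c' F δ N)
    (hp : p ∈ (extChartAt 𝓘(ℝ, E) c).source)
    (hz : tcoord c (⟨p, v⟩ : TangentBundle 𝓘(ℝ, E) M) ∈ N) {ξ : TangentSpace 𝓘(ℝ, E) p}
    (hξ : ξ ∈ tangentVectors 𝓘(ℝ, TangentSpace 𝓘(ℝ, E) p) (tangentConjLocus p) v) :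
    ∃ u : ℝ → E, HasDerivAt u (dchart c p ξ) 0 ∧
      u 0 = (tcoord c (⟨p, v⟩ : TangentBundle 𝓘(ℝ, E) M)).2 ∧
      ∀ᶠ t in 𝓝 (0 : ℝ), ∃ a ≠ 0, fderiv ℝ (expChart (E := E) c c')
        ((tcoord c (⟨p, v⟩ : TangentBundle 𝓘(ℝ, E) M)).1, u t) (0, a) = 0 := by
  obtain ⟨ε, γ, hε, hγ, hmem, hvel⟩ := hξ
  have h0 : (0 : ℝ) ∈ Ioo (-ε) ε := ⟨neg_lt_zero.2 hε, hε⟩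
  have hγ0 : γ 0 = v := congrArg TotalSpace.proj hvel
  subst hγ0
  have hd : DifferentiableAt ℝ γ 0 :=
    (contMDiffOn_iff_contDiffOn.1 hγ).differentiableAt_of_isOpen isOpen_Ioo h0
  have hξ : fderiv ℝ γ 0 1 = ξ := by
    have h1 := TotalSpace.mk_inj.1 hvel
    rw [mfderiv_eq_fderiv] at h1
    exact h1
  have hγd : HasDerivAt γ ξ 0 := by
    rw [← hξ, fderiv_apply_one_eq_deriv]
    exact hd.hasDerivAt
  have hA := hasFDerivAt_tcoord hp (γ 0)
  have hcoord : ∀ t, tcoord c (⟨p, γ t⟩ : TangentBundle 𝓘(ℝ, E) M) =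
      (extChartAt 𝓘(ℝ, E) c p, dchart c p (γ t)) := fun t => tcoord_apply (by exact hp)
  have hev : ∀ᶠ t in 𝓝 (0 : ℝ), tcoord c (⟨p, γ t⟩ : TangentBundle 𝓘(ℝ, E) M) ∈ N :=
    (ContinuousAt.comp (g := fun u : TangentSpace 𝓘(ℝ, E) p =>
      tcoord c (⟨p, u⟩ : TangentBundle 𝓘(ℝ, E) M)) hA.continuousAt hγd.continuousAt)
      (h.isOpen.mem_nhds hz)
  refine ⟨fun t => dchart c p (γ t), ?_, ?_, ?_⟩
  · exact HasFDerivAt.comp_hasDerivAt (l := dchart c p) (f := γ) 0 (dchart c p).hasFDerivAt hγd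
  · rw [hcoord]
  · filter_upwards [hev, isOpen_Ioo.mem_nhds h0] with t ht htI
    have h1 := (h.mem_tangentConjLocus_iff hp ht).1 (hmem t htI)
    rwa [hcoord] at h1 ⊢

theorem IsExpFlow.d2exp_apply (h : IsExpFlow c (riemannianExp p v) F δ N)
    (hp : p ∈ (extChartAt 𝓘(ℝ, E) c).source)
    (hz : tcoord c (⟨p, v⟩ : TangentBundle 𝓘(ℝ, E) M) ∈ N) (a b : TangentSpace 𝓘(ℝ, E) p) :
    d2exp p v a b = fderiv ℝ (fderiv ℝ (expChart (E := E) c (riemannianExp p v)))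
      (tcoord c (⟨p, v⟩ : TangentBundle 𝓘(ℝ, E) M)) (0, dchart c p a) (0, dchart c p b) :=
  fderiv_fderiv_comp_of_hasFDerivAt (fun u => hasFDerivAt_tcoord hp u) h.isOpen
    h.contDiffOn_expChart hz (fun _ hu => h.chart_riemannianExp hp hu) a b

theorem FoldForm.fderiv_V_eq_of_curve {f : E × E → E} {z₀ : E × E} (Φ : FoldForm f z₀) {z : E × E}
    (hz : z ∈ Φ.Ω) {u : ℝ → E} {τ η : E} (hτ : HasDerivAt u τ 0) (hu0 : u 0 = z.2)
    (hη : HasDerivAt (fun t => f (z.1, u t)) η 0)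
    (hu : ∀ᶠ t in 𝓝 (0 : ℝ), (z.1, u t) ∈ Φ.Ω → fderiv ℝ f (z.1, u t) (0, Φ.e (z.1, u t)) = 0) :
    τ = fderiv ℝ Φ.V (z.1, f z) (0, η) := by
  have hzu : (z.1, u 0) = z := Prod.ext rfl hu0
  have hc : ContinuousAt (fun t => (z.1, u t)) 0 := continuousAt_const.prodMk hτ.continuousAt
  have hV := Φ.contDiffOn_V.hasFDerivAt_of_isOpen Φ.isOpen_D (Φ.mem_D z hz)
  have h1 : HasDerivAt (fun t => Φ.V (z.1, f (z.1, u t))) (fderiv ℝ Φ.V (z.1, f z) (0, η)) 0 := by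
    refine HasFDerivAt.comp_hasDerivAt (l := Φ.V) 0 ?_ ((hasDerivAt_const (0 : ℝ) z.1).prodMk hη)
    rwa [hzu]
  refine hτ.unique (h1.congr_of_eventuallyEq ?_)
  filter_upwards [hu, hc.eventually (Φ.isOpen_Ω.mem_nhds (hzu.symm ▸ hz))] with t ht htΩ
  exact (Φ.V_apply _ htΩ (ht htΩ)).symm

namespace FoldChart

variable {z₀ : E × E} (K : FoldChart E c c' z₀)

/-- The coordinate expression of the exponential map. -/
local notation "f" => expChart (E := E) c c'

/-- The tangent vectors of the tangent conjugate locus are the image of the differential of `V`. -/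
theorem mem_tangentVectors_tangentConjLocus_iff (hp : p ∈ (extChartAt 𝓘(ℝ, E) c).source)
    (hz : tcoord c (⟨p, v⟩ : TangentBundle 𝓘(ℝ, E) M) ∈ K.form.Ω) (hv : v ∈ tangentConjLocus p)
    (ξ : TangentSpace 𝓘(ℝ, E) p) :
    ξ ∈ tangentVectors 𝓘(ℝ, TangentSpace 𝓘(ℝ, E) p) (tangentConjLocus p) v ↔
      ∃ η, dchart c p ξ = fderiv ℝ K.form.V ((tcoord c (⟨p, v⟩ : TangentBundle 𝓘(ℝ, E) M)).1,
        f (tcoord c (⟨p, v⟩ : TangentBundle 𝓘(ℝ, E) M))) (0, η) := by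
  have hcrit := (K.mem_tangentConjLocus_iff hp hz).1 hv
  have hcoord : ∀ u : TangentSpace 𝓘(ℝ, E) p, tcoord c (⟨p, u⟩ : TangentBundle 𝓘(ℝ, E) M) =
      ((tcoord c (⟨p, v⟩ : TangentBundle 𝓘(ℝ, E) M)).1, dchart c p u) := fun u => by
    rw [tcoord_apply (by exact hp), tcoord_apply (by exact hp)]
  constructor
  · intro hξ
    obtain ⟨u, hu, hu0, hev⟩ := K.flow.exists_hasDerivAt_of_mem_tangentVectors hp (K.subset hz) hξ
    refine ⟨fderiv ℝ f (tcoord c (⟨p, v⟩ : TangentBundle 𝓘(ℝ, E) M)) (0, dchart c p ξ),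
      K.form.fderiv_V_eq_of_curve hz hu hu0 ?_ (hev.mono fun t ⟨a, ha0, ha⟩ htΩ =>
        K.form.fderiv_e_eq_zero_of_ne_zero htΩ ha0 ha)⟩
    refine HasFDerivAt.comp_hasDerivAt (l := f) 0 ?_ ((hasDerivAt_const (0 : ℝ) _).prodMk hu)
    rw [hu0]
    exact K.form.contDiffOn_f.hasFDerivAt_of_isOpen K.form.isOpen_Ω hz
  · rintro ⟨η, hη⟩
    obtain ⟨μ, s, rfl⟩ := K.form.exists_eq_fderiv_add_smul hz hcrit η
    obtain ⟨ε, hε, u, hu, hmem, hu0, hder⟩ := K.form.exists_curve hz hcrit (0, μ)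
      isOpen_univ (mem_univ _)
    have h0 : (0 : ℝ) ∈ Ioo (-ε) ε := ⟨neg_lt_zero.2 hε, hε⟩
    simp only [smul_zero, add_zero] at hmem hder
    have hud := (hu.differentiableAt_of_isOpen isOpen_Ioo h0).hasDerivAt
    have hτ := K.form.fderiv_V_eq_of_curve hz hud hu0 hder (by
      filter_upwards [isOpen_Ioo.mem_nhds h0] with t ht _
      exact (hmem t ht).2.2)
    have hfd : FiniteDimensional ℝ (TangentSpace 𝓘(ℝ, E) p) := inferInstanceAs
      (FiniteDimensional ℝ E)
    set L := (LinearEquiv.ofBijective (dchart c p).toLinearMap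
      (bijective_dchart hp)).symm.toLinearMap.toContinuousLinearMap with hL
    have hLs : ∀ y, dchart c p (L y) = y := fun y =>
      (LinearEquiv.ofBijective (dchart c p).toLinearMap (bijective_dchart hp)).apply_symm_apply y
    have hLr : ∀ a, L (dchart c p a) = a := fun a => (bijective_dchart hp).1 (hLs _)
    have hγ : HasDerivAt (fun t => L (u t)) ξ 0 := by
      have h1 := HasFDerivAt.comp_hasDerivAt (0 : ℝ) (L.hasFDerivAt (x := u 0)) hud
      refine h1.congr_deriv ?_
      rw [hτ, ← hLr ξ, hη]
      congr 1
      rw [show ((0 : E), fderiv ℝ f (tcoord c (⟨p, v⟩ : TangentBundle 𝓘(ℝ, E) M)) (0, μ) +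
        s • K.form.c) = (0, fderiv ℝ f (tcoord c (⟨p, v⟩ : TangentBundle 𝓘(ℝ, E) M)) (0, μ)) +
        s • ((0 : E), K.form.c) by simp, map_add, map_smul,
        K.form.fderiv_V_c (K.form.mem_D _ hz), smul_zero, add_zero]
    have hγ0 : L (u 0) = v := by
      rw [hu0, hcoord]
      exact hLr v
    refine ⟨ε, fun t => L (u t), hε, ?_, fun t ht => ?_, ?_⟩
    · exact contMDiffOn_iff_contDiffOn.2 (L.contDiff.comp_contDiffOn hu)
    · have h1 := hmem t ht
      rw [K.mem_tangentConjLocus_iff hp]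
      · rw [hcoord, hLs]
        exact h1.2.2
      · rw [hcoord, hLs]
        exact h1.2.1
    · subst hγ0
      have h2 : fderiv ℝ (fun t => L (u t)) 0 (1 : ℝ) = ξ := by
        rw [fderiv_apply_one_eq_deriv]
        exact hγ.deriv
      refine congrArg (TotalSpace.mk' _ _) ?_
      rw [mfderiv_eq_fderiv]
      exact h2

theorem mem_tangentConjSpace_iff (hp : p ∈ (extChartAt 𝓘(ℝ, E) c).source)
    (hz : tcoord c (⟨p, v⟩ : TangentBundle 𝓘(ℝ, E) M) ∈ K.form.Ω) (hv : v ∈ tangentConjLocus p)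
    (τ : TangentSpace 𝓘(ℝ, E) p) :
    τ ∈ tangentConjSpace p v ↔
      ∃ η, dchart c p τ = fderiv ℝ K.form.V ((tcoord c (⟨p, v⟩ : TangentBundle 𝓘(ℝ, E) M)).1,
        f (tcoord c (⟨p, v⟩ : TangentBundle 𝓘(ℝ, E) M))) (0, η) := by
  set T : Submodule ℝ (TangentSpace 𝓘(ℝ, E) p) :=
    (LinearMap.range ((fderiv ℝ K.form.V ((tcoord c (⟨p, v⟩ : TangentBundle 𝓘(ℝ, E) M)).1,
      f (tcoord c (⟨p, v⟩ : TangentBundle 𝓘(ℝ, E) M)))).toLinearMap ∘ₗ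
      LinearMap.inr ℝ E E)).comap (dchart c p).toLinearMap with hT
  have hmem : ∀ τ, τ ∈ T ↔ ∃ η, dchart c p τ =
      fderiv ℝ K.form.V ((tcoord c (⟨p, v⟩ : TangentBundle 𝓘(ℝ, E) M)).1,
        f (tcoord c (⟨p, v⟩ : TangentBundle 𝓘(ℝ, E) M))) (0, η) := fun τ =>
    ⟨fun ⟨η, h⟩ => ⟨η, h.symm⟩, fun ⟨η, h⟩ => ⟨η, h.symm⟩⟩
  have h1 : tangentConjSpace p v = Submodule.span ℝ (T : Set (TangentSpace 𝓘(ℝ, E) p)) := by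
    refine congrArg (Submodule.span ℝ) (Set.ext fun τ => ?_)
    exact (K.mem_tangentVectors_tangentConjLocus_iff hp hz hv τ).trans (hmem τ).symm
  rw [h1, Submodule.span_eq, hmem]

end FoldChart

/-- The rank condition says that `Ψ₁` is an immersion at the conormal vectors over the fold
conjugate vector. -/
theorem FoldChart.injective_fderiv_Ψ₁_iff_foldRankCondition {z₀ : E × E}
    (K : FoldChart E c (riemannianExp p v) z₀) (hp : p ∈ (extChartAt 𝓘(ℝ, E) c).source)
    (hz : tcoord c (⟨p, v⟩ : TangentBundle 𝓘(ℝ, E) M) ∈ K.form.Ω) (hv : v ∈ tangentConjLocus p)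
    {y : E × E} (hy : y ∈ K.form.D)
    (hZ : K.form.Z y = tcoord c (⟨p, v⟩ : TangentBundle 𝓘(ℝ, E) M)) (hr : K.form.ℓ y.2 ≠ 0) :
    Function.Injective (fderiv ℝ K.form.Ψ₁ y) ↔ FoldRankCondition p v := by
  have hVy : fderiv ℝ K.form.V ((tcoord c (⟨p, v⟩ : TangentBundle 𝓘(ℝ, E) M)).1,
      expChart c (riemannianExp p v) (tcoord c (⟨p, v⟩ : TangentBundle 𝓘(ℝ, E) M))) =
      fderiv ℝ K.form.V y := by
    rw [← hZ, K.form.f_Z hy, K.form.q_eq]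
    exact K.form.fderiv_V_add _ _ _
  have hT := K.mem_tangentConjSpace_iff hp hz hv
  rw [hVy] at hT
  have hker := K.flow.dexp_eq_zero_iff hp (K.subset hz)
  have hd2 := K.flow.d2exp_apply hp (K.subset hz)
  have hcrit := (K.mem_tangentConjLocus_iff hp hz).1 hv
  rw [K.form.injective_fderiv_Ψ₁_iff hy hr, hZ]
  set z := tcoord c (⟨p, v⟩ : TangentBundle 𝓘(ℝ, E) M) with hzdef
  constructor
  · intro h α hα hα0 τ τ' hττ'
    have hαr := K.form.eq_smul_e z hz _ ((hker α).1 hα)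
    set r := K.form.m (dchart c p α) with hrdef
    have hr0 : r ≠ 0 := by
      intro h0
      rw [h0, zero_smul] at hαr
      exact hα0 ((bijective_dchart hp).1 (hαr.trans (map_zero _).symm))
    have h1 : d2exp p v α ((τ : TangentSpace 𝓘(ℝ, E) p) - τ') = 0 := by
      rw [map_sub]
      exact sub_eq_zero.2 hττ'
    obtain ⟨η, hη⟩ := (hT _).1 (Submodule.sub_mem _ τ.2 τ'.2)
    rw [hd2, hη, hαr, show ((0 : E), r • K.form.e z) = r • ((0 : E), K.form.e z) by simp,
      map_smul, smul_apply, smul_eq_zero] at h1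
    have h2 := h η (h1.resolve_left hr0)
    rw [← hη] at h2
    exact Subtype.ext (sub_eq_zero.1 ((bijective_dchart hp).1 (h2.trans (map_zero _).symm)))
  · intro h η hη
    obtain ⟨α, hα⟩ := (bijective_dchart hp).2 (K.form.e z)
    obtain ⟨τ, hτ⟩ := (bijective_dchart hp).2 (fderiv ℝ K.form.V y (0, η))
    have hα0 : α ≠ 0 := by
      rintro rfl
      exact K.form.e_ne_zero hz (hα.symm.trans (map_zero _))
    have hαk : α ∈ conjKernel p v := (hker α).2 (by rw [hα]; exact hcrit)
    have h1 := @h α hαk hα0 ⟨τ, (hT τ).2 ⟨η, hτ⟩⟩ 0 (by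
      show d2exp p v α τ = d2exp p v α ((0 : tangentConjSpace p v) : TangentSpace 𝓘(ℝ, E) p)
      rw [hd2, hα, hτ, hη, Submodule.coe_zero, map_zero])
    rw [← hτ, show τ = 0 from congrArg Subtype.val h1, map_zero]

end RankCondition

/-! ### Graphs of maps of the tangent bundle in coordinates -/

section Graph

set_option synthInstance.maxHeartbeats 200000
set_option linter.unusedSectionVars false

variable {E : Type*} [NormedAddCommGroup E] [NormedSpace ℝ E]
  {M : Type*} [TopologicalSpace M] [ChartedSpace E M] [IsManifold 𝓘(ℝ, E) ∞ M]

/-- The coordinate expression of a map between tangent bundles. -/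
def tcoordMap (c c' : M) (φ : TangentBundle 𝓘(ℝ, E) M → TangentBundle 𝓘(ℝ, E) M) (y : E × E) :
    E × E :=
  tcoord c' (φ ((tcoord c).symm y))

/-- The domain of the coordinate expression of a map defined on `U`. -/
def tcoordDomain (c c' : M) (φ : TangentBundle 𝓘(ℝ, E) M → TangentBundle 𝓘(ℝ, E) M)
    (U : Set (TangentBundle 𝓘(ℝ, E) M)) : Set (E × E) :=
  (tcoord (E := E) c).target ∩ (tcoord (E := E) c).symm ⁻¹'
    (U ∩ φ ⁻¹' (tcoord (E := E) c').source)

variable {c c' : M} {φ : TangentBundle 𝓘(ℝ, E) M → TangentBundle 𝓘(ℝ, E) M}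
  {U : Set (TangentBundle 𝓘(ℝ, E) M)}

theorem isOpen_tcoordDomain (hU : IsOpen U)
    (hφ : ContMDiffOn 𝓘(ℝ, E).tangent 𝓘(ℝ, E).tangent ∞ φ U) :
    IsOpen (tcoordDomain c c' φ U) :=
  contMDiffOn_tcoord_symm.continuousOn.isOpen_inter_preimage isOpen_tcoord_target
    (hφ.continuousOn.isOpen_inter_preimage hU isOpen_tcoord_source)

theorem contDiffOn_tcoordMap (hφ : ContMDiffOn 𝓘(ℝ, E).tangent 𝓘(ℝ, E).tangent ∞ φ U) :
    ContDiffOn ℝ ∞ (tcoordMap c c' φ) (tcoordDomain c c' φ U) := by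
  rw [← contMDiffOn_iff_contDiffOn]
  have h1 : ContMDiffOn 𝓘(ℝ, E × E) 𝓘(ℝ, E).tangent ∞ (fun y => φ ((tcoord c).symm y))
      (tcoordDomain c c' φ U) :=
    hφ.comp (contMDiffOn_tcoord_symm.mono inter_subset_left) fun y hy => hy.2.1
  exact contMDiffOn_tcoord.comp h1 fun y hy => hy.2.2

theorem tcoord_mem_tcoordDomain {x : TangentBundle 𝓘(ℝ, E) M} (hx : x ∈ U)
    (hxc : x ∈ (tcoord c).source) (hφx : φ x ∈ (tcoord c').source) :
    tcoord c x ∈ tcoordDomain c c' φ U := by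
  refine ⟨(tcoord c).map_source hxc, ?_⟩
  rw [mem_preimage, (tcoord c).left_inv hxc]
  exact ⟨hx, hφx⟩

/-- A map which is a local diffeomorphism in smooth coordinates is a local diffeomorphism. -/
theorem isLocalDiffeomorphAt_of_eqOn {V X : Type*} [NormedAddCommGroup V] [NormedSpace ℝ V]
    {H : Type*} [TopologicalSpace H] {I : ModelWithCorners ℝ V H} [TopologicalSpace X]
    [ChartedSpace H X] {e e' : PartialEquiv X V} (he : IsOpen e.source) (het : IsOpen e.target)
    (he' : IsOpen e'.source) (het' : IsOpen e'.target) (hes : ContMDiffOn I 𝓘(ℝ, V) ∞ e e.source)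
    (hei : ContMDiffOn 𝓘(ℝ, V) I ∞ e.symm e.target)
    (hes' : ContMDiffOn I 𝓘(ℝ, V) ∞ e' e'.source)
    (hei' : ContMDiffOn 𝓘(ℝ, V) I ∞ e'.symm e'.target) {G : OpenPartialHomeomorph V V}
    (hG : ContDiffOn ℝ ∞ G G.source) (hGs : ContDiffOn ℝ ∞ G.symm G.target) {φ : X → X} {x : X}
    (hx : x ∈ e.source) (hxG : e x ∈ G.source)
    (hφ : ∀ y ∈ e.source, e y ∈ G.source → φ y ∈ e'.source ∧ G (e y) = e' (φ y)) :
    IsLocalDiffeomorphAt I I ∞ φ x := by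
  have ho₁ : IsOpen (e.source ∩ e ⁻¹' G.source) :=
    hes.continuousOn.isOpen_inter_preimage he G.open_source
  have ho₂ : IsOpen (G.target ∩ G.symm ⁻¹' e.target) :=
    G.symm.continuousOn.isOpen_inter_preimage G.open_target het
  have hcomp : ContMDiffOn I 𝓘(ℝ, V) ∞ (fun y => G (e y)) (e.source ∩ e ⁻¹' G.source) :=
    (contMDiffOn_iff_contDiffOn.2 hG).comp (hes.mono inter_subset_left) fun y hy => hy.2
  have hcomp' : ContMDiffOn I 𝓘(ℝ, V) ∞ (fun y => G.symm (e' y))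
      (e'.source ∩ e' ⁻¹' (G.target ∩ G.symm ⁻¹' e.target)) :=
    (contMDiffOn_iff_contDiffOn.2 hGs).comp (hes'.mono inter_subset_left) fun y hy => hy.2.1
  refine ⟨⟨(e.trans G.toPartialEquiv).trans e'.symm, ?_, ?_, ?_, ?_⟩, ?_, ?_⟩
  · exact hcomp.continuousOn.isOpen_inter_preimage ho₁ het'
  · exact hes'.continuousOn.isOpen_inter_preimage he' ho₂
  · exact hei'.comp (hcomp.mono inter_subset_left) fun y hy => hy.2
  · exact hei.comp hcomp' fun y hy => hy.2.2
  · refine ⟨⟨hx, hxG⟩, ?_⟩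
    obtain ⟨h1, h2⟩ := hφ x hx hxG
    show G (e x) ∈ e'.target
    rw [h2]
    exact e'.map_source h1
  · rintro y ⟨⟨hy, hyG⟩, -⟩
    obtain ⟨h1, h2⟩ := hφ y hy hyG
    show φ y = e'.symm (G (e y))
    rw [h2, e'.left_inv h1]

/-- A smooth map of the tangent bundle is a local diffeomorphism where the derivative of its
coordinate expression is injective. -/
theorem isLocalDiffeomorphAt_of_injective_fderiv [FiniteDimensional ℝ E] (hU : IsOpen U)
    (hφ : ContMDiffOn 𝓘(ℝ, E).tangent 𝓘(ℝ, E).tangent ∞ φ U) {x : TangentBundle 𝓘(ℝ, E) M}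
    (hx : x ∈ U) (hxc : x ∈ (tcoord c).source) (hφx : φ x ∈ (tcoord c').source)
    (hinj : Function.Injective (fderiv ℝ (tcoordMap c c' φ) (tcoord c x))) :
    IsLocalDiffeomorphAt 𝓘(ℝ, E).tangent 𝓘(ℝ, E).tangent ∞ φ x := by
  obtain ⟨G, hxG, hGV, hGφ, hGs, -⟩ := exists_openPartialHomeomorph_of_isInvertible
    (isOpen_tcoordDomain (c := c) (c' := c') hU hφ) (contDiffOn_tcoordMap hφ)
    (tcoord_mem_tcoordDomain hx hxc hφx) (ContinuousLinearMap.isInvertible_of_injective rfl hinj)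
  refine isLocalDiffeomorphAt_of_eqOn (e' := tcoord c') isOpen_tcoord_source isOpen_tcoord_target
    isOpen_tcoord_source isOpen_tcoord_target contMDiffOn_tcoord contMDiffOn_tcoord_symm
    contMDiffOn_tcoord contMDiffOn_tcoord_symm
    (((contDiffOn_tcoordMap hφ).mono hGV).congr fun y _ => hGφ y) hGs hxc hxG fun y hy hyG => ?_
  have h1 := (hGV hyG).2.2
  rw [mem_preimage, (tcoord c).left_inv hy] at h1
  exact ⟨h1, by rw [hGφ, tcoordMap, (tcoord c).left_inv hy]⟩

variable [RiemannianBundle (fun x : M => TangentSpace 𝓘(ℝ, E) x)] [FiniteDimensional ℝ E]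
  [IsContMDiffRiemannianBundle 𝓘(ℝ, E) ∞ E (fun x : M => TangentSpace 𝓘(ℝ, E) x)]
  [T2Space M]

namespace FoldChart

variable {z₀ : E × E} {K : FoldChart E c c' z₀} {W : Set (TangentBundle 𝓘(ℝ, E) M)}
  {O : Set (TangentBundle 𝓘(ℝ, E) M × TangentBundle 𝓘(ℝ, E) M)}

variable (K) in
theorem Ψ₁_mem_target {p : E × E} (hp : p ∈ K.form.D) :
    K.form.Ψ₁ p ∈ (tcoord (E := E) c).target :=
  mem_tcoord_target.2 (K.mem_target (K.form.Z_mem hp) :)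

variable (K) in
theorem Ψ₂_mem_target {p : E × E} (hp : p ∈ K.form.D) :
    K.form.Ψ₂ p ∈ (tcoord (E := E) c').target := by
  have h1 := K.expChart_mem_target (K.form.Z_mem hp)
  rw [K.form.f_Z hp] at h1
  exact mem_tcoord_target.2 h1

/-- If a piece of the normal bundle is the graph of a smooth map, then at the parameter `p` of one
of its points the projection `Ψ₁` is an immersion, and the map is a local diffeomorphism, since
`Ψ₂` is also an immersion. -/
theorem of_isSmoothGraph (hW : K.Contains W) (hWo : IsOpen W)
    (h : IsSmoothGraph (puncturedNormalBundle W) O U φ) {p : E × E} (hp : p ∈ K.form.D)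
    (hU₁ : (tcoord c).symm (K.form.Ψ₁ p) ∈ U)
    (hφp : φ ((tcoord c).symm (K.form.Ψ₁ p)) = (tcoord c').symm (K.form.Ψ₂ p)) :
    Function.Injective (fderiv ℝ K.form.Ψ₁ p) ∧
      IsLocalDiffeomorphAt 𝓘(ℝ, E).tangent 𝓘(ℝ, E).tangent ∞ φ
        ((tcoord c).symm (K.form.Ψ₁ p)) := by
  obtain ⟨-, hU, hφ, hgraph⟩ := h
  have hΨ₁ := K.Ψ₁_mem_target hp
  have hΨ₂ := K.Ψ₂_mem_target hp
  have hsrc := (tcoord c).map_target hΨ₁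
  have hsrc' : φ ((tcoord c).symm (K.form.Ψ₁ p)) ∈ (tcoord c').source :=
    hφp ▸ (tcoord c').map_target hΨ₂
  have hdom := tcoord_mem_tcoordDomain hU₁ hsrc hsrc'
  have ho := isOpen_tcoordDomain (c := c) (c' := c') hU hφ
  rw [(tcoord c).right_inv hΨ₁] at hdom
  obtain ⟨h1, h2⟩ := K.form.injective_fderiv_of_graph hp (g := tcoordMap c c' φ)
    ((contDiffOn_tcoordMap hφ).differentiableAt_of_isOpen ho hdom)
    (by rw [tcoordMap, hφp, (tcoord c').right_inv hΨ₂]) (by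
      filter_upwards [ho.mem_nhds hdom] with y hy
      have hmem : ((tcoord c).symm y, φ ((tcoord c).symm y)) ∈ puncturedNormalBundle W :=
        (hgraph.superset ⟨hy.2.1, rfl⟩ : _ ∈ _ ∩ O).1
      obtain ⟨p', hp', -, -, e₁, e₂⟩ := (mem_puncturedNormalBundle_iff hW hWo).1 hmem
      refine ⟨p', hp', ?_, ?_⟩
      · have := congrArg (tcoord c) e₁
        rwa [(tcoord c).right_inv hy.1, (tcoord c).right_inv (K.Ψ₁_mem_target hp'),
          eq_comm] at this
      · have := congrArg (tcoord c') e₂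
        rw [(tcoord c').right_inv (K.Ψ₂_mem_target hp')] at this
        exact this.symm)
  refine ⟨h1, isLocalDiffeomorphAt_of_injective_fderiv hU hφ hU₁ hsrc hsrc' ?_⟩
  rw [(tcoord c).right_inv hΨ₁]
  refine h2 (K.form.injective_fderiv_Ψ₂ (G₁ := chartMetric c) (G₂ := chartMetric c')
    (fun z hz a ha => chartMetric_pos (K.mem_target hz) ha) (fun z hz => ?_) (fun z hz => ?_)
    (fun z hz => K.chartMetric_β hz) hp h1)
  · exact contDiffOn_chartMetric.differentiableAt_of_isOpen (isOpen_extChartAt_target c)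
      (K.mem_target hz)
  · exact contDiffOn_chartMetric.differentiableAt_of_isOpen (isOpen_extChartAt_target c')
      (K.expChart_mem_target hz)

theorem isLocalDiffeomorphOn_of_isSmoothGraph (hW : K.Contains W) (hWo : IsOpen W)
    (h : IsSmoothGraph (puncturedNormalBundle W) O U φ) :
    IsLocalDiffeomorphOn 𝓘(ℝ, E).tangent 𝓘(ℝ, E).tangent ∞ φ U := by
  rintro ⟨x, hx⟩
  have hmem : (x, φ x) ∈ puncturedNormalBundle W :=
    (h.2.2.2.superset ⟨hx, rfl⟩ : _ ∈ _ ∩ O).1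
  obtain ⟨p, hp, -, -, rfl, e₂⟩ := (mem_puncturedNormalBundle_iff hW hWo).1 hmem
  exact (of_isSmoothGraph hW hWo h hp hx e₂).2

variable (K) in
/-- If `Ψ₁` is an immersion over the fold conjugate vector, then the normal bundle is a graph. -/
theorem exists_isSmoothGraph
    (hinj : Function.Injective (fderiv ℝ K.form.Ψ₁ (K.form.param z₀ 1))) :
    ∃ Ω₁ : Set (E × E), IsOpen Ω₁ ∧ z₀ ∈ Ω₁ ∧ Ω₁ ⊆ K.form.Ω ∧
      ∀ W : Set (TangentBundle 𝓘(ℝ, E) M), IsOpen W →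
        (∀ x ∈ W, x.1 ∈ (extChartAt 𝓘(ℝ, E) c).source ∧ tcoord c x ∈ Ω₁) →
        ∃ U φ, IsSmoothGraph (puncturedNormalBundle W) univ U φ := by
  obtain ⟨Ω₁, hΩ₁, hz₀, hsub, hgraph⟩ := K.form.exists_graph hinj
  refine ⟨Ω₁, hΩ₁, hz₀, hsub, fun W hWo hWΩ => ?_⟩
  have hW : K.Contains W := fun x hx => ⟨(hWΩ x hx).1, hsub (hWΩ x hx).2⟩
  obtain ⟨U, g, hU, hg, hiff⟩ := hgraph (K.form.Ω ∩ (tcoord (E := E) c).symm ⁻¹' W)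
    (fun z hz => by
      have h1 := (hWΩ _ hz.2).2
      rwa [K.tcoord_tcoord_symm hz.1] at h1) (K.isOpen_preimage hWo)
  have hgt : ∀ y ∈ U, g y ∈ (tcoord (E := E) c').target := fun y hy => by
    obtain ⟨p, hp, -, -, -, h2⟩ := (hiff y (g y)).2 ⟨hy, rfl⟩
    rw [← h2]
    exact K.Ψ₂_mem_target hp
  refine ⟨(tcoord c).source ∩ tcoord c ⁻¹' U, fun x => (tcoord c').symm (g (tcoord c x)),
    isOpen_univ, contMDiffOn_tcoord.continuousOn.isOpen_inter_preimage isOpen_tcoord_source hU,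
    ?_, ?_⟩
  · have h1 : ContMDiffOn 𝓘(ℝ, E).tangent 𝓘(ℝ, E × E) ∞ (fun x => g (tcoord c x))
        ((tcoord (E := E) c).source ∩ tcoord c ⁻¹' U) :=
      (contMDiffOn_iff_contDiffOn.2 hg).comp (contMDiffOn_tcoord.mono inter_subset_left)
        fun y hy => hy.2
    exact contMDiffOn_tcoord_symm.comp h1 fun y hy => hgt _ hy.2
  · rw [inter_univ]
    ext X
    rw [mem_puncturedNormalBundle_iff hW hWo]
    constructor
    · rintro ⟨p, hp, hpW, hr, h1, h2⟩
      have hX : tcoord c X.1 = K.form.Ψ₁ p := by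
        rw [h1, (tcoord c).right_inv (K.Ψ₁_mem_target hp)]
      obtain ⟨hy, hy'⟩ := (hiff (K.form.Ψ₁ p) (K.form.Ψ₂ p)).1
        ⟨p, hp, ⟨K.form.Z_mem hp, hpW⟩, hr, rfl, rfl⟩
      refine ⟨⟨?_, ?_⟩, ?_⟩
      · rw [h1]
        exact (tcoord c).map_target (K.Ψ₁_mem_target hp)
      · rwa [mem_preimage, hX]
      · simp only [hX, ← hy', h2]
    · rintro ⟨⟨hs, hy⟩, h2⟩
      obtain ⟨p, hp, hpW, hr, e₁, e₂⟩ := (hiff (tcoord c X.1) (g (tcoord c X.1))).2 ⟨hy, rfl⟩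
      refine ⟨p, hp, hpW.2, hr, ?_, ?_⟩
      · rw [e₁, (tcoord c).left_inv hs]
      · rw [e₂, h2]

end FoldChart

end Graph

/-! ### The normal form near a fold conjugate vector -/

section FoldConjugateVector

set_option synthInstance.maxHeartbeats 200000
set_option linter.unusedSectionVars false

variable {E : Type*} [NormedAddCommGroup E] [NormedSpace ℝ E]
  {M : Type*} [TopologicalSpace M] [ChartedSpace E M]
  [RiemannianBundle (fun x : M => TangentSpace 𝓘(ℝ, E) x)]
  [IsManifold 𝓘(ℝ, E) ∞ M] [FiniteDimensional ℝ E]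
  [IsContMDiffRiemannianBundle 𝓘(ℝ, E) ∞ E (fun x : M => TangentSpace 𝓘(ℝ, E) x)]
  [T2Space M]

/-- The exponential map has a fold normal form near a fold conjugate vector. The fold condition,
that `D² exp (α, α)` is not in the range of `dexp` for `α` in the kernel, follows from the
transversality of the kernel to the tangent conjugate locus, since `D² exp (α, v)` is not in the
range. -/
theorem IsFoldConjugate.nonempty_foldChart {p : M} {v : TangentSpace 𝓘(ℝ, E) p}
    (hv : IsFoldConjugate p v) {c c' : M} (hp : p ∈ (extChartAt 𝓘(ℝ, E) c).source)
    (hq : riemannianExp p v ∈ (extChartAt 𝓘(ℝ, E) c').source) :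
    Nonempty (FoldChart E c c' (tcoord c (⟨p, v⟩ : TangentBundle 𝓘(ℝ, E) M))) := by
  obtain ⟨⟨hvS, -⟩, hdim, htrans⟩ := hv
  obtain ⟨δ, N, F, h, hz⟩ := exists_isExpFlow hvS.1 hp hq
  have hker := h.dexp_eq_zero_iff hp hz
  obtain ⟨⟨α, hα⟩, hα0, hspan⟩ := finrank_eq_one_iff'.1 hdim
  have hα0' : dchart c p α ≠ 0 := fun h0 =>
    hα0 (Subtype.ext ((bijective_dchart hp).1 (h0.trans (map_zero _).symm)))
  obtain ⟨lam, hlam⟩ : ∃ lam : E →L[ℝ] ℝ, lam (dchart c p α) = 1 := by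
    obtain ⟨lam, hlam⟩ := SeparatingDual.exists_eq_one (R := ℝ) hα0'
    exact ⟨lam, hlam⟩
  have hk : ∀ a, fderiv ℝ (expChart (E := E) c c')
      (tcoord c (⟨p, v⟩ : TangentBundle 𝓘(ℝ, E) M)) (0, a) = 0 ↔
      ∃ r : ℝ, a = r • dchart c p α := by
    intro a
    obtain ⟨b, rfl⟩ := (bijective_dchart hp).2 a
    rw [← hker]
    constructor
    · intro hb
      obtain ⟨r, hr⟩ := hspan ⟨b, hb⟩
      refine ⟨r, ?_⟩
      rw [← map_smul]
      exact congrArg (dchart c p) (congrArg Subtype.val hr).symm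
    · rintro ⟨r, hr⟩
      rw [← map_smul] at hr
      rw [(bijective_dchart hp).1 hr, map_smul]
      have hα' : dexp p v α = 0 := hα
      rw [hα', smul_zero]
  have hα1 := (hk _).2 ⟨1, (one_smul ℝ _).symm⟩
  have hmap : ∀ S : Set (TangentSpace 𝓘(ℝ, E) p), ∀ τ ∈ Submodule.span ℝ S,
      dchart c p τ ∈ Submodule.span ℝ (dchart c p '' S) := fun S τ hτ =>
    Submodule.apply_mem_span_image_of_mem_span (dchart c p).toLinearMap hτ
  obtain ⟨Φ, hΦ⟩ := nonempty_foldForm h.isOpen h.contDiffOn_expChart hz hlam hk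
    fun a => fderiv_fderiv_notMem_range_of_transversal h.isOpen h.contDiffOn_expChart hz hlam hk
      (h.fderiv_ne_fderiv_fderiv hz hα1 hα0')
      (dchart c p '' tangentVectors 𝓘(ℝ, TangentSpace 𝓘(ℝ, E) p) (tangentConjLocus p) v)
      (by
        rintro _ ⟨ξ, hξ, rfl⟩
        exact h.exists_hasDerivAt_of_mem_tangentVectors hp hz hξ)
      (by
        intro w
        obtain ⟨u, rfl⟩ := (bijective_dchart hp).2 w
        have hu : u ∈ conjKernel p v ⊔ tangentConjSpace p v := htrans ▸ Submodule.mem_top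
        obtain ⟨a, ha, τ, hτ, rfl⟩ := Submodule.mem_sup.1 hu
        obtain ⟨r, hr⟩ := (hk _).1 ((hker a).1 ha)
        refine ⟨r, ?_⟩
        rw [map_add, hr, add_sub_cancel_left]
        exact hmap _ τ hτ) a
  exact ⟨⟨F, δ, N, h, Φ, hΦ⟩⟩

end FoldConjugateVector

end FoldConjugate

theorem mainTheorem12 {E : Type*} [NormedAddCommGroup E] [NormedSpace ℝ E] [FiniteDimensional ℝ E]
    {M : Type*} [TopologicalSpace M] [T2Space M] [ChartedSpace E M] [IsManifold 𝓘(ℝ, E) ∞ M]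
    [RiemannianBundle (fun x : M => TangentSpace 𝓘(ℝ, E) x)]
    [IsContMDiffRiemannianBundle 𝓘(ℝ, E) ∞ E (fun x : M => TangentSpace 𝓘(ℝ, E) x)]
    (p₀ : M) (v₀ : TangentSpace 𝓘(ℝ, E) p₀) (hv₀ : IsFoldConjugate p₀ v₀) :
    ∃ W₀ : Set (TangentBundle 𝓘(ℝ, E) M), IsOpen W₀ ∧ ⟨p₀, v₀⟩ ∈ W₀ ∧
      ∀ W ⊆ W₀, IsOpen W → ⟨p₀, v₀⟩ ∈ W →
        -- the orthogonal splitting of `T_q M`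
        (∀ (p : M) (v : TangentSpace 𝓘(ℝ, E) p) (q : M) (w : TangentSpace 𝓘(ℝ, E) q),
          v ∈ tangentConjLocus p → (⟨p, v⟩ : TangentBundle 𝓘(ℝ, E) M) ∈ W →
          velocity E (geodesic p v) 1 = ⟨q, -w⟩ →
          ∃ T : Submodule ℝ (TangentSpace 𝓘(ℝ, E) q),
            (T : Set (TangentSpace 𝓘(ℝ, E) q)) = tangentVectors 𝓘(ℝ, E) (conjLocusAt W p) q ∧
            IsCompl T (conjKernel q w) ∧ Tᗮ = conjKernel q w) ∧
        -- local uniqueness of the geodesic from `p` to `q`, and the normal bundle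
        (∀ (p : M) (v v' : TangentSpace 𝓘(ℝ, E) p),
          v ∈ tangentConjLocus p → (⟨p, v⟩ : TangentBundle 𝓘(ℝ, E) M) ∈ W →
          (⟨p, v'⟩ : TangentBundle 𝓘(ℝ, E) M) ∈ W →
          riemannianExp p v' = riemannianExp p v → v' = v) ∧
        normalBundle W = jacobiPairs W ∧
        -- the graph condition
        ((∃ U f, IsSmoothGraph (puncturedNormalBundle W) univ U f) ↔ FoldRankCondition p₀ v₀) ∧
        (∀ z ∈ puncturedNormalBundle W, z.1.proj = p₀ → z.2.proj = riemannianExp p₀ v₀ →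
          ((∃ O U f, z ∈ O ∧ IsSmoothGraph (puncturedNormalBundle W) O U f) ↔
            FoldRankCondition p₀ v₀)) ∧
        (∀ O U f, IsSmoothGraph (puncturedNormalBundle W) O U f →
          IsLocalDiffeomorphOn 𝓘(ℝ, E).tangent 𝓘(ℝ, E).tangent ∞ f U) := by

  obtain ⟨K⟩ := hv₀.nonempty_foldChart (mem_extChartAt_source p₀)
    (mem_extChartAt_source (riemannianExp p₀ v₀))
  have hp₀ : p₀ ∈ (extChartAt 𝓘(ℝ, E) p₀).source := mem_extChartAt_source p₀
  have hv₀S : v₀ ∈ tangentConjLocus p₀ := hv₀.1.1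
  have hz₀ := K.form.mem_Ω
  have hz₁ : (tcoord p₀ (⟨p₀, v₀⟩ : TangentBundle 𝓘(ℝ, E) M)).1 = extChartAt 𝓘(ℝ, E) p₀ p₀ :=
    congrArg Prod.fst (tcoord_apply (by exact hp₀))
  have hfz₀ := K.flow.chart_riemannianExp hp₀ (K.subset hz₀)
  have hcrit := (K.mem_tangentConjLocus_iff hp₀ hz₀).1 hv₀S
  have hparam := K.form.param_mem hz₀ 1
  have hℓparam : K.form.ℓ (K.form.param (tcoord p₀ ⟨p₀, v₀⟩) 1).2 ≠ 0 := by
    rw [K.form.ℓ_param]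
    exact one_ne_zero
  have hrank {y : E × E} (hy : y ∈ K.form.D) (hZ : K.form.Z y = tcoord p₀ ⟨p₀, v₀⟩)
      (hr : K.form.ℓ y.2 ≠ 0) :=
    K.injective_fderiv_Ψ₁_iff_foldRankCondition hp₀ hz₀ hv₀S hy hZ hr
  -- if the rank condition holds, then `Ω₁` is so small that the normal bundle is a graph
  obtain ⟨Ω₁, hΩ₁, hzΩ₁, hsub, hgraph⟩ : ∃ Ω₁ : Set (E × E), IsOpen Ω₁ ∧
      tcoord p₀ ⟨p₀, v₀⟩ ∈ Ω₁ ∧ Ω₁ ⊆ K.form.Ω ∧ (FoldRankCondition p₀ v₀ →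
        ∀ W : Set (TangentBundle 𝓘(ℝ, E) M), IsOpen W →
          (∀ x ∈ W, x.1 ∈ (extChartAt 𝓘(ℝ, E) p₀).source ∧ tcoord p₀ x ∈ Ω₁) →
          ∃ U φ, IsSmoothGraph (puncturedNormalBundle W) univ U φ) := by
    by_cases h : FoldRankCondition p₀ v₀
    · obtain ⟨Ω₁, h1, h2, h3, h4⟩ := K.exists_isSmoothGraph
        ((hrank hparam (K.form.Z_param hz₀ hcrit 1) hℓparam).2 h)
      exact ⟨Ω₁, h1, h2, h3, fun _ => h4⟩
    · exact ⟨_, K.form.isOpen_Ω, hz₀, subset_rfl, fun h' => absurd h' h⟩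
  refine ⟨(tcoord p₀).source ∩ tcoord p₀ ⁻¹' Ω₁,
    contMDiffOn_tcoord.continuousOn.isOpen_inter_preimage isOpen_tcoord_source hΩ₁,
    ⟨mem_tcoord_source.2 hp₀, hzΩ₁⟩, fun W hWW hWo hv₀W => ?_⟩
  have hWΩ : ∀ x ∈ W, x.1 ∈ (extChartAt 𝓘(ℝ, E) p₀).source ∧ tcoord p₀ x ∈ Ω₁ :=
    fun x hx => ⟨mem_tcoord_source.1 (hWW hx).1, (hWW hx).2⟩
  have hW : K.Contains W := fun x hx => ⟨(hWΩ x hx).1, hsub (hWΩ x hx).2⟩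
  -- a piece of the normal bundle which is a graph near a vector over `(p₀, q₀)`
  have hlocal : ∀ z ∈ puncturedNormalBundle W, z.1.proj = p₀ → z.2.proj = riemannianExp p₀ v₀ →
      ∀ O U φ, z ∈ O → IsSmoothGraph (puncturedNormalBundle W) O U φ →
        FoldRankCondition p₀ v₀ := by
    intro z hz h1 h2 O U φ hzO hg
    obtain ⟨y, hy, -, hr, e₁, e₂⟩ := (FoldChart.mem_puncturedNormalBundle_iff hW hWo).1 hz
    obtain ⟨hU, hφ⟩ : z.1 ∈ U ∧ z.2 = φ z.1 := hg.2.2.2.subset ⟨hz, hzO⟩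
    rw [e₁] at hU hφ
    refine (hrank hy ?_ hr).1 (FoldChart.of_isSmoothGraph hW hWo hg hy hU (hφ ▸ e₂)).1
    have hy₁ := mem_tcoord_target.1 (K.Ψ₁_mem_target hy)
    have hy₂ := mem_tcoord_target.1 (K.Ψ₂_mem_target hy)
    refine K.form.eq_of_apply_eq hz₀ (K.form.Z_mem hy) hcrit ?_ ?_
    · rw [e₁, tcoord_symm_apply hy₁] at h1
      exact ((extChartAt 𝓘(ℝ, E) p₀).right_inv hy₁).symm.trans
        ((congrArg (extChartAt 𝓘(ℝ, E) p₀) h1).trans hz₁.symm)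
    · rw [e₂, tcoord_symm_apply hy₂] at h2
      rw [K.form.f_Z hy, ← hfz₀]
      exact ((extChartAt 𝓘(ℝ, E) (riemannianExp p₀ v₀)).right_inv hy₂).symm.trans
        (congrArg (extChartAt 𝓘(ℝ, E) (riemannianExp p₀ v₀)) h2)
  have hmem : (((tcoord p₀).symm (K.form.Ψ₁ (K.form.param (tcoord p₀ ⟨p₀, v₀⟩) 1)),
      (tcoord (riemannianExp p₀ v₀)).symm (K.form.Ψ₂ (K.form.param (tcoord p₀ ⟨p₀, v₀⟩) 1))) :
      TangentBundle 𝓘(ℝ, E) M × TangentBundle 𝓘(ℝ, E) M) ∈ puncturedNormalBundle W := by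
    refine (FoldChart.mem_puncturedNormalBundle_iff hW hWo).2 ⟨_, hparam, ?_, hℓparam, rfl, rfl⟩
    rwa [K.form.Z_param hz₀ hcrit, (tcoord p₀).left_inv (mem_tcoord_source.2 hp₀)]
  refine ⟨fun p v q w hv hvW hw => FoldChart.exists_submodule_eq_tangentVectors hW hWo hv hvW hw,
    fun p v v' hv hvW hvW' h => FoldChart.eq_of_riemannianExp_eq hW hv hvW hvW' h,
    FoldChart.normalBundle_eq_jacobiPairs hW hWo, ⟨?_, fun h => hgraph h W hWo hWΩ⟩,
    fun z hz h1 h2 => ⟨?_, fun h => ?_⟩,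
    fun O U φ hg => FoldChart.isLocalDiffeomorphOn_of_isSmoothGraph hW hWo hg⟩
  · rintro ⟨U, φ, hg⟩
    refine hlocal _ hmem ?_ ?_ univ U φ (mem_univ _) hg
    · have h1 := mem_tcoord_target.1 (K.Ψ₁_mem_target hparam)
      rw [tcoord_symm_apply h1]
      exact (congrArg (extChartAt 𝓘(ℝ, E) p₀).symm hz₁).trans
        ((extChartAt 𝓘(ℝ, E) p₀).left_inv hp₀)
    · have h1 := mem_tcoord_target.1 (K.Ψ₂_mem_target hparam)
      rw [tcoord_symm_apply h1, K.form.Ψ₂_param hz₀ hcrit, ← hfz₀]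
      exact (extChartAt 𝓘(ℝ, E) _).left_inv (mem_extChartAt_source _)
  · rintro ⟨O, U, φ, hzO, hg⟩
    exact hlocal z hz h1 h2 O U φ hzO hg
  · obtain ⟨U, φ, hg⟩ := hgraph h W hWo hWΩ
    exact ⟨univ, U, φ, mem_univ _, hg⟩
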